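/- **Setting.** Let $\Omega\subset\mathbb{R}^3$ be a bounded convex domain with $C^2$ boundary whose Gaussian curvature is positive everywhere, let $n(q)$ be the unit outward normal at $q\in\partial\Omega$, and put $\Gamma_-=\{(q,v)\in\partial\Omega\times\mathbb{R}^3:\ n(q)\cdot v<0\}$ and $\tau_+(q,v)=\inf\{t>0:\ q+tv\notin\Omega\}$. Let $\gamma\in[0,1]$ and let $B=B(r,\theta)$ be a measurable cross-section satisfying Grad's angular cutoff: for some constant $C$, $$0\le B(r,\theta)\le C\,r^{\gamma}\cos\theta\sin\theta\qquad (r>0,\ 0\le\theta\le\tfrac{\pi}{2}).$$ Define $$Q(F,G)(v)=\int_{\mathbb{R}^3}\int_0^{2\pi}\int_0^{\pi/2}\bigl(F(v')G(v'_*)-F(v)G(v_*)\bigr)B(|v-v_*|,\theta)\,d\theta\,d\varphi\,dv_*,$$ where $v'=v+((v_*-v)\cdot\alpha)\alpha$, $v'_*=v_*-((v_*-v)\cdot\alpha)\alpha$, $\alpha=\cos\theta\,e_1+\sin\theta\cos\varphi\,e_2+\sin\theta\sin\varphi\,e_3$, $e_1=\frac{v_*-v}{|v_*-v|}$, and $\{e_1,e_2,e_3\}$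 is an orthonormal basis of $\mathbb{R}^3$. With $M(v)=\pi^{-3/2}e^{-|v|^2}$ let $$L(f)=M^{-1/2}\bigl(Q(M,M^{1/2}f)+Q(M^{1/2}f,M)\bigr),$$ acting in the variable $v$. Let $g:\Gamma_-\to\mathbb{R}$ be such that for some constants $a,C>0$ $$|g(q_1,v)|\le C e^{-a|v|^2},\qquad |g(q_1,v)-g(q_2,v)|\le C|q_1-q_2|$$ for all $(q_1,v),(q_2,v)\in\Gamma_-$. **Theorem.** Let $f\in L^2(\Omega\times\mathbb{R}^3)$ be a real-valued solution of $$v\cdot\nabla_x f=L(f)\ \text{ in }\Omega\times\mathbb{R}^3,\qquad f|_{\Gamma_-}=g,$$ where the equation holds in the sense of distributions on $\Omega\times\mathbb{R}^3$ and the boundary condition in the sense of traces along characteristics: for almost every $(q,v)\in\Gamma_-$ the function $s\mapsto f(q+sv,v)$ on $(0,\tau_+(q,v))$ has a continuous representative whose limit as $s\to0^+$ is $g(q,v)$. Then for every $0<\epsilon<1$ one has $f\in L^2_v(\mathbb{R}^3;H^{1-\epsilon}_x(\Omega))$, that is, $f\in L^2(\Omega\times\mathbb{R}^3)$ and $$\int_{\mathbb{R}^3}\int_\Omega\int_\Omega\frac{|f(x,v)-f(y,v)|^2}{|x-y|^{3+2(1-\epsilon)}}\,dx\,dy\,dv<\infty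 .$$ -/

import Mathlib

open MeasureTheory Set Filter Topology
open scoped ContDiff RealInnerProductSpace

noncomputable section

namespace Boltzmann

/-- Euclidean three-space, used both for positions and for velocities. -/
abbrev E3 : Type := EuclideanSpace ℝ (Fin 3)

/-! ### An orthonormal frame completing a unit vector -/

/-- A unit vector orthogonal to the unit vector `e`. -/
def frame₂ (e : E3) : E3 :=
  if e 0 = 0 ∧ e 1 = 0 then !₂[1, 0, 0]
  else (Real.sqrt (e 0 ^ 2 + e 1 ^ 2))⁻¹ • !₂[-e 1, e 0, 0]

/-- The cross product `e × frame₂ e`, the third vector of the frame. -/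
def frame₃ (e : E3) : E3 :=
  !₂[e 1 * frame₂ e 2 - e 2 * frame₂ e 1,
     e 2 * frame₂ e 0 - e 0 * frame₂ e 2,
     e 0 * frame₂ e 1 - e 1 * frame₂ e 0]

theorem frame_orthonormal {e : E3} (he : ‖e‖ = 1) :
    Orthonormal ℝ ![e, frame₂ e, frame₃ e] := by
  have h1 : e 0 ^ 2 + e 1 ^ 2 + e 2 ^ 2 = 1 := by
    have h := EuclideanSpace.real_norm_sq_eq e
    rw [he, Fin.sum_univ_three] at h
    linarith
  have hn : ∀ x : E3, x 0 ^ 2 + x 1 ^ 2 + x 2 ^ 2 = 1 → ‖x‖ = 1 := by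
    intro x hx
    have h := EuclideanSpace.real_norm_sq_eq x
    rw [Fin.sum_univ_three, hx] at h
    exact (pow_eq_one_iff_of_nonneg (norm_nonneg x) two_ne_zero).1 h
  have hi : ∀ x y : E3, ⟪x, y⟫ = x 0 * y 0 + x 1 * y 1 + x 2 * y 2 := by
    intro x y
    simp [PiLp.inner_apply, Fin.sum_univ_three, mul_comm]
  obtain ⟨p, q, h2, h3, h4, h5⟩ : ∃ p q : ℝ, frame₂ e 0 = p ∧ frame₂ e 1 = q ∧ frame₂ e 2 = 0 ∧
      (p ^ 2 + q ^ 2 = 1 ∧ e 0 * p + e 1 * q = 0) := by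
    refine ⟨_, _, rfl, rfl, ?_⟩
    unfold frame₂
    split_ifs with h
    · simp [h.1, h.2]
    · have hpos : 0 < e 0 ^ 2 + e 1 ^ 2 := by
        rcases not_and_or.1 h with h | h <;> positivity
      have hs := Real.sq_sqrt hpos.le
      have hs0 := (Real.sqrt_pos.2 hpos).ne'
      simp
      refine ⟨?_, by ring⟩
      field_simp
      rw [hs]; ring
  have g0 : frame₃ e 0 = - e 2 * q := by simp [frame₃, h3, h4]
  have g1 : frame₃ e 1 = e 2 * p := by simp [frame₃, h2, h4]
  have g2 : frame₃ e 2 = e 0 * q - e 1 * p := by simp [frame₃, h2, h3]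
  have c1 : ⟪e, frame₂ e⟫ = 0 := by rw [hi, h2, h3, h4]; linarith [h5.2]
  have c2 : ⟪e, frame₃ e⟫ = 0 := by rw [hi, g0, g1, g2]; ring
  have c3 : ⟪frame₂ e, frame₃ e⟫ = 0 := by rw [hi, h2, h3, h4, g0, g1, g2]; ring
  have n2 : ‖frame₂ e‖ = 1 := hn _ (by rw [h2, h3, h4]; linarith [h5.1])
  have n3 : ‖frame₃ e‖ = 1 := hn _ (by
    rw [g0, g1, g2]
    linear_combination (e 0 ^ 2 + e 1 ^ 2 + e 2 ^ 2) * h5.1 + h1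
      - (e 0 * p + e 1 * q) * h5.2)
  constructor
  · intro i; fin_cases i <;> simp [he, n2, n3]
  · intro i j hij
    have c1' := (real_inner_comm e (frame₂ e)).trans c1
    have c2' := (real_inner_comm e (frame₃ e)).trans c2
    have c3' := (real_inner_comm (frame₂ e) (frame₃ e)).trans c3
    clear hi
    fin_cases i <;> fin_cases j <;> first | exact absurd rfl hij | assumption

/-! ### The collision operator -/

/-- The standard Maxwellian `M(v) = π^(-3/2) exp(-|v|²)`. -/
def maxwellian (v : E3) : ℝ := Real.pi ^ (-(3 / 2) : ℝ) * Real.exp (-‖v‖ ^ 2)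

/-- The unit vector `α = cos θ e₁ + sin θ cos φ e₂ + sin θ sin φ e₃`
with `e₁ = (v_* - v) / |v_* - v|`. -/
def collisionDir (v vs : E3) (θ φ : ℝ) : E3 :=
  let e₁ : E3 := ‖vs - v‖⁻¹ • (vs - v)
  Real.cos θ • e₁ + (Real.sin θ * Real.cos φ) • frame₂ e₁
    + (Real.sin θ * Real.sin φ) • frame₃ e₁

/-- The post-collisional velocity `v' = v + ((v_* - v) · α) α`. -/
def postVel (v vs : E3) (θ φ : ℝ) : E3 :=
  v + ⟪vs - v, collisionDir v vs θ φ⟫ • collisionDir v vs θ φ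

/-- The post-collisional velocity `v'_* = v_* - ((v_* - v) · α) α`. -/
def postVelStar (v vs : E3) (θ φ : ℝ) : E3 :=
  vs - ⟪vs - v, collisionDir v vs θ φ⟫ • collisionDir v vs θ φ

/-- The bilinear collision operator `Q(F, G)` with cross-section `B(|v - v_*|, θ)`. -/
def collisionQ (B : ℝ → ℝ → ℝ) (F G : E3 → ℝ) (v : E3) : ℝ :=
  ∫ vs : E3, ∫ φ in (0 : ℝ)..(2 * Real.pi), ∫ θ in (0 : ℝ)..(Real.pi / 2),
    (F (postVel v vs θ φ) * G (postVelStar v vs θ φ) - F v * G vs) * B ‖v - vs‖ θ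

/-- The linearized collision operator
`L(h) = M^(-1/2) (Q(M, M^(1/2) h) + Q(M^(1/2) h, M))`, acting on functions of the velocity. -/
def linearizedL (B : ℝ → ℝ → ℝ) (h : E3 → ℝ) (v : E3) : ℝ :=
  (Real.sqrt (maxwellian v))⁻¹ *
    (collisionQ B maxwellian (fun w => Real.sqrt (maxwellian w) * h w) v
      + collisionQ B (fun w => Real.sqrt (maxwellian w) * h w) maxwellian v)

/-- Grad's angular cutoff: `0 ≤ B(r, θ) ≤ C r^γ cos θ sin θ`. -/
def AngularCutoff (γ : ℝ) (B : ℝ → ℝ → ℝ) : Prop :=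
  ∃ C : ℝ, ∀ r θ : ℝ, 0 < r → 0 ≤ θ → θ ≤ Real.pi / 2 →
    0 ≤ B r θ ∧ B r θ ≤ C * r ^ γ * Real.cos θ * Real.sin θ

/-! ### Domains with `C²` boundary of positive Gaussian curvature -/

/-- `ρ` is a `C²` defining function of `Ω` on the open neighbourhood `U` of `q`. -/
structure IsDefiningFunction (Ω U : Set E3) (ρ : E3 → ℝ) (q : E3) : Prop where
  isOpen : IsOpen U
  mem : q ∈ U
  contDiffOn : ContDiffOn ℝ 2 ρ U
  gradient_ne_zero : ∀ x ∈ U, gradient ρ x ≠ 0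
  inter_eq : Ω ∩ U = {x ∈ U | ρ x < 0}

/-- The boundary of `Ω` is of class `C²`, with `Ω` locally on one side of it. -/
def HasC2Boundary (Ω : Set E3) : Prop :=
  ∀ q ∈ frontier Ω, ∃ U ρ, IsDefiningFunction Ω U ρ q

/-- The unit normal at `q` of the level set of `ρ` through `q`, pointing towards increasing `ρ`. -/
def levelNormal (ρ : E3 → ℝ) (q : E3) : E3 := ‖gradient ρ q‖⁻¹ • gradient ρ q

/-- The second fundamental form of the level set of `ρ` through `q`, for tangent vectors `u, w`:
the derivative of the unit normal is `D²ρ / |∇ρ|` on the tangent plane. -/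
def secondFundamentalForm (ρ : E3 → ℝ) (q u w : E3) : ℝ :=
  ‖gradient ρ q‖⁻¹ * fderiv ℝ (fderiv ℝ ρ) q u w

/-- The Gaussian curvature at `q` of the level set of `ρ` through `q`: the determinant of the
second fundamental form in an orthonormal basis of the tangent plane. -/
def gaussianCurvature (ρ : E3 → ℝ) (q : E3) : ℝ :=
  let t₁ := frame₂ (levelNormal ρ q)
  let t₂ := frame₃ (levelNormal ρ q)
  secondFundamentalForm ρ q t₁ t₁ * secondFundamentalForm ρ q t₂ t₂
    - secondFundamentalForm ρ q t₁ t₂ * secondFundamentalForm ρ q t₂ t₁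

/-- A bounded convex domain with `C²` boundary of positive Gaussian curvature. -/
structure PositiveCurvatureDomain (Ω : Set E3) : Prop where
  isOpen : IsOpen Ω
  isBounded : Bornology.IsBounded Ω
  convex : Convex ℝ Ω
  c2 : HasC2Boundary Ω
  curvature_pos : ∀ q ∈ frontier Ω, ∀ U ρ, IsDefiningFunction Ω U ρ q → 0 < gaussianCurvature ρ q

/-- `n` is the unit outward normal of `∂Ω` at `q`. -/
def IsOutwardNormal (Ω : Set E3) (q n : E3) : Prop :=
  ∃ U ρ, IsDefiningFunction Ω U ρ q ∧ n = levelNormal ρ q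

/-- The incoming part `Γ₋ = {(q, v) : q ∈ ∂Ω, n(q) · v < 0}` of the phase boundary. -/
def incoming (Ω : Set E3) : Set (E3 × E3) :=
  {p | p.1 ∈ frontier Ω ∧ ∃ n, IsOutwardNormal Ω p.1 n ∧ ⟪n, p.2⟫ < 0}

/-- The forward exit time `τ₊(x, v) = inf {t > 0 : x + t v ∉ Ω}`. -/
def exitTime (Ω : Set E3) (x v : E3) : ℝ := sInf {t : ℝ | 0 < t ∧ x + t • v ∉ Ω}

/-! ### The boundary value problem -/

/-- The incoming data are bounded by a Gaussian in `v` and Lipschitz in `q`. -/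
def IncomingAssumption (Ω : Set E3) (g : E3 × E3 → ℝ) : Prop :=
  ∃ a C : ℝ, 0 < a ∧ 0 < C ∧
    (∀ q v, (q, v) ∈ incoming Ω → |g (q, v)| ≤ C * Real.exp (-a * ‖v‖ ^ 2)) ∧
    (∀ q₁ q₂ v, (q₁, v) ∈ incoming Ω → (q₂, v) ∈ incoming Ω →
      |g (q₁, v) - g (q₂, v)| ≤ C * ‖q₁ - q₂‖)

/-- `v · ∇ₓ f = L(f)` in `Ω × ℝ³` in the sense of distributions. -/
def SolvesEquation (Ω : Set E3) (B : ℝ → ℝ → ℝ) (f : E3 × E3 → ℝ) : Prop :=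
  ∀ ψ : E3 × E3 → ℝ, ContDiff ℝ ∞ ψ → HasCompactSupport ψ → tsupport ψ ⊆ Ω ×ˢ univ →
    ∫ p in Ω ×ˢ univ, f p * fderiv ℝ ψ p (p.2, 0)
      = - ∫ p in Ω ×ˢ univ, linearizedL B (fun w => f (p.1, w)) p.2 * ψ p

/-- `f = g` on `Γ₋` in the sense of traces: for almost every `(q, v) ∈ Γ₋`, the function
`s ↦ f(q + s v, v)` on `(0, τ₊(q, v))` has a continuous representative, whose limit at `0⁺`
is `g(q, v)`. -/
def HasIncomingTrace (Ω : Set E3) (f g : E3 × E3 → ℝ) : Prop :=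
  ∀ᵐ v : E3, ∀ᵐ q ∂(Measure.hausdorffMeasure 2 : Measure E3).restrict (frontier Ω),
    (q, v) ∈ incoming Ω →
      ∃ h : ℝ → ℝ, ContinuousOn h (Ioo 0 (exitTime Ω q v)) ∧
        (∀ᵐ s ∂volume.restrict (Ioo 0 (exitTime Ω q v)), h s = f (q + s • v, v)) ∧
        Tendsto h (𝓝[>] 0) (𝓝 (g (q, v)))

/-- `f` is an `L²(Ω × ℝ³)` solution of the incoming boundary value problem
`v · ∇ₓ f = L(f)` in `Ω × ℝ³`, `f = g` on `Γ₋`. -/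
structure IsL2Solution (Ω : Set E3) (B : ℝ → ℝ → ℝ) (g f : E3 × E3 → ℝ) : Prop where
  memLp : MemLp f 2 (volume.restrict (Ω ×ˢ univ))
  equation : SolvesEquation Ω B f
  trace : HasIncomingTrace Ω f g

/-! ### The mixed fractional Sobolev space -/

/-- The squared Slobodeckij semi-norm
`∫_{ℝ³} ∫_Ω ∫_Ω |f(x,v) - f(y,v)|² / |x-y|^(3+2s) dx dy dv`. -/
def slobodeckij (Ω : Set E3) (s : ℝ) (f : E3 × E3 → ℝ) : ENNReal :=
  ∫⁻ v : E3, ∫⁻ y in Ω, ∫⁻ x in Ω,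
    ENNReal.ofReal (|f (x, v) - f (y, v)| ^ 2 / ‖x - y‖ ^ (3 + 2 * s))

/-- `f ∈ L²_v(ℝ³; H^s_x(Ω))`. -/
def MemL2Hs (Ω : Set E3) (s : ℝ) (f : E3 × E3 → ℝ) : Prop :=
  MemLp f 2 (volume.restrict (Ω ×ˢ univ)) ∧ slobodeckij Ω s f < ⊤

end Boltzmann

end

noncomputable section

namespace Boltzmann

/-! ### Integrability of radial weights on three-space -/

/-! Write `L = -ν + K`, with `ν` the collision frequency and `K` an integral operator in velocity
whose kernel is bounded by a multiple of `|v-w|⁻¹ exp(-|v-w|²/8)` (`exists_linearizedL_eq`; the gain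
terms come from Carleman's change of variables, `exists_carleman_le`). Integrating the equation
along characteristics gives `f = J + S F`. Here `F` is `K f` extended by zero outside `Ω`, `J(x,v) =
exp(-ν τ) g(x - τ v, v)` with `τ` the backward exit time, and `S F(x,v)` is the integral of `exp(-ν
s) F(x - s v, v)` over `0 < s ≤ D/|v|` (`ae_mild_formula`). Because `F` vanishes outside `Ω`, the
length of the ray does not depend on `x`.

Regularity is measured by differences in `x`. The target is that the squared `L²` norm of `f(x+b,v)
- f(x,v)`, over those `x` with `x` and `x+b` both in `Ω`, is `O(|b|^(2-3ε))` for every small `ε`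
(`exists_lintegral_innerDiff_le`). Integrating this against `|b|^(-3-2s)` yields the Slobodeckij
semi-norm. Two mechanisms produce powers of `|b|`.

Velocity averaging: `K S` gains half a derivative (`exists_lintegral_rayAvg_diff_le`). By duality,
this concerns the mean square of the ray integrals of a test function, averaged over directions and
lengths. That mean square is a correlation with the kernel `|z|⁻² (ℓ - |z|)₊`
(`lintegral_sq_ray_eq`), and translating this kernel by `h` changes it by `O(|h|^(1-ε))` in `L¹`.
The argument is entirely in physical space and tolerates the damping factor and the cut-off length
of the rays.

Convexity: the layer of points that leave `Ω` under translation by `h` meets every ball of radius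
`r` in volume `O(|h| r²)` (`volume_leaveSet_inter_ball_le`). The time that rays spend in this layer
is therefore `O(|h|^(2-ε))` in averaged square (`exists_lintegral_sq_ray_jump_le`), although the
layer itself only has volume `O(|h|)`. This controls the variation of the exit time, hence the
differences of `J`, and the crossings of the boundary by rays in `S F`.

On `Ω` the source satisfies `F = K J + K S F`. As a function on the whole space, `F` jumps across
the boundary, so one use of averaging gives it half a derivative and no more. By commutation with
translations a second difference of `K S F` is `K S` of a first difference of `F`, up to one further
difference, so two half derivatives add up. A Marchaud inequality (`exists_le_rpow_of_doubling`)
turns the second difference into a first one. Inside `Ω` the source thus has almost one full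
derivative, and `f = J + S F` inherits it.

Ray integrals have length `D/|v|`, so slow velocities require the weight `|v|⁻²`, and each averaging
step costs two powers of `1 + |v|`. Both are affordable because the source decays faster than every
power of the velocity (`exists_source_sq_le`). This starts from `L²` by two Riesz potential steps
and then bootstraps. -/

theorem lintegral_ball_norm_rpow_lt_top {p : ℝ} (hp : p < 3) (R : ℝ) :
    ∫⁻ z in Metric.ball (0 : E3) R, ENNReal.ofReal (‖z‖ ^ (-p)) < ⊤ := by
  have h1 : Integrable (fun z : E3 => (Ioo 0 R).indicator (fun t : ℝ => t ^ (-p)) ‖z‖) := by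
    rw [integrable_fun_norm_addHaar volume (f := (Ioo 0 R).indicator (fun t : ℝ => t ^ (-p)))]
    have h2 : IntegrableOn (fun t : ℝ => t ^ (2 - p)) (Ioo 0 R) := by
      rcases le_or_gt R 0 with hR | hR
      · simp [Ioo_eq_empty (not_lt.2 hR)]
      · rw [intervalIntegral.integrableOn_Ioo_rpow_iff hR]; linarith
    have h3 := (integrable_indicator_iff measurableSet_Ioo).2 h2
    refine (h3.congr (Eventually.of_forall fun t => ?_)).integrableOn
    by_cases ht : t ∈ Ioo 0 R
    · simp only [indicator_of_mem ht, finrank_euclideanSpace, Fintype.card_fin, smul_eq_mul]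
      have : t ^ (3 - 1) = t ^ (2 : ℝ) := (Real.rpow_natCast t 2).symm
      rw [this, ← Real.rpow_add ht.1]; ring_nf
    · simp [indicator_of_notMem ht]
  refine lt_of_le_of_lt ?_ h1.lintegral_lt_top
  rw [← lintegral_indicator measurableSet_ball]
  refine lintegral_mono_ae ?_
  have h0 : ∀ᵐ z : E3, z ≠ 0 := by simp [ae_iff]
  filter_upwards [h0] with z hz
  by_cases hz' : z ∈ Metric.ball (0 : E3) R
  · rw [indicator_of_mem hz', indicator_of_mem]
    exact ⟨norm_pos_iff.2 hz, by simpa using hz'⟩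
  · simp [indicator_of_notMem hz']

theorem exists_exp_neg_mul_sq_le (c q : ℝ) (hc : 0 < c) :
    ∃ C : ℝ, 0 < C ∧ ∀ r : ℝ, 0 ≤ r → Real.exp (-c * r ^ 2) ≤ C * (1 + r) ^ (-q) := by
  have h : Tendsto (fun r : ℝ => (1 + r) ^ |q| * Real.exp (-c * r ^ 2)) atTop (𝓝 0) := by
    have h1 := tendsto_rpow_mul_exp_neg_mul_atTop_nhds_zero |q| c hc
    have h2 := (h1.comp (tendsto_atTop_add_const_left atTop (1 : ℝ) tendsto_id)).mul_const
      (Real.exp c)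
    simp only [zero_mul] at h2
    refine squeeze_zero' ?_ ?_ h2
    · filter_upwards [eventually_ge_atTop (0 : ℝ)] with r hr
      positivity
    · filter_upwards [eventually_ge_atTop (1 : ℝ)] with r hr
      simp only [Function.comp, id]
      rw [mul_assoc, ← Real.exp_add]
      gcongr
      nlinarith [mul_nonneg hc.le (mul_nonneg (by linarith : (0 : ℝ) ≤ r) (sub_nonneg.2 hr))]
  obtain ⟨C, hC⟩ : ∃ C : ℝ, ∀ r : ℝ, 0 ≤ r → (1 + r) ^ |q| * Real.exp (-c * r ^ 2) ≤ C := by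
    obtain ⟨N, hN⟩ := eventually_atTop.1 (h.eventually (ge_mem_nhds (zero_lt_one)))
    have hcont : ContinuousOn (fun r : ℝ => (1 + r) ^ |q| * Real.exp (-c * r ^ 2))
        (Icc 0 N) := by
      refine ContinuousOn.mul ?_ (by fun_prop)
      exact ContinuousOn.rpow_const (by fun_prop) fun x hx => Or.inr (abs_nonneg _)
    obtain ⟨C, hC⟩ := (isCompact_Icc.image_of_continuousOn hcont).bddAbove
    refine ⟨max C 1, fun r hr => ?_⟩
    rcases le_total r N with h1 | h1
    · exact le_max_of_le_left (hC ⟨r, ⟨hr, h1⟩, rfl⟩)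
    · exact le_max_of_le_right (hN r h1)
  refine ⟨max C 1, by positivity, fun r hr => ?_⟩
  have h1 : 0 < (1 + r) ^ |q| := by positivity
  have h2 : (1 + r) ^ (-|q|) ≤ (1 + r) ^ (-q) :=
    Real.rpow_le_rpow_of_exponent_le (by linarith) (neg_le_neg (le_abs_self q))
  calc Real.exp (-c * r ^ 2) = ((1 + r) ^ |q| * Real.exp (-c * r ^ 2)) * (1 + r) ^ (-|q|) := by
        rw [Real.rpow_neg (by linarith)]; field_simp
    _ ≤ max C 1 * (1 + r) ^ (-q) := by
        gcongr
        exact le_max_of_le_left (hC r hr)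

/-- Peetre's inequality. For `q ≥ 0` it is a power of the triangle inequality; for `q < 0` it is
that case with `v` and `w` exchanged. -/
theorem one_add_norm_rpow_le (q : ℝ) (v w : E3) :
    (1 + ‖w‖) ^ q ≤ (1 + ‖v‖) ^ q * (1 + ‖v - w‖) ^ |q| := by
  have aux : ∀ q : ℝ, 0 ≤ q → ∀ v w : E3, (1 + ‖w‖) ^ q ≤ (1 + ‖v‖) ^ q * (1 + ‖v - w‖) ^ q := by
    intro q hq v w
    rw [← Real.mul_rpow (by positivity) (by positivity)]
    refine Real.rpow_le_rpow (by positivity) ?_ hq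
    have : ‖w‖ ≤ ‖v‖ + ‖v - w‖ := by
      calc ‖w‖ = ‖v - (v - w)‖ := by congr 1; abel
        _ ≤ _ := norm_sub_le _ _
    nlinarith [norm_nonneg v, norm_nonneg (v - w)]
  rcases le_total 0 q with hq | hq
  · rw [abs_of_nonneg hq]; exact aux q hq v w
  · rw [abs_of_nonpos hq]
    have h := aux (-q) (by linarith) w v
    rw [norm_sub_rev w v] at h
    have e1 : (1 + ‖w‖) ^ q * (1 + ‖w‖) ^ (-q) = 1 := by
      rw [← Real.rpow_add (by positivity)]; simp
    have e2 : (1 + ‖v‖) ^ q * (1 + ‖v‖) ^ (-q) = 1 := by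
      rw [← Real.rpow_add (by positivity)]; simp
    calc (1 + ‖w‖) ^ q = (1 + ‖w‖) ^ q * ((1 + ‖v‖) ^ q * (1 + ‖v‖) ^ (-q)) := by rw [e2, mul_one]
      _ ≤ (1 + ‖w‖) ^ q * ((1 + ‖v‖) ^ q * ((1 + ‖w‖) ^ (-q) * (1 + ‖v - w‖) ^ (-q))) := by gcongr
      _ = ((1 + ‖w‖) ^ q * (1 + ‖w‖) ^ (-q)) * ((1 + ‖v‖) ^ q * (1 + ‖v - w‖) ^ (-q)) := by ring
      _ = _ := by rw [e1, one_mul]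

/-- Convolution of a singular Gaussian with a polynomial weight. -/
theorem exists_lintegral_gaussian_weight_le (c q : ℝ) (hc : 0 < c) :
    ∃ C : ℝ, 0 < C ∧ ∀ v : E3,
      ∫⁻ w : E3, ENNReal.ofReal (Real.exp (-c * ‖v - w‖ ^ 2) * (1 + ‖w‖) ^ q *
        (1 + (‖w‖ ^ 2)⁻¹ + (‖v - w‖ ^ 2)⁻¹)) ≤ ENNReal.ofReal (C * (1 + ‖v‖) ^ q) := by
  -- The exponent `|q|` pays for moving the weight from `w` to `v`, and the remaining `4 > 3` makes
  -- what is left integrable.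
  obtain ⟨C1, hC1, h1⟩ := exists_exp_neg_mul_sq_le c (|q| + 4) hc
  set I : ENNReal := ∫⁻ z in Metric.ball (0 : E3) 1, ENNReal.ofReal (‖z‖ ^ (-2 : ℝ)) with hI
  have hIt : I < ⊤ := lintegral_ball_norm_rpow_lt_top (by norm_num) 1
  set J : ENNReal := ∫⁻ z : E3, ENNReal.ofReal ((1 + ‖z‖) ^ (-4 : ℝ)) with hJ
  have hJt : J < ⊤ := by
    have := (integrable_one_add_norm (E := E3) (μ := volume) (r := 4) (by simp; norm_num))
    exact this.lintegral_lt_top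
  have key : ∀ v : E3, ∫⁻ w : E3, ENNReal.ofReal ((1 + ‖v - w‖) ^ (-4 : ℝ) *
      (1 + (‖w‖ ^ 2)⁻¹ + (‖v - w‖ ^ 2)⁻¹)) ≤ 3 * J + I + I := by
    intro v
    have hb : ∀ z : E3, (‖z‖ ^ 2)⁻¹ ≤ 1 + (Metric.ball (0 : E3) 1).indicator
        (fun z => ‖z‖ ^ (-2 : ℝ)) z := by
      intro z
      by_cases hz : z ∈ Metric.ball (0 : E3) 1
      · rw [indicator_of_mem hz, Real.rpow_neg (norm_nonneg z)]; simp
      · rw [indicator_of_notMem hz, add_zero]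
        have : 1 ≤ ‖z‖ := by simpa using hz
        exact inv_le_one_of_one_le₀ (by nlinarith)
    have hle : ∀ w : E3, (1 + ‖v - w‖) ^ (-4 : ℝ) * (1 + (‖w‖ ^ 2)⁻¹ + (‖v - w‖ ^ 2)⁻¹) ≤
        3 * (1 + ‖v - w‖) ^ (-4 : ℝ) + (Metric.ball (0 : E3) 1).indicator
        (fun z => ‖z‖ ^ (-2 : ℝ)) w + (Metric.ball (0 : E3) 1).indicator
        (fun z => ‖z‖ ^ (-2 : ℝ)) (v - w) := by
      intro w
      have a1 : (1 + ‖v - w‖) ^ (-4 : ℝ) ≤ 1 :=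
        Real.rpow_le_one_of_one_le_of_nonpos (by linarith [norm_nonneg (v - w)]) (by norm_num)
      have a0 : 0 ≤ (1 + ‖v - w‖) ^ (-4 : ℝ) := by positivity
      have b1 := hb w
      have b2 := hb (v - w)
      have c1 : 0 ≤ (Metric.ball (0 : E3) 1).indicator (fun z => ‖z‖ ^ (-2 : ℝ)) w :=
        indicator_nonneg (fun _ _ => by positivity) _
      have c2 : 0 ≤ (Metric.ball (0 : E3) 1).indicator (fun z => ‖z‖ ^ (-2 : ℝ)) (v - w) :=
        indicator_nonneg (fun _ _ => by positivity) _
      nlinarith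
    have hind : Measurable ((Metric.ball (0 : E3) 1).indicator
        (fun z => ‖z‖ ^ (-2 : ℝ))) :=
      Measurable.indicator (by fun_prop) measurableSet_ball
    calc _ ≤ ∫⁻ w : E3, (3 * ENNReal.ofReal ((1 + ‖v - w‖) ^ (-4 : ℝ)) +
          ENNReal.ofReal ((Metric.ball (0 : E3) 1).indicator (fun z => ‖z‖ ^ (-2 : ℝ)) w) +
          ENNReal.ofReal ((Metric.ball (0 : E3) 1).indicator (fun z => ‖z‖ ^ (-2 : ℝ)) (v - w))) := by
          refine lintegral_mono fun w => ?_
          refine (ENNReal.ofReal_le_ofReal (hle w)).trans ?_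
          refine ENNReal.ofReal_add_le.trans (add_le_add_left (ENNReal.ofReal_add_le.trans ?_) _)
          rw [ENNReal.ofReal_mul (by norm_num)]; norm_num
      _ = 3 * J + I + I := by
          rw [lintegral_add_right _ (by fun_prop), lintegral_add_right _ (by fun_prop),
            lintegral_const_mul _ (by fun_prop)]
          rw [lintegral_sub_left_eq_self (fun w : E3 => ENNReal.ofReal ((1 + ‖w‖) ^ (-4 : ℝ))) v,
            lintegral_sub_left_eq_self (fun w : E3 => ENNReal.ofReal
              ((Metric.ball (0 : E3) 1).indicator (fun z => ‖z‖ ^ (-2 : ℝ)) w)) v]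
          have : ∫⁻ w : E3, ENNReal.ofReal
              ((Metric.ball (0 : E3) 1).indicator (fun z => ‖z‖ ^ (-2 : ℝ)) w) = I := by
            rw [hI, ← lintegral_indicator measurableSet_ball]
            congr 1; ext w
            by_cases hw : w ∈ Metric.ball (0 : E3) 1
            · rw [indicator_of_mem hw, indicator_of_mem hw]
            · rw [indicator_of_notMem hw, indicator_of_notMem hw]; simp
          rw [this]
  set S : ENNReal := 3 * J + I + I with hS
  have hSt : S ≠ ⊤ := by
    simp [hS, hJt.ne, hIt.ne, ENNReal.mul_eq_top]
  refine ⟨C1 * (S.toReal + 1), by positivity, fun v => ?_⟩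
  calc _ ≤ ∫⁻ w : E3, ENNReal.ofReal (C1 * (1 + ‖v‖) ^ q) * ENNReal.ofReal
        ((1 + ‖v - w‖) ^ (-4 : ℝ) * (1 + (‖w‖ ^ 2)⁻¹ + (‖v - w‖ ^ 2)⁻¹)) := by
        refine lintegral_mono fun w => ?_
        rw [← ENNReal.ofReal_mul (by positivity)]
        refine ENNReal.ofReal_le_ofReal ?_
        have e := h1 ‖v - w‖ (norm_nonneg _)
        have p := one_add_norm_rpow_le q v w
        calc _ ≤ (C1 * (1 + ‖v - w‖) ^ (-(|q| + 4))) *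
              ((1 + ‖v‖) ^ q * (1 + ‖v - w‖) ^ |q|) * (1 + (‖w‖ ^ 2)⁻¹ + (‖v - w‖ ^ 2)⁻¹) := by
              gcongr
          _ = C1 * (1 + ‖v‖) ^ q * (((1 + ‖v - w‖) ^ (-(|q| + 4)) * (1 + ‖v - w‖) ^ |q|) *
              (1 + (‖w‖ ^ 2)⁻¹ + (‖v - w‖ ^ 2)⁻¹)) := by ring
          _ = _ := by
              rw [← Real.rpow_add (by positivity)]
              ring_nf
    _ ≤ ENNReal.ofReal (C1 * (1 + ‖v‖) ^ q) * S := by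
        rw [lintegral_const_mul _ (by fun_prop)]
        gcongr
        exact key v
    _ ≤ _ := by
        rw [← ENNReal.ofReal_toReal hSt, ← ENNReal.ofReal_mul (by positivity)]
        refine ENNReal.ofReal_le_ofReal ?_
        have : 0 ≤ S.toReal := ENNReal.toReal_nonneg
        have h3 : 0 < (1 + ‖v‖) ^ q := by positivity
        rw [ENNReal.toReal_ofReal this]
        nlinarith [mul_pos hC1 h3]

/-! ### Cauchy–Schwarz for lower integrals -/

theorem lintegral_mul_sq_le {α : Type*} [MeasurableSpace α] (μ : Measure α) {f g : α → ENNReal}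
    (hf : AEMeasurable f μ) (hg : AEMeasurable g μ) :
    (∫⁻ a, f a * g a ∂μ) ^ 2 ≤ (∫⁻ a, f a ^ 2 ∂μ) * ∫⁻ a, g a ^ 2 ∂μ := by
  have h := ENNReal.lintegral_mul_le_Lp_mul_Lq μ Real.HolderConjugate.two_two hf hg
  simp only [Pi.mul_apply] at h
  calc _ ≤ ((∫⁻ a, f a ^ (2 : ℝ) ∂μ) ^ (1 / 2 : ℝ) * (∫⁻ a, g a ^ (2 : ℝ) ∂μ) ^ (1 / 2 : ℝ)) ^ 2 := by
        gcongr
    _ = _ := by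
        rw [mul_pow, ← ENNReal.rpow_natCast, ← ENNReal.rpow_mul, ← ENNReal.rpow_natCast,
          ← ENNReal.rpow_mul]
        norm_num


/-! ### Integration along rays -/

theorem lintegral_comp_const_smul {E : Type*} [NormedAddCommGroup E] [NormedSpace ℝ E]
    [MeasurableSpace E] [BorelSpace E] [FiniteDimensional ℝ E] (μ : Measure E)
    [μ.IsAddHaarMeasure] {Φ : E → ENNReal} (hΦ : Measurable Φ) {r : ℝ} (hr : r ≠ 0) :
    ∫⁻ w, Φ (r • w) ∂μ
      = ENNReal.ofReal (|r| ^ Module.finrank ℝ E)⁻¹ * ∫⁻ z, Φ z ∂μ := by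
  rw [← lintegral_map hΦ (measurable_const_smul r), Measure.map_addHaar_smul μ hr,
    lintegral_smul_measure, smul_eq_mul, abs_inv, abs_pow]

/-- The normalizing constant in the integration formula along rays. -/
def rayConst : ENNReal := ∫⁻ σ : ℝ, ENNReal.ofReal ((1 + |σ|) ^ 2)⁻¹

theorem rayConst_lt_top : rayConst < ⊤ := by
  have := (integrable_one_add_norm (E := ℝ) (μ := volume) (r := 2) (by simp)).lintegral_lt_top
  refine lt_of_le_of_lt (le_of_eq ?_) this
  unfold rayConst
  congr 1; ext σ
  rw [Real.rpow_neg (by positivity)]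
  simp

/-- For fixed `σ` substitute `z = σ w`: the weight with its Jacobian becomes `|z|⁻¹ (|σ| + |z|)⁻²`,
and integrating over `σ` leaves a constant times `|z|⁻²`. All integrals over pairs (direction,
position on the ray) are reduced to volume integrals in this way. -/
theorem lintegral_ray {Φ : E3 → ENNReal} (hΦ : Measurable Φ) :
    ∫⁻ w : E3, ∫⁻ σ : ℝ, ENNReal.ofReal (‖w‖⁻¹ * ((1 + ‖w‖) ^ 2)⁻¹) * Φ (σ • w)
      = rayConst * ∫⁻ z : E3, ENNReal.ofReal (‖z‖ ^ 2)⁻¹ * Φ z := by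
  have hm : Measurable fun p : E3 × ℝ => Φ (p.2 • p.1) := hΦ.comp (by fun_prop)
  rw [lintegral_lintegral_swap (by
    refine Measurable.aemeasurable (Measurable.mul ?_ hm); fun_prop)]
  have h1 : ∀ᵐ σ : ℝ, ∫⁻ w : E3, ENNReal.ofReal (‖w‖⁻¹ * ((1 + ‖w‖) ^ 2)⁻¹) * Φ (σ • w)
      = ∫⁻ z : E3, ENNReal.ofReal (‖z‖⁻¹ * ((|σ| + ‖z‖) ^ 2)⁻¹) * Φ z := by
    have h0 : ∀ᵐ σ : ℝ, σ ≠ 0 := by simp [ae_iff]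
    filter_upwards [h0] with σ hσ
    have hσ' : 0 < |σ| := abs_pos.2 hσ
    have e := lintegral_comp_const_smul (volume : Measure E3)
      (Φ := fun z => ENNReal.ofReal ((‖z‖ / |σ|)⁻¹ * ((1 + ‖z‖ / |σ|) ^ 2)⁻¹) * Φ z)
      (by fun_prop) hσ
    have e2 : ∀ w : E3, ‖σ • w‖ / |σ| = ‖w‖ := by
      intro w; rw [norm_smul, Real.norm_eq_abs]; field_simp
    simp only [e2] at e
    rw [e, ← lintegral_const_mul _ (by fun_prop)]
    congr 1; ext z
    rw [← mul_assoc, ← ENNReal.ofReal_mul (by positivity)]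
    congr 2
    simp only [finrank_euclideanSpace, Fintype.card_fin]
    by_cases hz : ‖z‖ = 0
    · simp [hz]
    · field_simp
  rw [lintegral_congr_ae h1, lintegral_lintegral_swap (by
    refine Measurable.aemeasurable (Measurable.mul ?_ (hΦ.comp measurable_snd)); fun_prop),
    ← lintegral_const_mul _ (by fun_prop)]
  refine lintegral_congr_ae ?_
  have h0 : ∀ᵐ z : E3, z ≠ 0 := by simp [ae_iff]
  filter_upwards [h0] with z hz
  have ht : 0 < ‖z‖ := norm_pos_iff.2 hz
  rw [lintegral_mul_const _ (by fun_prop), ← mul_assoc]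
  congr 1
  have e := lintegral_comp_const_smul (volume : Measure ℝ)
    (Φ := fun σ => ENNReal.ofReal ((1 + |σ|) ^ 2)⁻¹) (by fun_prop) (inv_ne_zero ht.ne')
  have e3 : ∀ σ : ℝ, ENNReal.ofReal (‖z‖⁻¹ * ((|σ| + ‖z‖) ^ 2)⁻¹)
      = ENNReal.ofReal (‖z‖ ^ 3)⁻¹ * ENNReal.ofReal ((1 + |‖z‖⁻¹ • σ|) ^ 2)⁻¹ := by
    intro σ
    rw [← ENNReal.ofReal_mul (by positivity)]
    congr 1
    rw [smul_eq_mul, abs_mul, abs_inv, abs_of_pos ht]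
    field_simp
    ring
  simp_rw [e3]
  rw [lintegral_const_mul _ (by fun_prop), e, ← mul_assoc, ← ENNReal.ofReal_mul (by positivity),
    mul_comm rayConst]
  unfold rayConst
  congr 2
  rw [abs_inv, abs_of_pos ht]
  simp only [Module.finrank_self, pow_one, inv_inv]
  field_simp

/-- The interval meets its translate by `σ` in a set of length `(L - |σ|)₊`; `ENNReal.ofReal`
supplies the positive part. -/
theorem setLIntegral_setLIntegral_sub {g : ℝ → ENNReal} (hg : Measurable g) (L : ℝ) :
    ∫⁻ s in Ioc 0 L, ∫⁻ s' in Ioc 0 L, g (s' - s) = ∫⁻ σ, ENNReal.ofReal (L - |σ|) * g σ := by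
  have h1 : ∀ s : ℝ, ∫⁻ s' in Ioc 0 L, g (s' - s)
      = ∫⁻ σ, (Ioc 0 L).indicator 1 (σ + s) * g σ := by
    intro s
    rw [← lintegral_indicator measurableSet_Ioc,
      ← lintegral_add_right_eq_self (fun σ => (Ioc 0 L).indicator (fun s' => g (s' - s)) σ) s]
    congr 1; ext σ
    by_cases h : σ + s ∈ Ioc 0 L
    · simp [indicator_of_mem h]
    · simp [indicator_of_notMem h]
  simp_rw [h1]
  have hm : Measurable ((Ioc (0:ℝ) L).indicator (1 : ℝ → ENNReal)) :=
    measurable_one.indicator measurableSet_Ioc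
  rw [lintegral_lintegral_swap (by
    refine Measurable.aemeasurable (Measurable.mul ?_ (hg.comp measurable_snd))
    exact hm.comp (by fun_prop))]
  congr 1; ext σ
  rw [lintegral_mul_const _ (by fun_prop)]
  congr 1
  have : ∀ s, (Ioc (0:ℝ) L).indicator (1 : ℝ → ENNReal) (σ + s)
      = (Ioc (-σ) (L - σ)).indicator 1 s := by
    intro s
    have : σ + s ∈ Ioc 0 L ↔ s ∈ Ioc (-σ) (L - σ) := by
      constructor <;> rintro ⟨h, h'⟩ <;> constructor <;> linarith
    by_cases h : s ∈ Ioc (-σ) (L - σ)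
    · rw [indicator_of_mem h, indicator_of_mem (this.2 h)]; rfl
    · rw [indicator_of_notMem h, indicator_of_notMem (fun h' => h (this.1 h'))]
  simp_rw [this]
  rw [lintegral_indicator_one measurableSet_Ioc, Measure.restrict_apply measurableSet_Ioc,
    Ioc_inter_Ioc, Real.volume_Ioc]
  congr 1
  rcases le_total 0 σ with h | h
  · rw [abs_of_nonneg h, max_eq_right (by linarith), min_eq_left (by linarith)]; ring
  · rw [abs_of_nonpos h, max_eq_left (by linarith), min_eq_right (by linarith)]

/-- Correlations of a function along pairs of points of a segment in direction `w`, averaged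
over `w`, are correlations with an explicit radial kernel. -/
theorem lintegral_ray_pair {Θ : E3 × E3 → ENNReal} (hΘ : Measurable Θ) (ℓ : ℝ) :
    ∫⁻ w : E3, ∫⁻ y : E3, ∫⁻ s in Ioc 0 (ℓ / ‖w‖), ∫⁻ s' in Ioc 0 (ℓ / ‖w‖),
        ENNReal.ofReal ((1 + ‖w‖) ^ 2)⁻¹ * Θ (y + s • w, y + s' • w)
      = rayConst * ∫⁻ z : E3, ∫⁻ y : E3,
          ENNReal.ofReal ((‖z‖ ^ 2)⁻¹ * max (ℓ - ‖z‖) 0) * Θ (y, y + z) := by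
  set Φ : E3 → ENNReal := fun z => ENNReal.ofReal (ℓ - ‖z‖) * ∫⁻ y : E3, Θ (y, y + z) with hΦ
  have hg : Measurable fun z : E3 => ∫⁻ y : E3, Θ (y, y + z) :=
    Measurable.lintegral_prod_right' (f := fun p : E3 × E3 => Θ (p.2, p.2 + p.1))
      (hΘ.comp (by fun_prop))
  have hΦm : Measurable Φ := Measurable.mul (by fun_prop) hg
  have key : ∀ w : E3, w ≠ 0 → ∫⁻ y : E3, ∫⁻ s in Ioc 0 (ℓ / ‖w‖), ∫⁻ s' in Ioc 0 (ℓ / ‖w‖),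
        ENNReal.ofReal ((1 + ‖w‖) ^ 2)⁻¹ * Θ (y + s • w, y + s' • w)
      = ∫⁻ σ : ℝ, ENNReal.ofReal (‖w‖⁻¹ * ((1 + ‖w‖) ^ 2)⁻¹) * Φ (σ • w) := by
    intro w hw
    have hw' : 0 < ‖w‖ := norm_pos_iff.2 hw
    have m3 : Measurable fun p : (E3 × ℝ) × ℝ => ENNReal.ofReal ((1 + ‖w‖) ^ 2)⁻¹ *
        Θ (p.1.1 + p.1.2 • w, p.1.1 + p.2 • w) :=
      measurable_const.mul (hΘ.comp (by fun_prop))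
    have m2 : Measurable fun p : E3 × ℝ => ∫⁻ s' in Ioc 0 (ℓ / ‖w‖),
        ENNReal.ofReal ((1 + ‖w‖) ^ 2)⁻¹ * Θ (p.1 + p.2 • w, p.1 + s' • w) :=
      m3.lintegral_prod_right'
    rw [lintegral_lintegral_swap m2.aemeasurable]
    have e1 : ∀ s : ℝ, ∫⁻ y : E3, ∫⁻ s' in Ioc 0 (ℓ / ‖w‖),
        ENNReal.ofReal ((1 + ‖w‖) ^ 2)⁻¹ * Θ (y + s • w, y + s' • w)
        = ∫⁻ s' in Ioc 0 (ℓ / ‖w‖), (fun σ : ℝ => ENNReal.ofReal ((1 + ‖w‖) ^ 2)⁻¹ *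
            ∫⁻ y : E3, Θ (y, y + σ • w)) (s' - s) := by
      intro s
      rw [lintegral_lintegral_swap (Measurable.aemeasurable
        (measurable_const.mul (hΘ.comp (by fun_prop))))]
      congr 1; ext s'
      rw [lintegral_const_mul _ (by fun_prop)]
      congr 1
      rw [← lintegral_add_right_eq_self (fun y : E3 => Θ (y, y + (s' - s) • w)) (s • w)]
      congr 1; ext y
      congr 2
      rw [sub_smul]; abel
    refine (lintegral_congr e1).trans ((setLIntegral_setLIntegral_sub (measurable_const.mul
      (hg.comp (by fun_prop : Measurable fun σ : ℝ => σ • w))) (ℓ / ‖w‖)).trans ?_)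
    congr 1; ext σ
    simp only [hΦ, Pi.mul_apply, Function.comp]
    rw [← mul_assoc, ← mul_assoc]
    congr 1
    rw [← ENNReal.ofReal_mul' (by positivity), ← ENNReal.ofReal_mul (by positivity)]
    congr 1
    rw [norm_smul, Real.norm_eq_abs]
    field_simp
  have h0 : ∀ᵐ z : E3, z ≠ 0 := by simp [ae_iff]
  rw [lintegral_congr_ae (h0.mono fun w hw => key w hw), lintegral_ray hΦm]
  congr 1
  congr 1; ext z
  rw [lintegral_const_mul _ (by fun_prop), ENNReal.ofReal_mul (by positivity)]
  simp only [hΦ]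
  rw [mul_assoc]
  congr 2
  rw [ENNReal.ofReal_max, ENNReal.ofReal_zero, max_eq_left zero_le]

/-! ### The correlation kernel -/

/-- The radial kernel `|z|⁻² (ℓ - |z|)₊`. -/
def pairKernel (ℓ : ℝ) (z : E3) : ℝ := (‖z‖ ^ 2)⁻¹ * max (ℓ - ‖z‖) 0

theorem measurable_pairKernel (ℓ : ℝ) : Measurable (pairKernel ℓ) := by
  unfold pairKernel; fun_prop

theorem pairKernel_nonneg (ℓ : ℝ) (z : E3) : 0 ≤ pairKernel ℓ z := by
  unfold pairKernel; positivity

/-- The majorant `|z|^(ε-3)` on the ball of radius `D`. -/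
def singWeight (D ε : ℝ) (z : E3) : ℝ :=
  (Metric.ball (0 : E3) D).indicator (fun z => ‖z‖ ^ (-(3 - ε))) z

theorem measurable_singWeight (D ε : ℝ) : Measurable (singWeight D ε) :=
  Measurable.indicator (by fun_prop) measurableSet_ball

theorem singWeight_nonneg (D ε : ℝ) (z : E3) : 0 ≤ singWeight D ε z :=
  indicator_nonneg (fun _ _ => by positivity) _

theorem lintegral_singWeight_lt_top (D : ℝ) {ε : ℝ} (hε : 0 < ε) :
    ∫⁻ z, ENNReal.ofReal (singWeight D ε z) < ⊤ := by
  refine lt_of_le_of_lt (le_of_eq ?_) (lintegral_ball_norm_rpow_lt_top (p := 3 - ε) (by linarith) D)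
  rw [← lintegral_indicator measurableSet_ball]
  congr 1; ext z
  unfold singWeight
  by_cases hz : z ∈ Metric.ball (0 : E3) D
  · rw [indicator_of_mem hz, indicator_of_mem hz]
  · rw [indicator_of_notMem hz, indicator_of_notMem hz]; simp

/-- Interpolation between the size bound `ℓ a⁻²` and the Lipschitz bound `3 ℓ η a⁻³`: the smaller of
`a` and `η` is at most `η^(1-ε) a^ε`. The resulting singularity of order `3 - ε` is just integrable
in three dimensions. -/
theorem pairKernel_profile_diff_le {ℓ ε a b η : ℝ} (hε : 0 ≤ ε) (hε1 : ε ≤ 1) (ha : 0 < a)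
    (hab : a ≤ b) (hη : b - a ≤ η) (haℓ : a < ℓ) :
    |(a ^ 2)⁻¹ * max (ℓ - a) 0 - (b ^ 2)⁻¹ * max (ℓ - b) 0|
      ≤ 3 * ℓ * η ^ (1 - ε) * a ^ (-(3 - ε)) := by
  have hb : 0 < b := ha.trans_le hab
  have hℓ : 0 < ℓ := ha.trans haℓ
  have hinv : (b ^ 2)⁻¹ ≤ (a ^ 2)⁻¹ := by gcongr
  have hmax : max (ℓ - b) 0 ≤ max (ℓ - a) 0 := max_le_max (by linarith) le_rfl
  have hma : max (ℓ - a) 0 = ℓ - a := max_eq_left (by linarith)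
  have hη0 : 0 ≤ η := by linarith
  rw [abs_of_nonneg (sub_nonneg.2 (mul_le_mul hinv hmax (le_max_right _ _) (by positivity)))]
  have bound0 : (a ^ 2)⁻¹ * max (ℓ - a) 0 - (b ^ 2)⁻¹ * max (ℓ - b) 0 ≤ ℓ * (a ^ 2)⁻¹ := by
    have h1 : 0 ≤ (b ^ 2)⁻¹ * max (ℓ - b) 0 := by positivity
    rw [hma]
    have : 0 < (a ^ 2)⁻¹ := by positivity
    nlinarith
  have e3 : a ^ (-(3 - ε)) = (a ^ 3)⁻¹ * a ^ ε := by
    rw [show -(3 - ε) = -3 + ε by ring, Real.rpow_add ha, Real.rpow_neg ha.le]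
    norm_num
  rw [e3]
  rcases le_total η a with h | h
  · have bound1 : (a ^ 2)⁻¹ * max (ℓ - a) 0 - (b ^ 2)⁻¹ * max (ℓ - b) 0
        ≤ 3 * ℓ * η * (a ^ 3)⁻¹ := by
      have d1 : (a ^ 2)⁻¹ - (b ^ 2)⁻¹ ≤ 2 * η * (a ^ 3)⁻¹ := by
        have : (a ^ 2)⁻¹ - (b ^ 2)⁻¹ = (b - a) * ((b + a) * (a ^ 2)⁻¹ * (b ^ 2)⁻¹) := by
          field_simp; ring
        rw [this]
        have : (b + a) * (a ^ 2)⁻¹ * (b ^ 2)⁻¹ ≤ 2 * (a ^ 3)⁻¹ := by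
          rw [← sub_nonneg]
          have : 2 * (a ^ 3)⁻¹ - (b + a) * (a ^ 2)⁻¹ * (b ^ 2)⁻¹
              = (2 * b ^ 2 - a * b - a ^ 2) * ((a ^ 3)⁻¹ * (b ^ 2)⁻¹) := by
            field_simp; ring
          rw [this]
          have : 0 ≤ 2 * b ^ 2 - a * b - a ^ 2 := by nlinarith
          positivity
        have h0 : 0 ≤ (b + a) * (a ^ 2)⁻¹ * (b ^ 2)⁻¹ := by positivity
        calc (b - a) * ((b + a) * (a ^ 2)⁻¹ * (b ^ 2)⁻¹) ≤ η * (2 * (a ^ 3)⁻¹) := by gcongr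
          _ = _ := by ring
      have d2 : max (ℓ - a) 0 - max (ℓ - b) 0 ≤ η := by
        rw [hma]; linarith [le_max_left (ℓ - b) 0]
      have h2 : (b ^ 2)⁻¹ ≤ ℓ * (a ^ 3)⁻¹ := by
        refine hinv.trans ?_
        have : (a ^ 2)⁻¹ = a * (a ^ 3)⁻¹ := by field_simp
        rw [this]; gcongr
      have h3 : max (ℓ - a) 0 ≤ ℓ := by rw [hma]; linarith
      have d0 : 0 ≤ max (ℓ - a) 0 - max (ℓ - b) 0 := by linarith
      calc (a ^ 2)⁻¹ * max (ℓ - a) 0 - (b ^ 2)⁻¹ * max (ℓ - b) 0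
          = ((a ^ 2)⁻¹ - (b ^ 2)⁻¹) * max (ℓ - a) 0
            + (b ^ 2)⁻¹ * (max (ℓ - a) 0 - max (ℓ - b) 0) := by ring
        _ ≤ (2 * η * (a ^ 3)⁻¹) * ℓ + (ℓ * (a ^ 3)⁻¹) * η := by gcongr
        _ = _ := by ring
    refine bound1.trans ?_
    have : η ≤ η ^ (1 - ε) * a ^ ε := by
      rcases hη0.eq_or_lt with h0 | h0
      · rw [← h0]; positivity
      · calc η = η ^ (1 - ε) * η ^ ε := by rw [← Real.rpow_add h0]; simp
          _ ≤ _ := by gcongr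
    calc 3 * ℓ * η * (a ^ 3)⁻¹ ≤ 3 * ℓ * (η ^ (1 - ε) * a ^ ε) * (a ^ 3)⁻¹ := by gcongr
      _ = _ := by ring
  · refine bound0.trans ?_
    have : a ≤ η ^ (1 - ε) * a ^ ε := by
      calc a = a ^ (1 - ε) * a ^ ε := by rw [← Real.rpow_add ha]; simp
        _ ≤ _ := by gcongr
    calc ℓ * (a ^ 2)⁻¹ = ℓ * a * (a ^ 3)⁻¹ := by field_simp
      _ ≤ ℓ * (η ^ (1 - ε) * a ^ ε) * (a ^ 3)⁻¹ := by gcongr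
      _ ≤ 3 * ℓ * η ^ (1 - ε) * ((a ^ 3)⁻¹ * a ^ ε) := by
        have : 0 ≤ ℓ * (η ^ (1 - ε) * a ^ ε) * (a ^ 3)⁻¹ := by positivity
        linarith

theorem abs_pairKernel_sub_le {ℓ D ε : ℝ} (hε : 0 ≤ ε) (hε1 : ε ≤ 1) (hℓ : 0 ≤ ℓ)
    (hℓD : ℓ ≤ D) {z h : E3} (hz : z ≠ 0) (hzh : z + h ≠ 0) :
    |pairKernel ℓ (z + h) - pairKernel ℓ z|
      ≤ 3 * ℓ * ‖h‖ ^ (1 - ε) * (singWeight D ε z + singWeight D ε (z + h)) := by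
  have aux : ∀ x y : E3, x ≠ 0 → y ≠ 0 → ‖x‖ ≤ ‖y‖ → ‖y‖ - ‖x‖ ≤ ‖h‖ →
      |pairKernel ℓ x - pairKernel ℓ y| ≤ 3 * ℓ * ‖h‖ ^ (1 - ε) * singWeight D ε x := by
    intro x y hx hy hxy hh
    by_cases hxl : ‖x‖ < ℓ
    · have hmem : x ∈ Metric.ball (0 : E3) D := by simpa using hxl.trans_le hℓD
      have := pairKernel_profile_diff_le hε hε1 (norm_pos_iff.2 hx) hxy hh hxl
      simpa only [pairKernel, singWeight, indicator_of_mem hmem] using this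
    · have h1 : pairKernel ℓ x = 0 := by simp [pairKernel, max_eq_right (by linarith : ℓ - ‖x‖ ≤ 0)]
      have h2 : pairKernel ℓ y = 0 := by simp [pairKernel, max_eq_right (by linarith : ℓ - ‖y‖ ≤ 0)]
      rw [h1, h2]
      have := singWeight_nonneg D ε x
      simp only [sub_zero, abs_zero]; positivity
  have n1 := singWeight_nonneg D ε z
  have n2 := singWeight_nonneg D ε (z + h)
  have hc : 0 ≤ 3 * ℓ * ‖h‖ ^ (1 - ε) := by positivity
  rcases le_total ‖z‖ ‖z + h‖ with hle | hle
  · rw [abs_sub_comm]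
    refine (aux z (z + h) hz hzh hle ?_).trans (by gcongr; linarith)
    linarith [norm_add_le z h]
  · refine (aux (z + h) z hzh hz hle ?_).trans (by gcongr; linarith)
    have := norm_sub_le (z + h) h
    rw [add_sub_cancel_right] at this
    linarith

/-- The kernel has almost one derivative in `L¹`. Keeping the factor `ℓ` is essential: it later
cancels a weight `1/r` when rays of length proportional to `r` are superposed. -/
theorem exists_lintegral_pairKernel_sub_le (D : ℝ) {ε : ℝ} (hε : 0 < ε) (hε1 : ε ≤ 1) :
    ∃ C : ℝ, 0 < C ∧ ∀ ℓ, 0 ≤ ℓ → ℓ ≤ D → ∀ h : E3,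
      ∫⁻ z, ‖pairKernel ℓ (z + h) - pairKernel ℓ z‖ₑ ≤ ENNReal.ofReal (C * ℓ * ‖h‖ ^ (1 - ε)) := by
  set I := ∫⁻ z, ENNReal.ofReal (singWeight D ε z) with hI
  have hIt : I < ⊤ := lintegral_singWeight_lt_top D hε
  refine ⟨6 * (I.toReal + 1), by positivity, fun ℓ hℓ hℓD h => ?_⟩
  have h0 : ∀ᵐ z : E3, z ≠ 0 := by simp [ae_iff]
  have h1 : ∀ᵐ z : E3, z + h ≠ 0 := by
    have : {z : E3 | ¬ (z + h ≠ 0)} = {-h} := by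
      ext z; simp [add_eq_zero_iff_eq_neg]
    rw [ae_iff, this]; simp
  have hms := measurable_singWeight D ε
  calc _ ≤ ∫⁻ z, ENNReal.ofReal (3 * ℓ * ‖h‖ ^ (1 - ε)) *
        (ENNReal.ofReal (singWeight D ε z) + ENNReal.ofReal (singWeight D ε (z + h))) := by
        refine lintegral_mono_ae ?_
        filter_upwards [h0, h1] with z hz hzh
        rw [Real.enorm_eq_ofReal_abs, ← ENNReal.ofReal_add (singWeight_nonneg _ _ _)
          (singWeight_nonneg _ _ _), ← ENNReal.ofReal_mul (by positivity)]
        exact ENNReal.ofReal_le_ofReal (abs_pairKernel_sub_le hε.le hε1 hℓ hℓD hz hzh)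
    _ = ENNReal.ofReal (3 * ℓ * ‖h‖ ^ (1 - ε)) * (I + I) := by
        rw [lintegral_const_mul _ (by fun_prop), lintegral_add_left (by fun_prop),
          lintegral_add_right_eq_self (fun z => ENNReal.ofReal (singWeight D ε z)) h]
    _ ≤ _ := by
        rw [← ENNReal.ofReal_toReal hIt.ne, ← ENNReal.ofReal_add (by positivity) (by positivity),
          ← ENNReal.ofReal_mul (by positivity)]
        refine ENNReal.ofReal_le_ofReal ?_
        rw [ENNReal.toReal_ofReal (by positivity)]
        have : 0 ≤ ℓ * ‖h‖ ^ (1 - ε) := by positivity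
        nlinarith

theorem lintegral_pairKernel_lt_top (ℓ : ℝ) :
    ∫⁻ z, ENNReal.ofReal (pairKernel ℓ z) < ⊤ := by
  refine lt_of_le_of_lt (b := ENNReal.ofReal |ℓ| * ∫⁻ z, ENNReal.ofReal (singWeight ℓ 1 z)) ?_
    (ENNReal.mul_lt_top ENNReal.ofReal_lt_top (lintegral_singWeight_lt_top ℓ one_pos))
  rw [← lintegral_const_mul _ (by have := measurable_singWeight ℓ 1; fun_prop)]
  refine lintegral_mono fun z => ?_
  rw [← ENNReal.ofReal_mul (abs_nonneg _)]
  refine ENNReal.ofReal_le_ofReal ?_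
  unfold pairKernel singWeight
  by_cases hz : z ∈ Metric.ball (0 : E3) ℓ
  · rw [indicator_of_mem hz]
    have hz' : ‖z‖ < ℓ := by simpa using hz
    rw [max_eq_left (by linarith), show -(3 - (1 : ℝ)) = -2 by norm_num,
      Real.rpow_neg (norm_nonneg z), abs_of_nonneg ((norm_nonneg z).trans hz'.le), mul_comm]
    norm_num
    gcongr
    linarith [norm_nonneg z]
  · rw [indicator_of_notMem hz]
    have hz' : ℓ ≤ ‖z‖ := by simpa using hz
    rw [max_eq_right (by linarith)]; simp


/-! ### The quadratic form of ray integrals -/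

/-- The values of `β` on the segment from `y` in direction `w` of length `ℓ`, with `p = (w, y)`. -/
def rayFun (β : E3 → ℝ) (ℓ : ℝ) (p : E3 × E3) (s : ℝ) : ℝ :=
  (Ioc 0 (ℓ / ‖p.1‖)).indicator (fun s => β (p.2 + s • p.1)) s

theorem rayFun_of_mem {β : E3 → ℝ} {ℓ : ℝ} {p : E3 × E3} {s : ℝ} (hs : s ∈ Ioc 0 (ℓ / ‖p.1‖)) :
    rayFun β ℓ p s = β (p.2 + s • p.1) := indicator_of_mem hs _

theorem rayFun_of_notMem {β : E3 → ℝ} {ℓ : ℝ} {p : E3 × E3} {s : ℝ}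
    (hs : s ∉ Ioc 0 (ℓ / ‖p.1‖)) : rayFun β ℓ p s = 0 := indicator_of_notMem hs _

theorem measurable_rayFun {β : E3 → ℝ} (hβ : Measurable β) (ℓ : ℝ) :
    Measurable fun p : (E3 × E3) × ℝ => rayFun β ℓ p.1 p.2 := by
  have hs : MeasurableSet {p : (E3 × E3) × ℝ | 0 < p.2 ∧ p.2 ≤ ℓ / ‖p.1.1‖} :=
    (measurableSet_lt measurable_const measurable_snd).inter
      (measurableSet_le measurable_snd (by fun_prop))
  have hm : Measurable fun p : (E3 × E3) × ℝ => β (p.1.2 + p.2 • p.1.1) := by fun_prop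
  have e : (fun p : (E3 × E3) × ℝ => rayFun β ℓ p.1 p.2)
      = {p : (E3 × E3) × ℝ | 0 < p.2 ∧ p.2 ≤ ℓ / ‖p.1.1‖}.indicator
        (fun p => β (p.1.2 + p.2 • p.1.1)) := by
    ext p
    by_cases hp : p.2 ∈ Ioc 0 (ℓ / ‖p.1.1‖)
    · rw [rayFun_of_mem hp, indicator_of_mem (by exact hp)]
    · rw [rayFun_of_notMem hp, indicator_of_notMem (by exact hp)]
  rw [e]
  exact hm.indicator hs

theorem integral_rayFun (β : E3 → ℝ) (ℓ : ℝ) (p : E3 × E3) :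
    ∫ s, rayFun β ℓ p s = ∫ s in Ioc 0 (ℓ / ‖p.1‖), β (p.2 + s • p.1) := by
  unfold rayFun
  rw [integral_indicator measurableSet_Ioc]

/-- The integrand whose integral is the averaged square of ray integrals. -/
def rayPair (β : E3 → ℝ) (ℓ : ℝ) (p : (E3 × E3) × (ℝ × ℝ)) : ℝ :=
  ((1 + ‖p.1.1‖) ^ 2)⁻¹ * (rayFun β ℓ p.1 p.2.1 * rayFun β ℓ p.1 p.2.2)

theorem measurable_rayPair {β : E3 → ℝ} (hβ : Measurable β) (ℓ : ℝ) :
    Measurable (rayPair β ℓ) := by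
  have h := measurable_rayFun hβ ℓ
  have h1 := h.comp
    (by fun_prop : Measurable fun p : (E3 × E3) × (ℝ × ℝ) => (p.1, p.2.1))
  have h2 := h.comp
    (by fun_prop : Measurable fun p : (E3 × E3) × (ℝ × ℝ) => (p.1, p.2.2))
  have h3 : Measurable fun p : (E3 × E3) × (ℝ × ℝ) => ((1 + ‖p.1.1‖) ^ 2)⁻¹ := by fun_prop
  have h4 := h3.mul (h1.mul h2)
  exact h4

/-- The test functions `β` have no sign, while the ray formula is about nonnegative integrands. A
positively homogeneous `T` covers the positive part, the negative part and the absolute value at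
once, which together give integrability and the signed identity. -/
theorem lintegral_ray_pair_prod {β : E3 → ℝ} (hβ : Measurable β) (ℓ : ℝ) {T : ℝ → ENNReal}
    (hT : Measurable T) (hTm : ∀ c a, 0 ≤ c → T (c * a) = ENNReal.ofReal c * T a) :
    ∫⁻ p : (E3 × E3) × (ℝ × ℝ), T (rayPair β ℓ p)
      = rayConst * ∫⁻ z : E3, ∫⁻ y : E3, T (pairKernel ℓ z * (β y * β (y + z))) := by
  have hT0 : T 0 = 0 := by simpa using hTm 0 0 le_rfl
  have hq : Measurable fun p => T (rayPair β ℓ p) := hT.comp (measurable_rayPair hβ ℓ)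
  have hΘ : Measurable fun p : E3 × E3 => T (β p.1 * β p.2) :=
    hT.comp ((hβ.comp measurable_fst).mul (hβ.comp measurable_snd))
  rw [Measure.volume_eq_prod, lintegral_prod _ hq.aemeasurable, Measure.volume_eq_prod,
    lintegral_prod _ hq.lintegral_prod_right'.aemeasurable]
  have key := lintegral_ray_pair hΘ ℓ
  have e2 : ∀ z y : E3, T (pairKernel ℓ z * (β y * β (y + z)))
      = ENNReal.ofReal ((‖z‖ ^ 2)⁻¹ * max (ℓ - ‖z‖) 0) * T (β y * β (y + z)) :=
    fun z y => hTm _ _ (pairKernel_nonneg ℓ z)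
  simp_rw [e2]
  rw [← key]
  congr 1; ext w
  congr 1; ext y
  set I := Ioc 0 (ℓ / ‖w‖) with hI
  have m2 : Measurable fun p : ℝ × ℝ => ENNReal.ofReal ((1 + ‖w‖) ^ 2)⁻¹ *
      T (β (y + p.1 • w) * β (y + p.2 • w)) := by fun_prop
  rw [← lintegral_prod _ (m2.aemeasurable (μ := (volume.restrict I).prod (volume.restrict I))),
    Measure.prod_restrict, ← lintegral_indicator (measurableSet_Ioc.prod measurableSet_Ioc),
    ← Measure.volume_eq_prod]
  congr 1; ext p
  unfold rayPair
  by_cases hp1 : p.1 ∈ I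
  · by_cases hp2 : p.2 ∈ I
    · rw [indicator_of_mem (show p ∈ I ×ˢ I from ⟨hp1, hp2⟩), rayFun_of_mem (p := (w, y)) hp1,
        rayFun_of_mem (p := (w, y)) hp2, hTm _ _ (by positivity)]
    · rw [indicator_of_notMem (show p ∉ I ×ˢ I from fun h => hp2 h.2), rayFun_of_notMem (p := (w, y)) hp2]
      simp [hT0]
  · rw [indicator_of_notMem (show p ∉ I ×ˢ I from fun h => hp1 h.1), rayFun_of_notMem (p := (w, y)) hp1]
    simp [hT0]

/-- The averaged square of ray integrals as a correlation integral. -/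
theorem lintegral_sq_ray_eq {β : E3 → ℝ} (hβ : Measurable β) (ℓ : ℝ)
    (hint : Integrable (fun p : E3 × E3 => pairKernel ℓ p.1 * (β p.2 * β (p.2 + p.1)))) :
    ∫⁻ w : E3, ∫⁻ y : E3, ENNReal.ofReal ((1 + ‖w‖) ^ 2)⁻¹ *
        ‖∫ s in Ioc 0 (ℓ / ‖w‖), β (y + s • w)‖ₑ ^ 2
      = rayConst * ENNReal.ofReal (∫ p : E3 × E3, pairKernel ℓ p.1 * (β p.2 * β (p.2 + p.1))) := by
  set k : E3 × E3 → ℝ := fun p => pairKernel ℓ p.1 * (β p.2 * β (p.2 + p.1)) with hk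
  have hkm : Measurable k := by
    have := measurable_pairKernel ℓ
    fun_prop
  set q : (E3 × E3) × (ℝ × ℝ) → ℝ := rayPair β ℓ with hq
  have hqm : Measurable q := measurable_rayPair hβ ℓ
  have gen : ∀ T : ℝ → ENNReal, Measurable T →
      (∀ c a, 0 ≤ c → T (c * a) = ENNReal.ofReal c * T a) →
      ∫⁻ p, T (q p) = rayConst * ∫⁻ p, T (k p) := by
    intro T hT hTm
    rw [Measure.volume_eq_prod E3 E3, lintegral_prod _ (by fun_prop)]
    exact lintegral_ray_pair_prod hβ ℓ hT hTm
  have gpos := gen ENNReal.ofReal ENNReal.measurable_ofReal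
    (fun c a hc => ENNReal.ofReal_mul hc)
  have gneg := gen (fun a => ENNReal.ofReal (-a)) (by fun_prop) (fun c a hc => by
    rw [← mul_neg, ENNReal.ofReal_mul hc])
  have gabs := gen (fun a => ‖a‖ₑ) (by fun_prop) (fun c a hc => by
    rw [enorm_mul, Real.enorm_of_nonneg hc])
  have hqi : Integrable q := by
    refine ⟨hqm.aestronglyMeasurable, ?_⟩
    rw [hasFiniteIntegral_iff_enorm, gabs]
    exact ENNReal.mul_lt_top rayConst_lt_top hint.2
  have hqk : ∫ p, q p = rayConst.toReal * ∫ p, k p := by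
    rw [integral_eq_lintegral_pos_part_sub_lintegral_neg_part hqi,
      integral_eq_lintegral_pos_part_sub_lintegral_neg_part hint, gpos, gneg,
      ENNReal.toReal_mul, ENNReal.toReal_mul]
    ring
  have hin : ∀ p : E3 × E3, ∫ r : ℝ × ℝ, q (p, r) = ((1 + ‖p.1‖) ^ 2)⁻¹ *
      (∫ s in Ioc 0 (ℓ / ‖p.1‖), β (p.2 + s • p.1)) ^ 2 := by
    intro p
    simp only [hq, rayPair]
    rw [integral_const_mul, Measure.volume_eq_prod,
      integral_prod_mul (rayFun β ℓ p) (rayFun β ℓ p), integral_rayFun, ← sq]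
  have hqi2 : Integrable fun p : E3 × E3 => ((1 + ‖p.1‖) ^ 2)⁻¹ *
      (∫ s in Ioc 0 (ℓ / ‖p.1‖), β (p.2 + s • p.1)) ^ 2 := by
    have := hqi.integral_prod_left
    exact this.congr (Eventually.of_forall hin)
  have hsq : ∫ p : E3 × E3, ((1 + ‖p.1‖) ^ 2)⁻¹ *
      (∫ s in Ioc 0 (ℓ / ‖p.1‖), β (p.2 + s • p.1)) ^ 2 = rayConst.toReal * ∫ p, k p := by
    rw [← hqk, Measure.volume_eq_prod (E3 × E3), integral_prod _ hqi]
    exact integral_congr_ae (Eventually.of_forall fun p => (hin p).symm)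
  rw [← ENNReal.ofReal_toReal rayConst_lt_top.ne, ← ENNReal.ofReal_mul (by positivity), ← hsq,
    ofReal_integral_eq_lintegral_ofReal hqi2 (Eventually.of_forall fun p => by positivity),
    Measure.volume_eq_prod, lintegral_prod _ hqi2.1.aemeasurable.ennreal_ofReal]
  congr 1; ext w
  congr 1; ext y
  rw [ENNReal.ofReal_mul (by positivity), ← enorm_pow, Real.enorm_of_nonneg (sq_nonneg _)]

theorem integrable_pairKernel (ℓ : ℝ) : Integrable (pairKernel ℓ) := by
  refine ⟨(measurable_pairKernel ℓ).aestronglyMeasurable, ?_⟩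
  rw [hasFiniteIntegral_iff_enorm]
  simp_rw [Real.enorm_of_nonneg (pairKernel_nonneg ℓ _)]
  exact lintegral_pairKernel_lt_top ℓ

theorem integrable_pairKernel_mul {β b : E3 → ℝ} (hβ : Integrable β) (hb : Measurable b)
    {M : ℝ} (hM : ∀ x, |b x| ≤ M) {P : E3 → ℝ} (hP : Integrable P) :
    Integrable (fun p : E3 × E3 => P p.1 * (β p.2 * b (p.2 + p.1))) := by
  have h1 : Integrable (fun p : E3 × E3 => P p.1 * β p.2) := hP.mul_prod hβ
  have h2 := h1.bdd_mul (f := fun p : E3 × E3 => b (p.2 + p.1)) (c := M)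
    (hb.comp (by fun_prop)).aestronglyMeasurable (Eventually.of_forall fun p => hM _)
  refine h2.congr (Eventually.of_forall fun p => ?_)
  simp only; ring

theorem two_mul_enorm_mul_enorm_le (x y : ℝ) :
    2 * (‖x‖ₑ * ‖y‖ₑ) ≤ ‖x‖ₑ ^ 2 + ‖y‖ₑ ^ 2 := by
  rw [Real.enorm_eq_ofReal_abs, Real.enorm_eq_ofReal_abs,
    ← ENNReal.ofReal_mul (abs_nonneg _), ← ENNReal.ofReal_pow (abs_nonneg _),
    ← ENNReal.ofReal_pow (abs_nonneg _), ← ENNReal.ofReal_add (by positivity) (by positivity),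
    show (2 : ENNReal) = ENNReal.ofReal 2 by simp, ← ENNReal.ofReal_mul (by norm_num)]
  refine ENNReal.ofReal_le_ofReal ?_
  nlinarith [sq_nonneg (|x| - |y|)]

theorem lintegral_enorm_mul_shift_le {b : E3 → ℝ} (hb : Measurable b) (a c : E3) :
    2 * ∫⁻ y, ‖b (y + a)‖ₑ * ‖b (y + c)‖ₑ ≤ 2 * ∫⁻ y, ‖b y‖ₑ ^ 2 := by
  rw [← lintegral_const_mul _ (by fun_prop)]
  calc _ ≤ ∫⁻ y, (‖b (y + a)‖ₑ ^ 2 + ‖b (y + c)‖ₑ ^ 2) := by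
        exact lintegral_mono fun y => two_mul_enorm_mul_enorm_le _ _
    _ = _ := by
        rw [lintegral_add_left (by fun_prop),
          lintegral_add_right_eq_self (fun y => ‖b y‖ₑ ^ 2) a,
          lintegral_add_right_eq_self (fun y => ‖b y‖ₑ ^ 2) c, two_mul]

/-- Averaging over directions gains half a derivative on ray integrals. -/
theorem lintegral_sq_ray_diff_le {b : E3 → ℝ} (hb : Measurable b) (hbi : Integrable b) {M : ℝ}
    (hM : ∀ x, |b x| ≤ M) (h : E3) (ℓ : ℝ) :
    ∫⁻ w : E3, ∫⁻ y : E3, ENNReal.ofReal ((1 + ‖w‖) ^ 2)⁻¹ *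
        ‖∫ s in Ioc 0 (ℓ / ‖w‖), (b (y + s • w - h) - b (y + s • w))‖ₑ ^ 2
      ≤ rayConst * ((∫⁻ z, ‖pairKernel ℓ (z + h) - pairKernel ℓ z‖ₑ) * (2 * ∫⁻ y, ‖b y‖ₑ ^ 2)) := by
  set β : E3 → ℝ := fun x => b (x - h) - b x with hβ
  have hβm : Measurable β := by fun_prop
  have hβi : Integrable β := (hbi.comp_sub_right h).sub hbi
  have hβM : ∀ x, |β x| ≤ 2 * M := fun x => by
    have := abs_sub (b (x - h)) (b x)
    linarith [hM (x - h), hM x]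
  have hP := integrable_pairKernel ℓ
  have i1 := integrable_pairKernel_mul hβi hβm hβM hP
  have i2 := integrable_pairKernel_mul hβi hb hM hP
  have i3 := integrable_pairKernel_mul hβi hb hM (hP.comp_add_right h)
  -- Translating `z` by `h` moves one of the two differences from `b` onto the kernel. The other one
  -- is only estimated by the size of `b`.
  have hshift : ∫ p : E3 × E3, pairKernel ℓ p.1 * (β p.2 * b (p.2 + p.1 - h))
      = ∫ p : E3 × E3, pairKernel ℓ (p.1 + h) * (β p.2 * b (p.2 + p.1)) := by
    rw [Measure.volume_eq_prod]
    have := integral_add_right_eq_self (μ := (volume : Measure E3).prod (volume : Measure E3))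
      (fun p : E3 × E3 => pairKernel ℓ p.1 * (β p.2 * b (p.2 + p.1 - h))) (h, 0)
    rw [← this]
    congr 1; ext p
    simp only [Prod.fst_add, Prod.snd_add, add_zero]
    congr 3; abel
  have i4 : Integrable (fun p : E3 × E3 => pairKernel ℓ p.1 * (β p.2 * b (p.2 + p.1 - h))) := by
    refine (i1.add i2).congr (Eventually.of_forall fun p => ?_)
    simp only [hβ, Pi.add_apply]; ring
  rw [lintegral_sq_ray_eq hβm ℓ i1]
  gcongr
  have e : ∫ p : E3 × E3, pairKernel ℓ p.1 * (β p.2 * β (p.2 + p.1))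
      = ∫ p : E3 × E3, (pairKernel ℓ (p.1 + h) - pairKernel ℓ p.1) * (β p.2 * b (p.2 + p.1)) := by
    have a1 : ∫ p : E3 × E3, pairKernel ℓ p.1 * (β p.2 * β (p.2 + p.1))
        = (∫ p : E3 × E3, pairKernel ℓ p.1 * (β p.2 * b (p.2 + p.1 - h)))
          - ∫ p : E3 × E3, pairKernel ℓ p.1 * (β p.2 * b (p.2 + p.1)) := by
      rw [← integral_sub i4 i2]
      congr 1; ext p
      simp only [hβ]; ring
    rw [a1, hshift, ← integral_sub i3 i2]
    congr 1; ext p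
    ring
  rw [e]
  calc _ ≤ ∫⁻ p : E3 × E3, ‖(pairKernel ℓ (p.1 + h) - pairKernel ℓ p.1) *
          (β p.2 * b (p.2 + p.1))‖ₑ := by
        refine (ENNReal.ofReal_le_ofReal (le_abs_self _)).trans ?_
        rw [← Real.enorm_eq_ofReal_abs]
        exact enorm_integral_le_lintegral_enorm _
    _ = ∫⁻ z, ‖pairKernel ℓ (z + h) - pairKernel ℓ z‖ₑ * ∫⁻ y, ‖β y * b (y + z)‖ₑ := by
        have hPm := measurable_pairKernel ℓ
        rw [Measure.volume_eq_prod, lintegral_prod _ (by fun_prop)]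
        congr 1; ext z
        rw [← lintegral_const_mul _ (by fun_prop)]
        congr 1; ext y
        rw [enorm_mul]
    _ ≤ ∫⁻ z, ‖pairKernel ℓ (z + h) - pairKernel ℓ z‖ₑ * (2 * ∫⁻ y, ‖b y‖ₑ ^ 2) := by
        gcongr with z
        calc ∫⁻ y, ‖β y * b (y + z)‖ₑ
            ≤ ∫⁻ y, (‖b (y + -h)‖ₑ * ‖b (y + z)‖ₑ + ‖b (y + 0)‖ₑ * ‖b (y + z)‖ₑ) := by
              refine lintegral_mono fun y => ?_
              rw [enorm_mul, ← add_mul]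
              gcongr
              simp only [hβ, add_zero, ← sub_eq_add_neg]
              exact enorm_sub_le
          _ = (∫⁻ y, ‖b (y + -h)‖ₑ * ‖b (y + z)‖ₑ) + ∫⁻ y, ‖b (y + 0)‖ₑ * ‖b (y + z)‖ₑ := by
              rw [lintegral_add_left (by fun_prop)]
          _ ≤ (∫⁻ y, ‖b y‖ₑ ^ 2) + ∫⁻ y, ‖b y‖ₑ ^ 2 := by
              have t2 : (2 : ENNReal) ≠ 0 := by norm_num
              have t3 : (2 : ENNReal) ≠ ⊤ := by norm_num
              have l1 := lintegral_enorm_mul_shift_le hb (-h) z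
              have l2 := lintegral_enorm_mul_shift_le hb 0 z
              rw [ENNReal.mul_le_mul_iff_right t2 t3] at l1 l2
              exact add_le_add l1 l2
          _ = _ := (two_mul _).symm
    _ = _ := by
        have hPm := measurable_pairKernel ℓ
        rw [lintegral_mul_const _ (by fun_prop)]


/-! ### Damped integrals along a segment -/

/-- Integration by parts against the primitive of `β`. Since `β` is merely integrable, the primitive
is only absolutely continuous. -/
theorem integral_exp_neg_mul_eq {β : ℝ → ℝ} (ν T : ℝ) (hβ : IntervalIntegrable β volume 0 T) :
    ∫ s in (0 : ℝ)..T, Real.exp (-ν * s) * β s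
      = Real.exp (-ν * T) * (∫ s in (0 : ℝ)..T, β s)
        + ∫ t in (0 : ℝ)..T, ν * Real.exp (-ν * t) * ∫ s in (0 : ℝ)..t, β s := by
  have hd : ∀ s, HasDerivAt (fun s => Real.exp (-ν * s)) (-ν * Real.exp (-ν * s)) s := fun s => by
    have := ((hasDerivAt_id s).const_mul (-ν)).exp
    simpa [mul_comm] using this
  have hg : AbsolutelyContinuousOnInterval (fun t => ∫ s in (0 : ℝ)..t, β s) 0 T :=
    hβ.absolutelyContinuousOnInterval_intervalIntegral (c := 0) (by simp)
  have hci : IntervalIntegrable (fun s => -ν * Real.exp (-ν * s)) volume 0 T :=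
    (by fun_prop : Continuous fun s => -ν * Real.exp (-ν * s)).intervalIntegrable _ _
  have hf : AbsolutelyContinuousOnInterval (fun s => Real.exp (-ν * s)) 0 T := by
    have h1 := hci.absolutelyContinuousOnInterval_intervalIntegral (c := 0) (by simp)
    have h2 : (fun s => Real.exp (-ν * s))
        = fun t => (∫ s in (0 : ℝ)..t, -ν * Real.exp (-ν * s)) - (-1) := by
      ext t
      rw [intervalIntegral.integral_eq_sub_of_hasDerivAt (fun s _ => hd s)
        ((by fun_prop : Continuous fun s => -ν * Real.exp (-ν * s)).intervalIntegrable _ _)]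
      simp
    rw [h2]
    refine h1.sub ?_
    have h3 := (IntervalIntegrable.zero (μ := volume) (a := 0) (b := T) (E := ℝ)).absolutelyContinuousOnInterval_intervalIntegral
      (c := 0) (by simp)
    unfold AbsolutelyContinuousOnInterval at h3 ⊢
    simpa using h3
  have key := hf.integral_mul_deriv_eq_deriv_mul hg
  have e1 : ∫ s in (0 : ℝ)..T, Real.exp (-ν * s) * β s
      = ∫ s in (0 : ℝ)..T, Real.exp (-ν * s) * deriv (fun t => ∫ s in (0 : ℝ)..t, β s) s := by
    refine intervalIntegral.integral_congr_ae ?_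
    filter_upwards [hβ.ae_hasDerivAt_integral] with x hx hx'
    rw [(hx (uIoc_subset_uIcc hx') 0 (by simp)).deriv]
  rw [e1, key]
  simp only [(hd _).deriv, intervalIntegral.integral_same, mul_zero, sub_zero]
  rw [sub_eq_add_neg, ← intervalIntegral.integral_neg]
  congr 1
  refine intervalIntegral.integral_congr fun x _ => ?_
  ring

theorem enorm_add_sq_le (x y : ℝ) : ‖x + y‖ₑ ^ 2 ≤ 2 * ‖x‖ₑ ^ 2 + 2 * ‖y‖ₑ ^ 2 := by
  rw [Real.enorm_eq_ofReal_abs, Real.enorm_eq_ofReal_abs, Real.enorm_eq_ofReal_abs,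
    ← ENNReal.ofReal_pow (abs_nonneg _), ← ENNReal.ofReal_pow (abs_nonneg _),
    ← ENNReal.ofReal_pow (abs_nonneg _), show (2 : ENNReal) = ENNReal.ofReal 2 by simp,
    ← ENNReal.ofReal_mul (by norm_num), ← ENNReal.ofReal_mul (by norm_num),
    ← ENNReal.ofReal_add (by positivity) (by positivity)]
  refine ENNReal.ofReal_le_ofReal ?_
  simp only [sq_abs]
  nlinarith [sq_nonneg (x - y)]

/-- A damped integral is controlled by the undamped integrals over the initial segments. -/
theorem enorm_damped_integral_sq_le {β : ℝ → ℝ} (hβ : Measurable β) {M : ℝ} (hM : ∀ s, |β s| ≤ M)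
    {ν T : ℝ} (hν : 0 ≤ ν) (hT : 0 ≤ T) :
    ‖∫ s in Ioc 0 T, Real.exp (-ν * s) * β s‖ₑ ^ 2
      ≤ 2 * ‖∫ s in Ioc 0 T, β s‖ₑ ^ 2
        + 2 * ∫⁻ r in Ioc (0 : ℝ) 1, ENNReal.ofReal r⁻¹ * ‖∫ s in Ioc 0 (r * T), β s‖ₑ ^ 2 := by
  have hβi : ∀ a b : ℝ, IntervalIntegrable β volume a b := fun a b => by
    refine (intervalIntegrable_const (c := M)).mono_fun hβ.aestronglyMeasurable
      (Eventually.of_forall fun s => ?_)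
    simpa using (hM s).trans (le_abs_self M)
  rw [← intervalIntegral.integral_of_le hT, ← intervalIntegral.integral_of_le hT,
    integral_exp_neg_mul_eq ν T (hβi 0 T)]
  refine (enorm_add_sq_le _ _).trans ?_
  gcongr 2 * ?_ + 2 * ?_
  · rw [enorm_mul]
    have : ‖Real.exp (-ν * T)‖ₑ ≤ 1 := by
      rw [Real.enorm_of_nonneg (Real.exp_pos _).le]
      rw [← ENNReal.ofReal_one]
      exact ENNReal.ofReal_le_ofReal (Real.exp_le_one_iff.2 (by nlinarith))
    calc (‖Real.exp (-ν * T)‖ₑ * ‖∫ s in (0 : ℝ)..T, β s‖ₑ) ^ 2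
        ≤ (1 * ‖∫ s in (0 : ℝ)..T, β s‖ₑ) ^ 2 := by gcongr
      _ = _ := by rw [one_mul]
  -- After rescaling to the unit interval, `c exp(-c r)` is a density of mass at most one, so the
  -- square may be moved inside the average. The bound `c exp(-c r) ≤ 1/r` then removes every trace
  -- of the damping rate.
  set c := ν * T with hc
  have hc0 : 0 ≤ c := by positivity
  set B : ℝ → ℝ := fun r => ∫ s in (0 : ℝ)..(r * T), β s with hB
  have hBc : Continuous B :=
    (intervalIntegral.continuous_primitive hβi 0).comp (by fun_prop : Continuous fun r => r * T)
  have e1 : ∫ t in (0 : ℝ)..T, ν * Real.exp (-ν * t) * ∫ s in (0 : ℝ)..t, β s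
      = ∫ r in (0 : ℝ)..1, c * Real.exp (-c * r) * B r := by
    have := intervalIntegral.smul_integral_comp_mul_right (a := 0) (b := 1)
      (fun t => ν * Real.exp (-ν * t) * ∫ s in (0 : ℝ)..t, β s) T
    simp only [zero_mul, one_mul] at this
    rw [← this, smul_eq_mul, ← intervalIntegral.integral_const_mul]
    refine intervalIntegral.integral_congr fun r _ => ?_
    simp only [hB, hc]
    rw [show -(ν * T) * r = -ν * (r * T) by ring]
    ring
  have hp : ∀ r, 0 ≤ c * Real.exp (-c * r) := fun r => by positivity
  have hpi : ∫⁻ r in Ioc (0 : ℝ) 1, ENNReal.ofReal (c * Real.exp (-c * r)) ≤ 1 := by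
    rw [← ofReal_integral_eq_lintegral_ofReal
      ((by fun_prop : Continuous fun r => c * Real.exp (-c * r)).integrableOn_Ioc)
      (Eventually.of_forall hp), ← intervalIntegral.integral_of_le zero_le_one]
    have hd : ∀ s, HasDerivAt (fun s => -Real.exp (-c * s)) (c * Real.exp (-c * s)) s := fun s => by
      have := (((hasDerivAt_id s).const_mul (-c)).exp).fun_neg
      simpa [mul_comm] using this
    rw [intervalIntegral.integral_eq_sub_of_hasDerivAt (fun s _ => hd s)
      ((by fun_prop : Continuous fun s => c * Real.exp (-c * s)).intervalIntegrable _ _),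
      ← ENNReal.ofReal_one]
    refine ENNReal.ofReal_le_ofReal ?_
    have := Real.exp_pos (-c * 1)
    simp at this ⊢
    linarith
  rw [e1, intervalIntegral.integral_of_le zero_le_one]
  have hBm : Measurable fun r => ‖B r‖ₑ := hBc.measurable.enorm
  have hpm : Measurable fun r => ENNReal.ofReal (c * Real.exp (-c * r)) := by fun_prop
  set μp := (volume.restrict (Ioc (0 : ℝ) 1)).withDensity
    fun r => ENNReal.ofReal (c * Real.exp (-c * r)) with hμp
  calc ‖∫ r in Ioc (0 : ℝ) 1, c * Real.exp (-c * r) * B r‖ₑ ^ 2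
      ≤ (∫⁻ r in Ioc (0 : ℝ) 1, ENNReal.ofReal (c * Real.exp (-c * r)) * ‖B r‖ₑ) ^ 2 := by
        gcongr
        refine (enorm_integral_le_lintegral_enorm _).trans (le_of_eq ?_)
        congr 1; ext r
        rw [enorm_mul, Real.enorm_of_nonneg (hp r)]
    _ = (∫⁻ r, 1 * ‖B r‖ₑ ∂μp) ^ 2 := by
        rw [hμp, lintegral_withDensity_eq_lintegral_mul _ hpm (by fun_prop)]
        simp
    _ ≤ (∫⁻ r, 1 ^ 2 ∂μp) * ∫⁻ r, ‖B r‖ₑ ^ 2 ∂μp :=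
        lintegral_mul_sq_le _ (by fun_prop) (by fun_prop)
    _ ≤ 1 * ∫⁻ r in Ioc (0 : ℝ) 1, ENNReal.ofReal (c * Real.exp (-c * r)) * ‖B r‖ₑ ^ 2 := by
        refine mul_le_mul' ?_ (le_of_eq ?_)
        · rw [hμp, lintegral_withDensity_eq_lintegral_mul _ hpm (by fun_prop)]
          simpa using hpi
        · rw [hμp, lintegral_withDensity_eq_lintegral_mul _ hpm (by fun_prop)]
          simp
    _ ≤ _ := by
        rw [one_mul]
        refine setLIntegral_mono' measurableSet_Ioc fun r hr => ?_
        rw [← intervalIntegral.integral_of_le (by have := hr.1; positivity)]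
        gcongr
        have h1 : c * r * Real.exp (-(c * r)) ≤ 1 := by
          have h2 : c * r ≤ Real.exp (c * r) := by linarith [Real.add_one_le_exp (c * r)]
          rw [Real.exp_neg]
          rw [← div_eq_mul_inv]
          exact div_le_one_of_le₀ h2 (Real.exp_pos _).le
        rw [← one_div, le_div_iff₀ hr.1]
        calc _ = c * r * Real.exp (-(c * r)) := by ring_nf
          _ ≤ 1 := h1

/-! ### The averaging estimate for ray integrals, with damping -/

theorem measurable_rayFun_length {β : E3 → ℝ} (hβ : Measurable β) :
    Measurable fun p : (ℝ × (E3 × E3)) × ℝ => rayFun β p.1.1 p.1.2 p.2 := by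
  have hs : MeasurableSet {p : (ℝ × (E3 × E3)) × ℝ | 0 < p.2 ∧ p.2 ≤ p.1.1 / ‖p.1.2.1‖} :=
    (measurableSet_lt measurable_const measurable_snd).inter
      (measurableSet_le measurable_snd (by fun_prop))
  have hm : Measurable fun p : (ℝ × (E3 × E3)) × ℝ => β (p.1.2.2 + p.2 • p.1.2.1) := by fun_prop
  have e : (fun p : (ℝ × (E3 × E3)) × ℝ => rayFun β p.1.1 p.1.2 p.2)
      = {p : (ℝ × (E3 × E3)) × ℝ | 0 < p.2 ∧ p.2 ≤ p.1.1 / ‖p.1.2.1‖}.indicator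
        (fun p => β (p.1.2.2 + p.2 • p.1.2.1)) := by
    ext p
    by_cases hp : p.2 ∈ Ioc 0 (p.1.1 / ‖p.1.2.1‖)
    · rw [rayFun_of_mem hp, indicator_of_mem (by exact hp)]
    · rw [rayFun_of_notMem hp, indicator_of_notMem (by exact hp)]
  rw [e]
  exact hm.indicator hs

theorem measurable_integral_rayFun {β : E3 → ℝ} (hβ : Measurable β) :
    Measurable fun p : ℝ × (E3 × E3) => ∫ s in Ioc 0 (p.1 / ‖p.2.1‖), β (p.2.2 + s • p.2.1) := by
  have h := (measurable_rayFun_length hβ).stronglyMeasurable.integral_prod_right' (ν := volume)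
  simp_rw [integral_rayFun] at h
  exact h.measurable

/-- The damped integral is an average of undamped ones over segments of length `r D`, with weight
`1/r`. The undamped estimate for length `r D` carries a factor `r D`, which cancels the weight, so
the constant is uniform in the collision frequency. -/
theorem exists_lintegral_sq_damped_ray_diff_le {D ε : ℝ} (hD : 0 ≤ D) (hε : 0 < ε) (hε1 : ε ≤ 1) :
    ∃ C : ℝ, 0 < C ∧ ∀ (ν : E3 → ℝ), (∀ w, 0 ≤ ν w) → ∀ (b : E3 → ℝ) (M : ℝ), Measurable b →
      Integrable b → (∀ x, |b x| ≤ M) → ∀ h : E3,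
      ∫⁻ w : E3, ∫⁻ y : E3, ENNReal.ofReal ((1 + ‖w‖) ^ 2)⁻¹ *
        ‖∫ s in Ioc 0 (D / ‖w‖), Real.exp (-ν w * s) * (b (y + s • w - h) - b (y + s • w))‖ₑ ^ 2
      ≤ ENNReal.ofReal (C * ‖h‖ ^ (1 - ε)) * ∫⁻ y, ‖b y‖ₑ ^ 2 := by
  obtain ⟨C1, hC1, h1⟩ := exists_lintegral_pairKernel_sub_le D hε hε1
  refine ⟨8 * rayConst.toReal * C1 * D + 1, by positivity, fun ν hν b M hb hbi hM h => ?_⟩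
  set β : E3 → ℝ := fun x => b (x - h) - b x with hβ
  have hβm : Measurable β := by fun_prop
  have hβM : ∀ x, |β x| ≤ 2 * M := fun x => by
    have := abs_sub (b (x - h)) (b x)
    linarith [hM (x - h), hM x]
  set X : ENNReal := ∫⁻ y, ‖b y‖ₑ ^ 2 with hX
  have hΛ : ∀ ℓ, 0 ≤ ℓ → ℓ ≤ D → ∫⁻ w : E3, ∫⁻ y : E3, ENNReal.ofReal ((1 + ‖w‖) ^ 2)⁻¹ *
        ‖∫ s in Ioc 0 (ℓ / ‖w‖), β (y + s • w)‖ₑ ^ 2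
      ≤ ENNReal.ofReal ℓ * (rayConst * (ENNReal.ofReal (C1 * ‖h‖ ^ (1 - ε)) * (2 * X))) := by
    intro ℓ hℓ hℓD
    refine (lintegral_sq_ray_diff_le hb hbi hM h ℓ).trans ?_
    calc _ ≤ rayConst * (ENNReal.ofReal (C1 * ℓ * ‖h‖ ^ (1 - ε)) * (2 * X)) := by
          gcongr
          exact h1 ℓ hℓ hℓD h
      _ = _ := by
          rw [show C1 * ℓ * ‖h‖ ^ (1 - ε) = ℓ * (C1 * ‖h‖ ^ (1 - ε)) by ring,
            ENNReal.ofReal_mul hℓ]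
          ring
  set Y := rayConst * (ENNReal.ofReal (C1 * ‖h‖ ^ (1 - ε)) * (2 * X)) with hY
  have hmB := measurable_integral_rayFun hβm
  have m1 : Measurable fun p : ℝ × (E3 × E3) => ENNReal.ofReal ((1 + ‖p.2.1‖) ^ 2)⁻¹ *
      ‖∫ s in Ioc 0 (p.1 / ‖p.2.1‖), β (p.2.2 + s • p.2.1)‖ₑ ^ 2 := by fun_prop
  have m1' : ∀ ℓ : ℝ, Measurable fun p : E3 × E3 => ENNReal.ofReal ((1 + ‖p.1‖) ^ 2)⁻¹ *
      ‖∫ s in Ioc 0 (ℓ / ‖p.1‖), β (p.2 + s • p.1)‖ₑ ^ 2 := fun ℓ => by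
    have := m1.comp (by fun_prop : Measurable fun p : E3 × E3 => (ℓ, p))
    exact this
  have m2 : Measurable fun p : (E3 × E3) × ℝ => ENNReal.ofReal p.2⁻¹ *
      (ENNReal.ofReal ((1 + ‖p.1.1‖) ^ 2)⁻¹ *
      ‖∫ s in Ioc 0 (p.2 * D / ‖p.1.1‖), β (p.1.2 + s • p.1.1)‖ₑ ^ 2) := by
    have := m1.comp (by fun_prop : Measurable fun p : (E3 × E3) × ℝ => (p.2 * D, p.1))
    have h2 : Measurable fun p : (E3 × E3) × ℝ => ENNReal.ofReal p.2⁻¹ := by fun_prop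
    exact h2.mul this
  calc _ ≤ ∫⁻ w : E3, ∫⁻ y : E3, (2 * (ENNReal.ofReal ((1 + ‖w‖) ^ 2)⁻¹ *
          ‖∫ s in Ioc 0 (D / ‖w‖), β (y + s • w)‖ₑ ^ 2)
        + 2 * ∫⁻ r in Ioc (0 : ℝ) 1, ENNReal.ofReal r⁻¹ * (ENNReal.ofReal ((1 + ‖w‖) ^ 2)⁻¹ *
          ‖∫ s in Ioc 0 (r * D / ‖w‖), β (y + s • w)‖ₑ ^ 2)) := by
        refine lintegral_mono fun w => lintegral_mono fun y => ?_
        have := enorm_damped_integral_sq_le (β := fun s => β (y + s • w)) (by fun_prop)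
          (fun s => hβM _) (hν w) (by positivity : 0 ≤ D / ‖w‖)
        refine (mul_le_mul_right this _).trans (le_of_eq ?_)
        rw [mul_add, mul_left_comm, mul_left_comm _ 2]
        congr 2
        have m3 : Measurable fun r : ℝ => ENNReal.ofReal r⁻¹ *
            ‖∫ s in Ioc 0 (r * (D / ‖w‖)), β (y + s • w)‖ₑ ^ 2 := by
          have := hmB.comp (by fun_prop : Measurable fun r : ℝ => (r * D, (w, y)))
          simp only [Function.comp_def, mul_div_assoc] at this
          fun_prop
        rw [← lintegral_const_mul _ m3]
        congr 1; ext r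
        rw [mul_left_comm, mul_div_assoc]
    _ = 2 * (∫⁻ w : E3, ∫⁻ y : E3, ENNReal.ofReal ((1 + ‖w‖) ^ 2)⁻¹ *
          ‖∫ s in Ioc 0 (D / ‖w‖), β (y + s • w)‖ₑ ^ 2)
        + 2 * ∫⁻ r in Ioc (0 : ℝ) 1, ENNReal.ofReal r⁻¹ * ∫⁻ w : E3, ∫⁻ y : E3,
          ENNReal.ofReal ((1 + ‖w‖) ^ 2)⁻¹ *
          ‖∫ s in Ioc 0 (r * D / ‖w‖), β (y + s • w)‖ₑ ^ 2 := by
        have e0 : ∀ φ : E3 × E3 → ENNReal, Measurable φ → ∫⁻ w : E3, ∫⁻ y : E3, φ (w, y)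
            = ∫⁻ p : E3 × E3, φ p := fun φ hφ => by
          rw [Measure.volume_eq_prod, lintegral_prod _ hφ.aemeasurable]
        have m4 : Measurable fun p : E3 × E3 => ∫⁻ r in Ioc (0 : ℝ) 1, ENNReal.ofReal r⁻¹ *
            (ENNReal.ofReal ((1 + ‖p.1‖) ^ 2)⁻¹ *
            ‖∫ s in Ioc 0 (r * D / ‖p.1‖), β (p.2 + s • p.1)‖ₑ ^ 2) := m2.lintegral_prod_right'
        have m5 : Measurable fun p : E3 × E3 => 2 * (ENNReal.ofReal ((1 + ‖p.1‖) ^ 2)⁻¹ *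
          ‖∫ s in Ioc 0 (D / ‖p.1‖), β (p.2 + s • p.1)‖ₑ ^ 2) := (m1' D).const_mul 2
        have e1 := e0 (fun p : E3 × E3 => 2 * (ENNReal.ofReal ((1 + ‖p.1‖) ^ 2)⁻¹ *
          ‖∫ s in Ioc 0 (D / ‖p.1‖), β (p.2 + s • p.1)‖ₑ ^ 2)
          + 2 * ∫⁻ r in Ioc (0 : ℝ) 1, ENNReal.ofReal r⁻¹ * (ENNReal.ofReal ((1 + ‖p.1‖) ^ 2)⁻¹ *
          ‖∫ s in Ioc 0 (r * D / ‖p.1‖), β (p.2 + s • p.1)‖ₑ ^ 2)) (m5.add (m4.const_mul 2))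
        refine e1.trans ?_
        rw [lintegral_add_left m5,
          lintegral_const_mul _ (m1' D), lintegral_const_mul _ m4, e0 _ (m1' D),
          lintegral_lintegral_swap m2.aemeasurable]
        congr 3; ext r
        rw [lintegral_const_mul _ (m1' _), e0 _ (m1' (r * D))]
    _ ≤ 2 * (ENNReal.ofReal D * Y) + 2 * ∫⁻ r in Ioc (0 : ℝ) 1, ENNReal.ofReal D * Y := by
        gcongr 2 * ?_ + 2 * ?_
        · exact hΛ D hD le_rfl
        · refine setLIntegral_mono' measurableSet_Ioc fun r hr => ?_
          calc _ ≤ ENNReal.ofReal r⁻¹ * (ENNReal.ofReal (r * D) * Y) := by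
                gcongr
                exact hΛ (r * D) (by have := hr.1; positivity) (by nlinarith [hr.2])
            _ = _ := by
                rw [← mul_assoc, ← ENNReal.ofReal_mul (by have := hr.1; positivity)]
                congr 2
                have := hr.1.ne'
                field_simp
    _ = ENNReal.ofReal (8 * rayConst.toReal * C1 * D * ‖h‖ ^ (1 - ε)) * X := by
        rw [setLIntegral_const, Real.volume_Ioc]
        simp only [sub_zero, ENNReal.ofReal_one, mul_one, hY]
        rw [show 8 * rayConst.toReal * C1 * D * ‖h‖ ^ (1 - ε)
          = 8 * (D * (rayConst.toReal * (C1 * ‖h‖ ^ (1 - ε)))) by ring,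
          ENNReal.ofReal_mul (p := 8) (by norm_num), ENNReal.ofReal_mul (p := D) hD,
          ENNReal.ofReal_mul (p := rayConst.toReal) (by positivity), ENNReal.ofReal_toReal rayConst_lt_top.ne,
          ENNReal.ofReal_ofNat]
        ring
    _ ≤ _ := by
        gcongr
        linarith


theorem measurable_setLIntegral_ray {β : E3 → ENNReal} (hβ : Measurable β) (ℓ : ℝ) :
    Measurable fun p : E3 × E3 => ∫⁻ s in Ioc 0 (ℓ / ‖p.1‖), β (p.2 + s • p.1) := by
  have hs : MeasurableSet {p : (E3 × E3) × ℝ | 0 < p.2 ∧ p.2 ≤ ℓ / ‖p.1.1‖} :=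
    (measurableSet_lt measurable_const measurable_snd).inter
      (measurableSet_le measurable_snd (by fun_prop))
  have hm : Measurable fun p : (E3 × E3) × ℝ => β (p.1.2 + p.2 • p.1.1) := by fun_prop
  have h1 := (hm.indicator hs).lintegral_prod_right' (ν := volume)
  refine (congrArg Measurable ?_).mp h1
  ext p
  rw [← lintegral_indicator measurableSet_Ioc]
  rfl

theorem lintegral_sq_ray_lintegral_eq {β : E3 → ENNReal} (hβ : Measurable β) (ℓ : ℝ) :
    ∫⁻ w : E3, ∫⁻ y : E3, ENNReal.ofReal ((1 + ‖w‖) ^ 2)⁻¹ *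
        (∫⁻ s in Ioc 0 (ℓ / ‖w‖), β (y + s • w)) ^ 2
      = rayConst * ∫⁻ z : E3, ENNReal.ofReal (pairKernel ℓ z) * ∫⁻ y : E3, β y * β (y + z) := by
  have h := lintegral_ray_pair (Θ := fun p => β p.1 * β p.2) (by fun_prop) ℓ
  simp only at h
  rw [show (∫⁻ z : E3, ENNReal.ofReal (pairKernel ℓ z) * ∫⁻ y : E3, β y * β (y + z))
    = ∫⁻ z : E3, ∫⁻ y : E3,
          ENNReal.ofReal ((‖z‖ ^ 2)⁻¹ * max (ℓ - ‖z‖) 0) * (β y * β (y + z)) from ?_, ← h]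
  · congr 1; ext w
    congr 1; ext y
    rw [pow_two (∫⁻ s in Ioc 0 (ℓ / ‖w‖), β (y + s • w)), ← lintegral_const_mul _ (by fun_prop),
      ← lintegral_const_mul _ (by fun_prop)]
    congr 1; ext s
    rw [lintegral_const_mul _ (by fun_prop), lintegral_const_mul _ (by fun_prop)]
    ring
  · congr 1; ext z
    rw [← lintegral_const_mul _ (by fun_prop)]
    rfl

theorem lintegral_enorm_sq_lt_top {b : E3 → ℝ} (hbi : Integrable b) {M : ℝ}
    (hM : ∀ x, |b x| ≤ M) : ∫⁻ y, ‖b y‖ₑ ^ 2 < ⊤ := by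
  refine lt_of_le_of_lt (b := ∫⁻ y, ENNReal.ofReal M * ‖b y‖ₑ) ?_ ?_
  · refine lintegral_mono fun y => ?_
    rw [sq]
    gcongr
    rw [Real.enorm_eq_ofReal_abs]
    exact ENNReal.ofReal_le_ofReal (hM y)
  · rw [lintegral_const_mul' _ _ ENNReal.ofReal_ne_top]
    exact ENNReal.mul_lt_top ENNReal.ofReal_lt_top hbi.2

theorem lintegral_sq_ray_lt_top {b : E3 → ℝ} (hb : Measurable b) (hbi : Integrable b) {M : ℝ}
    (hM : ∀ x, |b x| ≤ M) (ℓ : ℝ) :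
    ∫⁻ w : E3, ∫⁻ y : E3, ENNReal.ofReal ((1 + ‖w‖) ^ 2)⁻¹ *
        (∫⁻ s in Ioc 0 (ℓ / ‖w‖), ‖b (y + s • w)‖ₑ) ^ 2 < ⊤ := by
  rw [lintegral_sq_ray_lintegral_eq (β := fun y => ‖b y‖ₑ) (by fun_prop) ℓ]
  refine ENNReal.mul_lt_top rayConst_lt_top ?_
  have h2 := lintegral_enorm_sq_lt_top hbi hM
  refine lt_of_le_of_lt (b := ∫⁻ z, ENNReal.ofReal (pairKernel ℓ z) * ∫⁻ y, ‖b y‖ₑ ^ 2) ?_ ?_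
  · refine lintegral_mono fun z => mul_le_mul' le_rfl ?_
    have l2 := lintegral_enorm_mul_shift_le hb 0 z
    rw [ENNReal.mul_le_mul_iff_right (by norm_num) (by norm_num)] at l2
    simpa using l2
  · rw [lintegral_mul_const' _ _ h2.ne]
    exact ENNReal.mul_lt_top (lintegral_pairKernel_lt_top ℓ) h2

/-! ### Velocity averages of solutions of the transport equation -/

/-- The integrand of a velocity average of a damped ray integral. -/
def rayIntegrand (D : ℝ) (ν κ : E3 → ℝ) (H : E3 × E3 → ℝ) (x : E3) (p : E3 × ℝ) : ℝ :=
  (Ioc 0 (D / ‖p.1‖)).indicator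
    (fun s => κ p.1 * (Real.exp (-ν p.1 * s) * H (x - s • p.1, p.1))) p.2

/-- The velocity average `∫ κ(w) ∫₀^{D/|w|} exp(-ν(w)s) H(x - s w, w) ds dw`. -/
def rayAvg (D : ℝ) (ν κ : E3 → ℝ) (H : E3 × E3 → ℝ) (x : E3) : ℝ :=
  ∫ p, rayIntegrand D ν κ H x p

theorem rayIntegrand_of_mem {D : ℝ} {ν κ : E3 → ℝ} {H : E3 × E3 → ℝ} {x w : E3} {s : ℝ}
    (hs : s ∈ Ioc 0 (D / ‖w‖)) :
    rayIntegrand D ν κ H x (w, s) = κ w * (Real.exp (-ν w * s) * H (x - s • w, w)) :=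
  indicator_of_mem hs _

theorem rayIntegrand_of_notMem {D : ℝ} {ν κ : E3 → ℝ} {H : E3 × E3 → ℝ} {x w : E3} {s : ℝ}
    (hs : s ∉ Ioc 0 (D / ‖w‖)) : rayIntegrand D ν κ H x (w, s) = 0 :=
  indicator_of_notMem hs _

theorem measurable_rayIntegrand {D : ℝ} {ν κ : E3 → ℝ} {H : E3 × E3 → ℝ} (hν : Measurable ν)
    (hκ : Measurable κ) (hH : Measurable H) :
    Measurable fun q : E3 × (E3 × ℝ) => rayIntegrand D ν κ H q.1 q.2 := by
  have hs : MeasurableSet {q : E3 × (E3 × ℝ) | 0 < q.2.2 ∧ q.2.2 ≤ D / ‖q.2.1‖} :=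
    (measurableSet_lt measurable_const (measurable_snd.comp measurable_snd)).inter
      (measurableSet_le (measurable_snd.comp measurable_snd)
        (by fun_prop : Measurable fun q : E3 × (E3 × ℝ) => D / ‖q.2.1‖))
  have hm : Measurable fun q : E3 × (E3 × ℝ) =>
      κ q.2.1 * (Real.exp (-ν q.2.1 * q.2.2) * H (q.1 - q.2.2 • q.2.1, q.2.1)) := by fun_prop
  refine (congrArg Measurable ?_).mp (hm.indicator hs)
  ext q
  by_cases hq : q.2.2 ∈ Ioc 0 (D / ‖q.2.1‖)
  · rw [indicator_of_mem (by exact hq)]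
    exact (rayIntegrand_of_mem hq).symm
  · rw [indicator_of_notMem (by exact hq)]
    exact (rayIntegrand_of_notMem hq).symm

theorem measurable_rayAvg {D : ℝ} {ν κ : E3 → ℝ} {H : E3 × E3 → ℝ} (hν : Measurable ν)
    (hκ : Measurable κ) (hH : Measurable H) : Measurable (rayAvg D ν κ H) :=
  ((measurable_rayIntegrand hν hκ hH).stronglyMeasurable.integral_prod_right'
    (ν := volume)).measurable

/-- The weighted mass controlling a velocity average. -/
def avgMass (κ : E3 → ℝ) (H : E3 × E3 → ℝ) : ENNReal :=
  ∫⁻ w, ENNReal.ofReal ((1 + ‖w‖) ^ 2) * ‖κ w‖ₑ ^ 2 * ∫⁻ y, ‖H (y, w)‖ₑ ^ 2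

/-- Cauchy–Schwarz with the factor `1 + |w|` inserted on one side and removed on the other. The
weight `(1 + |w|)⁻²` left with `G` is the one for which averages over rays are computed explicitly.
-/
theorem lintegral_mul_sq_le_avgMass {κ : E3 → ℝ} {H : E3 × E3 → ℝ} (hκ : Measurable κ)
    (hH : Measurable H) {G : E3 × E3 → ENNReal} (hG : Measurable G) :
    (∫⁻ q : E3 × E3, ‖κ q.1‖ₑ * ‖H (q.2, q.1)‖ₑ * G q) ^ 2
      ≤ avgMass κ H * ∫⁻ w, ∫⁻ y, ENNReal.ofReal ((1 + ‖w‖) ^ 2)⁻¹ * G (w, y) ^ 2 := by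
  have e : ∀ q : E3 × E3, ‖κ q.1‖ₑ * ‖H (q.2, q.1)‖ₑ * G q
      = (ENNReal.ofReal (1 + ‖q.1‖) * ‖κ q.1‖ₑ * ‖H (q.2, q.1)‖ₑ)
        * (ENNReal.ofReal (1 + ‖q.1‖)⁻¹ * G q) := fun q => by
    have : ENNReal.ofReal (1 + ‖q.1‖) * ENNReal.ofReal (1 + ‖q.1‖)⁻¹ = 1 := by
      rw [← ENNReal.ofReal_mul (by positivity), mul_inv_cancel₀ (by positivity), ENNReal.ofReal_one]
    calc _ = ‖κ q.1‖ₑ * ‖H (q.2, q.1)‖ₑ * G q *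
          (ENNReal.ofReal (1 + ‖q.1‖) * ENNReal.ofReal (1 + ‖q.1‖)⁻¹) := by rw [this, mul_one]
      _ = _ := by ring
  simp_rw [e]
  refine (lintegral_mul_sq_le _ (by fun_prop) (by fun_prop)).trans (le_of_eq ?_)
  congr 1
  · rw [Measure.volume_eq_prod, lintegral_prod _ (by fun_prop)]
    unfold avgMass
    congr 1; ext w
    rw [← lintegral_const_mul _ (by fun_prop)]
    congr 1; ext y
    rw [mul_pow, mul_pow, ENNReal.ofReal_pow (by positivity)]
  · rw [Measure.volume_eq_prod, lintegral_prod _ (by fun_prop)]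
    congr 1; ext w
    congr 1; ext y
    rw [mul_pow, ← ENNReal.ofReal_pow (by positivity), inv_pow]

theorem lintegral_shear {Φ : E3 × (E3 × ℝ) → ENNReal} (hΦ : Measurable Φ) :
    ∫⁻ q, Φ q = ∫⁻ q : E3 × (E3 × ℝ), Φ (q.1 + q.2.2 • q.2.1, q.2) := by
  rw [Measure.volume_eq_prod, lintegral_prod_symm' _ hΦ, lintegral_prod_symm' _ (by fun_prop)]
  congr 1; ext p
  exact (lintegral_add_right_eq_self (fun x => Φ (x, p)) (p.2 • p.1)).symm

section Duality

variable {D : ℝ} {ν κ : E3 → ℝ} {H : E3 × E3 → ℝ}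

/-- The duality estimate with absolute values everywhere. It has no regularity content and provides
the integrability required by Fubini. -/
theorem lintegral_mul_rayIntegrand_sq_le (hν : Measurable ν) (hν0 : ∀ w, 0 ≤ ν w)
    (hκ : Measurable κ) (hH : Measurable H) {β : E3 → ℝ} (hβ : Measurable β) :
    (∫⁻ q : E3 × (E3 × ℝ), ‖β q.1 * rayIntegrand D ν κ H q.1 q.2‖ₑ) ^ 2
      ≤ avgMass κ H * ∫⁻ w, ∫⁻ y, ENNReal.ofReal ((1 + ‖w‖) ^ 2)⁻¹ *
        (∫⁻ s in Ioc 0 (D / ‖w‖), ‖β (y + s • w)‖ₑ) ^ 2 := by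
  have hm := measurable_rayIntegrand (D := D) hν hκ hH
  have hG := measurable_setLIntegral_ray (β := fun y => ‖β y‖ₑ) (by fun_prop) D
  refine le_trans ?_ (lintegral_mul_sq_le_avgMass hκ hH hG)
  gcongr
  have hm1 : Measurable fun q : E3 × (E3 × ℝ) => ‖β q.1 * rayIntegrand D ν κ H q.1 q.2‖ₑ :=
    ((hβ.comp measurable_fst).mul hm).enorm
  rw [lintegral_shear hm1]
  have hm2 : Measurable fun q : E3 × (E3 × ℝ) =>
      ‖β (q.1 + q.2.2 • q.2.1) * rayIntegrand D ν κ H (q.1 + q.2.2 • q.2.1) q.2‖ₑ := by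
    have := hm1.comp (by fun_prop : Measurable fun q : E3 × (E3 × ℝ) =>
      ((q.1 + q.2.2 • q.2.1, q.2) : E3 × (E3 × ℝ)))
    exact this
  rw [Measure.volume_eq_prod, lintegral_prod _ hm2.aemeasurable, Measure.volume_eq_prod E3 E3,
    lintegral_prod_symm' _ (by fun_prop)]
  refine lintegral_mono fun y => ?_
  have hm3 : Measurable fun p : E3 × ℝ =>
      ‖β (y + p.2 • p.1) * rayIntegrand D ν κ H (y + p.2 • p.1) p‖ₑ := by
    have := hm2.comp (by fun_prop : Measurable fun p : E3 × ℝ => (y, p))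
    exact this
  rw [Measure.volume_eq_prod, lintegral_prod _ hm3.aemeasurable]
  refine lintegral_mono fun w => ?_
  simp only
  rw [← lintegral_const_mul _ (by fun_prop), ← lintegral_indicator measurableSet_Ioc]
  refine lintegral_mono fun s => ?_
  by_cases hs : s ∈ Ioc 0 (D / ‖w‖)
  · rw [rayIntegrand_of_mem hs, indicator_of_mem hs, add_sub_cancel_right]
    have h1 : ‖Real.exp (-ν w * s)‖ₑ ≤ 1 := by
      rw [Real.enorm_of_nonneg (Real.exp_pos _).le, ← ENNReal.ofReal_one]
      exact ENNReal.ofReal_le_ofReal (Real.exp_le_one_iff.2 (by nlinarith [hν0 w, hs.1]))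
    calc _ = ‖Real.exp (-ν w * s)‖ₑ * (‖κ w‖ₑ * ‖H (y, w)‖ₑ * ‖β (y + s • w)‖ₑ) := by
          rw [enorm_mul, enorm_mul, enorm_mul]; ring
      _ ≤ 1 * (‖κ w‖ₑ * ‖H (y, w)‖ₑ * ‖β (y + s • w)‖ₑ) := by gcongr
      _ = _ := one_mul _
  · rw [rayIntegrand_of_notMem hs, indicator_of_notMem hs]; simp

theorem integrable_mul_rayIntegrand (hν : Measurable ν) (hν0 : ∀ w, 0 ≤ ν w)
    (hκ : Measurable κ) (hH : Measurable H) (hA : avgMass κ H < ⊤) {β : E3 → ℝ}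
    (hβ : Measurable β) (hβi : Integrable β) {M : ℝ} (hM : ∀ x, |β x| ≤ M) :
    Integrable fun q : E3 × (E3 × ℝ) => β q.1 * rayIntegrand D ν κ H q.1 q.2 := by
  have hm := measurable_rayIntegrand (D := D) hν hκ hH
  refine ⟨((hβ.comp measurable_fst).mul hm).aestronglyMeasurable, ?_⟩
  have h := lintegral_mul_rayIntegrand_sq_le (D := D) hν hν0 hκ hH hβ
  have h2 := ENNReal.mul_lt_top hA (lintegral_sq_ray_lt_top hβ hβi hM D)
  have h3 := h.trans_lt h2
  rw [hasFiniteIntegral_iff_enorm]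
  by_contra hcon
  rw [not_lt, top_le_iff] at hcon
  rw [hcon] at h3
  simp at h3

theorem ae_integrable_rayIntegrand (hν : Measurable ν) (hν0 : ∀ w, 0 ≤ ν w)
    (hκ : Measurable κ) (hH : Measurable H) (hA : avgMass κ H < ⊤) :
    ∀ᵐ x, Integrable (rayIntegrand D ν κ H x) := by
  have key : ∀ n : ℕ, ∀ᵐ x : E3, x ∈ Metric.ball (0 : E3) n →
      Integrable (rayIntegrand D ν κ H x) := by
    intro n
    have hb : Measurable ((Metric.ball (0 : E3) n).indicator (fun _ => (1 : ℝ))) :=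
      measurable_const.indicator measurableSet_ball
    have hbi : Integrable ((Metric.ball (0 : E3) n).indicator (fun _ => (1 : ℝ))) :=
      (integrable_indicator_iff measurableSet_ball).2 (by
        rw [integrableOn_const_iff]; exact Or.inr measure_ball_lt_top)
    have hM : ∀ x, |(Metric.ball (0 : E3) n).indicator (fun _ => (1 : ℝ)) x| ≤ 1 := fun x => by
      by_cases hx : x ∈ Metric.ball (0 : E3) n
      · simp [indicator_of_mem hx]
      · simp [indicator_of_notMem hx]
    have h := integrable_mul_rayIntegrand (D := D) hν hν0 hκ hH hA hb hbi hM
    rw [Measure.volume_eq_prod] at h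
    filter_upwards [h.prod_right_ae] with x hx hxn
    simpa [indicator_of_mem hxn] using hx
  filter_upwards [ae_all_iff.2 key] with x hx
  obtain ⟨n, hn⟩ := exists_nat_gt ‖x‖
  exact hx n (by simpa using hn)

/-- The shear `x = y + s w` frees `H` from the ray variable and places the test function on the ray
instead: `H` stands at `(y, w)` and `β` is integrated along the forward ray from `y`. Cauchy–Schwarz
then separates the two. -/
theorem enorm_integral_mul_rayAvg_sq_le (hν : Measurable ν) (hν0 : ∀ w, 0 ≤ ν w)
    (hκ : Measurable κ) (hH : Measurable H) (hA : avgMass κ H < ⊤) {β : E3 → ℝ}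
    (hβ : Measurable β) (hβi : Integrable β) {M : ℝ} (hM : ∀ x, |β x| ≤ M) :
    ‖∫ x, β x * rayAvg D ν κ H x‖ₑ ^ 2
      ≤ avgMass κ H * ∫⁻ w, ∫⁻ y, ENNReal.ofReal ((1 + ‖w‖) ^ 2)⁻¹ *
        ‖∫ s in Ioc 0 (D / ‖w‖), Real.exp (-ν w * s) * β (y + s • w)‖ₑ ^ 2 := by
  have hm := measurable_rayIntegrand (D := D) hν hκ hH
  have hZ := integrable_mul_rayIntegrand (D := D) hν hν0 hκ hH hA hβ hβi hM
  have hZs : Integrable fun q : E3 × (E3 × ℝ) =>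
      β (q.1 + q.2.2 • q.2.1) * rayIntegrand D ν κ H (q.1 + q.2.2 • q.2.1) q.2 := by
    have hm1 : Measurable fun q : E3 × (E3 × ℝ) => β q.1 * rayIntegrand D ν κ H q.1 q.2 :=
      (hβ.comp measurable_fst).mul hm
    have hm2 := hm1.comp (by fun_prop : Measurable fun q : E3 × (E3 × ℝ) =>
      ((q.1 + q.2.2 • q.2.1, q.2) : E3 × (E3 × ℝ)))
    refine ⟨hm2.aestronglyMeasurable, ?_⟩
    rw [hasFiniteIntegral_iff_enorm, ← lintegral_shear hm1.enorm]
    exact hZ.2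
  have hR : Measurable fun q : E3 × E3 =>
      ∫ s in Ioc 0 (D / ‖q.1‖), Real.exp (-ν q.1 * s) * β (q.2 + s • q.1) := by
    have hs : MeasurableSet {p : (E3 × E3) × ℝ | 0 < p.2 ∧ p.2 ≤ D / ‖p.1.1‖} :=
      (measurableSet_lt measurable_const measurable_snd).inter
        (measurableSet_le measurable_snd (by fun_prop))
    have hm : Measurable fun p : (E3 × E3) × ℝ =>
        Real.exp (-ν p.1.1 * p.2) * β (p.1.2 + p.2 • p.1.1) := by fun_prop
    have h1 := ((hm.indicator hs).stronglyMeasurable.integral_prod_right' (ν := volume)).measurable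
    refine (congrArg Measurable ?_).mp h1
    ext p
    rw [← integral_indicator measurableSet_Ioc]
    rfl
  refine le_trans ?_ (lintegral_mul_sq_le_avgMass hκ hH hR.enorm)
  gcongr
  have e1 : ∫ x, β x * rayAvg D ν κ H x
      = ∫ y, ∫ p : E3 × ℝ, β (y + p.2 • p.1) * rayIntegrand D ν κ H (y + p.2 • p.1) p := by
    calc ∫ x, β x * rayAvg D ν κ H x
        = ∫ x, ∫ p : E3 × ℝ, β x * rayIntegrand D ν κ H x p := by
          simp_rw [integral_const_mul]; rfl
      _ = ∫ p : E3 × ℝ, ∫ x, β x * rayIntegrand D ν κ H x p := integral_integral_swap hZ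
      _ = ∫ p : E3 × ℝ, ∫ y, β (y + p.2 • p.1) * rayIntegrand D ν κ H (y + p.2 • p.1) p := by
          congr 1; ext p
          exact (integral_add_right_eq_self (fun x => β x * rayIntegrand D ν κ H x p)
            (p.2 • p.1)).symm
      _ = _ := (integral_integral_swap hZs).symm
  rw [e1]
  have hmR : Measurable fun q : E3 × E3 => ‖κ q.1‖ₑ * ‖H (q.2, q.1)‖ₑ *
      ‖∫ s in Ioc 0 (D / ‖q.1‖), Real.exp (-ν q.1 * s) * β (q.2 + s • q.1)‖ₑ := by fun_prop
  rw [Measure.volume_eq_prod E3 E3, lintegral_prod_symm' _ hmR]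
  refine (enorm_integral_le_lintegral_enorm _).trans (lintegral_mono_ae ?_)
  have hae : ∀ᵐ y : E3, Integrable fun p : E3 × ℝ =>
      β (y + p.2 • p.1) * rayIntegrand D ν κ H (y + p.2 • p.1) p := by
    rw [Measure.volume_eq_prod] at hZs
    exact hZs.prod_right_ae
  filter_upwards [hae] with y hy
  rw [Measure.volume_eq_prod, integral_prod _ (by rwa [← Measure.volume_eq_prod])]
  refine (enorm_integral_le_lintegral_enorm _).trans (lintegral_mono fun w => ?_)
  simp only
  rw [← enorm_mul, ← enorm_mul, ← integral_const_mul, ← integral_indicator measurableSet_Ioc]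
  refine le_of_eq ?_
  congr 2; ext s
  by_cases hs : s ∈ Ioc 0 (D / ‖w‖)
  · rw [rayIntegrand_of_mem hs, indicator_of_mem hs, add_sub_cancel_right]
    ring
  · rw [rayIntegrand_of_notMem hs, indicator_of_notMem hs]; simp

theorem integrable_mul_rayAvg (hν : Measurable ν) (hν0 : ∀ w, 0 ≤ ν w)
    (hκ : Measurable κ) (hH : Measurable H) (hA : avgMass κ H < ⊤) {β : E3 → ℝ}
    (hβ : Measurable β) (hβi : Integrable β) {M : ℝ} (hM : ∀ x, |β x| ≤ M) :
    Integrable fun x => β x * rayAvg D ν κ H x := by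
  have hZ := integrable_mul_rayIntegrand (D := D) hν hν0 hκ hH hA hβ hβi hM
  rw [Measure.volume_eq_prod] at hZ
  have := hZ.integral_prod_left
  refine this.congr (Eventually.of_forall fun x => ?_)
  simp only [integral_const_mul]
  rfl

end Duality

/-- Testing against bounded integrable functions detects the `L²` norm. -/
theorem lintegral_enorm_sq_le_of_duality {φ : E3 → ℝ} (hφ : Measurable φ) {C : ENNReal}
    (h : ∀ (b : E3 → ℝ) (M : ℝ), Measurable b → Integrable b → (∀ x, |b x| ≤ M) →
      ‖∫ x, b x * φ x‖ₑ ^ 2 ≤ C * ∫⁻ x, ‖b x‖ₑ ^ 2) :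
    ∫⁻ x, ‖φ x‖ₑ ^ 2 ≤ C := by
  set S : ℕ → Set E3 := fun n => {x | |φ x| ≤ n} ∩ Metric.ball 0 n with hS
  have hSm : ∀ n, MeasurableSet (S n) := fun n =>
    (measurableSet_le (by fun_prop) measurable_const).inter measurableSet_ball
  have hmono : Monotone S := by
    intro m n hmn x hx
    have : (m : ℝ) ≤ n := by exact_mod_cast hmn
    exact ⟨le_trans (show |φ x| ≤ m from hx.1) this, Metric.ball_subset_ball this hx.2⟩
  have hU : ⋃ n, S n = univ := by
    refine eq_univ_of_forall fun x => ?_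
    obtain ⟨n, hn⟩ := exists_nat_gt (max |φ x| ‖x‖)
    exact mem_iUnion.2 ⟨n, (le_max_left _ _).trans hn.le, by
      simpa using (le_max_right _ _).trans_lt hn⟩
  have hbound : ∀ n, ∫⁻ x in S n, ‖φ x‖ₑ ^ 2 ≤ C := by
    intro n
    -- The test function is the truncation of `φ` itself. The hypothesis reads `X² ≤ C X` with `X`
    -- finite, and `X` can be cancelled.
    set b := (S n).indicator φ with hb
    have hbm : Measurable b := hφ.indicator (hSm n)
    have hM : ∀ x, |b x| ≤ n := fun x => by
      by_cases hx : x ∈ S n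
      · rw [hb, indicator_of_mem hx]; exact hx.1
      · rw [hb, indicator_of_notMem hx]; simp
    have hbi : Integrable b := by
      rw [hb, integrable_indicator_iff (hSm n)]
      refine Measure.integrableOn_of_bounded (M := n) ?_ hφ.aestronglyMeasurable ?_
      · exact ((measure_mono inter_subset_right).trans_lt measure_ball_lt_top).ne
      · exact (ae_restrict_iff' (hSm n)).2 (Eventually.of_forall fun x hx => hx.1)
    set X := ∫⁻ x, ‖b x‖ₑ ^ 2 with hX
    have hXt : X < ⊤ := lintegral_enorm_sq_lt_top hbi hM
    have e0 : ∫⁻ x in S n, ‖φ x‖ₑ ^ 2 = X := by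
      rw [← lintegral_indicator (hSm n), hX]
      congr 1; ext x
      by_cases hx : x ∈ S n
      · rw [hb, indicator_of_mem hx, indicator_of_mem hx]
      · rw [hb, indicator_of_notMem hx, indicator_of_notMem hx]; simp
    have e1 : ‖∫ x, b x * φ x‖ₑ = X := by
      have e2 : ∀ x, b x * φ x = b x ^ 2 := fun x => by
        by_cases hx : x ∈ S n
        · rw [hb, indicator_of_mem hx, sq]
        · rw [hb, indicator_of_notMem hx]; simp
      simp_rw [e2]
      rw [Real.enorm_of_nonneg (integral_nonneg fun x => sq_nonneg _),
        ofReal_integral_eq_lintegral_ofReal _ (Eventually.of_forall fun x => sq_nonneg _)]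
      · rw [hX]
        congr 1; ext x
        rw [← enorm_pow, Real.enorm_of_nonneg (sq_nonneg _)]
      · refine ⟨(hbm.pow_const 2).aestronglyMeasurable, ?_⟩
        rw [hasFiniteIntegral_iff_enorm]
        simpa [enorm_pow] using hXt
    have := h b n hbm hbi hM
    rw [e1, ← hX] at this
    rw [e0]
    by_cases h0 : X = 0
    · rw [h0]; exact zero_le
    · rw [sq] at this
      exact (ENNReal.mul_le_mul_iff_left h0 hXt.ne).1 this
  have := setLIntegral_iUnion_of_directed (μ := volume) (fun x => ‖φ x‖ₑ ^ 2) hmono.directed_le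
  rw [hU, setLIntegral_univ] at this
  rw [this]
  exact iSup_le hbound

/-- Velocity averaging in physical space: a velocity average of a damped ray integral has half a
derivative in `L²`. -/
theorem exists_lintegral_rayAvg_diff_le {D ε : ℝ} (hD : 0 ≤ D) (hε : 0 < ε) (hε1 : ε ≤ 1) :
    ∃ C : ℝ, 0 < C ∧ ∀ (ν κ : E3 → ℝ) (H : E3 × E3 → ℝ), Measurable ν → (∀ w, 0 ≤ ν w) →
      Measurable κ → Measurable H → avgMass κ H < ⊤ → ∀ h : E3,
      ∫⁻ x, ‖rayAvg D ν κ H (x + h) - rayAvg D ν κ H x‖ₑ ^ 2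
        ≤ ENNReal.ofReal (C * ‖h‖ ^ (1 - ε)) * avgMass κ H := by
  obtain ⟨C, hC, hCb⟩ := exists_lintegral_sq_damped_ray_diff_le hD hε hε1
  refine ⟨C, hC, fun ν κ H hν hν0 hκ hH hA h => ?_⟩
  have ham := measurable_rayAvg (D := D) hν hκ hH
  refine lintegral_enorm_sq_le_of_duality (by fun_prop) fun b M hb hbi hM => ?_
  set β : E3 → ℝ := fun x => b (x - h) - b x with hβ
  have hβm : Measurable β := by fun_prop
  have hβi : Integrable β := (hbi.comp_sub_right h).sub hbi
  have hβM : ∀ x, |β x| ≤ 2 * M := fun x => by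
    have := abs_sub (b (x - h)) (b x)
    linarith [hM (x - h), hM x]
  have i1 := integrable_mul_rayAvg (D := D) hν hν0 hκ hH hA hb hbi hM
  have i2 := integrable_mul_rayAvg (D := D) hν hν0 hκ hH hA (β := fun x => b (x - h))
    (by fun_prop) (hbi.comp_sub_right h) (fun x => hM _)
  have i3 : Integrable fun x => b x * rayAvg D ν κ H (x + h) := by
    have := i2.comp_add_right h
    simpa using this
  have e : ∫ x, b x * (rayAvg D ν κ H (x + h) - rayAvg D ν κ H x)
      = ∫ x, β x * rayAvg D ν κ H x := by
    have e1 : ∫ x, b x * rayAvg D ν κ H (x + h) = ∫ x, b (x - h) * rayAvg D ν κ H x := by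
      rw [← integral_add_right_eq_self (fun x => b (x - h) * rayAvg D ν κ H x) h]
      simp
    calc _ = (∫ x, b x * rayAvg D ν κ H (x + h)) - ∫ x, b x * rayAvg D ν κ H x := by
          rw [← integral_sub i3 i1]; congr 1; ext x; ring
      _ = _ := by
          rw [e1, ← integral_sub i2 i1]; congr 1; ext x; simp only [hβ]; ring
  rw [e]
  refine (enorm_integral_mul_rayAvg_sq_le (D := D) hν hν0 hκ hH hA hβm hβi hβM).trans ?_
  have := hCb ν hν0 b M hb hbi hM h
  calc _ ≤ avgMass κ H * (ENNReal.ofReal (C * ‖h‖ ^ (1 - ε)) * ∫⁻ y, ‖b y‖ₑ ^ 2) := by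
        gcongr
    _ = _ := by ring


theorem two_mul_ofReal (x : ℝ) : 2 * ENNReal.ofReal x = ENNReal.ofReal (2 * x) := by
  rw [ENNReal.ofReal_mul zero_le_two, ENNReal.ofReal_ofNat]

/-! ### Translates of convex sets -/

/-- The points of `Ω` that leave `Ω` under translation by `h`. -/
def leaveSet (Ω : Set E3) (h : E3) : Set E3 := {x | x ∈ Ω ∧ x + h ∉ Ω}

theorem measurableSet_leaveSet {Ω : Set E3} (hΩ : MeasurableSet Ω) (h : E3) :
    MeasurableSet (leaveSet Ω h) :=
  hΩ.inter (measurable_add_const h hΩ).compl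

/-- By convexity, a ray that leaves `Ω` never returns: `x + h` lies on the segment from `x` to `x +
n h`. -/
theorem notMem_of_mem_leaveSet {Ω : Set E3} (hc : Convex ℝ Ω) {x h : E3} (hx : x ∈ leaveSet Ω h)
    {n : ℕ} (hn : 1 ≤ n) : x + (n : ℝ) • h ∉ Ω := fun hmem => by
  have hn' : (1 : ℝ) ≤ n := by exact_mod_cast hn
  have := hc.add_smul_mem hx.1 hmem (t := (n : ℝ)⁻¹) ⟨by positivity, inv_le_one_of_one_le₀ hn'⟩
  rw [smul_smul, inv_mul_cancel₀ (by positivity), one_smul] at this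
  exact hx.2 this

/-- The translates of the layer by `0, h, 2h, …` are pairwise disjoint, because a point that leaves
`Ω` does not come back. About `r/|h|` of them, translating the part in the ball of radius `r`, fit
in the ball of radius `2r`. With `N ≥ r/(2|h|)` translates in volume `8 r³`, each has volume at most
`16 |h| r²` times that of the unit ball. For `r < |h|` the volume of the ball itself suffices. -/
theorem volume_leaveSet_inter_ball_le {Ω : Set E3} (hΩ : MeasurableSet Ω) (hc : Convex ℝ Ω)
    (h y : E3) {r : ℝ} (hr : 0 < r) :
    volume (leaveSet Ω h ∩ Metric.ball y r)
      ≤ ENNReal.ofReal (16 * ‖h‖ * r ^ 2) * volume (Metric.ball (0 : E3) 1) := by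
  set A := leaveSet Ω h ∩ Metric.ball y r with hA
  have hAm : MeasurableSet A := (measurableSet_leaveSet hΩ h).inter measurableSet_ball
  have hball : ∀ R : ℝ, volume (Metric.ball y R)
      = ENNReal.ofReal (R ^ 3) * volume (Metric.ball (0 : E3) 1) := fun R => by
    rcases le_or_gt R 0 with hR | hR
    · rw [Metric.ball_eq_empty.2 hR, ENNReal.ofReal_of_nonpos, zero_mul, measure_empty]
      exact Odd.pow_nonpos (by decide) hR
    · rw [Measure.addHaar_ball _ _ hR.le]; simp
  rcases eq_or_ne h 0 with rfl | hh
  · have : A = ∅ := by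
      ext x; simp only [hA, leaveSet, mem_inter_iff, mem_ofPred_eq, add_zero, mem_empty_iff_false,
        iff_false]; tauto
    rw [this]; simp
  have hh0 : 0 < ‖h‖ := norm_pos_iff.2 hh
  rcases lt_or_ge r ‖h‖ with hlt | hge
  · refine (measure_mono inter_subset_right).trans ?_
    rw [hball]
    gcongr
    nlinarith [sq_nonneg r, mul_pos (pow_pos hr 2) hh0]
  set N : ℕ := ⌊r / ‖h‖⌋₊ with hN
  have hq : 1 ≤ r / ‖h‖ := (one_le_div hh0).2 hge
  have hN1 : 1 ≤ N := Nat.one_le_floor_iff _ |>.2 hq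
  have hNle : (N : ℝ) * ‖h‖ ≤ r := by
    have := Nat.floor_le (div_nonneg hr.le hh0.le)
    rwa [le_div_iff₀ hh0] at this
  have hNge : r ≤ 2 * N * ‖h‖ := by
    have h1 := Nat.lt_floor_add_one (r / ‖h‖)
    rw [div_lt_iff₀ hh0] at h1
    have h2 : (1 : ℝ) ≤ N := by exact_mod_cast hN1
    nlinarith
  set S : ℕ → Set E3 := fun j => (fun x => x + -((j : ℝ) • h)) ⁻¹' A with hS
  have hSv : ∀ j, volume (S j) = volume A := fun j => measure_preimage_add_right _ _ _
  have hsub : ⋃ j ∈ Finset.range N, S j ⊆ Metric.ball y (2 * r) := by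
    refine iUnion₂_subset fun j hj x hx => ?_
    have hx2 : ‖x + -((j : ℝ) • h) - y‖ < r := by simpa [dist_eq_norm] using hx.2
    have hj' : (j : ℝ) * ‖h‖ ≤ r := by
      have : (j : ℝ) ≤ N := by exact_mod_cast (Finset.mem_range.1 hj).le
      nlinarith
    rw [Metric.mem_ball, dist_eq_norm]
    calc ‖x - y‖ = ‖(x + -((j : ℝ) • h) - y) + (j : ℝ) • h‖ := by congr 1; abel
      _ ≤ ‖x + -((j : ℝ) • h) - y‖ + ‖(j : ℝ) • h‖ := norm_add_le _ _
      _ < 2 * r := by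
          rw [norm_smul, Real.norm_of_nonneg (by positivity)]; linarith
  have haux : ∀ i j : ℕ, i < j → Disjoint (S i) (S j) := by
    intro i j hij
    refine Set.disjoint_left.2 fun x hxi hxj => ?_
    have := notMem_of_mem_leaveSet hc hxj.1 (n := j - i) (by omega)
    refine this ?_
    have e : x + -((j : ℝ) • h) + ((j - i : ℕ) : ℝ) • h = x + -((i : ℝ) • h) := by
      rw [Nat.cast_sub hij.le, sub_smul]; abel
    simp only
    rw [e]
    exact hxi.1.1
  have hdisj : (Finset.range N : Set ℕ).PairwiseDisjoint S := by
    intro i _ j _ hij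
    rcases lt_or_gt_of_ne hij with h1 | h1
    · exact haux i j h1
    · exact (haux j i h1).symm
  have hm := measure_mono (μ := volume) hsub
  rw [measure_biUnion_finset hdisj (fun j _ => (measurable_add_const _) hAm)] at hm
  simp only [hSv, Finset.sum_const, Finset.card_range, nsmul_eq_mul] at hm
  rw [hball] at hm
  have hN0 : (N : ENNReal) ≠ 0 := by simp; omega
  have hN1' : (1 : ℝ) ≤ N := by exact_mod_cast hN1
  refine (ENNReal.mul_le_mul_iff_right hN0 (ENNReal.natCast_ne_top N)).1 (hm.trans ?_)
  rw [← mul_assoc, ← ENNReal.ofReal_natCast, ← ENNReal.ofReal_mul (by positivity)]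
  gcongr
  nlinarith [mul_le_mul_of_nonneg_right hNge (sq_nonneg r)]

/-- Layer cake: the set where `|x-y|⁻² > t` is contained in a ball of radius `r = t^(-1/2)`. It
meets the layer in volume at most a multiple of `min(|h| r², r³)`, hence of `|h|^(1-ε) r^(2+ε)`, and
`r^(2+ε) = t^(-1-ε/2)` is integrable at infinity. -/
theorem exists_lintegral_leaveSet_le {Ω : Set E3} (hΩ : MeasurableSet Ω) (hc : Convex ℝ Ω)
    (hb : Bornology.IsBounded Ω) {ε : ℝ} (hε : 0 < ε) (hε1 : ε ≤ 1) :
    ∃ C : ℝ, 0 < C ∧ ∀ h : E3, ‖h‖ ≤ 1 →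
      volume (leaveSet Ω h) ≤ ENNReal.ofReal (C * ‖h‖) ∧
      ∀ y : E3, ∫⁻ x in leaveSet Ω h, ENNReal.ofReal (‖x - y‖ ^ 2)⁻¹
        ≤ ENNReal.ofReal (C * ‖h‖ ^ (1 - ε)) := by
  obtain ⟨R, hR, hRb⟩ := hb.subset_ball_lt 0 0
  set V := (volume (Metric.ball (0 : E3) 1)).toReal with hV
  have hVt : volume (Metric.ball (0 : E3) 1) = ENNReal.ofReal V :=
    (ENNReal.ofReal_toReal measure_ball_lt_top.ne).symm
  have hV0 : 0 < V := ENNReal.toReal_pos (Metric.measure_ball_pos _ _ one_pos).ne'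
    measure_ball_lt_top.ne
  have hI : ∫⁻ t in Ioi (1 : ℝ), ENNReal.ofReal (t ^ (-1 - ε / 2)) < ⊤ := by
    have := integrableOn_Ioi_rpow_of_lt (a := -1 - ε / 2) (by linarith) one_pos
    refine lt_of_le_of_lt (lintegral_mono fun t => ?_) this.2
    rw [Real.enorm_eq_ofReal_abs]
    exact ENNReal.ofReal_le_ofReal (le_abs_self _)
  set I := (∫⁻ t in Ioi (1 : ℝ), ENNReal.ofReal (t ^ (-1 - ε / 2))).toReal with hIdef
  have hvol : ∀ h : E3, volume (leaveSet Ω h) ≤ ENNReal.ofReal (16 * R ^ 2 * V * ‖h‖) := by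
    intro h
    have h1 := volume_leaveSet_inter_ball_le hΩ hc h 0 hR
    rw [inter_eq_left.2 ((fun x hx => hRb hx.1) : leaveSet Ω h ⊆ _), hVt,
      ← ENNReal.ofReal_mul (by positivity)] at h1
    refine h1.trans (ENNReal.ofReal_le_ofReal (le_of_eq (by ring)))
  have hI0 : 0 ≤ I := ENNReal.toReal_nonneg
  refine ⟨16 * R ^ 2 * V + 16 * V * I, by positivity, fun h hh => ⟨(hvol h).trans ?_, fun y => ?_⟩⟩
  · gcongr
    nlinarith [mul_nonneg hV0.le hI0]
  set E := leaveSet Ω h with hE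
  have hEm : MeasurableSet E := measurableSet_leaveSet hΩ h
  have hhp : ‖h‖ ≤ ‖h‖ ^ (1 - ε) := by
    rcases eq_or_ne ‖h‖ 0 with h0 | h0
    · rw [h0]; exact Real.rpow_nonneg le_rfl _
    · calc ‖h‖ = ‖h‖ ^ (1 : ℝ) := (Real.rpow_one _).symm
        _ ≤ _ := Real.rpow_le_rpow_of_exponent_ge (lt_of_le_of_ne (norm_nonneg _) h0.symm) hh
            (by linarith)
  have hms : ∀ t ∈ Ioi (1 : ℝ), volume.restrict E {x | t < (‖x - y‖ ^ 2)⁻¹}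
      ≤ ENNReal.ofReal (16 * V * ‖h‖ ^ (1 - ε)) * ENNReal.ofReal (t ^ (-1 - ε / 2)) := by
    intro t ht
    have ht0 : (0 : ℝ) < t := one_pos.trans ht
    set r := t ^ (-(1 / 2) : ℝ) with hr
    have hr0 : 0 < r := Real.rpow_pos_of_pos ht0 _
    have hr2 : r ^ 2 = t⁻¹ := by
      rw [hr, ← Real.rpow_natCast, ← Real.rpow_mul ht0.le, ← Real.rpow_neg_one]; norm_num
    have hsub : {x : E3 | t < (‖x - y‖ ^ 2)⁻¹} ⊆ Metric.ball y r := by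
      intro x hx
      rw [Metric.mem_ball, dist_eq_norm]
      refine lt_of_pow_lt_pow_left₀ 2 hr0.le ?_
      rw [hr2]
      have hx' : t < (‖x - y‖ ^ 2)⁻¹ := hx
      have : 0 < ‖x - y‖ ^ 2 := inv_pos.1 (ht0.trans hx')
      exact (lt_inv_comm₀ ht0 this).1 hx'
    have m1 : volume.restrict E {x | t < (‖x - y‖ ^ 2)⁻¹} ≤ volume (E ∩ Metric.ball y r) := by
      rw [Measure.restrict_apply' hEm, inter_comm]
      exact measure_mono (inter_subset_inter_right _ hsub)
    have m2 := volume_leaveSet_inter_ball_le hΩ hc h y hr0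
    have m3 : volume (E ∩ Metric.ball y r) ≤ ENNReal.ofReal (V * r ^ 3) := by
      refine (measure_mono inter_subset_right).trans ?_
      rw [Measure.addHaar_ball _ _ hr0.le, hVt, ← ENNReal.ofReal_mul (by positivity)]
      simp [mul_comm]
    rw [hVt, ← ENNReal.ofReal_mul (by positivity)] at m2
    rw [← ENNReal.ofReal_mul (by positivity)]
    refine (m1.trans (le_min m2 m3)).trans ?_
    rw [← ENNReal.ofReal_min]
    refine ENNReal.ofReal_le_ofReal ?_
    have e1 : t ^ (-1 - ε / 2) = r ^ (2 + ε) := by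
      rw [hr, ← Real.rpow_mul ht0.le]; congr 1; ring
    rw [e1, Real.rpow_add hr0, Real.rpow_two]
    rcases le_total r ‖h‖ with hrh | hrh
    · refine (min_le_right _ _).trans ?_
      have : r ≤ ‖h‖ ^ (1 - ε) * r ^ ε := by
        calc r = r ^ (1 - ε) * r ^ ε := by rw [← Real.rpow_add hr0]; simp
          _ ≤ _ := by gcongr
      have h3 := mul_le_mul_of_nonneg_left this (mul_pos hV0 (pow_pos hr0 2)).le
      have h4 : 0 ≤ ‖h‖ ^ (1 - ε) * r ^ ε := hr0.le.trans this
      nlinarith [mul_nonneg (mul_pos hV0 (pow_pos hr0 2)).le h4]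
    · refine (min_le_left _ _).trans ?_
      rcases eq_or_ne ‖h‖ 0 with h0 | h0
      · rw [h0]; simp only [mul_zero, zero_mul]; positivity
      have hp : 0 < ‖h‖ := lt_of_le_of_ne (norm_nonneg _) h0.symm
      have : ‖h‖ ≤ ‖h‖ ^ (1 - ε) * r ^ ε := by
        calc ‖h‖ = ‖h‖ ^ (1 - ε) * ‖h‖ ^ ε := by rw [← Real.rpow_add hp]; simp
          _ ≤ _ := by gcongr
      have h3 := mul_le_mul_of_nonneg_left this (mul_pos hV0 (pow_pos hr0 2)).le
      nlinarith
  -- Levels `t ≤ 1` are charged to the total volume of the layer, levels `t > 1` to the estimate in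
  -- small balls.
  rw [lintegral_eq_lintegral_meas_lt _ (Eventually.of_forall fun x => by positivity)
    (by fun_prop), ← Ioc_union_Ioi_eq_Ioi (zero_le_one' ℝ)]
  refine (lintegral_union_le _ _ _).trans ?_
  have p1 : ∫⁻ t in Ioc (0 : ℝ) 1, volume.restrict E {x | t < (‖x - y‖ ^ 2)⁻¹}
      ≤ ENNReal.ofReal (16 * R ^ 2 * V * ‖h‖) := by
    calc _ ≤ ∫⁻ t in Ioc (0 : ℝ) 1, volume E := by
          refine lintegral_mono fun t => ?_
          exact (measure_mono (subset_univ _)).trans (by simp)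
      _ = volume E := by simp
      _ ≤ _ := hvol h
  have p2 : ∫⁻ t in Ioi (1 : ℝ), volume.restrict E {x | t < (‖x - y‖ ^ 2)⁻¹}
      ≤ ENNReal.ofReal (16 * V * ‖h‖ ^ (1 - ε)) * ENNReal.ofReal I := by
    rw [hIdef, ENNReal.ofReal_toReal hI.ne, ← lintegral_const_mul _ (by fun_prop)]
    exact setLIntegral_mono (by fun_prop) hms
  refine (add_le_add p1 p2).trans ?_
  rw [← ENNReal.ofReal_mul (by positivity), ← ENNReal.ofReal_add (by positivity) (by positivity)]
  refine ENNReal.ofReal_le_ofReal ?_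
  have := mul_le_mul_of_nonneg_left hhp (by positivity : 0 ≤ 16 * R ^ 2 * V)
  nlinarith

/-- The indicator of the points where membership in `Ω` changes under translation by `h`. -/
def jump (Ω : Set E3) (h x : E3) : ENNReal :=
  (leaveSet Ω h).indicator 1 x + (leaveSet Ω (-h)).indicator 1 (x + h)

theorem measurable_jump {Ω : Set E3} (hΩ : MeasurableSet Ω) (h : E3) : Measurable (jump Ω h) := by
  have h1 : Measurable ((leaveSet Ω h).indicator (1 : E3 → ENNReal)) :=
    measurable_one.indicator (measurableSet_leaveSet hΩ h)
  have h2 : Measurable ((leaveSet Ω (-h)).indicator (1 : E3 → ENNReal)) :=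
    measurable_one.indicator (measurableSet_leaveSet hΩ (-h))
  exact h1.add (h2.comp (measurable_add_const h))

theorem one_le_jump {Ω : Set E3} {h x : E3} (hx : ¬(x ∈ Ω ↔ x + h ∈ Ω)) : 1 ≤ jump Ω h x := by
  unfold jump
  by_cases h1 : x ∈ Ω
  · have h2 : x + h ∉ Ω := by tauto
    rw [indicator_of_mem (show x ∈ leaveSet Ω h from ⟨h1, h2⟩)]
    simp
  · have h2 : x + h ∈ Ω := by tauto
    rw [indicator_of_mem (show x + h ∈ leaveSet Ω (-h) from ⟨h2, by simpa using h1⟩)]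
    simp

theorem lintegral_jump {Ω : Set E3} (hΩ : MeasurableSet Ω) (h : E3) :
    ∫⁻ x, jump Ω h x = volume (leaveSet Ω h) + volume (leaveSet Ω (-h)) := by
  unfold jump
  rw [lintegral_add_left (measurable_one.indicator (measurableSet_leaveSet hΩ h)),
    lintegral_add_right_eq_self (fun x => (leaveSet Ω (-h)).indicator (1 : E3 → ENNReal) x) h,
    lintegral_indicator_one (measurableSet_leaveSet hΩ h),
    lintegral_indicator_one (measurableSet_leaveSet hΩ (-h))]

/-- The mean square is the correlation of the layer with itself against a kernel at most `ℓ |z|⁻²`.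
Integrating one point against the singularity gives `|h|^(1-ε)` uniformly in the other, and the
other point contributes the volume `O(|h|)`. Rays thus see the layer as having thickness almost
`|h|` even in the mean square. -/
theorem exists_lintegral_sq_ray_leaveSet_le {Ω : Set E3} (hΩ : MeasurableSet Ω)
    (hc : Convex ℝ Ω) (hb : Bornology.IsBounded Ω) {ε : ℝ} (hε : 0 < ε) (hε1 : ε ≤ 1)
    {ℓ : ℝ} (hℓ : 0 ≤ ℓ) :
    ∃ C : ℝ, 0 < C ∧ ∀ h : E3, ‖h‖ ≤ 1 →
      ∫⁻ w : E3, ∫⁻ y : E3, ENNReal.ofReal ((1 + ‖w‖) ^ 2)⁻¹ *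
        (∫⁻ s in Ioc 0 (ℓ / ‖w‖), (leaveSet Ω h).indicator 1 (y + s • w)) ^ 2
        ≤ ENNReal.ofReal (C * ‖h‖ ^ (2 - ε)) := by
  obtain ⟨C, hC, hCb⟩ := exists_lintegral_leaveSet_le hΩ hc hb hε hε1
  refine ⟨rayConst.toReal * ℓ * C ^ 2 + 1, by positivity, fun h hh => ?_⟩
  obtain ⟨hv, hs⟩ := hCb h hh
  have hEm := measurableSet_leaveSet hΩ h
  set E := leaveSet Ω h
  have hme : Measurable (E.indicator (1 : E3 → ENNReal)) := measurable_one.indicator hEm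
  rw [lintegral_sq_ray_lintegral_eq (β := E.indicator 1) hme ℓ]
  have b1 : ∫⁻ z : E3, ENNReal.ofReal (pairKernel ℓ z) *
      ∫⁻ y : E3, E.indicator 1 y * E.indicator 1 (y + z)
      ≤ ENNReal.ofReal ℓ * (ENNReal.ofReal (C * ‖h‖ ^ (1 - ε)) * ENNReal.ofReal (C * ‖h‖)) := by
    calc _ ≤ ∫⁻ z : E3, ∫⁻ y : E3, ENNReal.ofReal ℓ *
          (E.indicator 1 y * (ENNReal.ofReal (‖z‖ ^ 2)⁻¹ * E.indicator 1 (y + z))) := by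
          refine lintegral_mono fun z => ?_
          rw [← lintegral_const_mul _ (by fun_prop)]
          refine lintegral_mono fun y => ?_
          have : ENNReal.ofReal (pairKernel ℓ z)
              ≤ ENNReal.ofReal ℓ * ENNReal.ofReal (‖z‖ ^ 2)⁻¹ := by
            rw [← ENNReal.ofReal_mul hℓ]
            refine ENNReal.ofReal_le_ofReal ?_
            unfold pairKernel
            rw [mul_comm]
            gcongr
            exact max_le (by linarith [norm_nonneg z]) hℓ
          calc _ ≤ ENNReal.ofReal ℓ * ENNReal.ofReal (‖z‖ ^ 2)⁻¹ *
                (E.indicator 1 y * E.indicator 1 (y + z)) := mul_le_mul' this le_rfl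
            _ = _ := by ring
      _ = ∫⁻ y : E3, ∫⁻ z : E3, ENNReal.ofReal ℓ *
          (E.indicator 1 y * (ENNReal.ofReal (‖z‖ ^ 2)⁻¹ * E.indicator 1 (y + z))) := by
          rw [lintegral_lintegral_swap]
          refine Measurable.aemeasurable ?_
          have h1 : Measurable fun p : E3 × E3 => E.indicator (1 : E3 → ENNReal) p.2 :=
            hme.comp measurable_snd
          have h2 : Measurable fun p : E3 × E3 => E.indicator (1 : E3 → ENNReal) (p.2 + p.1) :=
            hme.comp (by fun_prop)
          have h3 : Measurable fun p : E3 × E3 => ENNReal.ofReal (‖p.1‖ ^ 2)⁻¹ := by fun_prop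
          exact (h1.mul (h3.mul h2)).const_mul _
      _ ≤ ∫⁻ y : E3, ENNReal.ofReal ℓ *
          (E.indicator 1 y * ENNReal.ofReal (C * ‖h‖ ^ (1 - ε))) := by
          refine lintegral_mono fun y => ?_
          rw [lintegral_const_mul _ (by fun_prop), lintegral_const_mul _ (by fun_prop)]
          refine mul_le_mul' le_rfl (mul_le_mul' le_rfl ?_)
          refine le_trans (le_of_eq ?_) (hs y)
          rw [← lintegral_indicator hEm,
            ← lintegral_add_left_eq_self (fun x => E.indicator
              (fun x => ENNReal.ofReal (‖x - y‖ ^ 2)⁻¹) x) y]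
          congr 1; ext z
          by_cases hz : y + z ∈ E
          · rw [indicator_of_mem hz, indicator_of_mem hz]; simp
          · rw [indicator_of_notMem hz, indicator_of_notMem hz]; simp
      _ = ENNReal.ofReal ℓ * (volume E * ENNReal.ofReal (C * ‖h‖ ^ (1 - ε))) := by
          rw [lintegral_const_mul _ (by fun_prop), lintegral_mul_const _ (by fun_prop),
            lintegral_indicator_one hEm]
      _ ≤ _ := by
          rw [mul_comm (volume E)]
          exact mul_le_mul' le_rfl (mul_le_mul' le_rfl hv)
  refine (mul_le_mul' le_rfl b1).trans ?_
  rw [← ENNReal.ofReal_toReal rayConst_lt_top.ne, ← ENNReal.ofReal_mul (by positivity),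
    ← ENNReal.ofReal_mul (by positivity), ← ENNReal.ofReal_mul (by positivity)]
  refine ENNReal.ofReal_le_ofReal ?_
  have e : ‖h‖ ^ (1 - ε) * ‖h‖ = ‖h‖ ^ (2 - ε) := by
    rcases eq_or_ne ‖h‖ 0 with h0 | h0
    · rw [h0, mul_zero, Real.zero_rpow (by linarith)]
    · rw [← Real.rpow_add_one h0]; congr 1; ring
  rw [← e]
  have : 0 ≤ ‖h‖ ^ (1 - ε) * ‖h‖ := by positivity
  calc _ = rayConst.toReal * ℓ * C ^ 2 * (‖h‖ ^ (1 - ε) * ‖h‖) := by ring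
    _ ≤ _ := by
      rw [ENNReal.toReal_ofReal ENNReal.toReal_nonneg, add_mul, one_mul]
      exact le_add_of_nonneg_right this

theorem exists_lintegral_sq_ray_jump_le {Ω : Set E3} (hΩ : MeasurableSet Ω)
    (hc : Convex ℝ Ω) (hb : Bornology.IsBounded Ω) {ε : ℝ} (hε : 0 < ε) (hε1 : ε ≤ 1)
    {ℓ : ℝ} (hℓ : 0 ≤ ℓ) :
    ∃ C : ℝ, 0 < C ∧ ∀ h : E3, ‖h‖ ≤ 1 →
      ∫⁻ w : E3, ∫⁻ y : E3, ENNReal.ofReal ((1 + ‖w‖) ^ 2)⁻¹ *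
        (∫⁻ s in Ioc 0 (ℓ / ‖w‖), jump Ω h (y - s • w)) ^ 2
        ≤ ENNReal.ofReal (C * ‖h‖ ^ (2 - ε)) := by
  obtain ⟨C, hC, hCb⟩ := exists_lintegral_sq_ray_leaveSet_le hΩ hc hb hε hε1 hℓ
  refine ⟨2 * C + 2 * C, by positivity, fun h hh => ?_⟩
  have hm : ∀ k : E3, Measurable ((leaveSet Ω k).indicator (1 : E3 → ENNReal)) := fun k =>
    measurable_one.indicator (measurableSet_leaveSet hΩ k)
  have hR : ∀ k : E3, Measurable fun p : E3 × E3 =>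
      ∫⁻ s in Ioc 0 (ℓ / ‖p.1‖), (leaveSet Ω k).indicator 1 (p.2 + s • p.1) := fun k =>
    measurable_setLIntegral_ray (hm k) ℓ
  have hR' : ∀ (k : E3) (w : E3), Measurable fun y : E3 =>
      ∫⁻ s in Ioc 0 (ℓ / ‖w‖), (leaveSet Ω k).indicator 1 (y + s • w) := fun k w => by
    have := (hR k).comp (measurable_prodMk_left (x := w))
    exact this
  -- Reversing `w` turns backward rays into the forward rays of the preceding estimate; the weight
  -- is even.
  have flip := lintegral_neg_eq_self (μ := (volume : Measure E3))
    (fun w => ∫⁻ y : E3, ENNReal.ofReal ((1 + ‖w‖) ^ 2)⁻¹ *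
        (∫⁻ s in Ioc 0 (ℓ / ‖w‖), jump Ω h (y - s • w)) ^ 2)
  rw [← flip]
  calc _ ≤ ∫⁻ w : E3, ((∫⁻ y : E3, 2 * (ENNReal.ofReal ((1 + ‖w‖) ^ 2)⁻¹ *
        (∫⁻ s in Ioc 0 (ℓ / ‖w‖), (leaveSet Ω h).indicator 1 (y + s • w)) ^ 2))
        + ∫⁻ y : E3, 2 * (ENNReal.ofReal ((1 + ‖w‖) ^ 2)⁻¹ *
        (∫⁻ s in Ioc 0 (ℓ / ‖w‖), (leaveSet Ω (-h)).indicator 1 (y + s • w)) ^ 2)) := by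
        refine lintegral_mono fun w => ?_
        rw [← lintegral_add_right_eq_self (fun y => 2 * (ENNReal.ofReal ((1 + ‖w‖) ^ 2)⁻¹ *
          (∫⁻ s in Ioc 0 (ℓ / ‖w‖), (leaveSet Ω (-h)).indicator 1 (y + s • w)) ^ 2)) h,
          ← lintegral_add_left ((((hR' h w).pow_const 2).const_mul _).const_mul _)]
        refine lintegral_mono fun y => ?_
        simp only [norm_neg, smul_neg, sub_neg_eq_add]
        have : ∫⁻ s in Ioc 0 (ℓ / ‖w‖), jump Ω h (y + s • w)
            = (∫⁻ s in Ioc 0 (ℓ / ‖w‖), (leaveSet Ω h).indicator 1 (y + s • w))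
            + ∫⁻ s in Ioc 0 (ℓ / ‖w‖), (leaveSet Ω (-h)).indicator 1 (y + h + s • w) := by
          have hmm : Measurable fun s : ℝ =>
              (leaveSet Ω h).indicator (1 : E3 → ENNReal) (y + s • w) :=
            (hm h).comp (by fun_prop)
          rw [← lintegral_add_left hmm]
          congr 1; ext s
          unfold jump
          rw [add_right_comm]
        rw [this]
        calc _ ≤ ENNReal.ofReal ((1 + ‖w‖) ^ 2)⁻¹ * (2 * ((_ : ENNReal) ^ 2 + _ ^ 2)) := by
              refine mul_le_mul' le_rfl ?_
              have := ENNReal.rpow_add_le_mul_rpow_add_rpow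
                (∫⁻ s in Ioc 0 (ℓ / ‖w‖), (leaveSet Ω h).indicator 1 (y + s • w))
                (∫⁻ s in Ioc 0 (ℓ / ‖w‖), (leaveSet Ω (-h)).indicator 1 (y + h + s • w))
                (p := 2) (by norm_num)
              norm_num at this
              exact this
          _ = _ := by ring
    _ = 2 * (∫⁻ w : E3, ∫⁻ y : E3, ENNReal.ofReal ((1 + ‖w‖) ^ 2)⁻¹ *
        (∫⁻ s in Ioc 0 (ℓ / ‖w‖), (leaveSet Ω h).indicator 1 (y + s • w)) ^ 2)
        + 2 * ∫⁻ w : E3, ∫⁻ y : E3, ENNReal.ofReal ((1 + ‖w‖) ^ 2)⁻¹ *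
        (∫⁻ s in Ioc 0 (ℓ / ‖w‖), (leaveSet Ω (-h)).indicator 1 (y + s • w)) ^ 2 := by
        have hmw : ∀ k : E3, Measurable fun w : E3 => ∫⁻ y : E3, ENNReal.ofReal ((1 + ‖w‖) ^ 2)⁻¹ *
            (∫⁻ s in Ioc 0 (ℓ / ‖w‖), (leaveSet Ω k).indicator 1 (y + s • w)) ^ 2 := fun k => by
          have h1 : Measurable fun p : E3 × E3 => ENNReal.ofReal ((1 + ‖p.1‖) ^ 2)⁻¹ := by fun_prop
          exact (h1.mul ((hR k).pow_const 2)).lintegral_prod_right'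
        have hmy : ∀ (k w : E3), Measurable fun y : E3 => ENNReal.ofReal ((1 + ‖w‖) ^ 2)⁻¹ *
            (∫⁻ s in Ioc 0 (ℓ / ‖w‖), (leaveSet Ω k).indicator 1 (y + s • w)) ^ 2 := fun k w =>
          ((hR' k w).pow_const 2).const_mul _
        simp_rw [lintegral_const_mul 2 (hmy _ _)]
        rw [lintegral_add_left ((hmw h).const_mul 2), lintegral_const_mul 2 (hmw _),
          lintegral_const_mul 2 (hmw _)]
    _ ≤ 2 * ENNReal.ofReal (C * ‖h‖ ^ (2 - ε)) + 2 * ENNReal.ofReal (C * ‖-h‖ ^ (2 - ε)) :=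
        add_le_add (mul_le_mul' le_rfl (hCb h hh))
          (mul_le_mul' le_rfl (hCb (-h) (by rwa [norm_neg])))
    _ = _ := by
        rw [norm_neg, two_mul_ofReal, ← ENNReal.ofReal_add (by positivity) (by positivity)]
        congr 1; ring


/-! ### Angular integration and the Carleman change of variables -/

theorem measurePreserving_frame {b : Fin 3 → E3} (hb : Orthonormal ℝ b) :
    MeasurePreserving fun q : ℝ × (ℝ × ℝ) => q.1 • b 0 + q.2.1 • b 1 + q.2.2 • b 2 := by
  have hsp : ⊤ ≤ Submodule.span ℝ (Set.range b) := by
    have := (basisOfOrthonormalOfCardEqFinrank hb (by simp)).span_eq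
    rw [coe_basisOfOrthonormalOfCardEqFinrank] at this
    exact this.ge
  set o : OrthonormalBasis (Fin 3) ℝ E3 := OrthonormalBasis.mk hb hsp with ho
  have h1 : MeasurePreserving (Prod.map (id : ℝ → ℝ) (MeasurableEquiv.finTwoArrow (α := ℝ)).symm)
      (volume : Measure (ℝ × (ℝ × ℝ))) volume :=
    (MeasurePreserving.id (volume : Measure ℝ)).prod ((volume_preserving_finTwoArrow ℝ).symm _)
  have h2 := (volume_preserving_piFinSuccAbove (fun _ : Fin 3 => ℝ) 0).symm
  have h3 := PiLp.volume_preserving_toLp (Fin 3)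
  have h := o.measurePreserving_repr_symm.comp (h3.comp (h2.comp h1))
  refine (congrArg (fun F => MeasurePreserving F volume volume) ?_).mp h
  ext1 q
  simp only [Function.comp_apply]
  rw [← OrthonormalBasis.sum_repr_symm, Fin.sum_univ_three]
  simp only [ho, OrthonormalBasis.coe_mk]
  rfl

theorem lintegral_frame {b : Fin 3 → E3} (hb : Orthonormal ℝ b) {Y : E3 → ENNReal}
    (hY : Measurable Y) :
    ∫⁻ y, Y y = ∫⁻ z : ℝ, ∫⁻ q : ℝ × ℝ, Y (z • b 0 + q.1 • b 1 + q.2 • b 2) := by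
  rw [← (measurePreserving_frame hb).lintegral_comp hY, Measure.volume_eq_prod,
    lintegral_prod _ (by fun_prop)]

/-- The unit vector with polar angles `θ, φ` in the frame `b`. -/
def polarDir (b : Fin 3 → E3) (θ φ : ℝ) : E3 :=
  Real.cos θ • b 0 + (Real.sin θ * Real.cos φ) • b 1 + (Real.sin θ * Real.sin φ) • b 2

theorem inner_frame {b : Fin 3 → E3} (hb : Orthonormal ℝ b) (i j : Fin 3) :
    ⟪b i, b j⟫ = if i = j then 1 else 0 :=
  orthonormal_iff_ite.1 hb i j

theorem norm_sq_frame {b : Fin 3 → E3} (hb : Orthonormal ℝ b) (x y z : ℝ) :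
    ‖x • b 0 + y • b 1 + z • b 2‖ ^ 2 = x ^ 2 + y ^ 2 + z ^ 2 := by
  rw [← real_inner_self_eq_norm_sq]
  simp only [inner_add_left, inner_add_right, inner_smul_left, inner_smul_right,
    inner_frame hb]
  simp
  ring

theorem norm_polarDir {b : Fin 3 → E3} (hb : Orthonormal ℝ b) (θ φ : ℝ) :
    ‖polarDir b θ φ‖ = 1 := by
  have := norm_sq_frame hb (Real.cos θ) (Real.sin θ * Real.cos φ) (Real.sin θ * Real.sin φ)
  have h2 : ‖polarDir b θ φ‖ ^ 2 = 1 := by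
    unfold polarDir
    rw [this]
    nlinarith [Real.sin_sq_add_cos_sq θ, Real.sin_sq_add_cos_sq φ]
  exact (pow_eq_one_iff_of_nonneg (norm_nonneg _) two_ne_zero).1 h2

theorem inner_polarDir {b : Fin 3 → E3} (hb : Orthonormal ℝ b) (θ φ : ℝ) :
    ⟪b 0, polarDir b θ φ⟫ = Real.cos θ := by
  unfold polarDir
  simp only [inner_add_right, inner_smul_right, inner_frame hb]
  simp

theorem orthonormal_frame_neg {b : Fin 3 → E3} (hb : Orthonormal ℝ b) :
    Orthonormal ℝ ![b 0, -b 1, -b 2] := by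
  rw [orthonormal_iff_ite]
  intro i j
  fin_cases i <;> fin_cases j <;> simp [inner_frame hb, hb.1]

/-- Using polar coordinates twice, first around the axis `b 0` and then in the half-plane through
it, the volume integral contains the angular integral times an integral over the radius `R`. On `0 <
R < 1` the radial weight is `R² R⁻² (1+R)⁻² ≥ 1/4`, whence the factor `4`. A volume integral is what
can be combined with the ray formula. -/
theorem lintegral_angle_le {b : Fin 3 → E3} (hb : Orthonormal ℝ b) {X : E3 → ENNReal}
    (hX : Measurable X) :
    ∫⁻ φ in Ioc 0 (2 * Real.pi), ∫⁻ θ in Ioc 0 (Real.pi / 2),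
        ENNReal.ofReal (Real.sin θ) * X (polarDir b θ φ)
      ≤ 4 * ∫⁻ y, ENNReal.ofReal ((‖y‖ ^ 2)⁻¹ * ((1 + ‖y‖) ^ 2)⁻¹) * X (‖y‖⁻¹ • y) := by
  -- Polar coordinates put the azimuth in `(-π, π)`. Shifting it by `π` to reach `(0, 2π)` reverses
  -- the last two frame vectors.
  set b' : Fin 3 → E3 := ![b 0, -b 1, -b 2] with hb'
  have hbo : Orthonormal ℝ b' := orthonormal_frame_neg hb
  set Y : E3 → ENNReal :=
    fun y => ENNReal.ofReal ((‖y‖ ^ 2)⁻¹ * ((1 + ‖y‖) ^ 2)⁻¹) * X (‖y‖⁻¹ • y) with hY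
  have hYm : Measurable Y := by fun_prop
  have hpi := Real.pi_pos
  have s1 : ∫⁻ y, Y y = ∫⁻ φ in Ioo (-Real.pi) Real.pi, ∫⁻ z : ℝ, ∫⁻ ρ in Ioi (0 : ℝ),
      ENNReal.ofReal ρ * Y (z • b' 0 + (ρ * Real.cos φ) • b' 1 + (ρ * Real.sin φ) • b' 2) := by
    rw [lintegral_frame hbo hYm]
    symm
    rw [lintegral_lintegral_swap]
    · congr 1; ext z
      rw [← lintegral_comp_polarCoord_symm, polarCoord_target, Measure.volume_eq_prod,
        ← Measure.prod_restrict, lintegral_prod_symm']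
      · simp only [polarCoord_symm_apply, smul_eq_mul]
      · simp only [polarCoord_symm_apply, smul_eq_mul]
        fun_prop
    · refine Measurable.aemeasurable ?_
      refine Measurable.lintegral_prod_right' (f := fun p : (ℝ × ℝ) × ℝ => ENNReal.ofReal p.2 *
        Y (p.1.2 • b' 0 + (p.2 * Real.cos p.1.1) • b' 1 + (p.2 * Real.sin p.1.1) • b' 2)) ?_
      fun_prop
  have s2 : ∀ φ : ℝ, ∫⁻ θ in Ioo 0 (Real.pi / 2), ENNReal.ofReal (Real.sin θ) *
        X (polarDir b' θ φ)
      ≤ 4 * ∫⁻ z : ℝ, ∫⁻ ρ in Ioi (0 : ℝ), ENNReal.ofReal ρ *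
        Y (z • b' 0 + (ρ * Real.cos φ) • b' 1 + (ρ * Real.sin φ) • b' 2) := by
    intro φ
    set Z : ℝ × ℝ → ENNReal := fun p => ENNReal.ofReal p.2 *
        Y (p.1 • b' 0 + (p.2 * Real.cos φ) • b' 1 + (p.2 * Real.sin φ) • b' 2) with hZ
    have hZm : Measurable Z := by fun_prop
    have e1 : ∫⁻ z : ℝ, ∫⁻ ρ in Ioi (0 : ℝ), ENNReal.ofReal ρ *
        Y (z • b' 0 + (ρ * Real.cos φ) • b' 1 + (ρ * Real.sin φ) • b' 2) = ∫⁻ p, Z p := by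
      rw [Measure.volume_eq_prod, lintegral_prod _ hZm.aemeasurable]
      congr 1; ext z
      rw [← lintegral_indicator measurableSet_Ioi]
      congr 1; ext ρ
      by_cases hρ : ρ ∈ Ioi (0 : ℝ)
      · rw [indicator_of_mem hρ]
      · rw [indicator_of_notMem hρ, hZ]
        simp only
        rw [ENNReal.ofReal_of_nonpos (not_lt.1 hρ), zero_mul]
    rw [e1, ← lintegral_comp_polarCoord_symm Z]
    have hsub : Ioo (0 : ℝ) 1 ×ˢ Ioo 0 (Real.pi / 2) ⊆ polarCoord.target := by
      rw [polarCoord_target]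
      exact prod_mono Ioo_subset_Ioi_self (Ioo_subset_Ioo (by linarith) (by linarith))
    refine le_trans ?_ (mul_le_mul' le_rfl (lintegral_mono_set hsub))
    have hmm : Measurable fun p : ℝ × ℝ => ENNReal.ofReal p.1 • Z (polarCoord.symm p) := by
      simp only [polarCoord_symm_apply, smul_eq_mul]
      fun_prop
    rw [Measure.volume_eq_prod, ← Measure.prod_restrict, lintegral_prod_symm' _ hmm,
      ← lintegral_const_mul' _ _ (by norm_num)]
    refine setLIntegral_mono' measurableSet_Ioo fun θ hθ => ?_
    have hsin : 0 < Real.sin θ := Real.sin_pos_of_pos_of_lt_pi hθ.1 (by linarith [hθ.2])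
    have e2 : ∀ R ∈ Ioo (0 : ℝ) 1, ENNReal.ofReal (1 / 4) *
        (ENNReal.ofReal (Real.sin θ) * X (polarDir b' θ φ))
        ≤ ENNReal.ofReal R • Z (polarCoord.symm (R, θ)) := by
      intro R hR
      have hR0 : 0 < R := hR.1
      simp only [polarCoord_symm_apply, smul_eq_mul, hZ, hY]
      have ed : (R * Real.cos θ) • b' 0 + (R * Real.sin θ * Real.cos φ) • b' 1
          + (R * Real.sin θ * Real.sin φ) • b' 2 = R • polarDir b' θ φ := by
        unfold polarDir
        simp only [smul_add, smul_smul, mul_assoc]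
      rw [ed, norm_smul, norm_polarDir hbo, mul_one, Real.norm_of_nonneg hR0.le, smul_smul,
        inv_mul_cancel₀ hR0.ne', one_smul, ← mul_assoc, ← mul_assoc, ← mul_assoc,
        ← ENNReal.ofReal_mul (by norm_num), ← ENNReal.ofReal_mul hR0.le,
        ← ENNReal.ofReal_mul (by positivity)]
      refine mul_le_mul' (ENNReal.ofReal_le_ofReal ?_) le_rfl
      have e3 : R * (R * Real.sin θ) * ((R ^ 2)⁻¹ * ((1 + R) ^ 2)⁻¹)
          = ((1 + R) ^ 2)⁻¹ * Real.sin θ := by field_simp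
      rw [e3]
      refine mul_le_mul_of_nonneg_right ?_ hsin.le
      rw [one_div]
      exact inv_anti₀ (by positivity) (by nlinarith [hR.2])
    calc _ = 4 * ∫⁻ R in Ioo (0 : ℝ) 1, ENNReal.ofReal (1 / 4) *
        (ENNReal.ofReal (Real.sin θ) * X (polarDir b' θ φ)) := by
          rw [setLIntegral_const, Real.volume_Ioo, sub_zero, ENNReal.ofReal_one, mul_one,
            ← mul_assoc, ← ENNReal.ofReal_ofNat 4, ← ENNReal.ofReal_mul (by norm_num)]
          norm_num
      _ ≤ _ := mul_le_mul' le_rfl (setLIntegral_mono' measurableSet_Ioo e2)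
  rw [s1, ← lintegral_const_mul' _ _ (by norm_num)]
  refine le_trans (le_of_eq ?_) (lintegral_mono fun φ => s2 φ)
  have s3 : ∀ φ : ℝ, ∫⁻ θ in Ioc 0 (Real.pi / 2),
      ENNReal.ofReal (Real.sin θ) * X (polarDir b θ (φ + Real.pi))
      = ∫⁻ θ in Ioo 0 (Real.pi / 2), ENNReal.ofReal (Real.sin θ) * X (polarDir b' θ φ) := by
    intro φ
    rw [restrict_Ioo_eq_restrict_Ioc]
    congr 1; ext θ
    congr 2
    unfold polarDir
    simp [hb']
  simp_rw [← s3]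
  rw [restrict_Ioo_eq_restrict_Ioc, ← lintegral_indicator measurableSet_Ioc,
    ← lintegral_indicator measurableSet_Ioc,
    ← lintegral_add_right_eq_self (fun φ => (Ioc 0 (2 * Real.pi)).indicator
      (fun φ => ∫⁻ θ in Ioc 0 (Real.pi / 2),
        ENNReal.ofReal (Real.sin θ) * X (polarDir b θ φ)) φ) Real.pi]
  congr 1; ext φ
  by_cases hφ : φ ∈ Ioc (-Real.pi) Real.pi
  · rw [indicator_of_mem hφ, indicator_of_mem]
    exact ⟨by linarith [hφ.1], by linarith [hφ.2]⟩
  · rw [indicator_of_notMem hφ, indicator_of_notMem]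
    intro h
    exact hφ ⟨by linarith [h.1], by linarith [h.2]⟩

theorem exists_lintegral_sqrt_gaussian_le :
    ∃ A : ℝ, 0 < A ∧ ∀ c : ℝ,
      ∫⁻ a : ℝ, ENNReal.ofReal ((|a| ^ (-(1 / 2) : ℝ) + 1) * Real.exp (-(c + a) ^ 2))
        ≤ ENNReal.ofReal A := by
  have h1 : ∫⁻ a in Metric.ball (0 : ℝ) 1, ENNReal.ofReal (|a| ^ (-(1 / 2) : ℝ)) < ⊤ := by
    have h1 : Integrable (fun z : ℝ => (Ioo 0 1).indicator (fun t : ℝ => t ^ (-(1 / 2) : ℝ)) ‖z‖) := by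
      rw [integrable_fun_norm_addHaar volume
        (f := (Ioo 0 1).indicator (fun t : ℝ => t ^ (-(1 / 2) : ℝ)))]
      have h2 : IntegrableOn (fun t : ℝ => t ^ (-(1 / 2) : ℝ)) (Ioo 0 1) := by
        rw [intervalIntegral.integrableOn_Ioo_rpow_iff one_pos]; norm_num
      have h3 := (integrable_indicator_iff measurableSet_Ioo).2 h2
      simpa using h3.integrableOn
    refine lt_of_le_of_lt ?_ h1.lintegral_lt_top
    rw [← lintegral_indicator measurableSet_ball]
    refine lintegral_mono_ae ?_
    have h0 : ∀ᵐ z : ℝ, z ≠ 0 := by simp [ae_iff]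
    filter_upwards [h0] with z hz
    by_cases hz' : z ∈ Metric.ball (0 : ℝ) 1
    · rw [indicator_of_mem hz', indicator_of_mem]
      · rfl
      · exact ⟨norm_pos_iff.2 hz, by simpa using hz'⟩
    · simp [indicator_of_notMem hz']
  have h2 : ∫⁻ a : ℝ, ENNReal.ofReal (Real.exp (-a ^ 2)) < ⊤ := by
    have := (integrable_exp_neg_mul_sq one_pos).lintegral_lt_top
    simpa using this
  refine ⟨(∫⁻ a in Metric.ball (0 : ℝ) 1, ENNReal.ofReal (|a| ^ (-(1 / 2) : ℝ))).toReal
    + 2 * (∫⁻ a : ℝ, ENNReal.ofReal (Real.exp (-a ^ 2))).toReal + 1, by positivity, fun c => ?_⟩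
  have h2c := lintegral_add_left_eq_self (μ := volume)
    (fun a : ℝ => ENNReal.ofReal (Real.exp (-a ^ 2))) c
  rw [ENNReal.ofReal_add (by positivity) zero_le_one, ENNReal.ofReal_add (by positivity)
    (by positivity), ENNReal.ofReal_toReal h1.ne, ENNReal.ofReal_mul zero_le_two,
    ENNReal.ofReal_toReal h2.ne, ← h2c,
    ← lintegral_const_mul _ (by fun_prop), ← lintegral_indicator measurableSet_ball,
    ← lintegral_add_right _ (by fun_prop)]
  refine le_trans (lintegral_mono fun a => ?_) le_self_add
  by_cases ha : a ∈ Metric.ball (0 : ℝ) 1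
  · rw [indicator_of_mem ha, ← ENNReal.ofReal_mul zero_le_two,
      ← ENNReal.ofReal_add (by positivity) (by positivity)]
    refine ENNReal.ofReal_le_ofReal ?_
    have e1 : Real.exp (-(c + a) ^ 2) ≤ 1 := Real.exp_le_one_iff.2 (by nlinarith [sq_nonneg (c + a)])
    have e2 : 0 ≤ |a| ^ (-(1 / 2) : ℝ) := by positivity
    nlinarith [Real.exp_pos (-(c + a) ^ 2)]
  · rw [indicator_of_notMem ha, ← ENNReal.ofReal_mul zero_le_two, zero_add]
    refine ENNReal.ofReal_le_ofReal ?_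
    have ha1 : 1 ≤ |a| := by simpa using ha
    have e2 : |a| ^ (-(1 / 2) : ℝ) ≤ 1 := Real.rpow_le_one_of_one_le_of_nonpos ha1 (by norm_num)
    nlinarith [Real.exp_pos (-(c + a) ^ 2)]

/-- The gain integrand in terms of the relative velocity `u` and the collision direction `α`. -/
def gainIntegrand (Φ : E3 → ENNReal) (v u α : E3) : ENNReal :=
  ENNReal.ofReal (Real.exp (-(‖v + u - ⟪u, α⟫ • α‖ ^ 2 + ‖v + u‖ ^ 2) / 2)
    * ((1 + ‖u‖) * ‖u‖⁻¹ * ⟪u, α⟫)) * Φ (v + ⟪u, α⟫ • α)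

theorem measurable_gainIntegrand {Φ : E3 → ENNReal} (hΦ : Measurable Φ) (v : E3) :
    Measurable fun p : E3 × E3 => gainIntegrand Φ v p.1 p.2 := by
  unfold gainIntegrand
  fun_prop

/-- The singularity `1/r` of the relative velocity is split into a product of two one-dimensional
singularities of order `1/2`, via `r² ≥ |a| |b|`. The two transverse integrals then separate. -/
theorem one_div_sqrt_le {z a b r : ℝ} (ha : a ≠ 0) (hb : b ≠ 0) (hr : 0 ≤ r)
    (h : r ^ 2 = z ^ 2 + a ^ 2 + b ^ 2) :
    (1 + r) * r⁻¹ ≤ (|a| ^ (-(1 / 2) : ℝ) + 1) * (|b| ^ (-(1 / 2) : ℝ) + 1) := by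
  have ha' := abs_pos.2 ha
  have hb' := abs_pos.2 hb
  have hr0 : 0 < r := lt_of_le_of_ne hr fun h0 => by
    rw [← h0] at h; nlinarith [sq_nonneg z, sq_nonneg a, pow_pos hb' 2, sq_abs b]
  have h1 : |a| ^ ((1 / 2) : ℝ) * |b| ^ ((1 / 2) : ℝ) ≤ r := by
    rw [← Real.mul_rpow ha'.le hb'.le, ← Real.sqrt_eq_rpow]
    refine Real.sqrt_le_iff.2 ⟨hr, ?_⟩
    rw [h]
    nlinarith [sq_nonneg (|a| - |b|), sq_abs a, sq_abs b, sq_nonneg z]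
  have h2 : r⁻¹ ≤ |a| ^ (-(1 / 2) : ℝ) * |b| ^ (-(1 / 2) : ℝ) := by
    rw [Real.rpow_neg ha'.le, Real.rpow_neg hb'.le, ← mul_inv]
    exact inv_anti₀ (by positivity) h1
  have h3 : (1 + r) * r⁻¹ = r⁻¹ + 1 := by field_simp
  rw [h3]
  nlinarith [Real.rpow_nonneg ha'.le (-(1 / 2)), Real.rpow_nonneg hb'.le (-(1 / 2))]

/-- For a fixed direction `α`, the argument of `Φ` depends only on the component `z` of `u` along
`α`. The two transverse components are integrated out against Gaussians, uniformly in `v`. -/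
theorem exists_lintegral_gainIntegrand_le :
    ∃ A : ℝ, 0 < A ∧ ∀ (Φ : E3 → ENNReal), Measurable Φ → ∀ v α : E3, ‖α‖ = 1 →
      ∫⁻ u, gainIntegrand Φ v u α
        ≤ ENNReal.ofReal A * ∫⁻ z : ℝ, ENNReal.ofReal (z * Real.exp (-z ^ 2 / 4)) *
          Φ (v + z • α) := by
  obtain ⟨A, hA, hAb⟩ := exists_lintegral_sqrt_gaussian_le
  refine ⟨A * A, by positivity, fun Φ hΦ v α hα => ?_⟩
  have hb := frame_orthonormal hα
  set b : Fin 3 → E3 := ![α, frame₂ α, frame₃ α] with hbdef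
  have hm : Measurable fun u => gainIntegrand Φ v u α := by
    have := (measurable_gainIntegrand hΦ v).comp (measurable_prodMk_right (y := α))
    exact this
  rw [lintegral_frame hb hm, ← lintegral_const_mul _ (by fun_prop)]
  refine lintegral_mono fun z => ?_
  set c₁ := ⟪b 1, v⟫
  set c₂ := ⟪b 2, v⟫
  have hae : ∀ᵐ a : ℝ, a ≠ 0 := by simp [ae_iff]
  have key : ∀ a c : ℝ, a ≠ 0 → c ≠ 0 →
      gainIntegrand Φ v (z • b 0 + a • b 1 + c • b 2) α
      ≤ ENNReal.ofReal (z * Real.exp (-z ^ 2 / 4)) * Φ (v + z • α) *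
        (ENNReal.ofReal ((|a| ^ (-(1 / 2) : ℝ) + 1) * Real.exp (-(c₁ + a) ^ 2)) *
          ENNReal.ofReal ((|c| ^ (-(1 / 2) : ℝ) + 1) * Real.exp (-(c₂ + c) ^ 2))) := by
    intro a c ha hc
    have hα0 : α = b 0 := rfl
    have hin : ⟪z • b 0 + a • b 1 + c • b 2, α⟫ = z := by
      rw [hα0]
      simp only [inner_add_left, inner_smul_left, inner_frame hb]
      simp
    unfold gainIntegrand
    rw [hin]
    rcases le_or_gt z 0 with hz | hz
    · rw [ENNReal.ofReal_of_nonpos]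
      · simp
      · exact mul_nonpos_of_nonneg_of_nonpos (by positivity)
          (mul_nonpos_of_nonneg_of_nonpos (by positivity) hz)
    rw [mul_right_comm (ENNReal.ofReal (z * Real.exp (-z ^ 2 / 4))),
      ← ENNReal.ofReal_mul (by positivity), ← ENNReal.ofReal_mul (by positivity)]
    refine mul_le_mul' (ENNReal.ofReal_le_ofReal ?_) le_rfl
    have hn := norm_sq_frame hb z a c
    have h1 := one_div_sqrt_le ha hc (norm_nonneg _) hn
    set x := v + a • b 1 + c • b 2 with hx
    have ex1 : v + (z • b 0 + a • b 1 + c • b 2) - z • α = x := by rw [hα0, hx]; abel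
    have ex2 : v + (z • b 0 + a • b 1 + c • b 2) = x + z • b 0 := by rw [hx]; abel
    -- Parallelogram identity around the midpoint: it produces the decay `exp(-z²/4)`, and the
    -- transverse components of the midpoint produce the two Gaussians.
    have hp : ‖x‖ ^ 2 + ‖x + z • b 0‖ ^ 2 = 2 * ‖x + (z / 2) • b 0‖ ^ 2 + z ^ 2 / 2 := by
      have e0 : ‖b 0‖ = 1 := hb.1 0
      rw [norm_add_sq_real x (z • b 0), norm_add_sq_real x ((z / 2) • b 0)]
      simp only [norm_smul, e0, inner_smul_right, Real.norm_eq_abs, mul_one, sq_abs]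
      ring
    have hlow : (c₁ + a) ^ 2 + (c₂ + c) ^ 2 ≤ ‖x + (z / 2) • b 0‖ ^ 2 := by
      set X := x + (z / 2) • b 0
      have hs := hb.sum_inner_products_le (x := X) (s := {1, 2})
      rw [Finset.sum_pair (by decide)] at hs
      have i1 : ⟪b 1, X⟫ = c₁ + a := by
        simp only [X, hx, inner_add_right, inner_smul_right, inner_frame hb]
        simp [c₁]
      have i2 : ⟪b 2, X⟫ = c₂ + c := by
        simp only [X, hx, inner_add_right, inner_smul_right, inner_frame hb]
        simp [c₂]
      rw [i1, i2] at hs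
      simpa using hs
    have hexp : Real.exp (-(‖v + (z • b 0 + a • b 1 + c • b 2) - z • α‖ ^ 2
        + ‖v + (z • b 0 + a • b 1 + c • b 2)‖ ^ 2) / 2)
        ≤ Real.exp (-z ^ 2 / 4) * (Real.exp (-(c₁ + a) ^ 2) * Real.exp (-(c₂ + c) ^ 2)) := by
      rw [← Real.exp_add, ← Real.exp_add, ex1, ex2, hp]
      refine Real.exp_le_exp.2 ?_
      linarith
    calc _ ≤ (Real.exp (-z ^ 2 / 4) * (Real.exp (-(c₁ + a) ^ 2) * Real.exp (-(c₂ + c) ^ 2))) *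
          ((|a| ^ (-(1 / 2) : ℝ) + 1) * (|c| ^ (-(1 / 2) : ℝ) + 1) * z) := by
          gcongr
      _ = _ := by ring
  have hm2 : Measurable fun q : ℝ × ℝ => gainIntegrand Φ v (z • b 0 + q.1 • b 1 + q.2 • b 2) α := by
    have := hm.comp (by fun_prop : Measurable fun q : ℝ × ℝ => z • b 0 + q.1 • b 1 + q.2 • b 2)
    exact this
  rw [Measure.volume_eq_prod, lintegral_prod _ hm2.aemeasurable]
  calc _ ≤ ∫⁻ a : ℝ, ∫⁻ c : ℝ, ENNReal.ofReal (z * Real.exp (-z ^ 2 / 4)) * Φ (v + z • α) *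
        (ENNReal.ofReal ((|a| ^ (-(1 / 2) : ℝ) + 1) * Real.exp (-(c₁ + a) ^ 2)) *
          ENNReal.ofReal ((|c| ^ (-(1 / 2) : ℝ) + 1) * Real.exp (-(c₂ + c) ^ 2))) := by
        refine lintegral_mono_ae ?_
        filter_upwards [hae] with a ha
        refine lintegral_mono_ae ?_
        filter_upwards [hae] with c hc
        exact key a c ha hc
    _ = ENNReal.ofReal (z * Real.exp (-z ^ 2 / 4)) * Φ (v + z • α) *
        ((∫⁻ a : ℝ, ENNReal.ofReal ((|a| ^ (-(1 / 2) : ℝ) + 1) * Real.exp (-(c₁ + a) ^ 2))) *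
          ∫⁻ c : ℝ, ENNReal.ofReal ((|c| ^ (-(1 / 2) : ℝ) + 1) * Real.exp (-(c₂ + c) ^ 2))) := by
        rw [← lintegral_mul_const _ (by fun_prop), ← lintegral_const_mul _ (by fun_prop)]
        congr 1; ext a
        rw [lintegral_const_mul _ (by fun_prop), lintegral_const_mul _ (by fun_prop)]
    _ ≤ ENNReal.ofReal (z * Real.exp (-z ^ 2 / 4)) * Φ (v + z • α) *
        (ENNReal.ofReal A * ENNReal.ofReal A) :=
        mul_le_mul' le_rfl (mul_le_mul' (hAb _) (hAb _))
    _ = _ := by rw [ENNReal.ofReal_mul hA.le]; ring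

/-- The Carleman bound for the gain part of the linearized collision operator. -/
theorem exists_carleman_le :
    ∃ A : ℝ, 0 < A ∧ ∀ (Φ : E3 → ENNReal), Measurable Φ → ∀ (v : E3) (b : E3 → Fin 3 → E3),
      (∀ u, u ≠ 0 → Orthonormal ℝ (b u)) →
      ∫⁻ u, ∫⁻ φ in Ioc 0 (2 * Real.pi), ∫⁻ θ in Ioc 0 (Real.pi / 2),
          ENNReal.ofReal (Real.sin θ) * gainIntegrand Φ v u (polarDir (b u) θ φ)
        ≤ ENNReal.ofReal A * ∫⁻ w, ENNReal.ofReal (‖w‖⁻¹ * Real.exp (-‖w‖ ^ 2 / 4)) *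
          Φ (v + w) := by
  obtain ⟨A, hA, hAb⟩ := exists_lintegral_gainIntegrand_le
  refine ⟨4 * A * rayConst.toReal + 1, by positivity, fun Φ hΦ v b hb => ?_⟩
  have h0 : ∀ᵐ u : E3, u ≠ 0 := by simp [ae_iff]
  have hg := measurable_gainIntegrand hΦ v
  set W : E3 → ENNReal := fun w => ENNReal.ofReal (‖w‖ * Real.exp (-‖w‖ ^ 2 / 4)) * Φ (v + w)
    with hW
  have hWm : Measurable W := by fun_prop
  have hgm : Measurable fun p : E3 × E3 =>
      ENNReal.ofReal ((‖p.2‖ ^ 2)⁻¹ * ((1 + ‖p.2‖) ^ 2)⁻¹) *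
        gainIntegrand Φ v p.1 (‖p.2‖⁻¹ • p.2) := by
    have := hg.comp (by fun_prop : Measurable fun p : E3 × E3 => (p.1, ‖p.2‖⁻¹ • p.2))
    have h2 : Measurable fun p : E3 × E3 => ENNReal.ofReal ((‖p.2‖ ^ 2)⁻¹ * ((1 + ‖p.2‖) ^ 2)⁻¹) := by
      fun_prop
    exact h2.mul this
  calc _ ≤ ∫⁻ u, 4 * ∫⁻ y, ENNReal.ofReal ((‖y‖ ^ 2)⁻¹ * ((1 + ‖y‖) ^ 2)⁻¹) *
        gainIntegrand Φ v u (‖y‖⁻¹ • y) := by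
        refine lintegral_mono_ae ?_
        filter_upwards [h0] with u hu
        refine lintegral_angle_le (hb u hu) ?_
        have := hg.comp (measurable_prodMk_left (x := u))
        exact this
    _ = 4 * ∫⁻ y, ENNReal.ofReal ((‖y‖ ^ 2)⁻¹ * ((1 + ‖y‖) ^ 2)⁻¹) *
        ∫⁻ u, gainIntegrand Φ v u (‖y‖⁻¹ • y) := by
        rw [lintegral_const_mul' _ _ (by norm_num), lintegral_lintegral_swap hgm.aemeasurable]
        congr 2; ext y
        rw [lintegral_const_mul' _ _ ENNReal.ofReal_ne_top]
    -- With direction `y/|y|` and line variable `z = |y| t`, the point `z y/|y|` is `t y`.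
    -- Directions and lengths recombine through `lintegral_ray` into a volume integral with density
    -- `|w|⁻²`, and the factor `|w|` contained in `W` reduces this to `|w|⁻¹`.
    _ ≤ 4 * ∫⁻ y, ENNReal.ofReal A * ∫⁻ t : ℝ, ENNReal.ofReal (‖y‖⁻¹ * ((1 + ‖y‖) ^ 2)⁻¹) *
        W (t • y) := by
        refine mul_le_mul' le_rfl (lintegral_mono_ae ?_)
        filter_upwards [h0] with y hy
        have hy0 : 0 < ‖y‖ := norm_pos_iff.2 hy
        refine (mul_le_mul' le_rfl (hAb Φ hΦ v (‖y‖⁻¹ • y) (by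
          rw [norm_smul, norm_inv, norm_norm, inv_mul_cancel₀ hy0.ne']))).trans ?_
        set G : ℝ → ENNReal := fun z => ENNReal.ofReal (z * Real.exp (-z ^ 2 / 4)) *
          Φ (v + z • ‖y‖⁻¹ • y) with hG
        have hGm : Measurable G := by fun_prop
        have e1 : ∫⁻ z, G z = ENNReal.ofReal ‖y‖ * ∫⁻ t : ℝ, G (‖y‖ • t) := by
          rw [lintegral_comp_const_smul volume hGm hy0.ne', ← mul_assoc,
            ← ENNReal.ofReal_mul hy0.le]
          simp [hy0.ne']
        rw [e1, lintegral_const_mul _ (by fun_prop)]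
        have e2 : ∫⁻ t : ℝ, G (‖y‖ • t) ≤ ∫⁻ t : ℝ, W (t • y) := by
          refine lintegral_mono fun t => ?_
          simp only [hG, hW, smul_eq_mul, smul_smul]
          have e3 : ‖y‖ * t * ‖y‖⁻¹ = t := by field_simp
          rw [e3, norm_smul, Real.norm_eq_abs, mul_pow, mul_pow, sq_abs, mul_comm (‖y‖ ^ 2)]
          refine mul_le_mul' (ENNReal.ofReal_le_ofReal (mul_le_mul_of_nonneg_right ?_
            (Real.exp_pos _).le)) le_rfl
          nlinarith [le_abs_self t]
        calc _ ≤ ENNReal.ofReal ((‖y‖ ^ 2)⁻¹ * ((1 + ‖y‖) ^ 2)⁻¹) * (ENNReal.ofReal A *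
              (ENNReal.ofReal ‖y‖ * ∫⁻ t : ℝ, W (t • y))) := by gcongr
          _ = ENNReal.ofReal A * ((ENNReal.ofReal ((‖y‖ ^ 2)⁻¹ * ((1 + ‖y‖) ^ 2)⁻¹) *
              ENNReal.ofReal ‖y‖) * ∫⁻ t : ℝ, W (t • y)) := by ring
          _ = _ := by
              rw [← ENNReal.ofReal_mul (by positivity)]
              congr 3
              field_simp
    _ = 4 * (ENNReal.ofReal A * (rayConst * ∫⁻ z : E3, ENNReal.ofReal (‖z‖ ^ 2)⁻¹ * W z)) := by
        rw [lintegral_const_mul' _ _ ENNReal.ofReal_ne_top, lintegral_ray hWm]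
    _ = ENNReal.ofReal (4 * A * rayConst.toReal) *
        ∫⁻ w, ENNReal.ofReal (‖w‖⁻¹ * Real.exp (-‖w‖ ^ 2 / 4)) * Φ (v + w) := by
        rw [ENNReal.ofReal_mul (by positivity), ENNReal.ofReal_toReal rayConst_lt_top.ne,
          ENNReal.ofReal_mul (by norm_num), ENNReal.ofReal_ofNat, mul_assoc, mul_assoc]
        congr 4; ext w
        rw [hW, ← mul_assoc, ← ENNReal.ofReal_mul (by positivity)]
        congr 2
        rcases eq_or_ne w 0 with rfl | hw
        · simp
        · have := norm_pos_iff.2 hw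
          field_simp
    _ ≤ _ := by gcongr; linarith


/-! ### Densities of push-forwards depending on a parameter -/

/-- The push-forwards are dominated by `K(v, w) dw`, so they have densities. The Radon–Nikodym
theorem for kernels is used instead of the one for measures because the density has to be jointly
measurable in `v` and `w`. -/
theorem exists_density {P : Type*} [MeasurableSpace P] {μ : Measure P} [SFinite μ]
    {W : E3 × P → ENNReal} (hW : Measurable W) {Y : E3 × P → E3} (hY : Measurable Y)
    {K : E3 × E3 → ℝ} (hK : Measurable K) (hK0 : ∀ q, 0 ≤ K q) {m : ENNReal} (hm : m < ⊤)
    (hKm : ∀ v, ∫⁻ w, ENNReal.ofReal (K (v, w)) ≤ m)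
    (hle : ∀ (v : E3) (Φ : E3 → ENNReal), Measurable Φ →
      ∫⁻ p, W (v, p) * Φ (Y (v, p)) ∂μ ≤ ∫⁻ w, ENNReal.ofReal (K (v, w)) * Φ w) :
    ∃ k : E3 × E3 → ℝ, Measurable k ∧ (∀ q, 0 ≤ k q) ∧ (∀ q, k q ≤ K q) ∧
      ∀ v, Measure.map (fun p => Y (v, p)) (μ.withDensity fun p => W (v, p))
        = volume.withDensity fun w => ENNReal.ofReal (k (v, w)) := by
  have hWv : ∀ v, Measurable fun p => W (v, p) := fun v => hW.comp measurable_prodMk_left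
  have hYv : ∀ v, Measurable fun p => Y (v, p) := fun v => hY.comp measurable_prodMk_left
  have hKv : ∀ v, Measurable fun w => ENNReal.ofReal (K (v, w)) := fun v =>
    (hK.comp measurable_prodMk_left).ennreal_ofReal
  have hval : ∀ (v : E3) (S : Set E3), MeasurableSet S →
      Measure.map (fun p => Y (v, p)) (μ.withDensity fun p => W (v, p)) S
        = ∫⁻ p, W (v, p) * S.indicator 1 (Y (v, p)) ∂μ := by
    intro v S hS
    rw [Measure.map_apply (hYv v) hS, withDensity_apply _ (hYv v hS),
      ← lintegral_indicator (hYv v hS)]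
    congr 1; ext p
    by_cases hp : Y (v, p) ∈ S
    · rw [indicator_of_mem hp, indicator_of_mem (show p ∈ (fun p => Y (v, p)) ⁻¹' S from hp)]
      simp
    · rw [indicator_of_notMem hp,
        indicator_of_notMem (show p ∉ (fun p => Y (v, p)) ⁻¹' S from hp)]
      simp
  let κ : ProbabilityTheory.Kernel E3 E3 :=
    ⟨fun v => Measure.map (fun p => Y (v, p)) (μ.withDensity fun p => W (v, p)), by
      refine Measure.measurable_of_measurable_coe _ fun S hS => ?_
      simp_rw [hval _ S hS]
      have h1 : Measurable fun q : E3 × P => S.indicator (1 : E3 → ENNReal) (Y q) :=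
        (measurable_one.indicator hS).comp hY
      exact (hW.mul h1).lintegral_prod_right'⟩
  let η : ProbabilityTheory.Kernel E3 E3 :=
    ⟨fun v => volume.withDensity fun w => ENNReal.ofReal (K (v, w)), by
      refine Measure.measurable_of_measurable_coe _ fun S hS => ?_
      simp_rw [withDensity_apply _ hS]
      exact (hK.ennreal_ofReal).lintegral_prod_right'⟩
  have hκ : ∀ v, κ v = Measure.map (fun p => Y (v, p)) (μ.withDensity fun p => W (v, p)) :=
    fun v => rfl
  have hη : ∀ v, η v = volume.withDensity fun w => ENNReal.ofReal (K (v, w)) := fun v => rfl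
  have hle' : ∀ v, κ v ≤ η v := by
    intro v
    refine Measure.le_iff.2 fun S hS => ?_
    rw [hκ, hη, hval v S hS, withDensity_apply _ hS, ← lintegral_indicator hS]
    refine (hle v _ (measurable_one.indicator hS)).trans (le_of_eq ?_)
    congr 1; ext w
    by_cases hw : w ∈ S
    · simp [indicator_of_mem hw]
    · simp [indicator_of_notMem hw]
  have hηm : ∀ v, η v univ ≤ m := fun v => by
    rw [hη, withDensity_apply _ MeasurableSet.univ, setLIntegral_univ]; exact hKm v
  have : ProbabilityTheory.IsFiniteKernel η := ⟨m, hm, hηm⟩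
  have : ProbabilityTheory.IsFiniteKernel κ := ⟨m, hm, fun v => (hle' v univ).trans (hηm v)⟩
  -- Truncating the derivative at `1`, which alters it only on null sets, makes the bound by `K`
  -- hold at every point.
  refine ⟨fun q => (min (κ.rnDeriv η q.1 q.2) 1).toReal * K q, ?_, fun q => ?_, fun q => ?_,
    fun v => ?_⟩
  · exact ((κ.measurable_rnDeriv η).min measurable_const).ennreal_toReal.mul hK
  · exact mul_nonneg ENNReal.toReal_nonneg (hK0 q)
  · refine mul_le_of_le_one_left (hK0 q) ?_
    exact ENNReal.toReal_le_of_le_ofReal zero_le_one (by simp)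
  · have hr : Measurable fun w => κ.rnDeriv η v w :=
      (κ.measurable_rnDeriv η).comp measurable_prodMk_left
    have h1 := ProbabilityTheory.Kernel.withDensity_rnDeriv_eq (κ := κ) (η := η) (a := v)
      (Measure.absolutelyContinuous_of_le (hle' v))
    rw [ProbabilityTheory.Kernel.withDensity_apply _ (κ.measurable_rnDeriv η)] at h1
    rw [← hκ, ← h1]
    have h2 : κ.rnDeriv η v =ᵐ[η v] fun w => min (κ.rnDeriv η v w) 1 := by
      filter_upwards [ProbabilityTheory.Kernel.rnDeriv_eq_rnDeriv_measure (κ := κ) (η := η)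
        (a := v), Measure.rnDeriv_le_one_of_le (hle' v)] with w hw1 hw2
      rw [min_eq_left]
      rw [hw1]; exact hw2
    rw [withDensity_congr_ae h2, hη, ← withDensity_mul _ (hKv v) (hr.min measurable_const)]
    congr 1; ext w
    simp only [Pi.mul_apply]
    rw [ENNReal.ofReal_mul ENNReal.toReal_nonneg, ENNReal.ofReal_toReal, mul_comm]
    exact ((min_le_right _ _).trans_lt ENNReal.one_lt_top).ne

theorem integral_comp_of_map_eq {P : Type*} [MeasurableSpace P] {μ : Measure P}
    {W : P → ENNReal} (hW : Measurable W) (hWt : ∀ p, W p < ⊤) {Y : P → E3} (hY : Measurable Y)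
    {k : E3 → ℝ} (hk : Measurable k) (hk0 : ∀ w, 0 ≤ k w)
    (hmap : Measure.map Y (μ.withDensity W) = volume.withDensity fun w => ENNReal.ofReal (k w))
    {h : E3 → ℝ} (hh : AEStronglyMeasurable h volume) (hkh : Integrable fun w => k w * h w) :
    Integrable (fun p => (W p).toReal * h (Y p)) μ ∧
      ∫ p, (W p).toReal * h (Y p) ∂μ = ∫ w, k w * h w := by
  have hh' : AEStronglyMeasurable h (Measure.map Y (μ.withDensity W)) := by
    rw [hmap]
    exact hh.mono_ac (withDensity_absolutelyContinuous _ _)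
  have e : ∀ w, (ENNReal.ofReal (k w)).toReal = k w := fun w => ENNReal.toReal_ofReal (hk0 w)
  have i1 : Integrable h (Measure.map Y (μ.withDensity W)) := by
    rw [hmap, integrable_withDensity_iff_integrable_smul' hk.ennreal_ofReal
      (Eventually.of_forall fun w => ENNReal.ofReal_lt_top)]
    simpa only [e, smul_eq_mul] using hkh
  constructor
  · have := (integrable_map_measure hh' hY.aemeasurable).1 i1
    rw [integrable_withDensity_iff_integrable_smul' hW (Eventually.of_forall hWt)] at this
    exact this
  · calc _ = ∫ p, h (Y p) ∂(μ.withDensity W) := by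
          rw [integral_withDensity_eq_integral_toReal_smul hW (Eventually.of_forall hWt)]
          rfl
      _ = ∫ w, h w ∂(Measure.map Y (μ.withDensity W)) := (integral_map hY.aemeasurable hh').symm
      _ = _ := by
          rw [hmap, integral_withDensity_eq_integral_toReal_smul hk.ennreal_ofReal
            (Eventually.of_forall fun w => ENNReal.ofReal_lt_top)]
          simp only [e, smul_eq_mul]

/-! ### Collision geometry -/

theorem measurable_frame₂ : Measurable frame₂ := by
  unfold frame₂
  refine Measurable.ite ?_ measurable_const ?_
  · exact ((measurableSet_singleton (0 : ℝ)).preimage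
      (by fun_prop : Measurable fun e : E3 => e 0)).inter
      ((measurableSet_singleton (0 : ℝ)).preimage (by fun_prop : Measurable fun e : E3 => e 1))
  · fun_prop

theorem measurable_frame₃ : Measurable frame₃ := by
  have := measurable_frame₂
  unfold frame₃
  fun_prop

theorem measurable_collisionDir :
    Measurable fun q : E3 × (E3 × (ℝ × ℝ)) => collisionDir q.1 q.2.1 q.2.2.2 q.2.2.1 := by
  have h2 := measurable_frame₂
  have h3 := measurable_frame₃
  unfold collisionDir
  fun_prop

theorem measurable_postVel :
    Measurable fun q : E3 × (E3 × (ℝ × ℝ)) => postVel q.1 q.2.1 q.2.2.2 q.2.2.1 := by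
  have h := measurable_collisionDir
  unfold postVel
  have h1 : Measurable fun q : E3 × (E3 × (ℝ × ℝ)) => q.2.1 - q.1 := by fun_prop
  have := measurable_fst.add ((h1.inner (𝕜 := ℝ) h).smul h)
  exact this

theorem measurable_postVelStar :
    Measurable fun q : E3 × (E3 × (ℝ × ℝ)) => postVelStar q.1 q.2.1 q.2.2.2 q.2.2.1 := by
  have h := measurable_collisionDir
  unfold postVelStar
  have h1 : Measurable fun q : E3 × (E3 × (ℝ × ℝ)) => q.2.1 - q.1 := by fun_prop
  have := (measurable_fst.comp measurable_snd).sub ((h1.inner (𝕜 := ℝ) h).smul h)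
  exact this

/-- The frame attached to the relative velocity `u`. -/
def relFrame (u : E3) : Fin 3 → E3 :=
  ![‖u‖⁻¹ • u, frame₂ (‖u‖⁻¹ • u), frame₃ (‖u‖⁻¹ • u)]

theorem relFrame_orthonormal {u : E3} (hu : u ≠ 0) : Orthonormal ℝ (relFrame u) := by
  refine frame_orthonormal ?_
  rw [norm_smul, norm_inv, norm_norm, inv_mul_cancel₀ (norm_ne_zero_iff.2 hu)]

theorem collisionDir_eq (v vs : E3) (θ φ : ℝ) :
    collisionDir v vs θ φ = polarDir (relFrame (vs - v)) θ φ := rfl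

theorem norm_smul_relFrame_zero {u : E3} (hu : u ≠ 0) : ‖u‖ • relFrame u 0 = u := by
  unfold relFrame
  simp only [Matrix.cons_val_zero]
  rw [smul_smul, mul_inv_cancel₀ (norm_ne_zero_iff.2 hu), one_smul]

theorem inner_polarDir_relFrame {u : E3} (hu : u ≠ 0) {b : Fin 3 → E3} (hb : Orthonormal ℝ b)
    (hb0 : b 0 = relFrame u 0) (θ φ : ℝ) : ⟪u, polarDir b θ φ⟫ = ‖u‖ * Real.cos θ := by
  conv_lhs => rw [← norm_smul_relFrame_zero hu]
  rw [inner_smul_left, ← hb0, inner_polarDir hb]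
  rfl

/-- In the plane of `u` and `α`, the direction with polar angle `π/2 - θ` on the other side of `u`
is orthogonal to `α`, so `u` is the sum of its projections on the two. Exchanging the directions
exchanges the roles of the post-collisional velocities, and both gain terms reduce to one estimate.
-/
theorem postVel_reflect {v vs : E3} (h : vs - v ≠ 0) (θ φ : ℝ) {b' : Fin 3 → E3}
    (hb' : b' = ![relFrame (vs - v) 0, -relFrame (vs - v) 1, -relFrame (vs - v) 2]) :
    postVel v vs θ φ = v + (vs - v) - ⟪vs - v, polarDir b' (Real.pi / 2 - θ) φ⟫ •
        polarDir b' (Real.pi / 2 - θ) φ ∧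
      postVelStar v vs θ φ = v + ⟪vs - v, polarDir b' (Real.pi / 2 - θ) φ⟫ •
        polarDir b' (Real.pi / 2 - θ) φ := by
  have hb := relFrame_orthonormal h
  have hbo : Orthonormal ℝ b' := hb' ▸ orthonormal_frame_neg hb
  set u := vs - v with hu
  have h0 : b' 0 = relFrame u 0 := by rw [hb']; rfl
  have h1 : b' 1 = -relFrame u 1 := by rw [hb']; rfl
  have h2 : b' 2 = -relFrame u 2 := by rw [hb']; rfl
  have key : ⟪u, polarDir (relFrame u) θ φ⟫ • polarDir (relFrame u) θ φ
      + ⟪u, polarDir b' (Real.pi / 2 - θ) φ⟫ • polarDir b' (Real.pi / 2 - θ) φ = u := by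
    rw [inner_polarDir_relFrame h hb rfl, inner_polarDir_relFrame h hbo h0]
    conv_rhs => rw [← norm_smul_relFrame_zero h]
    unfold polarDir
    rw [h0, h1, h2, Real.cos_pi_div_two_sub, Real.sin_pi_div_two_sub]
    have : ‖u‖ • relFrame u 0
        = (‖u‖ * (Real.cos θ ^ 2 + Real.sin θ ^ 2)) • relFrame u 0 := by
      rw [Real.cos_sq_add_sin_sq, mul_one]
    rw [this]
    module
  unfold postVel postVelStar
  rw [collisionDir_eq, ← hu]
  constructor
  · rw [← sub_eq_zero]
    calc _ = (⟪u, polarDir (relFrame u) θ φ⟫ • polarDir (relFrame u) θ φ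
      + ⟪u, polarDir b' (Real.pi / 2 - θ) φ⟫ • polarDir b' (Real.pi / 2 - θ) φ) - u := by abel
      _ = 0 := by rw [key, sub_self]
  · rw [← sub_eq_zero]
    calc _ = u - (⟪u, polarDir (relFrame u) θ φ⟫ • polarDir (relFrame u) θ φ
      + ⟪u, polarDir b' (Real.pi / 2 - θ) φ⟫ • polarDir b' (Real.pi / 2 - θ) φ) := by
          rw [hu]; abel
      _ = 0 := by rw [key, sub_self]

theorem norm_sq_postVel (v vs : E3) (θ φ : ℝ) :
    ‖postVel v vs θ φ‖ ^ 2 + ‖postVelStar v vs θ φ‖ ^ 2 = ‖v‖ ^ 2 + ‖vs‖ ^ 2 := by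
  rcases eq_or_ne (vs - v) 0 with h | h
  · unfold postVel postVelStar; rw [h]; simp
  · have hn := norm_polarDir (relFrame_orthonormal h) θ φ
    unfold postVel postVelStar
    rw [collisionDir_eq]
    set α := polarDir (relFrame (vs - v)) θ φ
    rw [norm_add_sq_real, norm_sub_sq_real, norm_smul, hn, inner_smul_right, inner_smul_right,
      inner_sub_left]
    simp only [Real.norm_eq_abs, mul_one, sq_abs]
    ring

theorem sqrt_maxwellian (v : E3) :
    Real.sqrt (maxwellian v) = Real.sqrt (Real.pi ^ (-(3 / 2) : ℝ)) * Real.exp (-‖v‖ ^ 2 / 2) := by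
  unfold maxwellian
  rw [Real.sqrt_mul (by positivity)]
  congr 1
  rw [show Real.exp (-‖v‖ ^ 2) = Real.exp (-‖v‖ ^ 2 / 2) ^ 2 by
    rw [← Real.exp_nat_mul]; congr 1; push_cast; ring]
  exact Real.sqrt_sq (Real.exp_pos _).le

theorem maxwellian_pos (v : E3) : 0 < maxwellian v := by unfold maxwellian; positivity

theorem measurable_sqrt_maxwellian : Measurable fun v => Real.sqrt (maxwellian v) := by
  unfold maxwellian; fun_prop

theorem measurable_maxwellian : Measurable maxwellian := by
  unfold maxwellian; fun_prop

theorem pi_rpow_le_one : Real.pi ^ (-(3 / 2) : ℝ) ≤ 1 :=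
  Real.rpow_le_one_of_one_le_of_nonpos (by linarith [Real.pi_gt_three]) (by norm_num)

theorem sqrt_maxwellian_mul (v w : E3) :
    Real.sqrt (maxwellian v) * Real.sqrt (maxwellian w)
      = Real.pi ^ (-(3 / 2) : ℝ) * Real.exp (-(‖v‖ ^ 2 + ‖w‖ ^ 2) / 2) := by
  rw [sqrt_maxwellian, sqrt_maxwellian, mul_mul_mul_comm, Real.mul_self_sqrt (by positivity),
    ← Real.exp_add]
  congr 2; ring

theorem sqrt_maxwellian_mul_le (v w : E3) :
    Real.sqrt (maxwellian v) * Real.sqrt (maxwellian w)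
      ≤ Real.exp (-(‖v‖ ^ 2 + ‖w‖ ^ 2) / 2) := by
  rw [sqrt_maxwellian_mul]
  exact mul_le_of_le_one_left (Real.exp_pos _).le pi_rpow_le_one

theorem sqrt_maxwellian_post (v vs : E3) (θ φ : ℝ) :
    Real.sqrt (maxwellian (postVel v vs θ φ)) * Real.sqrt (maxwellian (postVelStar v vs θ φ))
      = Real.sqrt (maxwellian v) * Real.sqrt (maxwellian vs) := by
  rw [sqrt_maxwellian_mul, sqrt_maxwellian_mul, norm_sq_postVel]

theorem AngularCutoff.exists_bound {γ : ℝ} (hγ0 : 0 ≤ γ) (hγ1 : γ ≤ 1) {B : ℝ → ℝ → ℝ}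
    (hB : AngularCutoff γ B) : ∃ C : ℝ, 0 < C ∧ ∀ r θ : ℝ, 0 < r → 0 ≤ θ → θ ≤ Real.pi / 2 →
      0 ≤ B r θ ∧ B r θ ≤ C * ((1 + r) * Real.cos θ * Real.sin θ) := by
  obtain ⟨C, hC⟩ := hB
  refine ⟨|C| + 1, by positivity, fun r θ hr h0 h1 => ⟨(hC r θ hr h0 h1).1, ?_⟩⟩
  refine (hC r θ hr h0 h1).2.trans ?_
  have hc : 0 ≤ Real.cos θ := Real.cos_nonneg_of_mem_Icc ⟨by linarith [Real.pi_pos], h1⟩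
  have hs : 0 ≤ Real.sin θ := Real.sin_nonneg_of_nonneg_of_le_pi h0 (by linarith [Real.pi_pos])
  have hp : r ^ γ ≤ 1 + r := by
    calc r ^ γ ≤ (1 + r) ^ γ := Real.rpow_le_rpow hr.le (by linarith) hγ0
      _ ≤ (1 + r) ^ (1 : ℝ) := Real.rpow_le_rpow_of_exponent_le (by linarith) hγ1
      _ = _ := Real.rpow_one _
  calc C * r ^ γ * Real.cos θ * Real.sin θ ≤ (|C| + 1) * (1 + r) * Real.cos θ * Real.sin θ := by
        gcongr
        linarith [le_abs_self C]
    _ = _ := by ring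

/-! ### Bounds for the gain and loss terms -/

/-- The measure on the collision parameters `(v_*, (φ, θ))`. -/
def collisionMeasure : Measure (E3 × (ℝ × ℝ)) :=
  (volume : Measure E3).prod ((volume.restrict (Ioc 0 (2 * Real.pi))).prod
    (volume.restrict (Ioc 0 (Real.pi / 2))))

instance : SFinite collisionMeasure := by unfold collisionMeasure; infer_instance

theorem lintegral_collisionMeasure {Ψ : E3 × (ℝ × ℝ) → ENNReal} (hΨ : Measurable Ψ) :
    ∫⁻ p, Ψ p ∂collisionMeasure = ∫⁻ vs, ∫⁻ φ in Ioc 0 (2 * Real.pi),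
      ∫⁻ θ in Ioc 0 (Real.pi / 2), Ψ (vs, (φ, θ)) := by
  unfold collisionMeasure
  rw [lintegral_prod _ hΨ.aemeasurable]
  congr 1; ext vs
  have : Measurable fun q : ℝ × ℝ => Ψ (vs, q) := hΨ.comp measurable_prodMk_left
  rw [lintegral_prod _ this.aemeasurable]

theorem integral_collisionMeasure {F : E3 × (ℝ × ℝ) → ℝ} (hF : Integrable F collisionMeasure) :
    ∫ vs, ∫ φ in (0 : ℝ)..(2 * Real.pi), ∫ θ in (0 : ℝ)..(Real.pi / 2), F (vs, (φ, θ))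
      = ∫ p, F p ∂collisionMeasure := by
  have h2 := hF
  unfold collisionMeasure at h2 ⊢
  rw [integral_prod _ h2]
  refine integral_congr_ae ?_
  filter_upwards [h2.prod_right_ae] with vs hvs
  rw [integral_prod _ hvs, intervalIntegral.integral_of_le (by positivity)]
  congr 1; ext φ
  rw [intervalIntegral.integral_of_le (by positivity)]

theorem ae_collisionMeasure (v : E3) :
    ∀ᵐ p ∂collisionMeasure, p.1 ≠ v ∧ p.2.2 ∈ Ioc 0 (Real.pi / 2) := by
  have h1 : ∀ᵐ p ∂collisionMeasure, p.1 ≠ v := by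
    have : ∀ᵐ w : E3, w ≠ v := by simp [ae_iff]
    exact Measure.quasiMeasurePreserving_fst.ae this
  have h2 : ∀ᵐ p ∂collisionMeasure, p.2.2 ∈ Ioc 0 (Real.pi / 2) := by
    have h3 : ∀ᵐ θ ∂(volume.restrict (Ioc 0 (Real.pi / 2))), θ ∈ Ioc 0 (Real.pi / 2) :=
      ae_restrict_mem measurableSet_Ioc
    exact Measure.quasiMeasurePreserving_snd.ae (Measure.quasiMeasurePreserving_snd.ae h3)
  filter_upwards [h1, h2] with p a b using ⟨a, b⟩

/-- The Grad bound for the kernel of the linearized collision operator. -/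
def gradBound (v w : E3) : ℝ := ‖v - w‖⁻¹ * Real.exp (-‖v - w‖ ^ 2 / 8)

theorem gradBound_nonneg (v w : E3) : 0 ≤ gradBound v w := by unfold gradBound; positivity

theorem measurable_gradBound : Measurable fun q : E3 × E3 => gradBound q.1 q.2 := by
  unfold gradBound; fun_prop

theorem lintegral_setIoc_reflect (F : ℝ → ENNReal) (a : ℝ) :
    ∫⁻ θ in Ioc 0 a, F (a - θ) = ∫⁻ θ in Ioc 0 a, F θ := by
  rw [← restrict_Ioo_eq_restrict_Ioc, ← lintegral_indicator measurableSet_Ioo,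
    ← lintegral_indicator measurableSet_Ioo, ← lintegral_sub_left_eq_self _ a]
  congr 1; ext θ
  by_cases h : θ ∈ Ioo 0 a
  · have h' : a - θ ∈ Ioo 0 a := ⟨by linarith [h.2], by linarith [h.1]⟩
    rw [indicator_of_mem h, indicator_of_mem h']
    simp
  · rw [indicator_of_notMem h, indicator_of_notMem]
    exact fun h' => h ⟨by linarith [h'.2], by linarith [h'.1]⟩

/-- In the cutoff bound, `sin θ` is kept as the surface density of the sphere and `cos θ` equals
`|u|⁻¹ ⟪u, α⟫`, the Jacobian factor built into `gainIntegrand`. -/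
theorem ofReal_mul_le_gainIntegrand {C₀ : ℝ} (hC₀ : 0 < C₀) (Φ : E3 → ENNReal) {v u α a x : E3}
    {θ β : ℝ} (hu : u ≠ 0) (hθ0 : 0 ≤ θ) (hθ1 : θ ≤ Real.pi / 2)
    (hα : ⟪u, α⟫ = ‖u‖ * Real.cos θ)
    (hβ : β ≤ C₀ * ((1 + ‖u‖) * Real.cos θ * Real.sin θ)) (ha : a = v + u - ⟪u, α⟫ • α)
    (hx : x = v + ⟪u, α⟫ • α) :
    ENNReal.ofReal (Real.sqrt (maxwellian a) * Real.sqrt (maxwellian (v + u)) * β) * Φ x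
      ≤ ENNReal.ofReal C₀ * (ENNReal.ofReal (Real.sin θ) * gainIntegrand Φ v u α) := by
  have hc : 0 ≤ Real.cos θ := Real.cos_nonneg_of_mem_Icc ⟨by linarith [Real.pi_pos], hθ1⟩
  have hs : 0 ≤ Real.sin θ := Real.sin_nonneg_of_nonneg_of_le_pi hθ0 (by linarith [Real.pi_pos])
  have hu0 : 0 < ‖u‖ := norm_pos_iff.2 hu
  unfold gainIntegrand
  rw [← hx, ← ha, ← mul_assoc, ← mul_assoc, ← ENNReal.ofReal_mul hC₀.le,
    ← ENNReal.ofReal_mul (by positivity)]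
  refine mul_le_mul' (ENNReal.ofReal_le_ofReal ?_) le_rfl
  rw [hα]
  calc _ ≤ Real.sqrt (maxwellian a) * Real.sqrt (maxwellian (v + u)) *
        (C₀ * ((1 + ‖u‖) * Real.cos θ * Real.sin θ)) := by gcongr
    _ ≤ Real.exp (-(‖a‖ ^ 2 + ‖v + u‖ ^ 2) / 2) *
        (C₀ * ((1 + ‖u‖) * Real.cos θ * Real.sin θ)) := by
        gcongr
        exact sqrt_maxwellian_mul_le _ _
    _ = _ := by field_simp

theorem exists_lintegral_le_gradBound {C₀ : ℝ} (hC₀ : 0 < C₀) :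
    ∃ A : ℝ, 0 < A ∧ ∀ (Φ : E3 → ENNReal), Measurable Φ → ∀ (v : E3) (b : E3 → Fin 3 → E3),
      (∀ u, u ≠ 0 → Orthonormal ℝ (b u)) → ∀ G : E3 → ℝ → ℝ → ENNReal,
      (∀ u φ θ, u ≠ 0 → 0 ≤ θ → θ ≤ Real.pi / 2 → G u φ θ ≤ ENNReal.ofReal C₀ *
        (ENNReal.ofReal (Real.sin θ) * gainIntegrand Φ v u (polarDir (b u) θ φ))) →
      ∫⁻ u, ∫⁻ φ in Ioc 0 (2 * Real.pi), ∫⁻ θ in Ioc 0 (Real.pi / 2), G u φ θ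
        ≤ ENNReal.ofReal A * ∫⁻ w, ENNReal.ofReal (gradBound v w) * Φ w := by
  obtain ⟨A, hA, hAb⟩ := exists_carleman_le
  refine ⟨C₀ * A, by positivity, fun Φ hΦ v b hb G hG => ?_⟩
  have h0 : ∀ᵐ u : E3, u ≠ 0 := by simp [ae_iff]
  calc _ ≤ ∫⁻ u, ∫⁻ φ in Ioc 0 (2 * Real.pi), ∫⁻ θ in Ioc 0 (Real.pi / 2), ENNReal.ofReal C₀ *
        (ENNReal.ofReal (Real.sin θ) * gainIntegrand Φ v u (polarDir (b u) θ φ)) := by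
        refine lintegral_mono_ae ?_
        filter_upwards [h0] with u hu
        refine lintegral_mono fun φ => setLIntegral_mono' measurableSet_Ioc fun θ hθ => ?_
        exact hG u φ θ hu hθ.1.le hθ.2
    _ = ENNReal.ofReal C₀ * ∫⁻ u, ∫⁻ φ in Ioc 0 (2 * Real.pi), ∫⁻ θ in Ioc 0 (Real.pi / 2),
        ENNReal.ofReal (Real.sin θ) * gainIntegrand Φ v u (polarDir (b u) θ φ) := by
        simp_rw [lintegral_const_mul' _ _ (ENNReal.ofReal_ne_top (r := C₀))]
    _ ≤ ENNReal.ofReal C₀ * (ENNReal.ofReal A *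
        ∫⁻ w, ENNReal.ofReal (‖w‖⁻¹ * Real.exp (-‖w‖ ^ 2 / 4)) * Φ (v + w)) :=
        mul_le_mul' le_rfl (hAb Φ hΦ v b hb)
    _ ≤ ENNReal.ofReal C₀ * (ENNReal.ofReal A *
        ∫⁻ w, ENNReal.ofReal (gradBound v (v + w)) * Φ (v + w)) := by
        refine mul_le_mul' le_rfl (mul_le_mul' le_rfl (lintegral_mono fun w =>
          mul_le_mul' (ENNReal.ofReal_le_ofReal ?_) le_rfl))
        -- The Gaussian exponent `1/4` is relaxed to `1/8` so that one bound also covers the loss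
        -- kernel, where half of the exponent absorbs polynomial growth.
        unfold gradBound
        rw [sub_add_cancel_left, norm_neg]
        exact mul_le_mul_of_nonneg_left (Real.exp_le_exp.2 (by nlinarith [sq_nonneg ‖w‖]))
          (by positivity)
    _ = _ := by
        rw [lintegral_add_left_eq_self (fun w => ENNReal.ofReal (gradBound v w) * Φ w) v,
          ENNReal.ofReal_mul hC₀.le, mul_assoc]

theorem one_add_mul_exp_le : ∃ C : ℝ, 0 < C ∧ ∀ r : ℝ, 0 < r →
    (1 + r) * Real.exp (-r ^ 2 / 4) ≤ C * (r⁻¹ * Real.exp (-r ^ 2 / 8)) := by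
  obtain ⟨C, hC, h⟩ := exists_exp_neg_mul_sq_le (1 / 8) 2 (by norm_num)
  refine ⟨C, hC, fun r hr => ?_⟩
  have h1 := h r hr.le
  have e : Real.exp (-r ^ 2 / 4) = Real.exp (-(1 / 8) * r ^ 2) * Real.exp (-r ^ 2 / 8) := by
    rw [← Real.exp_add]; congr 1; ring
  rw [e, ← mul_assoc, ← mul_assoc]
  refine mul_le_mul_of_nonneg_right ?_ (Real.exp_pos _).le
  rw [Real.rpow_neg (by positivity), Real.rpow_two] at h1
  calc (1 + r) * Real.exp (-(1 / 8) * r ^ 2) ≤ (1 + r) * (C * ((1 + r) ^ 2)⁻¹) := by gcongr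
    _ = C * (1 + r)⁻¹ := by field_simp
    _ ≤ C * r⁻¹ := by gcongr; linarith

section Bounds

variable {B : ℝ → ℝ → ℝ} {C₀ : ℝ}

theorem measurable_cross (hBm : Measurable (Function.uncurry B)) :
    Measurable fun q : E3 × (E3 × (ℝ × ℝ)) => B ‖q.1 - q.2.1‖ q.2.2.2 := by
  have := hBm.comp (by fun_prop : Measurable fun q : E3 × (E3 × (ℝ × ℝ)) =>
    (‖q.1 - q.2.1‖, q.2.2.2))
  exact this

theorem exists_lintegral_gain_le (hBm : Measurable (Function.uncurry B)) (hC₀ : 0 < C₀)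
    (hB : ∀ r θ : ℝ, 0 < r → 0 ≤ θ → θ ≤ Real.pi / 2 →
      0 ≤ B r θ ∧ B r θ ≤ C₀ * ((1 + r) * Real.cos θ * Real.sin θ)) :
    ∃ A : ℝ, 0 < A ∧ ∀ (v : E3) (Φ : E3 → ENNReal), Measurable Φ →
      ∫⁻ p, ENNReal.ofReal (Real.sqrt (maxwellian (postVelStar v p.1 p.2.2 p.2.1)) *
        Real.sqrt (maxwellian p.1) * B ‖v - p.1‖ p.2.2) * Φ (postVel v p.1 p.2.2 p.2.1)
        ∂collisionMeasure ≤ ENNReal.ofReal A * ∫⁻ w, ENNReal.ofReal (gradBound v w) * Φ w := by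
  obtain ⟨A, hA, hAb⟩ := exists_lintegral_le_gradBound hC₀
  refine ⟨A, hA, fun v Φ hΦ => ?_⟩
  have hm : Measurable fun q : E3 × (E3 × (ℝ × ℝ)) =>
      ENNReal.ofReal (Real.sqrt (maxwellian (postVelStar q.1 q.2.1 q.2.2.2 q.2.2.1)) *
        Real.sqrt (maxwellian q.2.1) * B ‖q.1 - q.2.1‖ q.2.2.2) *
        Φ (postVel q.1 q.2.1 q.2.2.2 q.2.2.1) :=
    ((((measurable_sqrt_maxwellian.comp measurable_postVelStar).mul
      (measurable_sqrt_maxwellian.comp (measurable_fst.comp measurable_snd))).mul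
      (measurable_cross hBm)).ennreal_ofReal).mul (hΦ.comp measurable_postVel)
  have hm' := hm.comp (measurable_prodMk_left (x := v))
  rw [lintegral_collisionMeasure (by exact hm'), ← lintegral_add_left_eq_self _ v]
  refine hAb Φ hΦ v relFrame (fun u hu => relFrame_orthonormal hu) _ fun u φ θ hu h0 h1 => ?_
  have hu0 : 0 < ‖u‖ := norm_pos_iff.2 hu
  have eu : v + u - v = u := add_sub_cancel_left v u
  have en : ‖v - (v + u)‖ = ‖u‖ := by rw [sub_add_cancel_left, norm_neg]
  simp only [en]
  refine ofReal_mul_le_gainIntegrand hC₀ Φ hu h0 h1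
    (inner_polarDir_relFrame hu (relFrame_orthonormal hu) rfl θ φ) (hB _ _ hu0 h0 h1).2 ?_ ?_
  · unfold postVelStar; rw [collisionDir_eq, eu]
  · unfold postVel; rw [collisionDir_eq, eu]

/-- The substitution `θ ↦ π/2 - θ` preserves the bound `cos θ sin θ` of the cross-section, and by
`postVel_reflect` it turns this term into the other gain term, with the reflected frame. -/
theorem exists_lintegral_gainStar_le (hBm : Measurable (Function.uncurry B)) (hC₀ : 0 < C₀)
    (hB : ∀ r θ : ℝ, 0 < r → 0 ≤ θ → θ ≤ Real.pi / 2 →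
      0 ≤ B r θ ∧ B r θ ≤ C₀ * ((1 + r) * Real.cos θ * Real.sin θ)) :
    ∃ A : ℝ, 0 < A ∧ ∀ (v : E3) (Φ : E3 → ENNReal), Measurable Φ →
      ∫⁻ p, ENNReal.ofReal (Real.sqrt (maxwellian (postVel v p.1 p.2.2 p.2.1)) *
        Real.sqrt (maxwellian p.1) * B ‖v - p.1‖ p.2.2) * Φ (postVelStar v p.1 p.2.2 p.2.1)
        ∂collisionMeasure ≤ ENNReal.ofReal A * ∫⁻ w, ENNReal.ofReal (gradBound v w) * Φ w := by
  obtain ⟨A, hA, hAb⟩ := exists_lintegral_le_gradBound hC₀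
  refine ⟨A, hA, fun v Φ hΦ => ?_⟩
  have hm : Measurable fun q : E3 × (E3 × (ℝ × ℝ)) =>
      ENNReal.ofReal (Real.sqrt (maxwellian (postVel q.1 q.2.1 q.2.2.2 q.2.2.1)) *
        Real.sqrt (maxwellian q.2.1) * B ‖q.1 - q.2.1‖ q.2.2.2) *
        Φ (postVelStar q.1 q.2.1 q.2.2.2 q.2.2.1) :=
    ((((measurable_sqrt_maxwellian.comp measurable_postVel).mul
      (measurable_sqrt_maxwellian.comp (measurable_fst.comp measurable_snd))).mul
      (measurable_cross hBm)).ennreal_ofReal).mul (hΦ.comp measurable_postVelStar)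
  have hm' := hm.comp (measurable_prodMk_left (x := v))
  rw [lintegral_collisionMeasure (by exact hm'), ← lintegral_add_left_eq_self _ v]
  have hr : ∀ u φ, ∫⁻ θ in Ioc 0 (Real.pi / 2),
      ENNReal.ofReal (Real.sqrt (maxwellian (postVel v (v + u) θ φ)) *
        Real.sqrt (maxwellian (v + u)) * B ‖v - (v + u)‖ θ) * Φ (postVelStar v (v + u) θ φ)
      = ∫⁻ θ in Ioc 0 (Real.pi / 2),
      ENNReal.ofReal (Real.sqrt (maxwellian (postVel v (v + u) (Real.pi / 2 - θ) φ)) *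
        Real.sqrt (maxwellian (v + u)) * B ‖v - (v + u)‖ (Real.pi / 2 - θ)) *
        Φ (postVelStar v (v + u) (Real.pi / 2 - θ) φ) := fun u φ =>
    (lintegral_setIoc_reflect (fun θ =>
      ENNReal.ofReal (Real.sqrt (maxwellian (postVel v (v + u) θ φ)) *
        Real.sqrt (maxwellian (v + u)) * B ‖v - (v + u)‖ θ) *
        Φ (postVelStar v (v + u) θ φ)) _).symm
  simp_rw [hr]
  refine hAb Φ hΦ v (fun u => ![relFrame u 0, -relFrame u 1, -relFrame u 2])
    (fun u hu => orthonormal_frame_neg (relFrame_orthonormal hu)) _ fun u φ θ hu h0 h1 => ?_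
  have hu0 : 0 < ‖u‖ := norm_pos_iff.2 hu
  have eu : v + u - v = u := add_sub_cancel_left v u
  have en : ‖v - (v + u)‖ = ‖u‖ := by rw [sub_add_cancel_left, norm_neg]
  simp only [en]
  have hb := (hB ‖u‖ (Real.pi / 2 - θ) hu0 (by linarith) (by linarith)).2
  rw [Real.cos_pi_div_two_sub, Real.sin_pi_div_two_sub, mul_right_comm] at hb
  obtain ⟨e1, e2⟩ := postVel_reflect (v := v) (vs := v + u) (by rwa [eu]) (Real.pi / 2 - θ) φ rfl
  rw [eu, sub_sub_cancel] at e1 e2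
  exact ofReal_mul_le_gainIntegrand hC₀ Φ hu h0 h1
    (inner_polarDir_relFrame hu (orthonormal_frame_neg (relFrame_orthonormal hu)) rfl θ φ) hb e1 e2

theorem setLIntegral_angle_const (c : ENNReal) :
    ∫⁻ _ in Ioc 0 (2 * Real.pi), ∫⁻ _ in Ioc 0 (Real.pi / 2), c
      = c * ENNReal.ofReal (Real.pi ^ 2) := by
  simp only [lintegral_const, Measure.restrict_apply MeasurableSet.univ, univ_inter,
    Real.volume_Ioc, sub_zero]
  rw [mul_assoc, ← ENNReal.ofReal_mul (by positivity)]
  congr 2; ring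

theorem cross_le (hC₀ : 0 < C₀) (hB : ∀ r θ : ℝ, 0 < r → 0 ≤ θ → θ ≤ Real.pi / 2 →
      0 ≤ B r θ ∧ B r θ ≤ C₀ * ((1 + r) * Real.cos θ * Real.sin θ)) {r θ : ℝ} (hr : 0 < r)
    (h0 : 0 ≤ θ) (h1 : θ ≤ Real.pi / 2) : B r θ ≤ C₀ * (1 + r) := by
  refine (hB r θ hr h0 h1).2.trans ?_
  have hc : 0 ≤ Real.cos θ := Real.cos_nonneg_of_mem_Icc ⟨by linarith [Real.pi_pos], h1⟩
  have h2 : Real.cos θ * Real.sin θ ≤ 1 :=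
    mul_le_one₀ (Real.cos_le_one _) (Real.sin_nonneg_of_nonneg_of_le_pi h0
      (by linarith [Real.pi_pos])) (Real.sin_le_one _)
  rw [mul_assoc (1 + r)]
  gcongr
  exact mul_le_of_le_one_right (by positivity) h2

/-- Here the kernel is explicit. The inequality `|v-w|² ≤ 2(|v|² + |w|²)` converts the two
Maxwellian factors into decay in `v - w`. -/
theorem exists_lintegral_loss_le (hBm : Measurable (Function.uncurry B)) (hC₀ : 0 < C₀)
    (hB : ∀ r θ : ℝ, 0 < r → 0 ≤ θ → θ ≤ Real.pi / 2 →
      0 ≤ B r θ ∧ B r θ ≤ C₀ * ((1 + r) * Real.cos θ * Real.sin θ)) :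
    ∃ A : ℝ, 0 < A ∧ ∀ (v : E3) (Φ : E3 → ENNReal), Measurable Φ →
      ∫⁻ p, ENNReal.ofReal (Real.sqrt (maxwellian v) *
        Real.sqrt (maxwellian p.1) * B ‖v - p.1‖ p.2.2) * Φ p.1
        ∂collisionMeasure ≤ ENNReal.ofReal A * ∫⁻ w, ENNReal.ofReal (gradBound v w) * Φ w := by
  obtain ⟨C, hC, hCb⟩ := one_add_mul_exp_le
  refine ⟨C₀ * C * Real.pi ^ 2, by positivity, fun v Φ hΦ => ?_⟩
  have hm : Measurable fun q : E3 × (E3 × (ℝ × ℝ)) =>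
      ENNReal.ofReal (Real.sqrt (maxwellian q.1) *
        Real.sqrt (maxwellian q.2.1) * B ‖q.1 - q.2.1‖ q.2.2.2) * Φ q.2.1 :=
    ((((measurable_sqrt_maxwellian.comp measurable_fst).mul
      (measurable_sqrt_maxwellian.comp (measurable_fst.comp measurable_snd))).mul
      (measurable_cross hBm)).ennreal_ofReal).mul (hΦ.comp (measurable_fst.comp measurable_snd))
  have hm' := hm.comp (measurable_prodMk_left (x := v))
  rw [lintegral_collisionMeasure (by exact hm')]
  have h0 : ∀ᵐ u : E3, u ≠ v := by simp [ae_iff]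
  calc _ ≤ ∫⁻ w : E3, ∫⁻ _ in Ioc 0 (2 * Real.pi), ∫⁻ _ in Ioc 0 (Real.pi / 2),
        ENNReal.ofReal (C₀ * C * gradBound v w) * Φ w := by
        refine lintegral_mono_ae ?_
        filter_upwards [h0] with w hw
        refine lintegral_mono fun φ => setLIntegral_mono' measurableSet_Ioc fun θ hθ => ?_
        refine mul_le_mul' (ENNReal.ofReal_le_ofReal ?_) le_rfl
        have hr : 0 < ‖v - w‖ := norm_pos_iff.2 (sub_ne_zero.2 hw.symm)
        have h1 := cross_le hC₀ hB hr hθ.1.le hθ.2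
        have h2 : Real.exp (-(‖v‖ ^ 2 + ‖w‖ ^ 2) / 2) ≤ Real.exp (-‖v - w‖ ^ 2 / 4) := by
          refine Real.exp_le_exp.2 ?_
          have := norm_sub_le v w
          nlinarith [sq_nonneg (‖v‖ - ‖w‖), norm_nonneg (v - w), norm_nonneg v, norm_nonneg w]
        calc _ ≤ Real.sqrt (maxwellian v) * Real.sqrt (maxwellian w) * (C₀ * (1 + ‖v - w‖)) := by
              gcongr
          _ ≤ Real.exp (-‖v - w‖ ^ 2 / 4) * (C₀ * (1 + ‖v - w‖)) := by
              gcongr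
              exact (sqrt_maxwellian_mul_le v w).trans h2
          _ = C₀ * ((1 + ‖v - w‖) * Real.exp (-‖v - w‖ ^ 2 / 4)) := by ring
          _ ≤ C₀ * (C * (‖v - w‖⁻¹ * Real.exp (-‖v - w‖ ^ 2 / 8))) := by
              exact mul_le_mul_of_nonneg_left (hCb _ hr) hC₀.le
          _ = _ := by unfold gradBound; ring
    _ = ∫⁻ w : E3, ENNReal.ofReal (C₀ * C * Real.pi ^ 2) *
        (ENNReal.ofReal (gradBound v w) * Φ w) := by
        congr 1; ext w
        rw [setLIntegral_angle_const, ENNReal.ofReal_mul (by positivity : 0 ≤ C₀ * C),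
          ENNReal.ofReal_mul (by positivity : 0 ≤ C₀ * C)]
        ring
    _ = _ := lintegral_const_mul' _ _ ENNReal.ofReal_ne_top

/-- The collision frequency. -/
def collisionFreq (B : ℝ → ℝ → ℝ) (v : E3) : ℝ :=
  (∫⁻ p, ENNReal.ofReal (maxwellian p.1 * B ‖v - p.1‖ p.2.2) ∂collisionMeasure).toReal

theorem measurable_freqIntegrand (hBm : Measurable (Function.uncurry B)) :
    Measurable fun q : E3 × (E3 × (ℝ × ℝ)) =>
      ENNReal.ofReal (maxwellian q.2.1 * B ‖q.1 - q.2.1‖ q.2.2.2) :=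
  ((measurable_maxwellian.comp (measurable_fst.comp measurable_snd)).mul
    (measurable_cross hBm)).ennreal_ofReal

theorem measurable_collisionFreq (hBm : Measurable (Function.uncurry B)) :
    Measurable (collisionFreq B) :=
  ((measurable_freqIntegrand hBm).lintegral_prod_right' (ν := collisionMeasure)).ennreal_toReal

theorem exists_lintegral_freq_le (hBm : Measurable (Function.uncurry B)) (hC₀ : 0 < C₀)
    (hB : ∀ r θ : ℝ, 0 < r → 0 ≤ θ → θ ≤ Real.pi / 2 →
      0 ≤ B r θ ∧ B r θ ≤ C₀ * ((1 + r) * Real.cos θ * Real.sin θ)) :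
    ∃ A : ℝ, 0 < A ∧ ∀ v : E3,
      ∫⁻ p, ENNReal.ofReal (maxwellian p.1 * B ‖v - p.1‖ p.2.2) ∂collisionMeasure
        ≤ ENNReal.ofReal (A * (1 + ‖v‖)) := by
  obtain ⟨C, hC, hCb⟩ := exists_lintegral_gaussian_weight_le 1 1 one_pos
  refine ⟨Real.pi ^ 2 * C₀ * C, by positivity, fun v => ?_⟩
  have hm' := (measurable_freqIntegrand hBm).comp (measurable_prodMk_left (x := v))
  rw [lintegral_collisionMeasure (by exact hm')]
  have h0 : ∀ᵐ u : E3, u ≠ v := by simp [ae_iff]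
  calc _ ≤ ∫⁻ w : E3, ∫⁻ _ in Ioc 0 (2 * Real.pi), ∫⁻ _ in Ioc 0 (Real.pi / 2),
        ENNReal.ofReal (C₀ * (1 + ‖v‖)) * ENNReal.ofReal (Real.exp (-1 * ‖0 - w‖ ^ 2) *
          (1 + ‖w‖) ^ (1 : ℝ) * (1 + (‖w‖ ^ 2)⁻¹ + (‖0 - w‖ ^ 2)⁻¹)) := by
        refine lintegral_mono_ae ?_
        filter_upwards [h0] with w hw
        refine lintegral_mono fun φ => setLIntegral_mono' measurableSet_Ioc fun θ hθ => ?_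
        rw [← ENNReal.ofReal_mul (by positivity)]
        refine ENNReal.ofReal_le_ofReal ?_
        have hr : 0 < ‖v - w‖ := norm_pos_iff.2 (sub_ne_zero.2 hw.symm)
        have h1 := cross_le hC₀ hB hr hθ.1.le hθ.2
        have h2 : 1 + ‖v - w‖ ≤ (1 + ‖v‖) * (1 + ‖w‖) := by
          nlinarith [norm_sub_le v w, norm_nonneg v, norm_nonneg w,
            mul_nonneg (norm_nonneg v) (norm_nonneg w)]
        have h3 : maxwellian w ≤ Real.exp (-1 * ‖0 - w‖ ^ 2) := by
          unfold maxwellian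
          rw [zero_sub, norm_neg, neg_one_mul]
          exact mul_le_of_le_one_left (Real.exp_pos _).le pi_rpow_le_one
        have h4 : 1 ≤ 1 + (‖w‖ ^ 2)⁻¹ + (‖0 - w‖ ^ 2)⁻¹ := by
          have : 0 ≤ (‖w‖ ^ 2)⁻¹ + (‖0 - w‖ ^ 2)⁻¹ := by positivity
          linarith
        rw [Real.rpow_one]
        calc _ ≤ maxwellian w * (C₀ * (1 + ‖v - w‖)) := by
              gcongr
              exact (maxwellian_pos w).le
          _ ≤ Real.exp (-1 * ‖0 - w‖ ^ 2) * (C₀ * ((1 + ‖v‖) * (1 + ‖w‖))) := by gcongr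
          _ = C₀ * (1 + ‖v‖) * (Real.exp (-1 * ‖0 - w‖ ^ 2) * (1 + ‖w‖) * 1) := by ring
          _ ≤ _ := by gcongr
    _ = ENNReal.ofReal (Real.pi ^ 2) * (ENNReal.ofReal (C₀ * (1 + ‖v‖)) *
        ∫⁻ w : E3, ENNReal.ofReal (Real.exp (-1 * ‖0 - w‖ ^ 2) *
          (1 + ‖w‖) ^ (1 : ℝ) * (1 + (‖w‖ ^ 2)⁻¹ + (‖0 - w‖ ^ 2)⁻¹))) := by
        rw [← lintegral_const_mul' _ _ ENNReal.ofReal_ne_top,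
          ← lintegral_const_mul' _ _ ENNReal.ofReal_ne_top]
        congr 1; ext w
        rw [setLIntegral_angle_const, mul_comm]
    _ ≤ ENNReal.ofReal (Real.pi ^ 2) * (ENNReal.ofReal (C₀ * (1 + ‖v‖)) *
        ENNReal.ofReal (C * (1 + ‖(0 : E3)‖) ^ (1 : ℝ))) :=
        mul_le_mul' le_rfl (mul_le_mul' le_rfl (hCb 0))
    _ = _ := by
        rw [norm_zero, add_zero, Real.one_rpow, ← ENNReal.ofReal_mul (by positivity),
          ← ENNReal.ofReal_mul (by positivity)]
        congr 1; ring

end Bounds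


/-! ### The linearized collision operator as a multiplication plus an integral operator -/

theorem exists_lintegral_gradBound_le :
    ∃ C : ℝ, 0 < C ∧ ∀ v : E3, ∫⁻ w, ENNReal.ofReal (gradBound v w) ≤ ENNReal.ofReal C ∧
      ∫⁻ w, ENNReal.ofReal (gradBound v w ^ 2) ≤ ENNReal.ofReal C := by
  obtain ⟨C, hC, hCb⟩ := exists_lintegral_gaussian_weight_le (1 / 8) 0 (by norm_num)
  have hx : ∀ v w : E3, Real.exp (-(1 / 8) * ‖v - w‖ ^ 2) * (1 + ‖w‖) ^ (0 : ℝ) *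
        (1 + (‖w‖ ^ 2)⁻¹ + (‖v - w‖ ^ 2)⁻¹)
        = Real.exp (-‖v - w‖ ^ 2 / 8) * (1 + (‖w‖ ^ 2)⁻¹ + (‖v - w‖ ^ 2)⁻¹) := fun v w => by
    rw [Real.rpow_zero, mul_one]; congr 2; ring
  have hb : ∀ v, ∫⁻ w : E3, ENNReal.ofReal (Real.exp (-‖v - w‖ ^ 2 / 8) *
        (1 + (‖w‖ ^ 2)⁻¹ + (‖v - w‖ ^ 2)⁻¹)) ≤ ENNReal.ofReal C := fun v => by
    have := hCb v
    simp only [hx] at this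
    rw [Real.rpow_zero, mul_one] at this
    exact this
  refine ⟨C, hC, fun v => ⟨(lintegral_mono fun w => ENNReal.ofReal_le_ofReal ?_).trans (hb v),
    (lintegral_mono fun w => ENNReal.ofReal_le_ofReal ?_).trans (hb v)⟩⟩
  · unfold gradBound
    rw [mul_comm]
    refine mul_le_mul_of_nonneg_left ?_ (Real.exp_pos _).le
    have h1 : 0 ≤ (‖w‖ ^ 2)⁻¹ := by positivity
    rw [← inv_pow ‖v - w‖]
    nlinarith [sq_nonneg (‖v - w‖⁻¹ - 1), sq_nonneg (‖v - w‖⁻¹)]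
  · unfold gradBound
    have h1 : 0 ≤ (‖w‖ ^ 2)⁻¹ := by positivity
    have h2 : Real.exp (-‖v - w‖ ^ 2 / 8) ≤ 1 :=
      Real.exp_le_one_iff.2 (by nlinarith [sq_nonneg ‖v - w‖])
    have h3 := Real.exp_pos (-‖v - w‖ ^ 2 / 8)
    rw [mul_pow, inv_pow]
    calc (‖v - w‖ ^ 2)⁻¹ * Real.exp (-‖v - w‖ ^ 2 / 8) ^ 2
        ≤ (‖v - w‖ ^ 2)⁻¹ * Real.exp (-‖v - w‖ ^ 2 / 8) := by
          refine mul_le_mul_of_nonneg_left ?_ (by positivity)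
          nlinarith
      _ = Real.exp (-‖v - w‖ ^ 2 / 8) * (‖v - w‖ ^ 2)⁻¹ := mul_comm _ _
      _ ≤ _ := by
          refine mul_le_mul_of_nonneg_left ?_ h3.le
          linarith

theorem integrable_kernel_mul {k : E3 × E3 → ℝ} (hk : Measurable k) {C : ℝ}
    (hkb : ∀ q, |k q| ≤ C * gradBound q.1 q.2) {h : E3 → ℝ} (hh : MemLp h 2) (v : E3) :
    Integrable fun w => k (v, w) * h w := by
  obtain ⟨A, hA, hAb⟩ := exists_lintegral_gradBound_le
  have hkv : Measurable fun w => k (v, w) := hk.comp measurable_prodMk_left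
  refine ⟨hkv.aestronglyMeasurable.mul hh.1, ?_⟩
  rw [hasFiniteIntegral_iff_enorm]
  have hcs := lintegral_mul_sq_le volume (f := fun w => ‖k (v, w)‖ₑ) (g := fun w => ‖h w‖ₑ)
    hkv.enorm.aemeasurable hh.1.enorm
  have h1 : ∫⁻ w, ‖k (v, w)‖ₑ ^ 2 < ⊤ := by
    calc _ ≤ ∫⁻ w, ENNReal.ofReal (C ^ 2) * ENNReal.ofReal (gradBound v w ^ 2) := by
          refine lintegral_mono fun w => ?_
          rw [← ENNReal.ofReal_mul (by positivity), ← enorm_pow,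
            Real.enorm_of_nonneg (sq_nonneg _), ← mul_pow, ← sq_abs]
          refine ENNReal.ofReal_le_ofReal ?_
          gcongr
          exact hkb (v, w)
      _ < ⊤ := by
          rw [lintegral_const_mul' _ _ ENNReal.ofReal_ne_top]
          exact ENNReal.mul_lt_top ENNReal.ofReal_lt_top
            ((hAb v).2.trans_lt ENNReal.ofReal_lt_top)
  have h2 : ∫⁻ w, ‖h w‖ₑ ^ 2 < ⊤ := by
    have := lintegral_rpow_enorm_lt_top_of_eLpNorm_lt_top two_ne_zero ENNReal.ofNat_ne_top hh.2
    simpa using this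
  simp_rw [enorm_mul]
  by_contra hcon
  rw [not_lt, top_le_iff] at hcon
  rw [hcon] at hcs
  have h3 := hcs.trans_lt (ENNReal.mul_lt_top h1 h2)
  simp at h3

/-- A weighted collision integral that is dominated on nonnegative functions by the operator with
kernel `gradBound` is itself an integral operator, with a kernel satisfying the same bound. It is
applied to the two gain terms and to one loss term. -/
theorem exists_kernel_of_bound {W : E3 × (E3 × (ℝ × ℝ)) → ℝ} (hW : Measurable W)
    {Y : E3 × (E3 × (ℝ × ℝ)) → E3} (hY : Measurable Y)
    (hle : ∃ A : ℝ, 0 < A ∧ ∀ (v : E3) (Φ : E3 → ENNReal), Measurable Φ →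
      ∫⁻ p, ENNReal.ofReal (W (v, p)) * Φ (Y (v, p)) ∂collisionMeasure
        ≤ ENNReal.ofReal A * ∫⁻ w, ENNReal.ofReal (gradBound v w) * Φ w)
    (hW0 : ∀ v, ∀ᵐ p ∂collisionMeasure, 0 ≤ W (v, p)) :
    ∃ (k : E3 × E3 → ℝ) (A : ℝ), 0 < A ∧ Measurable k ∧ (∀ q, |k q| ≤ A * gradBound q.1 q.2) ∧
      ∀ h : E3 → ℝ, MemLp h 2 → ∀ v,
        Integrable (fun p => W (v, p) * h (Y (v, p))) collisionMeasure ∧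
        ∫ p, W (v, p) * h (Y (v, p)) ∂collisionMeasure = ∫ w, k (v, w) * h w := by
  obtain ⟨A, hA, hAb⟩ := hle
  obtain ⟨C, hC, hCb⟩ := exists_lintegral_gradBound_le
  have hAg : ∀ q : E3 × E3, 0 ≤ A * gradBound q.1 q.2 := fun q =>
    mul_nonneg hA.le (gradBound_nonneg _ _)
  obtain ⟨k, hk, hk0, hkK, hmap⟩ := exists_density (μ := collisionMeasure)
    (W := fun q => ENNReal.ofReal (W q)) hW.ennreal_ofReal hY
    (K := fun q => A * gradBound q.1 q.2) (measurable_gradBound.const_mul A) hAg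
    (m := ENNReal.ofReal A * ENNReal.ofReal C)
    (ENNReal.mul_lt_top ENNReal.ofReal_lt_top ENNReal.ofReal_lt_top)
    (fun v => by
      simp_rw [ENNReal.ofReal_mul hA.le]
      rw [lintegral_const_mul' _ _ ENNReal.ofReal_ne_top]
      exact mul_le_mul' le_rfl (hCb v).1)
    (fun v Φ hΦ => by
      refine (hAb v Φ hΦ).trans (le_of_eq ?_)
      simp_rw [ENNReal.ofReal_mul hA.le, mul_assoc]
      rw [lintegral_const_mul' _ _ ENNReal.ofReal_ne_top])
  have hkb : ∀ q, |k q| ≤ A * gradBound q.1 q.2 := fun q => by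
    rw [abs_of_nonneg (hk0 q)]; exact hkK q
  refine ⟨k, A, hA, hk, hkb, fun h hh v => ?_⟩
  have hWv : Measurable fun p => ENNReal.ofReal (W (v, p)) :=
    (hW.comp measurable_prodMk_left).ennreal_ofReal
  obtain ⟨i1, i2⟩ := integral_comp_of_map_eq hWv (fun p => ENNReal.ofReal_lt_top)
    (hY.comp measurable_prodMk_left) (hk.comp (measurable_prodMk_left (x := v)))
    (fun w => hk0 (v, w)) (hmap v) hh.1 (integrable_kernel_mul hk hkb hh v)
  have hae : (fun p => (ENNReal.ofReal (W (v, p))).toReal * h (Y (v, p)))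
      =ᵐ[collisionMeasure] fun p => W (v, p) * h (Y (v, p)) := by
    filter_upwards [hW0 v] with p hp
    rw [ENNReal.toReal_ofReal hp]
  exact ⟨i1.congr hae, (integral_congr_ae hae).symm.trans i2⟩

theorem integral_freq {B : ℝ → ℝ → ℝ} (hBm : Measurable (Function.uncurry B)) {v : E3}
    (hB0 : ∀ᵐ p ∂collisionMeasure, 0 ≤ B ‖v - p.1‖ p.2.2) {A : ℝ}
    (hA : ∫⁻ p, ENNReal.ofReal (maxwellian p.1 * B ‖v - p.1‖ p.2.2) ∂collisionMeasure
      ≤ ENNReal.ofReal A) :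
    Integrable (fun p : E3 × (ℝ × ℝ) => maxwellian p.1 * B ‖v - p.1‖ p.2.2) collisionMeasure ∧
      ∫ p, maxwellian p.1 * B ‖v - p.1‖ p.2.2 ∂collisionMeasure = collisionFreq B v := by
  have hmv : Measurable fun p : E3 × (ℝ × ℝ) => maxwellian p.1 * B ‖v - p.1‖ p.2.2 := by
    have h1 : Measurable fun p : E3 × (ℝ × ℝ) => maxwellian p.1 :=
      measurable_maxwellian.comp measurable_fst
    have h2 : Measurable fun p : E3 × (ℝ × ℝ) => B ‖v - p.1‖ p.2.2 := by
      have := (measurable_cross hBm).comp (measurable_prodMk_left (x := v))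
      exact this
    exact h1.mul h2
  have h0 : 0 ≤ᵐ[collisionMeasure] fun p : E3 × (ℝ × ℝ) =>
      maxwellian p.1 * B ‖v - p.1‖ p.2.2 := by
    filter_upwards [hB0] with p hp
    exact mul_nonneg (maxwellian_pos _).le hp
  constructor
  · refine ⟨hmv.aestronglyMeasurable, ?_⟩
    rw [hasFiniteIntegral_iff_ofReal h0]
    exact hA.trans_lt ENNReal.ofReal_lt_top
  · rw [integral_eq_lintegral_of_nonneg_ae h0 hmv.aestronglyMeasurable]
    rfl

/-- The two collision integrals consist of two gain and two loss terms. Conservation of energy, in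
the form that the product of the two Maxwellian square roots is unchanged by the collision, extracts
the factor `√M(v)` that the prefactor of `L` cancels. The loss term containing `h(v)` is
multiplication by the collision frequency; the other three give the kernel `k₁ + k₂ - k₃`. -/
theorem exists_linearizedL_eq {γ : ℝ} (hγ0 : 0 ≤ γ) (hγ1 : γ ≤ 1) {B : ℝ → ℝ → ℝ}
    (hBm : Measurable (Function.uncurry B)) (hB : AngularCutoff γ B) :
    ∃ (ν : E3 → ℝ) (k : E3 × E3 → ℝ) (C : ℝ), 0 < C ∧ Measurable ν ∧ (∀ v, 0 ≤ ν v) ∧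
      (∀ v, ν v ≤ C * (1 + ‖v‖)) ∧ Measurable k ∧ (∀ q, |k q| ≤ C * gradBound q.1 q.2) ∧
      ∀ h : E3 → ℝ, MemLp h 2 → ∀ v,
        linearizedL B h v = -ν v * h v + ∫ w, k (v, w) * h w := by
  obtain ⟨C₀, hC₀, hB⟩ := hB.exists_bound hγ0 hγ1
  have hcross := measurable_cross hBm
  have hsm := measurable_sqrt_maxwellian
  have hB0 : ∀ v, ∀ᵐ p ∂collisionMeasure, 0 ≤ B ‖v - p.1‖ p.2.2 := fun v => by
    filter_upwards [ae_collisionMeasure v] with p hp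
    exact (hB _ _ (norm_pos_iff.2 (sub_ne_zero.2 hp.1.symm)) hp.2.1.le hp.2.2).1
  have hm2 : Measurable fun q : E3 × (E3 × (ℝ × ℝ)) => Real.sqrt (maxwellian q.2.1) :=
    hsm.comp (measurable_fst.comp measurable_snd)
  obtain ⟨k₁, A₁, hA₁, hk₁, hb₁, h₁⟩ := exists_kernel_of_bound
    (W := fun q => Real.sqrt (maxwellian (postVel q.1 q.2.1 q.2.2.2 q.2.2.1)) *
        Real.sqrt (maxwellian q.2.1) * B ‖q.1 - q.2.1‖ q.2.2.2)
    (((hsm.comp measurable_postVel).mul hm2).mul hcross) measurable_postVelStar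
    (exists_lintegral_gainStar_le hBm hC₀ hB) (fun v => by
      filter_upwards [hB0 v] with p hp
      exact mul_nonneg (by positivity) hp)
  obtain ⟨k₂, A₂, hA₂, hk₂, hb₂, h₂⟩ := exists_kernel_of_bound
    (W := fun q => Real.sqrt (maxwellian (postVelStar q.1 q.2.1 q.2.2.2 q.2.2.1)) *
        Real.sqrt (maxwellian q.2.1) * B ‖q.1 - q.2.1‖ q.2.2.2)
    (((hsm.comp measurable_postVelStar).mul hm2).mul hcross) measurable_postVel
    (exists_lintegral_gain_le hBm hC₀ hB) (fun v => by
      filter_upwards [hB0 v] with p hp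
      exact mul_nonneg (by positivity) hp)
  obtain ⟨k₃, A₃, hA₃, hk₃, hb₃, h₃⟩ := exists_kernel_of_bound
    (W := fun q => Real.sqrt (maxwellian q.1) *
        Real.sqrt (maxwellian q.2.1) * B ‖q.1 - q.2.1‖ q.2.2.2)
    (Y := fun q => q.2.1)
    (((hsm.comp measurable_fst).mul hm2).mul hcross) (measurable_fst.comp measurable_snd)
    (exists_lintegral_loss_le hBm hC₀ hB) (fun v => by
      filter_upwards [hB0 v] with p hp
      exact mul_nonneg (by positivity) hp)
  obtain ⟨A₄, hA₄, hb₄⟩ := exists_lintegral_freq_le hBm hC₀ hB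
  refine ⟨collisionFreq B, fun q => k₁ q + k₂ q - k₃ q, A₁ + A₂ + A₃ + A₄, by positivity,
    measurable_collisionFreq hBm, fun v => ENNReal.toReal_nonneg, fun v => ?_,
    (hk₁.add hk₂).sub hk₃, fun q => ?_, fun h hh v => ?_⟩
  · refine (ENNReal.toReal_le_of_le_ofReal (by positivity) (hb₄ v)).trans ?_
    gcongr
    linarith
  · have hg := gradBound_nonneg q.1 q.2
    calc |k₁ q + k₂ q - k₃ q| ≤ |k₁ q| + |k₂ q| + |k₃ q| := by
          refine (abs_sub _ _).trans ?_
          gcongr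
          exact abs_add_le _ _
      _ ≤ A₁ * gradBound q.1 q.2 + A₂ * gradBound q.1 q.2 + A₃ * gradBound q.1 q.2 := by
          gcongr
          exacts [hb₁ q, hb₂ q, hb₃ q]
      _ ≤ _ := by nlinarith
  · obtain ⟨i₁, e₁⟩ := h₁ h hh v
    obtain ⟨i₂, e₂⟩ := h₂ h hh v
    obtain ⟨i₃, e₃⟩ := h₃ h hh v
    obtain ⟨i₄, e₄⟩ := integral_freq hBm (hB0 v) (hb₄ v)
    set s := Real.sqrt (maxwellian v) with hs
    have hs0 : 0 < s := Real.sqrt_pos.2 (maxwellian_pos v)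
    have hsq : ∀ w, maxwellian w = Real.sqrt (maxwellian w) * Real.sqrt (maxwellian w) :=
      fun w => (Real.mul_self_sqrt (maxwellian_pos w).le).symm
    have q1 : collisionQ B maxwellian (fun w => Real.sqrt (maxwellian w) * h w) v
        = s * ((∫ w, k₁ (v, w) * h w) - ∫ w, k₃ (v, w) * h w) := by
      rw [← e₁, ← e₃, ← integral_sub i₁ i₃, ← integral_const_mul]
      refine Eq.trans ?_ (integral_collisionMeasure ((i₁.sub i₃).const_mul s))
      unfold collisionQ
      congr 1; ext vs
      congr 1; ext φ
      congr 1; ext θ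
      have := sqrt_maxwellian_post v vs θ φ
      simp only
      linear_combination (Real.sqrt (maxwellian (postVel v vs θ φ)) * h (postVelStar v vs θ φ) *
        B ‖v - vs‖ θ) * this + (Real.sqrt (maxwellian (postVelStar v vs θ φ)) *
        h (postVelStar v vs θ φ) * B ‖v - vs‖ θ) * hsq (postVel v vs θ φ)
        - (Real.sqrt (maxwellian vs) * h vs * B ‖v - vs‖ θ) * hsq v
    have q2 : collisionQ B (fun w => Real.sqrt (maxwellian w) * h w) maxwellian v
        = s * ((∫ w, k₂ (v, w) * h w) - h v * collisionFreq B v) := by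
      rw [← e₂, ← e₄, ← integral_const_mul, ← integral_sub i₂ (i₄.const_mul _),
        ← integral_const_mul]
      refine Eq.trans ?_ (integral_collisionMeasure ((i₂.sub (i₄.const_mul (h v))).const_mul s))
      unfold collisionQ
      congr 1; ext vs
      congr 1; ext φ
      congr 1; ext θ
      have := sqrt_maxwellian_post v vs θ φ
      simp only
      linear_combination (Real.sqrt (maxwellian (postVelStar v vs θ φ)) * h (postVel v vs θ φ) *
        B ‖v - vs‖ θ) * this + (Real.sqrt (maxwellian (postVel v vs θ φ)) *
        h (postVel v vs θ φ) * B ‖v - vs‖ θ) * hsq (postVelStar v vs θ φ)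
    have j₁ := integrable_kernel_mul hk₁ hb₁ hh v
    have j₂ := integrable_kernel_mul hk₂ hb₂ hh v
    have j₃ := integrable_kernel_mul hk₃ hb₃ hh v
    have hsum : ∫ w, (k₁ (v, w) + k₂ (v, w) - k₃ (v, w)) * h w
        = (∫ w, k₁ (v, w) * h w) + (∫ w, k₂ (v, w) * h w) - ∫ w, k₃ (v, w) * h w := by
      have j₁₂ : Integrable fun w => k₁ (v, w) * h w + k₂ (v, w) * h w := j₁.add j₂
      rw [← integral_add j₁ j₂, ← integral_sub j₁₂ j₃]
      congr 1; ext w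
      ring
    unfold linearizedL
    rw [q1, q2, hsum, ← mul_add, ← hs, ← mul_assoc, inv_mul_cancel₀ hs0.ne', one_mul]
    ring


/-! ### The transport equation along characteristics -/

/-- The free flow `(x, v) ↦ (x + t v, v)`. -/
def flow (t : ℝ) (p : E3 × E3) : E3 × E3 := (p.1 + t • p.2, p.2)

theorem contDiff_flow (t : ℝ) : ContDiff ℝ ∞ (flow t) := by
  unfold flow; fun_prop

theorem continuous_flow (t : ℝ) : Continuous (flow t) := (contDiff_flow t).continuous

theorem flow_flow (s t : ℝ) (p : E3 × E3) : flow s (flow t p) = flow (t + s) p := by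
  unfold flow; simp only [Prod.mk.injEq, and_true]; rw [add_smul, add_assoc]

theorem flow_zero (p : E3 × E3) : flow 0 p = p := by unfold flow; simp

/-- The free flow as a homeomorphism. -/
def flowHomeomorph (t : ℝ) : E3 × E3 ≃ₜ E3 × E3 where
  toFun := flow t
  invFun := flow (-t)
  left_inv p := by rw [flow_flow, add_neg_cancel, flow_zero]
  right_inv p := by rw [flow_flow, neg_add_cancel, flow_zero]
  continuous_toFun := continuous_flow t
  continuous_invFun := continuous_flow (-t)

theorem measurePreserving_flow (t : ℝ) : MeasurePreserving (flow t) := by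
  refine ⟨(continuous_flow t).measurable, ?_⟩
  ext S hS
  rw [Measure.map_apply (continuous_flow t).measurable hS, Measure.volume_eq_prod,
    Measure.prod_apply_symm ((continuous_flow t).measurable hS), Measure.prod_apply_symm hS]
  congr 1; ext v
  exact measure_preimage_add_right volume (t • v) ((fun x => (x, v)) ⁻¹' S)

theorem integral_flow (t : ℝ) (h : E3 × E3 → ℝ) : ∫ p, h (flow t p) = ∫ p, h p :=
  (measurePreserving_flow t).integral_comp (flowHomeomorph t).measurableEmbedding h

theorem measurable_flow_uncurry : Measurable fun z : (E3 × E3) × ℝ => flow z.2 z.1 := by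
  unfold flow; fun_prop

theorem measurable_flow_neg_uncurry : Measurable fun z : (E3 × E3) × ℝ => flow (-z.2) z.1 := by
  unfold flow; fun_prop

theorem integrable_flow_prod {G : E3 × E3 → ℝ} (hG : Measurable G) (hGi : Integrable G) (r : ℝ) :
    Integrable (fun z : (E3 × E3) × ℝ => G (flow (-z.2) z.1))
      ((volume : Measure (E3 × E3)).prod (volume.restrict (Ioc 0 r))) := by
  have hm : Measurable fun z : (E3 × E3) × ℝ => G (flow (-z.2) z.1) :=
    hG.comp measurable_flow_neg_uncurry
  refine ⟨hm.aestronglyMeasurable, ?_⟩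
  rw [hasFiniteIntegral_iff_enorm, lintegral_prod_symm' _ hm.enorm]
  have h1 : ∀ s : ℝ, ∫⁻ p : E3 × E3, ‖G (flow (-s) p)‖ₑ = ∫⁻ p, ‖G p‖ₑ := fun s =>
    (measurePreserving_flow (-s)).lintegral_comp hG.enorm
  simp only [h1, lintegral_const, Measure.restrict_apply MeasurableSet.univ, univ_inter,
    Real.volume_Ioc]
  exact ENNReal.mul_lt_top hGi.2 ENNReal.ofReal_lt_top

/-- The weak equation is tested with `ψ` transported by the flow for each time between `0` and `r`.
Integrating in time gives `ψ ∘ flow r - ψ`, and since the flow preserves volume, all factors can be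
moved off `ψ`. The identity then holds against every test function supported in an open set. -/
theorem transport_of_weak {Ω : Set E3} (hΩ : IsOpen Ω) (hc : Convex ℝ Ω) {f G : E3 × E3 → ℝ}
    (hfi : Integrable f) (hG : Measurable G) (hGi : Integrable G) {R : ℝ}
    (hw : ∀ ψ : E3 × E3 → ℝ, ContDiff ℝ ∞ ψ → HasCompactSupport ψ →
      tsupport ψ ⊆ Ω ×ˢ Metric.ball 0 R →
      ∫ p, f p * fderiv ℝ ψ p (p.2, 0) = - ∫ p, G p * ψ p) {r : ℝ} (hr : 0 ≤ r) :
    ∀ᵐ p : E3 × E3, p.1 ∈ Ω → (flow (-r) p).1 ∈ Ω → ‖p.2‖ < R →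
      f p - f (flow (-r) p) = ∫ s in Ioc 0 r, G (flow (-s) p) := by
  set U : Set (E3 × E3) := {p | p.1 ∈ Ω ∧ (flow (-r) p).1 ∈ Ω ∧ ‖p.2‖ < R} with hU
  have hUo : IsOpen U := by
    refine (hΩ.preimage continuous_fst).inter ((hΩ.preimage
      (continuous_fst.comp (continuous_flow (-r)))).inter ?_)
    exact isOpen_lt (continuous_norm.comp continuous_snd) continuous_const
  set H : E3 × E3 → ℝ := fun p => f p - f (flow (-r) p) - ∫ s in Ioc 0 r, G (flow (-s) p) with hH
  have i1 : Integrable fun p => f (flow (-r) p) :=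
    (measurePreserving_flow (-r)).integrable_comp_of_integrable hfi
  have hGp := integrable_flow_prod hG hGi r
  have i2 : Integrable fun p => ∫ s in Ioc 0 r, G (flow (-s) p) := hGp.integral_prod_left
  have hHi : Integrable H := (hfi.sub i1).sub i2
  have key : ∀ᵐ p : E3 × E3, p ∈ U → H p = 0 := by
    refine hUo.ae_eq_zero_of_integral_contDiff_smul_eq_zero (hHi.locallyIntegrable.locallyIntegrableOn _)
      fun ψ hψ hψc hψs => ?_
    have hdψ : Continuous fun p : E3 × E3 => fderiv ℝ ψ p (p.2, 0) :=
      (hψ.continuous_fderiv (by simp)).clm_apply (by fun_prop)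
    obtain ⟨M, hM⟩ := hψc.exists_bound_of_continuous hψ.continuous
    have hdc : HasCompactSupport fun p : E3 × E3 => fderiv ℝ ψ p (p.2, 0) := by
      refine (hψc.fderiv (𝕜 := ℝ)).mono fun p hp => ?_
      rw [Function.mem_support] at hp ⊢
      intro h0
      rw [h0] at hp
      simp at hp
    obtain ⟨M', hM'⟩ := hdc.exists_bound_of_continuous hdψ
    have hweak : ∀ s ∈ Icc 0 r, ∫ p, f p * fderiv ℝ ψ (flow s p) (p.2, 0)
        = - ∫ p, G p * ψ (flow s p) := by
      intro s hs
      have h1 : ContDiff ℝ ∞ (ψ ∘ flow s) := hψ.comp (contDiff_flow s)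
      have h2 : HasCompactSupport (ψ ∘ flow s) :=
        hψc.comp_isClosedEmbedding (flowHomeomorph s).isClosedEmbedding
      -- Convexity enters here: if both ends of a characteristic segment lie in `Ω`, so do all
      -- intermediate points, and the transported test function is admissible.
      have h3 : tsupport (ψ ∘ flow s) ⊆ Ω ×ˢ Metric.ball 0 R := by
        have hsub : tsupport (ψ ∘ flow s) ⊆ flow s ⁻¹' tsupport ψ :=
          closure_minimal (fun p hp => subset_tsupport ψ hp)
            ((isClosed_tsupport ψ).preimage (continuous_flow s))
        refine hsub.trans fun p hp => ?_
        have hp' := hψs hp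
        refine ⟨?_, by simpa [flow] using hp'.2.2⟩
        have ha : p.1 + s • p.2 ∈ Ω := hp'.1
        have hb : p.1 + s • p.2 + (-r) • p.2 ∈ Ω := hp'.2.1
        rcases eq_or_lt_of_le hr with h0 | h0
        · have : s = 0 := le_antisymm (h0 ▸ hs.2) hs.1
          simpa [this] using ha
        · have := hc.add_smul_mem ha hb (t := s / r)
            ⟨div_nonneg hs.1 hr, (div_le_one h0).2 hs.2⟩
          rw [smul_smul, show s / r * -r = -s by field_simp, neg_smul, add_neg_cancel_right]
            at this
          exact this
      have h4 := hw _ h1 h2 h3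
      have h5 : ∀ p : E3 × E3, fderiv ℝ (ψ ∘ flow s) p (p.2, 0)
          = fderiv ℝ ψ (flow s p) (p.2, 0) := by
        intro p
        have hd : HasFDerivAt (flow s)
            (((ContinuousLinearMap.fst ℝ E3 E3) + s • (ContinuousLinearMap.snd ℝ E3 E3)).prod
              (ContinuousLinearMap.snd ℝ E3 E3)) p := by
          have := (((ContinuousLinearMap.fst ℝ E3 E3) + s • (ContinuousLinearMap.snd ℝ E3 E3)).prod
              (ContinuousLinearMap.snd ℝ E3 E3)).hasFDerivAt (x := p)
          exact this
        have hψd : HasFDerivAt ψ (fderiv ℝ ψ (flow s p)) (flow s p) :=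
          (hψ.differentiable (by simp) _).hasFDerivAt
        rw [(hψd.comp p hd).fderiv]
        simp
      simp_rw [h5] at h4
      exact h4
    have hftc : ∀ p : E3 × E3, ψ (flow r p) - ψ p
        = ∫ s in Ioc 0 r, fderiv ℝ ψ (flow s p) (p.2, 0) := by
      intro p
      rw [← intervalIntegral.integral_of_le hr]
      have hd : ∀ s ∈ uIcc 0 r, HasDerivAt (fun s => ψ (flow s p))
          (fderiv ℝ ψ (flow s p) (p.2, 0)) s := by
        intro s _
        have hψd : HasFDerivAt ψ (fderiv ℝ ψ (flow s p)) (flow s p) :=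
          (hψ.differentiable (by simp) _).hasFDerivAt
        refine hψd.comp_hasDerivAt s ?_
        have h1 : HasDerivAt (fun s : ℝ => p.1 + s • p.2) p.2 s := by
          simpa using ((hasDerivAt_id s).smul_const p.2).const_add p.1
        exact h1.prodMk (hasDerivAt_const s p.2)
      have hcont : Continuous fun s => fderiv ℝ ψ (flow s p) (p.2, 0) := by
        have h1 : Continuous fun s : ℝ => flow s p := by unfold flow; fun_prop
        exact ((hψ.continuous_fderiv (by simp)).comp h1).clm_apply continuous_const
      rw [intervalIntegral.integral_eq_sub_of_hasDerivAt hd (hcont.intervalIntegrable _ _),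
        flow_zero]
    have e1 : ∫ p, f p * (ψ (flow r p) - ψ p) = - ∫ s in Ioc 0 r, ∫ p, G p * ψ (flow s p) := by
      have hint : Integrable (fun z : (E3 × E3) × ℝ => f z.1 * fderiv ℝ ψ (flow z.2 z.1) (z.1.2, 0))
          ((volume : Measure (E3 × E3)).prod (volume.restrict (Ioc 0 r))) := by
        refine Integrable.mul_bdd (c := M') (hfi.comp_fst _) ?_ ?_
        · have := hdψ.measurable.comp measurable_flow_uncurry
          exact this.aestronglyMeasurable
        · exact Eventually.of_forall fun z => hM' (flow z.2 z.1)
      simp_rw [hftc, ← integral_const_mul]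
      rw [integral_integral_swap hint, ← integral_neg]
      exact setIntegral_congr_fun measurableSet_Ioc fun s hs => hweak s ⟨hs.1.le, hs.2⟩
    have e2 : ∫ p, ψ p * ∫ s in Ioc 0 r, G (flow (-s) p)
        = ∫ s in Ioc 0 r, ∫ p, G p * ψ (flow s p) := by
      have hint : Integrable (fun z : (E3 × E3) × ℝ => ψ z.1 * G (flow (-z.2) z.1))
          ((volume : Measure (E3 × E3)).prod (volume.restrict (Ioc 0 r))) := by
        refine Integrable.bdd_mul (c := M) hGp ?_ (Eventually.of_forall fun z => hM z.1)
        exact (hψ.continuous.comp continuous_fst).aestronglyMeasurable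
      simp_rw [← integral_const_mul]
      rw [integral_integral_swap hint]
      congr 1; ext s
      rw [← integral_flow s]
      congr 1; ext p
      rw [flow_flow, add_neg_cancel, flow_zero, mul_comm]
    have e3 : ∫ p, ψ p * f (flow (-r) p) = ∫ p, f p * ψ (flow r p) := by
      rw [← integral_flow r]
      congr 1; ext p
      rw [flow_flow, add_neg_cancel, flow_zero, mul_comm]
    have b1 : Integrable fun p => ψ p * f p :=
      hfi.bdd_mul (c := M) hψ.continuous.aestronglyMeasurable (Eventually.of_forall hM)
    have b2 : Integrable fun p => ψ p * f (flow (-r) p) :=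
      i1.bdd_mul (c := M) hψ.continuous.aestronglyMeasurable (Eventually.of_forall hM)
    have b3 : Integrable fun p => ψ p * ∫ s in Ioc 0 r, G (flow (-s) p) :=
      i2.bdd_mul (c := M) hψ.continuous.aestronglyMeasurable (Eventually.of_forall hM)
    have b4 : Integrable fun p => f p * ψ (flow r p) :=
      hfi.mul_bdd (c := M) (hψ.continuous.comp (continuous_flow r)).aestronglyMeasurable
        (Eventually.of_forall fun p => hM (flow r p))
    have b5 : Integrable fun p => f p * ψ p := by simpa only [mul_comm] using b1
    have b12 : Integrable fun p => ψ p * f p - ψ p * f (flow (-r) p) := b1.sub b2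
    simp only [hH, smul_eq_mul, mul_sub]
    rw [integral_sub b12 b3, integral_sub b1 b2, e2, e3]
    simp only [mul_sub] at e1
    rw [integral_sub b4 b5] at e1
    have e4 : ∫ p, ψ p * f p = ∫ p, f p * ψ p := by simp only [mul_comm]
    rw [e4]
    linarith
  filter_upwards [key] with p hp h1 h2 h3
  have := hp ⟨h1, h2, h3⟩
  simp only [hH] at this
  linarith


theorem ae_ae_flow {P : E3 × E3 → Prop} (hP : ∀ᵐ p, P p) : ∀ᵐ p, ∀ᵐ s : ℝ, P (flow (-s) p) := by
  obtain ⟨S, hS, hSm, hS0⟩ := exists_measurable_superset_of_null (ae_iff.1 hP)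
  have hmeas : MeasurableSet {z : ℝ × (E3 × E3) | flow (-z.1) z.2 ∉ S} := by
    have hm : Measurable fun z : ℝ × (E3 × E3) => flow (-z.1) z.2 := by unfold flow; fun_prop
    exact (hm hSm).compl
  have h1 : ∀ᵐ s : ℝ, ∀ᵐ p : E3 × E3, flow (-s) p ∉ S := Eventually.of_forall fun s =>
    (measurePreserving_flow (-s)).quasiMeasurePreserving.ae (measure_eq_zero_iff_ae_notMem.1 hS0)
  rw [Measure.ae_ae_comm hmeas] at h1
  filter_upwards [h1] with p hp
  filter_upwards [hp] with s hs
  by_contra hcon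
  exact hs (hS hcon)

theorem measurable_integral_flow {G : E3 × E3 → ℝ} (hG : Measurable G) :
    Measurable fun z : ℝ × (E3 × E3) => ∫ s in Ioc 0 z.1, G (flow (-s) z.2) := by
  have hs : MeasurableSet {y : (ℝ × (E3 × E3)) × ℝ | 0 < y.2 ∧ y.2 ≤ y.1.1} :=
    (measurableSet_lt measurable_const measurable_snd).inter
      (measurableSet_le measurable_snd (measurable_fst.comp measurable_fst))
  have hm : Measurable fun y : (ℝ × (E3 × E3)) × ℝ => G (flow (-y.2) y.1.2) := by
    unfold flow; fun_prop
  have h1 := ((hm.indicator hs).stronglyMeasurable.integral_prod_right' (ν := volume)).measurable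
  refine (congrArg Measurable ?_).mp h1
  ext p
  rw [← integral_indicator measurableSet_Ioc]
  rfl

section Transport

variable {Ω : Set E3} {f G : E3 × E3 → ℝ}

theorem ae_integrableOn_flow (hG : Measurable G)
    (hGi : ∀ R : ℝ, Integrable ({p : E3 × E3 | ‖p.2‖ < R}.indicator G)) :
    ∀ᵐ p : E3 × E3, ∀ r : ℝ, IntegrableOn (fun s => G (flow (-s) p)) (Ioc 0 r) := by
  have hms : ∀ R : ℝ, MeasurableSet {p : E3 × E3 | ‖p.2‖ < R} := fun R =>
    measurableSet_lt (by fun_prop) measurable_const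
  have h : ∀ n : ℕ, ∀ᵐ p : E3 × E3, IntegrableOn
      (fun s => {p : E3 × E3 | ‖p.2‖ < n}.indicator G (flow (-s) p)) (Ioc 0 n) := fun n =>
    (integrable_flow_prod (hG.indicator (hms n)) (hGi n) n).prod_right_ae
  filter_upwards [ae_all_iff.2 h] with p hp r
  obtain ⟨n, hn⟩ := exists_nat_gt (max r ‖p.2‖)
  refine ((hp n).mono_set (Ioc_subset_Ioc_right ((le_max_left _ _).trans hn.le))).congr_fun
    (fun s _ => ?_) measurableSet_Ioc
  exact indicator_of_mem (show flow (-s) p ∈ {p : E3 × E3 | ‖p.2‖ < n} from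
    (le_max_right r ‖p.2‖).trans_lt hn) G

/-- Integrability is available only for bounded velocities, so the preceding result is applied after
cutting off at each integer speed; the flow does not change the velocity. Fubini exchanges "for
every time, almost every point" with "for almost every point, almost every time". -/
theorem ae_transport (hΩ : IsOpen Ω) (hc : Convex ℝ Ω) (hf : Measurable f)
    (hfi : ∀ R : ℝ, Integrable ({p : E3 × E3 | ‖p.2‖ < R}.indicator f)) (hG : Measurable G)
    (hGi : ∀ R : ℝ, Integrable ({p : E3 × E3 | ‖p.2‖ < R}.indicator G))
    (hw : ∀ ψ : E3 × E3 → ℝ, ContDiff ℝ ∞ ψ → HasCompactSupport ψ → tsupport ψ ⊆ Ω ×ˢ univ →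
      ∫ p, f p * fderiv ℝ ψ p (p.2, 0) = - ∫ p, G p * ψ p) :
    ∀ᵐ p : E3 × E3, ∀ᵐ r : ℝ, 0 ≤ r → p.1 ∈ Ω → (flow (-r) p).1 ∈ Ω →
      f p - f (flow (-r) p) = ∫ s in Ioc 0 r, G (flow (-s) p) := by
  have hms : ∀ R : ℝ, MeasurableSet {p : E3 × E3 | ‖p.2‖ < R} := fun R =>
    measurableSet_lt (by fun_prop) measurable_const
  have h1 : ∀ r : ℝ, ∀ᵐ p : E3 × E3, 0 ≤ r → p.1 ∈ Ω → (flow (-r) p).1 ∈ Ω →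
      f p - f (flow (-r) p) = ∫ s in Ioc 0 r, G (flow (-s) p) := by
    intro r
    rcases lt_or_ge r 0 with hr | hr
    · exact Eventually.of_forall fun p h => absurd h (not_le.2 hr)
    have h2 : ∀ n : ℕ, ∀ᵐ p : E3 × E3, p.1 ∈ Ω → (flow (-r) p).1 ∈ Ω → ‖p.2‖ < n →
        f p - f (flow (-r) p) = ∫ s in Ioc 0 r, G (flow (-s) p) := by
      intro n
      have h3 := transport_of_weak hΩ hc (hfi n) (hG.indicator (hms n))
        (hGi n) (R := n) (fun ψ hψ hψc hψs => ?_) hr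
      · filter_upwards [h3] with p hp a b c
        have := hp a b c
        rw [indicator_of_mem (show p ∈ {p : E3 × E3 | ‖p.2‖ < n} from c),
          indicator_of_mem (show flow (-r) p ∈ {p : E3 × E3 | ‖p.2‖ < n} from c)] at this
        rw [this]
        refine setIntegral_congr_fun measurableSet_Ioc fun s _ => ?_
        exact indicator_of_mem (show flow (-s) p ∈ {p : E3 × E3 | ‖p.2‖ < n} from c) _
      · have h4 := hw ψ hψ hψc (hψs.trans (prod_mono_right (subset_univ _)))
        have hout : ∀ p : E3 × E3, p ∉ {p : E3 × E3 | ‖p.2‖ < n} → p ∉ tsupport ψ :=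
          fun p hp hps => hp (by simpa using (hψs hps).2)
        convert h4 using 1
        · congr 1; ext p
          by_cases hp : p ∈ {p : E3 × E3 | ‖p.2‖ < n}
          · rw [indicator_of_mem hp]
          · rw [indicator_of_notMem hp, fderiv_of_notMem_tsupport ℝ (hout p hp)]; simp
        · congr 2; ext p
          by_cases hp : p ∈ {p : E3 × E3 | ‖p.2‖ < n}
          · rw [indicator_of_mem hp]
          · rw [indicator_of_notMem hp, image_eq_zero_of_notMem_tsupport (hout p hp)]; simp
    filter_upwards [ae_all_iff.2 h2] with p hp _ a b
    obtain ⟨n, hn⟩ := exists_nat_gt ‖p.2‖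
    exact hp n a b hn
  have hfl : Measurable fun z : ℝ × (E3 × E3) => flow (-z.1) z.2 := by unfold flow; fun_prop
  refine (Measure.ae_ae_comm ?_).1 (Eventually.of_forall h1 : ∀ᵐ r : ℝ, _)
  have m1 : MeasurableSet {z : ℝ × (E3 × E3) | 0 ≤ z.1} :=
    measurableSet_le measurable_const measurable_fst
  have m2 : MeasurableSet {z : ℝ × (E3 × E3) | z.2.1 ∈ Ω} :=
    (measurable_fst.comp measurable_snd) hΩ.measurableSet
  have m3 : MeasurableSet {z : ℝ × (E3 × E3) | (flow (-z.1) z.2).1 ∈ Ω} :=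
    (measurable_fst.comp hfl) hΩ.measurableSet
  have m4 : MeasurableSet {z : ℝ × (E3 × E3) |
      f z.2 - f (flow (-z.1) z.2) = ∫ s in Ioc 0 z.1, G (flow (-s) z.2)} :=
    measurableSet_eq_fun ((hf.comp measurable_snd).sub (hf.comp hfl)) (measurable_integral_flow hG)
  refine (congrArg MeasurableSet ?_).mp (m1.compl.union (m2.compl.union (m3.compl.union m4)))
  ext z
  change (¬ _ ∨ ¬ _ ∨ ¬ _ ∨ _) ↔ (_ → _ → _ → _)
  tauto

end Transport

/-! ### Boundary points hit by backward characteristics -/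

/-- The points whose line in direction `v` meets `Z` are the preimage of the projection of `Z` along
`v` to a plane. The projection is Lipschitz, so the image is null for planar measure, and the
preimage of a null set under a surjective linear map is null. The condition `v 0 ≠ 0` allows an
explicit projection. -/
theorem volume_project_eq_zero {v : E3} (hv : v 0 ≠ 0) {Z : Set E3}
    (hZ : (Measure.hausdorffMeasure 2 : Measure E3) Z = 0) :
    volume {x : E3 | ∃ t : ℝ, x + t • v ∈ Z} = 0 := by
  set π : E3 →ₗ[ℝ] (Fin 2 → ℝ) :=
    { toFun := fun x => ![x 1 - x 0 * (v 1 / v 0), x 2 - x 0 * (v 2 / v 0)]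
      map_add' := fun x y => by
        ext i; fin_cases i <;> simp <;> ring
      map_smul' := fun c x => by
        ext i; fin_cases i <;> simp <;> ring } with hπ
  have hπv : π v = 0 := by
    ext i; fin_cases i <;> simp [hπ] <;> field_simp <;> ring
  have hsurj : Function.Surjective π := by
    intro y
    refine ⟨!₂[0, y 0, y 1], ?_⟩
    ext i; fin_cases i <;> simp [hπ]
  have hlip := (LinearMap.toContinuousLinearMap π).lipschitz
  have himg : volume (π '' Z) = 0 := by
    have h1 := hlip.hausdorffMeasure_image_le (d := 2) zero_le_two Z
    rw [hZ, mul_zero] at h1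
    have h2 := hausdorffMeasure_pi_real (ι := Fin 2)
    simp only [Fintype.card_fin, Nat.cast_ofNat] at h2
    rw [h2] at h1
    exact le_antisymm h1 zero_le
  obtain ⟨c, _, hmap⟩ := π.exists_map_addHaar_eq_smul_addHaar volume volume hsurj
  have hsub : {x : E3 | ∃ t : ℝ, x + t • v ∈ Z} ⊆ π ⁻¹' (toMeasurable volume (π '' Z)) := by
    rintro x ⟨t, ht⟩
    refine subset_toMeasurable _ _ ⟨_, ht, ?_⟩
    rw [map_add, map_smul, hπv, smul_zero, add_zero]
  refine measure_mono_null hsub ?_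
  have hπm : Measurable π := (LinearMap.toContinuousLinearMap π).continuous.measurable
  rw [← Measure.map_apply hπm (measurableSet_toMeasurable _ _), hmap, Measure.smul_apply,
    measure_toMeasurable, himg, smul_zero]

/-- The length of time for which the backward characteristic from `x` stays in `Ω`, for a domain of
diameter at most `D`. -/
def backTime (Ω : Set E3) (D : ℝ) (x v : E3) : ℝ :=
  (∫⁻ s in Ioc 0 (D / ‖v‖), Ω.indicator 1 (x - s • v)).toReal

/-- Convexity makes the set of times spent in `Ω` an interval starting at `0`, and openness makes it
half-open, so the integral of the indicator is its length. The integral form of the exit time is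
what later bounds its variation by `jump`. -/
theorem backTime_spec {Ω : Set E3} (hΩ : IsOpen Ω) (hc : Convex ℝ Ω) {D : ℝ}
    (hD : ∀ x ∈ Ω, ∀ y ∈ Ω, ‖x - y‖ ≤ D) {x v : E3} (hx : x ∈ Ω) (hv : v ≠ 0) :
    0 < backTime Ω D x v ∧ backTime Ω D x v ≤ D / ‖v‖ ∧
      (∀ s, 0 ≤ s → (x - s • v ∈ Ω ↔ s < backTime Ω D x v)) := by
  have hv0 : 0 < ‖v‖ := norm_pos_iff.2 hv
  set A : Set ℝ := {s | 0 ≤ s ∧ x - s • v ∈ Ω} with hA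
  have hA0 : (0 : ℝ) ∈ A := ⟨le_rfl, by simpa using hx⟩
  have hAb : ∀ s ∈ A, s ≤ D / ‖v‖ := by
    intro s hs
    have := hD x hx _ hs.2
    rw [sub_sub_cancel, norm_smul, Real.norm_of_nonneg hs.1] at this
    rwa [le_div_iff₀ hv0]
  have hbdd : BddAbove A := ⟨_, hAb⟩
  set σ := sSup A with hσ
  have hopen : ∀ s ∈ A, ∃ s' ∈ A, s < s' := by
    intro s hs
    have hcont : Continuous fun t : ℝ => x - t • v := by fun_prop
    obtain ⟨δ, hδ, hball⟩ := Metric.isOpen_iff.1 (hΩ.preimage hcont) s hs.2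
    refine ⟨s + δ / 2, ⟨by linarith [hs.1], hball ?_⟩, by linarith⟩
    rw [Metric.mem_ball, Real.dist_eq, add_sub_cancel_left, abs_of_pos (by linarith)]
    linarith
  have hlt : ∀ s ∈ A, s < σ := fun s hs => by
    obtain ⟨s', hs', h⟩ := hopen s hs
    exact h.trans_le (le_csSup hbdd hs')
  have hmem : ∀ s, 0 ≤ s → s < σ → s ∈ A := by
    intro s hs0 hs
    obtain ⟨s', hs', h⟩ := exists_lt_of_lt_csSup ⟨0, hA0⟩ hs
    have hs'0 : 0 < s' := hs0.trans_lt h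
    refine ⟨hs0, ?_⟩
    have := hc.add_smul_mem hx (y := -(s' • v)) (by rw [← sub_eq_add_neg]; exact hs'.2)
      (t := s / s') ⟨by positivity, (div_le_one hs'0).2 h.le⟩
    rwa [smul_neg, smul_smul, div_mul_cancel₀ _ hs'0.ne', ← sub_eq_add_neg] at this
  have hσ0 : 0 < σ := hlt 0 hA0
  have hσT : σ ≤ D / ‖v‖ := csSup_le ⟨0, hA0⟩ hAb
  have hτ : backTime Ω D x v = σ := by
    unfold backTime
    have hms : MeasurableSet {s : ℝ | x - s • v ∈ Ω} :=
      (by fun_prop : Measurable fun s : ℝ => x - s • v) hΩ.measurableSet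
    have e1 : ∀ s : ℝ, Ω.indicator (1 : E3 → ENNReal) (x - s • v)
        = {s : ℝ | x - s • v ∈ Ω}.indicator 1 s := fun s => rfl
    simp_rw [e1]
    rw [lintegral_indicator_one hms, Measure.restrict_apply hms]
    have e2 : {s : ℝ | x - s • v ∈ Ω} ∩ Ioc 0 (D / ‖v‖) = Ioo 0 σ := by
      ext s
      constructor
      · rintro ⟨h1, h2⟩
        exact ⟨h2.1, hlt s ⟨h2.1.le, h1⟩⟩
      · rintro ⟨h1, h2⟩
        exact ⟨(hmem s h1.le h2).2, h1, h2.le.trans hσT⟩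
    rw [e2, Real.volume_Ioo, sub_zero, ENNReal.toReal_ofReal hσ0.le]
  rw [hτ]
  exact ⟨hσ0, hσT, fun s hs => ⟨fun h => hlt s ⟨hs, h⟩, fun h => (hmem s hs h).2⟩⟩

/-- By convexity the gradient of the defining function at `q` gives a supporting half-space of `Ω`.
Being interior, `x` can be pushed slightly in the gradient direction, so its inequality is strict;
and `x - q` is a positive multiple of `v`. -/
theorem incoming_of_backward {Ω : Set E3} (hΩ : IsOpen Ω) (hc : Convex ℝ Ω)
    (hC2 : HasC2Boundary Ω) {x v q : E3} (hx : x ∈ Ω) {τ : ℝ} (hτ : 0 < τ)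
    (hq : q = x - τ • v) (hqf : q ∈ frontier Ω) : (q, v) ∈ incoming Ω := by
  obtain ⟨U, ρ, hρ⟩ := hC2 q hqf
  refine ⟨hqf, _, ⟨U, ρ, hρ, rfl⟩, ?_⟩
  have hdiff : HasFDerivAt ρ (fderiv ℝ ρ q) q :=
    ((hρ.contDiffOn.differentiableOn (by norm_num)).differentiableAt
      (hρ.isOpen.mem_nhds hρ.mem)).hasFDerivAt
  have hin : ∀ w, ⟪gradient ρ q, w⟫ = fderiv ℝ ρ q w := fun w => by
    unfold gradient; rw [InnerProductSpace.toDual_symm_apply]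
  have hqn : q ∉ Ω := by
    rw [hΩ.frontier_eq] at hqf; exact hqf.2
  have hρq : 0 ≤ ρ q := by
    by_contra hneg
    have : q ∈ Ω ∩ U := by rw [hρ.inter_eq]; exact ⟨hρ.mem, not_le.1 hneg⟩
    exact hqn this.1
  have hle : ∀ z ∈ Ω, ⟪gradient ρ q, z - q⟫ ≤ 0 := by
    intro z hz
    rw [hin]
    have hline : HasDerivAt (fun t : ℝ => ρ (q + t • (z - q))) (fderiv ℝ ρ q (z - q)) 0 := by
      have h1 : HasDerivAt (fun t : ℝ => q + t • (z - q)) (z - q) 0 := by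
        simpa using ((hasDerivAt_id (0 : ℝ)).smul_const (z - q)).const_add q
      have h2 : HasFDerivAt ρ (fderiv ℝ ρ q) (q + (0 : ℝ) • (z - q)) := by simpa using hdiff
      exact h2.comp_hasDerivAt (0 : ℝ) h1
    have hU : ∀ᶠ t : ℝ in 𝓝[>] 0, q + t • (z - q) ∈ U := by
      have hcont : Continuous fun t : ℝ => q + t • (z - q) := by fun_prop
      have : ∀ᶠ t : ℝ in 𝓝 0, q + t • (z - q) ∈ U :=
        hcont.continuousAt.eventually_mem (by simpa using hρ.isOpen.mem_nhds hρ.mem)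
      exact this.filter_mono nhdsWithin_le_nhds
    have h1 : ∀ᶠ t : ℝ in 𝓝[>] 0, t ≤ 1 :=
      (eventually_le_nhds one_pos).filter_mono nhdsWithin_le_nhds
    have hslope := hline.tendsto_slope_zero_right
    refine le_of_tendsto hslope ?_
    filter_upwards [hU, h1, self_mem_nhdsWithin] with t htU ht1 ht0
    have ht0' : 0 < t := ht0
    have hmem : q + t • (z - q) ∈ Ω := by
      have hcl : q ∈ closure Ω := frontier_subset_closure hqf
      have := hc.combo_closure_interior_mem_interior hcl
        (show z ∈ interior Ω by rwa [hΩ.interior_eq]) (a := 1 - t) (b := t) (by linarith) ht0'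
        (by ring)
      rw [hΩ.interior_eq] at this
      convert this using 1
      rw [smul_sub, sub_smul, one_smul]; abel
    have hneg : ρ (q + t • (z - q)) < 0 := by
      have : q + t • (z - q) ∈ Ω ∩ U := ⟨hmem, htU⟩
      rw [hρ.inter_eq] at this
      exact this.2
    simp only [zero_add, zero_smul, add_zero, smul_eq_mul]
    exact mul_nonpos_of_nonneg_of_nonpos (by positivity) (by linarith)
  have hg := hρ.gradient_ne_zero q hρ.mem
  have hg0 : 0 < ‖gradient ρ q‖ := norm_pos_iff.2 hg
  have hlt : ⟪gradient ρ q, x - q⟫ < 0 := by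
    obtain ⟨δ, hδ, hball⟩ := Metric.isOpen_iff.1 hΩ x hx
    have h1 : x + (δ / 2 / ‖gradient ρ q‖) • gradient ρ q ∈ Ω := hball (by
      rw [Metric.mem_ball, dist_eq_norm, add_sub_cancel_left, norm_smul,
        Real.norm_of_nonneg (by positivity), div_mul_cancel₀ _ hg0.ne']
      linarith)
    have h2 := hle _ h1
    rw [add_sub_right_comm, inner_add_right, inner_smul_right, real_inner_self_eq_norm_sq] at h2
    have : 0 < δ / 2 / ‖gradient ρ q‖ * ‖gradient ρ q‖ ^ 2 := by positivity
    linarith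
  have hxq : x - q = τ • v := by rw [hq]; abel
  rw [hxq, inner_smul_right] at hlt
  unfold levelNormal
  rw [inner_smul_left]
  have : ⟪gradient ρ q, v⟫ < 0 := by
    by_contra hcon
    have := mul_nonneg hτ.le (not_lt.1 hcon)
    linarith
  exact mul_neg_of_pos_of_neg (by simpa using hg) this


/-! ### Boundary values and Duhamel's formula -/

/-- Two functions agreeing almost everywhere near the end point agree at points arbitrarily close to
it, since every interval there has positive length. Their limits therefore coincide. -/
theorem eq_of_tendsto_of_ae_eq {τ a b c : ℝ} (hτ : 0 < τ) {h B : ℝ → ℝ}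
    (hh : Tendsto h (𝓝[>] 0) (𝓝 a)) (hB : Tendsto B (𝓝[<] τ) (𝓝 b))
    (hae : ∀ᵐ s : ℝ, s ∈ Ioo 0 τ → h (τ - s) = c - B s) : a = c - b := by
  have h1 : Tendsto (fun s => h (τ - s)) (𝓝[<] τ) (𝓝 a) := by
    refine hh.comp (tendsto_nhdsWithin_iff.2 ⟨?_, ?_⟩)
    · have : Tendsto (fun s : ℝ => τ - s) (𝓝 τ) (𝓝 (τ - τ)) :=
        (continuous_const.sub continuous_id).tendsto τ
      rw [sub_self] at this
      exact this.mono_left nhdsWithin_le_nhds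
    · filter_upwards [self_mem_nhdsWithin] with s hs
      have hs' : s < τ := hs
      exact sub_pos.2 hs'
  have h2 : Tendsto (fun s => c - B s) (𝓝[<] τ) (𝓝 (c - b)) := tendsto_const_nhds.sub hB
  refine tendsto_nhds_unique_of_frequently_eq h1 h2 ?_
  intro hev
  obtain ⟨l, hl, hl2⟩ := (mem_nhdsLT_iff_exists_Ioo_subset (a := τ)).1 hev
  have hl' : l < τ := hl
  have hsub : Ioo (max l 0) τ ⊆ {s | ¬(s ∈ Ioo 0 τ → h (τ - s) = c - B s)} := by
    intro s hs hcon
    exact hl2 ⟨(le_max_left _ _).trans_lt hs.1, hs.2⟩ (hcon ⟨(le_max_right _ _).trans_lt hs.1, hs.2⟩)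
  have h0 := measure_mono_null hsub (ae_iff.1 hae)
  rw [Real.volume_Ioo, ENNReal.ofReal_eq_zero] at h0
  have : max l 0 < τ := max_lt hl' hτ
  linarith

/-- This is the integrating factor in integrated form: `φ` is known only through its increments and
only almost everywhere, so differentiation of `exp(-ν s) φ` is replaced by integration by parts of
the damped primitive. -/
theorem duhamel {τ ν a c : ℝ} (hτ : 0 ≤ τ) {β φ : ℝ → ℝ} (hβ : IntegrableOn β (Ioc 0 τ))
    (hφ : ∀ᵐ s : ℝ, s ∈ Ioc 0 τ → c - φ s = ∫ t in Ioc 0 s, β t)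
    (ha : a = c - ∫ t in Ioc 0 τ, β t) :
    c = Real.exp (-ν * τ) * a + ∫ s in Ioc 0 τ, Real.exp (-ν * s) * (β s + ν * φ s) := by
  have hβi : IntervalIntegrable β volume 0 τ := (intervalIntegrable_iff_integrableOn_Ioc_of_le hτ).2 hβ
  have key := integral_exp_neg_mul_eq ν τ hβi
  have hBc : ContinuousOn (fun s => ∫ t in (0 : ℝ)..s, β t) (Icc 0 τ) := by
    have := intervalIntegral.continuousOn_primitive_interval' hβi left_mem_uIcc
    rwa [uIcc_of_le hτ] at this
  have i1 : IntegrableOn (fun s => Real.exp (-ν * s) * β s) (Ioc 0 τ) := by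
    have hc : ContinuousOn (fun s : ℝ => Real.exp (-ν * s)) (Icc 0 τ) := by fun_prop
    have hβ' : IntegrableOn β (Icc 0 τ) := (integrableOn_Icc_iff_integrableOn_Ioc (by simp)).2 hβ
    exact (hβ'.continuousOn_mul hc isCompact_Icc).mono_set Ioc_subset_Icc_self
  have i2 : IntegrableOn (fun s => ν * Real.exp (-ν * s) * (∫ t in (0 : ℝ)..s, β t)) (Ioc 0 τ) := by
    have hc : ContinuousOn (fun s : ℝ => ν * Real.exp (-ν * s) * (∫ t in (0 : ℝ)..s, β t))
        (Icc 0 τ) := ContinuousOn.mul (by fun_prop) hBc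
    exact (hc.integrableOn_compact isCompact_Icc).mono_set Ioc_subset_Icc_self
  have i3 : IntegrableOn (fun s => c * (ν * Real.exp (-ν * s))) (Ioc 0 τ) := by
    have hc : Continuous fun s : ℝ => c * (ν * Real.exp (-ν * s)) := by fun_prop
    exact (hc.integrableOn_Icc).mono_set Ioc_subset_Icc_self
  have e1 : ∫ s in Ioc 0 τ, Real.exp (-ν * s) * (β s + ν * φ s)
      = (∫ s in Ioc 0 τ, Real.exp (-ν * s) * β s) + (∫ s in Ioc 0 τ, c * (ν * Real.exp (-ν * s)))
        - ∫ s in Ioc 0 τ, ν * Real.exp (-ν * s) * (∫ t in (0 : ℝ)..s, β t) := by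
    have i13 : IntegrableOn (fun s => Real.exp (-ν * s) * β s + c * (ν * Real.exp (-ν * s)))
      (Ioc 0 τ) := i1.add i3
    rw [← integral_add i1 i3, ← integral_sub i13 i2]
    refine setIntegral_congr_ae measurableSet_Ioc ?_
    filter_upwards [hφ] with s hs hsm
    have h1 := hs hsm
    rw [← intervalIntegral.integral_of_le hsm.1.le] at h1
    linear_combination (-(Real.exp (-ν * s) * ν)) * h1
  have e2 : ∫ s in Ioc 0 τ, c * (ν * Real.exp (-ν * s)) = c * (1 - Real.exp (-ν * τ)) := by
    rw [integral_const_mul, ← intervalIntegral.integral_of_le hτ]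
    congr 1
    have hd : ∀ s ∈ uIcc 0 τ, HasDerivAt (fun s => -Real.exp (-ν * s)) (ν * Real.exp (-ν * s)) s := by
      intro s _
      have h1 : HasDerivAt (fun s : ℝ => -ν * s) (-ν) s := by
        simpa using (hasDerivAt_id s).const_mul (-ν)
      exact (h1.exp.fun_neg).congr_deriv (by ring)
    rw [intervalIntegral.integral_eq_sub_of_hasDerivAt hd (by
      apply Continuous.intervalIntegrable; fun_prop)]
    rw [mul_zero, Real.exp_zero]; ring
  simp only [intervalIntegral.integral_of_le hτ] at key
  rw [e1, e2, ha]
  linear_combination (-1 : ℝ) * key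

/-- The source of the transport equation, extended by zero outside `Ω`. -/
def source (Ω : Set E3) (k f : E3 × E3 → ℝ) (p : E3 × E3) : ℝ :=
  Ω.indicator (fun x => ∫ w, k (p.2, w) * f (x, w)) p.1

theorem measurable_source {Ω : Set E3} (hΩ : MeasurableSet Ω) {k f : E3 × E3 → ℝ}
    (hk : Measurable k) (hf : Measurable f) : Measurable (source Ω k f) := by
  have h1 : Measurable fun y : (E3 × E3) × E3 => k (y.1.2, y.2) * f (y.1.1, y.2) := by fun_prop
  have h2 : Measurable fun p : E3 × E3 => ∫ w, k (p.2, w) * f (p.1, w) :=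
    (h1.stronglyMeasurable.integral_prod_right' (ν := volume)).measurable
  refine (congrArg Measurable ?_).mp (h2.indicator (measurable_fst hΩ))
  ext p
  rfl

/-- The contribution of the source to the solution along backward characteristics. -/
def duhamelTerm (D : ℝ) (ν : E3 → ℝ) (H : E3 × E3 → ℝ) (p : E3 × E3) : ℝ :=
  ∫ s in Ioc 0 (D / ‖p.2‖), Real.exp (-ν p.2 * s) * H (p.1 - s • p.2, p.2)

theorem ae_ae_swap {P : E3 × E3 → Prop} (hP : ∀ᵐ p, P p) : ∀ᵐ v : E3, ∀ᵐ x : E3, P (x, v) := by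
  have h1 : ∀ᵐ p : E3 × E3, P (p.2, p.1) := by
    have := (Measure.measurePreserving_swap (μ := (volume : Measure E3))
      (ν := (volume : Measure E3))).quasiMeasurePreserving.ae hP
    exact this
  exact Measure.ae_ae_of_ae_prod h1

/-- The representation of a solution along backward characteristics. -/
theorem ae_mild_formula {Ω : Set E3} (hΩ : IsOpen Ω) (hc : Convex ℝ Ω) (hC2 : HasC2Boundary Ω)
    {D : ℝ} (hD : ∀ x ∈ Ω, ∀ y ∈ Ω, ‖x - y‖ ≤ D) {f f₀ G g H : E3 × E3 → ℝ} {ν : E3 → ℝ}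
    (hf₀ : Measurable f₀) (hff₀ : ∀ᵐ p : E3 × E3, p.1 ∈ Ω → f p = f₀ p)
    (hfi : ∀ R : ℝ, Integrable ({p : E3 × E3 | ‖p.2‖ < R}.indicator f₀)) (hG : Measurable G)
    (hGi : ∀ R : ℝ, Integrable ({p : E3 × E3 | ‖p.2‖ < R}.indicator G))
    (hw : ∀ ψ : E3 × E3 → ℝ, ContDiff ℝ ∞ ψ → HasCompactSupport ψ → tsupport ψ ⊆ Ω ×ˢ univ →
      ∫ p, f₀ p * fderiv ℝ ψ p (p.2, 0) = - ∫ p, G p * ψ p)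
    (hH : ∀ p : E3 × E3, p.1 ∈ Ω → H p = G p + ν p.2 * f₀ p)
    (hH0 : ∀ p : E3 × E3, p.1 ∉ Ω → H p = 0) (htr : HasIncomingTrace Ω f g) :
    ∀ᵐ v : E3, ∀ᵐ x : E3, x ∈ Ω →
      (x - backTime Ω D x v • v, v) ∈ incoming Ω ∧
      f₀ (x, v) = Real.exp (-ν v * backTime Ω D x v) * g (x - backTime Ω D x v • v, v)
        + duhamelTerm D ν H (x, v) := by
  have a1 := ae_ae_swap (ae_transport hΩ hc hf₀ hfi hG hGi hw)
  have a2 := ae_ae_swap (ae_integrableOn_flow hG hGi)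
  have a3 := ae_ae_swap (ae_ae_flow hff₀)
  have a4 : ∀ᵐ v : E3, v 0 ≠ 0 := by
    have hmp := PiLp.volume_preserving_ofLp (Fin 3)
    have h1 : ∀ᵐ y : Fin 3 → ℝ, y 0 ≠ 0 := by
      have h2 : ∀ᵐ t : ℝ, t ≠ 0 := by simp [ae_iff]
      exact (Measure.quasiMeasurePreserving_eval (fun _ : Fin 3 => (volume : Measure ℝ)) 0).ae h2
    exact hmp.quasiMeasurePreserving.ae h1
  filter_upwards [a1, a2, a3, a4, htr] with v b1 b2 b3 b4 b5
  have hv : v ≠ 0 := by rintro rfl; simp at b4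
  have hv0 : 0 < ‖v‖ := norm_pos_iff.2 hv
  -- The boundary points where the trace condition fails. They are null for surface measure, so the
  -- lines in direction `v` through almost every `x` avoid them.
  set Z : Set E3 := {q | q ∈ frontier Ω ∧ ¬((q, v) ∈ incoming Ω →
      ∃ h : ℝ → ℝ, ContinuousOn h (Ioo 0 (exitTime Ω q v)) ∧
        (∀ᵐ s ∂volume.restrict (Ioo 0 (exitTime Ω q v)), h s = f (q + s • v, v)) ∧
        Tendsto h (𝓝[>] 0) (𝓝 (g (q, v))))} with hZ
  have hZ0 : (Measure.hausdorffMeasure 2 : Measure E3) Z = 0 := by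
    have := ae_iff.1 ((ae_restrict_iff' isClosed_frontier.measurableSet).1 b5)
    refine measure_mono_null ?_ this
    intro q hq hcon
    exact hq.2 (hcon hq.1)
  have b6 : ∀ᵐ x : E3, ¬∃ t : ℝ, x + t • v ∈ Z := by
    have := volume_project_eq_zero b4 hZ0
    exact measure_eq_zero_iff_ae_notMem.1 this
  filter_upwards [b1, b2, b3, b6] with x c1 c2 c3 c6 hx
  obtain ⟨hτ0, hτT, hτ⟩ := backTime_spec hΩ hc hD hx hv
  set τ := backTime Ω D x v with hτdef
  set q := x - τ • v with hq
  have hqn : q ∉ Ω := fun h => lt_irrefl τ ((hτ τ hτ0.le).1 h)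
  have hqf : q ∈ frontier Ω := by
    rw [hΩ.frontier_eq]
    refine ⟨?_, hqn⟩
    have hcont : Tendsto (fun s : ℝ => x - s • v) (𝓝[<] τ) (𝓝 q) := by
      have : Continuous fun s : ℝ => x - s • v := by fun_prop
      exact (this.tendsto τ).mono_left nhdsWithin_le_nhds
    refine mem_closure_of_tendsto hcont ?_
    have h1 : ∀ᶠ s in 𝓝[<] τ, s ∈ Ioo 0 τ := Ioo_mem_nhdsLT hτ0
    filter_upwards [h1] with s hs
    exact (hτ s hs.1.le).2 hs.2
  have hinc := incoming_of_backward hΩ hc hC2 hx hτ0 hq hqf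
  refine ⟨hinc, ?_⟩
  have hqZ : q ∉ Z := fun h => c6 ⟨-τ, by rwa [neg_smul, ← sub_eq_add_neg]⟩
  have htrq : ∃ h : ℝ → ℝ, ContinuousOn h (Ioo 0 (exitTime Ω q v)) ∧
        (∀ᵐ s ∂volume.restrict (Ioo 0 (exitTime Ω q v)), h s = f (q + s • v, v)) ∧
        Tendsto h (𝓝[>] 0) (𝓝 (g (q, v))) := by
    by_contra hcon
    exact hqZ ⟨hqf, fun h => hcon (h hinc)⟩
  obtain ⟨h, -, hh, hlim⟩ := htrq
  have hexit : τ ≤ exitTime Ω q v := by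
    have hD0 : 0 ≤ D := (norm_nonneg _).trans (hD x hx x hx)
    refine le_csInf ?_ ?_
    -- The infimum of the empty set of reals is `0`, so an exit must be exhibited: at this time the
    -- point would be farther than `D` from `x`.
    · refine ⟨τ + D / ‖v‖ + 1, by positivity, fun hmem => ?_⟩
      have h1 := hD _ hmem x hx
      have h2 : q + (τ + D / ‖v‖ + 1) • v - x = (D / ‖v‖ + 1) • v := by
        rw [hq]; module
      rw [h2, norm_smul, Real.norm_of_nonneg (by positivity), add_mul, div_mul_cancel₀ _ hv0.ne']
        at h1
      linarith
    · rintro t ⟨ht0, htn⟩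
      by_contra hcon
      rw [not_le] at hcon
      refine htn ?_
      have h1 : q + t • v = x - (τ - t) • v := by rw [hq]; module
      rw [h1]
      exact (hτ (τ - t) (by linarith)).2 (by linarith)
  have hfl : ∀ s : ℝ, flow (-s) (x, v) = (x - s • v, v) := fun s => by
    unfold flow; simp [sub_eq_add_neg]
  simp only [hfl] at c1 c2 c3
  set β : ℝ → ℝ := fun s => G (x - s • v, v) with hβ
  set φ : ℝ → ℝ := fun s => f₀ (x - s • v, v) with hφ
  have hβi : IntegrableOn β (Ioc 0 τ) := c2 τ
  have hφae : ∀ᵐ s : ℝ, s ∈ Ioo 0 τ → f₀ (x, v) - φ s = ∫ t in Ioc 0 s, β t := by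
    filter_upwards [c1] with s hs hsm
    exact hs hsm.1.le hx ((hτ s hsm.1.le).2 hsm.2)
  have hφae' : ∀ᵐ s : ℝ, s ∈ Ioc 0 τ → f₀ (x, v) - φ s = ∫ t in Ioc 0 s, β t := by
    have : ∀ᵐ s : ℝ, s ≠ τ := by simp [ae_iff]
    filter_upwards [hφae, this] with s hs h1 hsm
    exact hs ⟨hsm.1, lt_of_le_of_ne hsm.2 h1⟩
  have hlimB : Tendsto (fun s => ∫ t in Ioc 0 s, β t) (𝓝[<] τ) (𝓝 (∫ t in Ioc 0 τ, β t)) := by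
    have hβi' : IntervalIntegrable β volume 0 τ :=
      (intervalIntegrable_iff_integrableOn_Ioc_of_le hτ0.le).2 hβi
    have hBc := intervalIntegral.continuousOn_primitive_interval' hβi' left_mem_uIcc
    rw [uIcc_of_le hτ0.le] at hBc
    have h1 := (hBc τ ⟨hτ0.le, le_rfl⟩).tendsto
    have h2 : Tendsto (fun s => ∫ t in (0 : ℝ)..s, β t) (𝓝[<] τ)
        (𝓝 (∫ t in (0 : ℝ)..τ, β t)) := by
      refine h1.mono_left ?_
      rw [← nhdsWithin_Ioo_eq_nhdsLT hτ0]
      exact nhdsWithin_mono _ Ioo_subset_Icc_self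
    rw [intervalIntegral.integral_of_le hτ0.le] at h2
    refine h2.congr' ?_
    have h3 : ∀ᶠ s in 𝓝[<] τ, s ∈ Ioo 0 τ := Ioo_mem_nhdsLT hτ0
    filter_upwards [h3] with s hs
    rw [intervalIntegral.integral_of_le hs.1.le]
  have ha : g (q, v) = f₀ (x, v) - ∫ t in Ioc 0 τ, β t := by
    refine eq_of_tendsto_of_ae_eq hτ0 hlim hlimB ?_
    have h1 := (ae_restrict_iff' measurableSet_Ioo).1 hh
    have h2 := (Measure.measurePreserving_sub_left (volume : Measure ℝ) τ).quasiMeasurePreserving.ae h1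
    filter_upwards [h2, c3, hφae] with s d1 d2 d3 hs
    have hsΩ : x - s • v ∈ Ω := (hτ s hs.1.le).2 hs.2
    have e1 := d1 ⟨by linarith [hs.2], by linarith [hs.1]⟩
    have e2 : q + (τ - s) • v = x - s • v := by rw [hq]; module
    rw [e2, d2 hsΩ] at e1
    rw [e1]
    have := d3 hs
    simp only [hφ] at this
    linarith
  have hmain := duhamel (ν := ν v) hτ0.le hβi hφae' ha
  rw [hmain]
  congr 1
  unfold duhamelTerm
  simp only
  -- Beyond `τ` the characteristic has left `Ω` for good and the source vanishes, so the upper limit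
  -- may be taken independent of `x`. This is what makes the Duhamel term commute with translations.
  have hsplit : ∫ s in Ioc 0 (D / ‖v‖), Real.exp (-ν v * s) * H (x - s • v, v)
      = ∫ s in Ioc 0 τ, Real.exp (-ν v * s) * H (x - s • v, v) := by
    refine setIntegral_eq_of_subset_of_forall_sdiff_eq_zero measurableSet_Ioc
      (Ioc_subset_Ioc_right hτT) fun s hs => ?_
    have hs2 : τ < s := by
      by_contra hcon
      exact hs.2 ⟨hs.1.1, not_lt.1 hcon⟩
    have : x - s • v ∉ Ω := fun h => absurd ((hτ s hs.1.1.le).1 h) (not_lt.2 hs2.le)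
    rw [hH0 _ this, mul_zero]
  rw [hsplit]
  refine setIntegral_congr_ae measurableSet_Ioc ?_
  have hne : ∀ᵐ s : ℝ, s ≠ τ := by simp [ae_iff]
  filter_upwards [hne] with s hs hsm
  rw [hH _ ((hτ s hsm.1.le).2 (lt_of_le_of_ne hsm.2 hs))]


/-! ### Pointwise estimates for the integral operator -/

theorem ennreal_add_sq_le (x y : ENNReal) : (x + y) ^ 2 ≤ 2 * (x ^ 2 + y ^ 2) := by
  calc (x + y) ^ 2 = x ^ 2 + y ^ 2 + (x * y + x * y) := by ring
    _ ≤ x ^ 2 + y ^ 2 + (x ^ 2 + y ^ 2) := by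
        have h2 : x * y + x * y = 2 * (x * y) := by ring
        have : 2 * (x * y) ≤ x ^ 2 + y ^ 2 := by
          rcases eq_or_ne x ⊤ with rfl | hx
          · simp
          rcases eq_or_ne y ⊤ with rfl | hy
          · simp
          lift x to NNReal using hx
          lift y to NNReal using hy
          have := two_mul_le_add_sq x y
          rw [mul_assoc] at this
          exact_mod_cast this
        rw [h2]
        exact add_le_add le_rfl this
    _ = 2 * (x ^ 2 + y ^ 2) := by ring

/-- The Gaussian is divided into two equal factors. One is paired with `|v-w|⁻¹`, which is locally
square integrable in three dimensions; the other stays with `φ` to preserve localisation in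
velocity. -/
theorem exists_lintegral_gradBound_mul_sq_le :
    ∃ C : ℝ, 0 < C ∧ ∀ (φ : E3 → ENNReal) (v : E3), Measurable φ →
      (∫⁻ w, ENNReal.ofReal (gradBound v w) * φ w) ^ 2
        ≤ ENNReal.ofReal C *
          ∫⁻ w, ENNReal.ofReal (Real.exp (-(1 / 8) * ‖v - w‖ ^ 2)) * φ w ^ 2 := by
  obtain ⟨C, hC, hCb⟩ := exists_lintegral_gaussian_weight_le (1 / 8) 0 (by norm_num)
  refine ⟨C, hC, fun φ v hφ => ?_⟩
  have e1 : ∀ w, ENNReal.ofReal (gradBound v w) * φ w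
      = ENNReal.ofReal (‖v - w‖⁻¹ * Real.exp (-(1 / 16) * ‖v - w‖ ^ 2))
        * (ENNReal.ofReal (Real.exp (-(1 / 16) * ‖v - w‖ ^ 2)) * φ w) := by
    intro w
    rw [← mul_assoc, ← ENNReal.ofReal_mul (by positivity), mul_assoc, ← Real.exp_add]
    unfold gradBound
    ring_nf
  simp only [e1]
  refine (lintegral_mul_sq_le volume (by fun_prop) (by fun_prop)).trans (mul_le_mul' ?_ ?_)
  · have h := hCb v
    rw [Real.rpow_zero, mul_one] at h
    refine le_trans (lintegral_mono fun w => ?_) h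
    rw [← ENNReal.ofReal_pow (by positivity)]
    refine ENNReal.ofReal_le_ofReal ?_
    rw [mul_pow, ← Real.exp_nat_mul, Real.rpow_zero, mul_one, inv_pow, mul_comm]
    refine mul_le_mul (le_of_eq (by push_cast; ring_nf)) ?_ (by positivity) (by positivity)
    have : 0 ≤ (‖w‖ ^ 2)⁻¹ := by positivity
    linarith
  · refine lintegral_mono fun w => ?_
    rw [mul_pow, ← ENNReal.ofReal_pow (by positivity), ← Real.exp_nat_mul]
    refine mul_le_mul' (le_of_eq (by push_cast; ring_nf)) le_rfl

theorem exists_enorm_kernel_integral_sq_le {k : E3 × E3 → ℝ} {A : ℝ} (hA : 0 < A)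
    (hk : ∀ q, |k q| ≤ A * gradBound q.1 q.2) :
    ∃ C : ℝ, 0 < C ∧ ∀ (φ : E3 → ℝ) (ψ : E3 → ENNReal) (v : E3), Measurable ψ →
      (∀ᵐ w, ‖φ w‖ₑ ≤ ψ w) →
      ‖∫ w, k (v, w) * φ w‖ₑ ^ 2 ≤ ENNReal.ofReal C *
          ∫⁻ w, ENNReal.ofReal (Real.exp (-(1 / 8) * ‖v - w‖ ^ 2)) * ψ w ^ 2 := by
  obtain ⟨C, hC, hCb⟩ := exists_lintegral_gradBound_mul_sq_le
  refine ⟨A ^ 2 * C, by positivity, fun φ ψ v hψ hφ => ?_⟩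
  have h1 : ‖∫ w, k (v, w) * φ w‖ₑ ≤ ENNReal.ofReal A * ∫⁻ w, ENNReal.ofReal (gradBound v w) * ψ w := by
    refine (enorm_integral_le_lintegral_enorm _).trans ?_
    rw [← lintegral_const_mul' _ _ ENNReal.ofReal_ne_top]
    refine lintegral_mono_ae ?_
    filter_upwards [hφ] with w hw
    rw [enorm_mul, ← mul_assoc, ← ENNReal.ofReal_mul hA.le]
    refine mul_le_mul' ?_ hw
    rw [Real.enorm_eq_ofReal_abs]
    exact ENNReal.ofReal_le_ofReal (hk (v, w))
  refine (pow_le_pow_left' h1 2).trans ?_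
  rw [mul_pow, ENNReal.ofReal_mul (by positivity), ENNReal.ofReal_pow hA.le, mul_assoc]
  exact mul_le_mul' le_rfl (hCb ψ v hψ)

/-! ### Integrals along characteristics and mild solutions -/

/-- The integral of a nonnegative function along backward characteristics. -/
def rayInt (D : ℝ) (H : E3 × E3 → ENNReal) (p : E3 × E3) : ENNReal :=
  ∫⁻ s in Ioc 0 (D / ‖p.2‖), H (p.1 - s • p.2, p.2)

theorem measurable_rayInt {H : E3 × E3 → ENNReal} (hH : Measurable H) (D : ℝ) :
    Measurable (rayInt D H) := by
  have hs : MeasurableSet {p : (E3 × E3) × ℝ | 0 < p.2 ∧ p.2 ≤ D / ‖p.1.2‖} :=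
    (measurableSet_lt measurable_const measurable_snd).inter
      (measurableSet_le measurable_snd (by fun_prop))
  have hm : Measurable fun p : (E3 × E3) × ℝ => H (p.1.1 - p.2 • p.1.2, p.1.2) := by
    have := hH.comp (by fun_prop : Measurable fun p : (E3 × E3) × ℝ => (p.1.1 - p.2 • p.1.2, p.1.2))
    exact this
  have := (hm.indicator hs).lintegral_prod_right' (ν := (volume : Measure ℝ))
  refine (congrArg Measurable ?_).mp this
  ext p
  unfold rayInt
  rw [← lintegral_indicator measurableSet_Ioc]
  rfl

theorem rayInt_sq_le {H : E3 × E3 → ENNReal} (hH : Measurable H) (D : ℝ) (p : E3 × E3) :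
    rayInt D H p ^ 2 ≤ ENNReal.ofReal (D / ‖p.2‖) * rayInt D (fun q => H q ^ 2) p := by
  have hm : Measurable fun s : ℝ => H (p.1 - s • p.2, p.2) := by
    have := hH.comp (by fun_prop : Measurable fun s : ℝ => (p.1 - s • p.2, p.2))
    exact this
  have h := lintegral_mul_sq_le (volume.restrict (Ioc 0 (D / ‖p.2‖))) (f := fun _ => 1)
    (g := fun s => H (p.1 - s • p.2, p.2)) (by fun_prop) hm.aemeasurable
  simp only [one_mul, one_pow, lintegral_const, Measure.restrict_apply_univ, Real.volume_Ioc,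
    sub_zero] at h
  exact h

theorem lintegral_rayInt {H : E3 × E3 → ENNReal} (hH : Measurable H) (D : ℝ) (v : E3) :
    ∫⁻ x, rayInt D H (x, v) = ENNReal.ofReal (D / ‖v‖) * ∫⁻ x, H (x, v) := by
  unfold rayInt
  simp only
  rw [lintegral_lintegral_swap]
  · simp only [fun s : ℝ => lintegral_sub_right_eq_self (μ := (volume : Measure E3))
      (fun x => H (x, v)) (s • v), lintegral_const, Measure.restrict_apply_univ, Real.volume_Ioc,
      sub_zero]
    rw [mul_comm]
  · have := hH.comp (by fun_prop : Measurable fun q : E3 × ℝ => (q.1 - q.2 • v, v))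
    exact Measurable.aemeasurable this

theorem rayInt_le_of_ae {H G : E3 × E3 → ENNReal} (D : ℝ) (hHG : ∀ᵐ p, H p ≤ G p) :
    ∀ᵐ p, rayInt D H p ≤ rayInt D G p := by
  filter_upwards [ae_ae_flow hHG] with p hp
  unfold rayInt
  refine lintegral_mono_ae (ae_restrict_of_ae ?_)
  filter_upwards [hp] with s hs
  simpa [flow, sub_eq_add_neg] using hs

/-- A function on `Ω × ℝ³` given by Duhamel's formula along backward characteristics, for the
collision frequency `ν`, the kernel `k` and the incoming data `g`. -/
structure IsMildSolution (Ω : Set E3) (D A : ℝ) (ν : E3 → ℝ) (k f g : E3 × E3 → ℝ) : Prop where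
  isOpen : IsOpen Ω
  convex : Convex ℝ Ω
  isBounded : Bornology.IsBounded Ω
  D_pos : 0 < D
  norm_sub_le : ∀ x ∈ Ω, ∀ y ∈ Ω, ‖x - y‖ ≤ D
  A_pos : 0 < A
  measurable_freq : Measurable ν
  freq_nonneg : ∀ v, 0 ≤ ν v
  freq_le : ∀ v, ν v ≤ A * (1 + ‖v‖)
  measurable_kernel : Measurable k
  kernel_le : ∀ q, |k q| ≤ A * gradBound q.1 q.2
  measurable : Measurable f
  eq_zero : ∀ p : E3 × E3, p.1 ∉ Ω → f p = 0
  lintegral_lt_top : ∫⁻ p, ‖f p‖ₑ ^ 2 < ⊤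
  data : IncomingAssumption Ω g
  mild : ∀ᵐ v : E3, ∀ᵐ x : E3, x ∈ Ω →
      (x - backTime Ω D x v • v, v) ∈ incoming Ω ∧
      f (x, v) = Real.exp (-ν v * backTime Ω D x v) * g (x - backTime Ω D x v • v, v)
        + duhamelTerm D ν (source Ω k f) (x, v)

theorem source_of_notMem {Ω : Set E3} {k f : E3 × E3 → ℝ} {p : E3 × E3} (hp : p.1 ∉ Ω) :
    source Ω k f p = 0 := indicator_of_notMem hp _

theorem source_of_mem {Ω : Set E3} {k f : E3 × E3 → ℝ} {p : E3 × E3} (hp : p.1 ∈ Ω) :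
    source Ω k f p = ∫ w, k (p.2, w) * f (p.1, w) := indicator_of_mem hp _

theorem enorm_duhamelTerm_le {D : ℝ} {ν : E3 → ℝ} (hν : ∀ v, 0 ≤ ν v) (H : E3 × E3 → ℝ)
    (p : E3 × E3) : ‖duhamelTerm D ν H p‖ₑ ≤ rayInt D (fun q => ‖H q‖ₑ) p := by
  refine (enorm_integral_le_lintegral_enorm _).trans ?_
  refine setLIntegral_mono' measurableSet_Ioc fun s hs => ?_
  rw [enorm_mul]
  refine mul_le_of_le_one_left zero_le ?_
  rw [Real.enorm_of_nonneg (Real.exp_pos _).le, ENNReal.ofReal_le_one, Real.exp_le_one_iff]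
  have := mul_nonneg (hν p.2) hs.1.le
  linarith

theorem ae_prod_of_ae_ae_swap {P : E3 × E3 → Prop} (hP : MeasurableSet {p | P p})
    (h : ∀ᵐ v : E3, ∀ᵐ x : E3, P (x, v)) : ∀ᵐ p, P p := by
  rw [Measure.volume_eq_prod, Measure.ae_prod_iff_ae_ae hP]
  exact (Measure.ae_ae_comm (p := fun x v => P (x, v)) hP).2 h

namespace IsMildSolution

variable {Ω : Set E3} {D A : ℝ} {ν : E3 → ℝ} {k f g : E3 × E3 → ℝ}

theorem measurable_source (h : IsMildSolution Ω D A ν k f g) : Measurable (source Ω k f) :=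
  Boltzmann.measurable_source h.isOpen.measurableSet h.measurable_kernel h.measurable

/-- The solution is dominated by the incoming data and the integral of the source. -/
theorem exists_ae_enorm_le (h : IsMildSolution Ω D A ν k f g) :
    ∃ a C : ℝ, 0 < a ∧ 0 < C ∧ ∀ᵐ p : E3 × E3,
      ‖f p‖ₑ ≤ ENNReal.ofReal (C * Real.exp (-a * ‖p.2‖ ^ 2))
        + rayInt D (fun q => ‖source Ω k f q‖ₑ) p := by
  obtain ⟨a, C, ha, hC, hg, -⟩ := h.data
  refine ⟨a, C, ha, hC, ae_prod_of_ae_ae_swap ?_ ?_⟩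
  · have hm := measurable_rayInt (D := D) (H := fun q => ‖source Ω k f q‖ₑ)
      h.measurable_source.enorm
    refine measurableSet_le h.measurable.enorm (Measurable.add ?_ hm)
    fun_prop
  · filter_upwards [h.mild] with v hv
    filter_upwards [hv] with x hx
    by_cases hxΩ : x ∈ Ω
    · obtain ⟨h1, h2⟩ := hx hxΩ
      rw [h2]
      refine (enorm_add_le _ _).trans (add_le_add ?_ (enorm_duhamelTerm_le h.freq_nonneg _ _))
      rw [Real.enorm_eq_ofReal_abs, abs_mul, abs_of_pos (Real.exp_pos _)]
      refine ENNReal.ofReal_le_ofReal ((mul_le_of_le_one_left (abs_nonneg _) ?_).trans (hg _ _ h1))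
      rw [Real.exp_le_one_iff]
      have : 0 ≤ ν v * backTime Ω D x v := mul_nonneg (h.freq_nonneg v) ENNReal.toReal_nonneg
      linarith
    · rw [h.eq_zero _ hxΩ]; simp

/-- Inserting the bound of `f` by data and source into `F = K f` gives a closed inequality for the
source alone. All pointwise bounds of the source are obtained by iterating it. -/
theorem exists_ae_enorm_source_sq_le (h : IsMildSolution Ω D A ν k f g) :
    ∃ a C : ℝ, 0 < a ∧ 0 < C ∧ ∀ᵐ x : E3, ∀ v,
      ‖source Ω k f (x, v)‖ₑ ^ 2 ≤ ENNReal.ofReal C *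
        ∫⁻ w, ENNReal.ofReal (Real.exp (-(1 / 8) * ‖v - w‖ ^ 2)) *
          (ENNReal.ofReal (Real.exp (-a * ‖w‖ ^ 2))
            + rayInt D (fun q => ‖source Ω k f q‖ₑ) (x, w) ^ 2) := by
  obtain ⟨a, C, ha, hC, hae⟩ := h.exists_ae_enorm_le
  obtain ⟨C2, hC2, hK⟩ := exists_enorm_kernel_integral_sq_le h.A_pos h.kernel_le
  have hm := measurable_rayInt (D := D) (H := fun q => ‖source Ω k f q‖ₑ)
      h.measurable_source.enorm
  refine ⟨a, C2 * (2 * (C ^ 2 + 1)), ha, by positivity, ?_⟩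
  filter_upwards [Measure.ae_ae_of_ae_prod hae] with x hx v
  by_cases hxΩ : x ∈ Ω
  · rw [source_of_mem hxΩ]
    have hmx : Measurable fun w => rayInt D (fun q => ‖source Ω k f q‖ₑ) (x, w) := by fun_prop
    refine (hK (fun w => f (x, w)) (fun w => ENNReal.ofReal (C * Real.exp (-a * ‖w‖ ^ 2))
        + rayInt D (fun q => ‖source Ω k f q‖ₑ) (x, w)) v (by fun_prop) hx).trans ?_
    rw [ENNReal.ofReal_mul hC2.le, mul_assoc]
    refine mul_le_mul' le_rfl ?_
    rw [← lintegral_const_mul' _ _ ENNReal.ofReal_ne_top]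
    refine lintegral_mono fun w => ?_
    rw [mul_left_comm]
    refine mul_le_mul' le_rfl ?_
    refine (ennreal_add_sq_le _ _).trans ?_
    rw [← two_mul_ofReal, mul_assoc]
    refine mul_le_mul' le_rfl ?_
    rw [mul_add]
    refine add_le_add ?_ (le_mul_of_one_le_left zero_le ?_)
    · rw [← ENNReal.ofReal_pow (by positivity), ← ENNReal.ofReal_mul (by positivity), mul_pow]
      refine ENNReal.ofReal_le_ofReal ?_
      have h1 : Real.exp (-a * ‖w‖ ^ 2) ≤ 1 := by
        rw [Real.exp_le_one_iff]
        have : 0 ≤ a * ‖w‖ ^ 2 := by positivity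
        linarith
      have h2 : 0 < Real.exp (-a * ‖w‖ ^ 2) := Real.exp_pos _
      have h3 : Real.exp (-a * ‖w‖ ^ 2) ^ 2 ≤ Real.exp (-a * ‖w‖ ^ 2) := by nlinarith
      exact mul_le_mul (by linarith) h3 (by positivity) (by positivity)
    · rw [ENNReal.one_le_ofReal]
      nlinarith [sq_nonneg C]
  · rw [source_of_notMem hxΩ]; simp

end IsMildSolution


/-! ### Decay of the source in velocity -/

/-- Cauchy–Schwarz against a power of the distance travelled. The exponent `3/5` is below `1`, so
its inverse is integrable along the ray, and above `1/2`: the ray formula produces the potential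
`|z|^(3/5-2) = |z|^(-7/5)`, whose square is still locally integrable. -/
theorem exists_setLIntegral_sq_le {D : ℝ} (hD : 0 < D) :
    ∃ C : ℝ, 0 < C ∧ ∀ (β : ℝ → ENNReal) (w : E3), Measurable β → w ≠ 0 →
      (∫⁻ s in Ioc 0 (D / ‖w‖), β s) ^ 2 ≤ ENNReal.ofReal (C * ‖w‖⁻¹) *
        ∫⁻ s in Ioc 0 (D / ‖w‖), ENNReal.ofReal (‖s • w‖ ^ (3 / 5 : ℝ)) * β s ^ 2 := by
  have hI : 0 < ∫ x in (0 : ℝ)..D, x ^ (-(3 / 5) : ℝ) := by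
    rw [integral_rpow (Or.inl (by norm_num)), Real.zero_rpow (by norm_num), sub_zero]
    positivity
  refine ⟨_, hI, fun β w hβ hw => ?_⟩
  have hw0 : 0 < ‖w‖ := norm_pos_iff.2 hw
  have e1 : ∀ s ∈ Ioc 0 (D / ‖w‖), β s = ENNReal.ofReal ((s * ‖w‖) ^ (-(3 / 10) : ℝ))
      * (ENNReal.ofReal ((s * ‖w‖) ^ (3 / 10 : ℝ)) * β s) := by
    intro s hs
    have hs0 : 0 < s * ‖w‖ := mul_pos hs.1 hw0
    rw [← mul_assoc, ← ENNReal.ofReal_mul (by positivity), ← Real.rpow_add hs0]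
    norm_num
  rw [setLIntegral_congr_fun measurableSet_Ioc e1]
  refine (lintegral_mul_sq_le _ (by fun_prop) (by fun_prop)).trans (mul_le_mul' ?_ ?_)
  · have e2 : ∀ s ∈ Ioc 0 (D / ‖w‖), ENNReal.ofReal ((s * ‖w‖) ^ (-(3 / 10) : ℝ)) ^ 2
        = ENNReal.ofReal ((s * ‖w‖) ^ (-(3 / 5) : ℝ)) := by
      intro s hs
      have hs0 : 0 < s * ‖w‖ := mul_pos hs.1 hw0
      rw [← ENNReal.ofReal_pow (by positivity), ← Real.rpow_natCast, ← Real.rpow_mul hs0.le]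
      norm_num
    rw [setLIntegral_congr_fun measurableSet_Ioc e2]
    have hint : IntervalIntegrable (fun x : ℝ => x ^ (-(3 / 5) : ℝ)) volume 0 D :=
      intervalIntegral.intervalIntegrable_rpow' (by norm_num)
    have hint2 : IntervalIntegrable (fun s : ℝ => (s * ‖w‖) ^ (-(3 / 5) : ℝ)) volume 0 (D / ‖w‖) := by
      have := hint.comp_mul_right (c := ‖w‖)
      rwa [zero_div] at this
    have hT : 0 ≤ D / ‖w‖ := by positivity
    rw [← ofReal_integral_eq_lintegral_ofReal
      ((intervalIntegrable_iff_integrableOn_Ioc_of_le hT).1 hint2)]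
    · rw [← intervalIntegral.integral_of_le hT,
        intervalIntegral.integral_comp_mul_right (fun x : ℝ => x ^ (-(3 / 5) : ℝ)) hw0.ne',
        zero_mul, div_mul_cancel₀ _ hw0.ne', smul_eq_mul, mul_comm]
    · refine (ae_restrict_iff' measurableSet_Ioc).2 (Eventually.of_forall fun s hs => ?_)
      have hs0 : 0 < s * ‖w‖ := mul_pos hs.1 hw0
      exact Real.rpow_nonneg hs0.le _
  · refine setLIntegral_mono' measurableSet_Ioc fun s hs => ?_
    have hs0 : 0 < s * ‖w‖ := mul_pos hs.1 hw0
    rw [mul_pow, norm_smul, Real.norm_of_nonneg hs.1.le, ← ENNReal.ofReal_pow (by positivity),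
      ← Real.rpow_natCast, ← Real.rpow_mul hs0.le]
    norm_num

theorem exists_exp_mul_weight_le (c q : ℝ) (hc : 0 < c) :
    ∃ C : ℝ, 0 < C ∧ ∀ v w : E3,
      Real.exp (-c * ‖v - w‖ ^ 2) * (1 + ‖w‖) ^ q ≤ C * (1 + ‖v‖) ^ q := by
  obtain ⟨C, hC, hCb⟩ := exists_exp_neg_mul_sq_le c |q| hc
  refine ⟨C, hC, fun v w => ?_⟩
  have h1 := hCb ‖v - w‖ (norm_nonneg _)
  have h2 := one_add_norm_rpow_le q v w
  calc Real.exp (-c * ‖v - w‖ ^ 2) * (1 + ‖w‖) ^ q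
      ≤ (C * (1 + ‖v - w‖) ^ (-|q|)) * ((1 + ‖v‖) ^ q * (1 + ‖v - w‖) ^ |q|) := by
        refine mul_le_mul h1 h2 (by positivity) (by positivity)
    _ = C * (1 + ‖v‖) ^ q * ((1 + ‖v - w‖) ^ (-|q|) * (1 + ‖v - w‖) ^ |q|) := by ring
    _ = C * (1 + ‖v‖) ^ q := by
        rw [← Real.rpow_add (by positivity), neg_add_cancel, Real.rpow_zero, mul_one]

theorem exists_lintegral_exp_le {c : ℝ} (hc : 0 < c) :
    ∃ C : ℝ, 0 < C ∧ ∀ v : E3,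
      ∫⁻ w : E3, ENNReal.ofReal (Real.exp (-c * ‖v - w‖ ^ 2)) ≤ ENNReal.ofReal C := by
  obtain ⟨C, hC, hCb⟩ := exists_lintegral_gaussian_weight_le c 0 hc
  refine ⟨C, hC, fun v => ?_⟩
  have := hCb v
  rw [Real.rpow_zero, mul_one] at this
  refine (lintegral_mono fun w => ENNReal.ofReal_le_ofReal ?_).trans this
  rw [Real.rpow_zero, mul_one]
  refine le_mul_of_one_le_right (by positivity) ?_
  have h1 : 0 ≤ (‖w‖ ^ 2)⁻¹ := by positivity
  have h2 : 0 ≤ (‖v - w‖ ^ 2)⁻¹ := by positivity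
  linarith

namespace IsMildSolution

variable {Ω : Set E3} {D A : ℝ} {ν : E3 → ℝ} {k f g : E3 × E3 → ℝ}

/-- Transport along characteristics turns a bound of the source into a Riesz potential bound. -/
theorem exists_source_sq_le_potential (h : IsMildSolution Ω D A ν k f g) {j : ℝ} (hj : 0 ≤ j) :
    ∃ C : ℝ, 0 < C ∧ ∀ Ψ : E3 → ENNReal, Measurable Ψ →
      (∀ᵐ x, ∀ w, ‖source Ω k f (x, w)‖ₑ ^ 2 ≤ ENNReal.ofReal ((1 + ‖w‖) ^ j) * Ψ x) →
      ∀ᵐ x, ∀ v, ‖source Ω k f (x, v)‖ₑ ^ 2 ≤ ENNReal.ofReal (C * (1 + ‖v‖) ^ (j + 2)) *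
        (1 + ∫⁻ z, ENNReal.ofReal (‖z‖ ^ (-(7 / 5) : ℝ)) * Ψ (x - z)) := by
  obtain ⟨a, C1, ha, hC1, hs⟩ := h.exists_ae_enorm_source_sq_le
  obtain ⟨C2, hC2, hCS⟩ := exists_setLIntegral_sq_le h.D_pos
  -- The Gaussian carries the power `j + 2` from `w` to `v`. The two extra powers leave behind the
  -- factor `(1 + |w|)⁻²` required by `lintegral_ray`.
  obtain ⟨C3, hC3, hwt⟩ := exists_exp_mul_weight_le (1 / 8) (j + 2) (by norm_num)
  obtain ⟨C4, hC4, hexp⟩ := exists_lintegral_exp_le (c := 1 / 8) (by norm_num)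
  have hmF : Measurable fun q => ‖source Ω k f q‖ₑ := h.measurable_source.enorm
  refine ⟨C1 * (C4 + C2 * C3 * rayConst.toReal), by positivity, fun Ψ hΨ hb => ?_⟩
  have hb' : ∀ᵐ p : E3 × E3, ‖source Ω k f p‖ₑ ^ 2
      ≤ ENNReal.ofReal ((1 + ‖p.2‖) ^ j) * Ψ p.1 := by
    have := (Measure.quasiMeasurePreserving_fst (μ := (volume : Measure E3))
      (ν := (volume : Measure E3))).ae hb
    filter_upwards [this] with p hp using hp p.2
  filter_upwards [hs, Measure.ae_ae_of_ae_prod (ae_ae_flow hb')] with x h1 h2 v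
  refine (h1 v).trans ?_
  have hΦ : Measurable fun z => ENNReal.ofReal (‖z‖ ^ (3 / 5 : ℝ)) * Ψ (x - z) := by fun_prop
  have hne : ∀ᵐ w : E3, w ≠ 0 := by simp [ae_iff]
  have hpt : ∀ᵐ w : E3, ENNReal.ofReal (Real.exp (-(1 / 8) * ‖v - w‖ ^ 2)) *
          (ENNReal.ofReal (Real.exp (-a * ‖w‖ ^ 2))
            + rayInt D (fun q => ‖source Ω k f q‖ₑ) (x, w) ^ 2)
      ≤ ENNReal.ofReal (Real.exp (-(1 / 8) * ‖v - w‖ ^ 2))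
        + ENNReal.ofReal (C2 * C3 * (1 + ‖v‖) ^ (j + 2)) *
          ∫⁻ s : ℝ, ENNReal.ofReal (‖w‖⁻¹ * ((1 + ‖w‖) ^ 2)⁻¹) *
            (ENNReal.ofReal (‖s • w‖ ^ (3 / 5 : ℝ)) * Ψ (x - s • w)) := by
    filter_upwards [h2, hne] with w hw hw0
    rw [mul_add]
    refine add_le_add (mul_le_of_le_one_right zero_le ?_) ?_
    · rw [ENNReal.ofReal_le_one, Real.exp_le_one_iff]
      have : 0 ≤ a * ‖w‖ ^ 2 := by positivity
      linarith
    have hmβ : Measurable fun s : ℝ => ‖source Ω k f (x - s • w, w)‖ₑ := by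
      have := hmF.comp (by fun_prop : Measurable fun s : ℝ => (x - s • w, w))
      exact this
    have k1 : rayInt D (fun q => ‖source Ω k f q‖ₑ) (x, w) ^ 2
        ≤ ENNReal.ofReal (C2 * ‖w‖⁻¹) * (ENNReal.ofReal ((1 + ‖w‖) ^ j) *
          ∫⁻ s : ℝ, ENNReal.ofReal (‖s • w‖ ^ (3 / 5 : ℝ)) * Ψ (x - s • w)) := by
      refine (hCS _ w hmβ hw0).trans (mul_le_mul' le_rfl ?_)
      rw [← lintegral_const_mul' _ _ ENNReal.ofReal_ne_top]
      refine le_trans (lintegral_mono_ae (ae_restrict_of_ae ?_)) (setLIntegral_le_lintegral _ _)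
      filter_upwards [hw] with s hs
      rw [mul_left_comm]
      refine mul_le_mul' le_rfl ?_
      simpa [flow, sub_eq_add_neg] using hs
    refine (mul_le_mul' le_rfl k1).trans ?_
    rw [lintegral_const_mul' _ _ ENNReal.ofReal_ne_top, ← mul_assoc, ← mul_assoc, ← mul_assoc,
      ← ENNReal.ofReal_mul (by positivity), ← ENNReal.ofReal_mul (by positivity),
      ← ENNReal.ofReal_mul (by positivity)]
    refine mul_le_mul' (ENNReal.ofReal_le_ofReal ?_) le_rfl
    have e := hwt v w
    have hw1 : 0 < 1 + ‖w‖ := by positivity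
    rw [Real.rpow_add hw1, Real.rpow_two] at e
    have h3 : Real.exp (-(1 / 8) * ‖v - w‖ ^ 2) * (1 + ‖w‖) ^ j
        ≤ C3 * (1 + ‖v‖) ^ (j + 2) * ((1 + ‖w‖) ^ 2)⁻¹ := by
      rw [← div_eq_mul_inv, le_div_iff₀ (by positivity), mul_assoc]
      exact e
    calc Real.exp (-(1 / 8) * ‖v - w‖ ^ 2) * (C2 * ‖w‖⁻¹) * (1 + ‖w‖) ^ j
        = C2 * ‖w‖⁻¹ * (Real.exp (-(1 / 8) * ‖v - w‖ ^ 2) * (1 + ‖w‖) ^ j) := by ring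
      _ ≤ C2 * ‖w‖⁻¹ * (C3 * (1 + ‖v‖) ^ (j + 2) * ((1 + ‖w‖) ^ 2)⁻¹) :=
          mul_le_mul_of_nonneg_left h3 (by positivity)
      _ = _ := by ring
  have hray := lintegral_ray hΦ
  have hI := lintegral_mono_ae hpt
  rw [lintegral_add_left (by fun_prop), lintegral_const_mul' _ _ ENNReal.ofReal_ne_top, hray] at hI
  refine (mul_le_mul' le_rfl hI).trans ?_
  set P := ∫⁻ z, ENNReal.ofReal (‖z‖ ^ (-(7 / 5) : ℝ)) * Ψ (x - z) with hP
  have e3 : ∫⁻ z : E3, ENNReal.ofReal (‖z‖ ^ 2)⁻¹ *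
      (ENNReal.ofReal (‖z‖ ^ (3 / 5 : ℝ)) * Ψ (x - z)) ≤ P := by
    refine lintegral_mono_ae ?_
    filter_upwards [hne] with z hz
    have hz0 : 0 < ‖z‖ := norm_pos_iff.2 hz
    rw [← mul_assoc, ← ENNReal.ofReal_mul (by positivity), ← Real.rpow_natCast,
      ← Real.rpow_neg hz0.le, ← Real.rpow_add hz0]
    norm_num
  have e4 : rayConst = ENNReal.ofReal rayConst.toReal :=
    (ENNReal.ofReal_toReal rayConst_lt_top.ne).symm
  have hv1 : 1 ≤ (1 + ‖v‖) ^ (j + 2) :=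
    Real.one_le_rpow (by linarith [norm_nonneg v]) (by linarith)
  calc ENNReal.ofReal C1 * ((∫⁻ w, ENNReal.ofReal (Real.exp (-(1 / 8) * ‖v - w‖ ^ 2)))
        + ENNReal.ofReal (C2 * C3 * (1 + ‖v‖) ^ (j + 2)) * (rayConst *
          ∫⁻ z : E3, ENNReal.ofReal (‖z‖ ^ 2)⁻¹ *
            (ENNReal.ofReal (‖z‖ ^ (3 / 5 : ℝ)) * Ψ (x - z))))
      ≤ ENNReal.ofReal C1 * (ENNReal.ofReal (C4 * (1 + ‖v‖) ^ (j + 2))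
        + ENNReal.ofReal (C2 * C3 * (1 + ‖v‖) ^ (j + 2)) * (ENNReal.ofReal rayConst.toReal * P)) := by
        rw [← e4]
        refine mul_le_mul' le_rfl (add_le_add ((hexp v).trans (ENNReal.ofReal_le_ofReal ?_))
          (mul_le_mul' le_rfl (mul_le_mul' le_rfl e3)))
        exact le_mul_of_one_le_right hC4.le hv1
    _ = ENNReal.ofReal (C1 * (C4 * (1 + ‖v‖) ^ (j + 2)))
        + ENNReal.ofReal (C1 * (C2 * C3 * (1 + ‖v‖) ^ (j + 2) * rayConst.toReal)) * P := by
        rw [mul_add, ← mul_assoc (ENNReal.ofReal (C2 * C3 * _)), ← mul_assoc (ENNReal.ofReal C1),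
          ← ENNReal.ofReal_mul (by positivity), ← ENNReal.ofReal_mul (by positivity),
          ← ENNReal.ofReal_mul (by positivity)]
    _ ≤ _ := by
        rw [mul_add, mul_one]
        refine add_le_add (ENNReal.ofReal_le_ofReal ?_)
          (mul_le_mul' (ENNReal.ofReal_le_ofReal ?_) le_rfl)
        · rw [mul_assoc]
          refine mul_le_mul_of_nonneg_left ?_ hC1.le
          refine mul_le_mul_of_nonneg_right ?_ (by positivity)
          have : 0 ≤ C2 * C3 * rayConst.toReal := by positivity
          linarith
        · have : 0 ≤ C1 * C4 * (1 + ‖v‖) ^ (j + 2) := by positivity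
          nlinarith

end IsMildSolution


/-- The product of the two singularities of order `7/5` is at most the sum of their squares, of
order `14/5 < 3`. Each square is locally integrable, leaving the total mass of `Ψ`. Two potential
steps therefore lead from `L¹` to `L∞`. -/
theorem exists_lintegral_double_potential_le {Ω : Set E3} {D : ℝ}
    (hD : ∀ x ∈ Ω, ∀ y ∈ Ω, ‖x - y‖ ≤ D) :
    ∃ C : ℝ, 0 < C ∧ ∀ Ψ : E3 → ENNReal, Measurable Ψ → (∀ x, x ∉ Ω → Ψ x = 0) → ∀ x ∈ Ω,
      ∫⁻ z, ENNReal.ofReal (‖z‖ ^ (-(7 / 5) : ℝ)) * Ω.indicator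
        (fun y => 1 + ∫⁻ u, ENNReal.ofReal (‖u‖ ^ (-(7 / 5) : ℝ)) * Ψ (y - u)) (x - z)
        ≤ ENNReal.ofReal C * (1 + ∫⁻ y, Ψ y) := by
  set U := Metric.ball (0 : E3) (D + 1) with hU
  set I1 := ∫⁻ z in U, ENNReal.ofReal (‖z‖ ^ (-(7 / 5) : ℝ)) with hI1
  set I2 := ∫⁻ z in U, ENNReal.ofReal (‖z‖ ^ (-(14 / 5) : ℝ)) with hI2
  have hI1t : I1 < ⊤ := lintegral_ball_norm_rpow_lt_top (by norm_num) _
  have hI2t : I2 < ⊤ := lintegral_ball_norm_rpow_lt_top (by norm_num) _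
  refine ⟨I1.toReal + 2 * I2.toReal + 1, by positivity, fun Ψ hΨ hΨ0 x hx => ?_⟩
  set b : E3 → ENNReal := U.indicator fun z => ENNReal.ofReal (‖z‖ ^ (-(14 / 5) : ℝ)) with hb
  have hbm : Measurable b := Measurable.indicator (by fun_prop) measurableSet_ball
  have hbI : ∫⁻ z, b z = I2 := lintegral_indicator measurableSet_ball _
  have hpt : ∀ z, ENNReal.ofReal (‖z‖ ^ (-(7 / 5) : ℝ)) * Ω.indicator
        (fun y => 1 + ∫⁻ u, ENNReal.ofReal (‖u‖ ^ (-(7 / 5) : ℝ)) * Ψ (y - u)) (x - z)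
      ≤ U.indicator (fun z => ENNReal.ofReal (‖z‖ ^ (-(7 / 5) : ℝ))) z
        + ∫⁻ u, (b z * Ψ (x - z - u) + b u * Ψ (x - z - u)) := by
    intro z
    by_cases hz : x - z ∈ Ω
    · have hzU : z ∈ U := by
        have := hD x hx _ hz
        rw [sub_sub_cancel] at this
        rw [hU, mem_ball_zero_iff]; linarith
      rw [indicator_of_mem hz, indicator_of_mem hzU, mul_add, mul_one]
      refine add_le_add le_rfl ?_
      rw [← lintegral_const_mul' _ _ ENNReal.ofReal_ne_top]
      refine lintegral_mono fun u => ?_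
      by_cases hu : x - z - u ∈ Ω
      · have huU : u ∈ U := by
          have := hD _ hz _ hu
          rw [sub_sub_cancel] at this
          rw [hU, mem_ball_zero_iff]; linarith
        rw [← mul_assoc, ← add_mul]
        refine mul_le_mul' ?_ le_rfl
        rw [hb, indicator_of_mem hzU, indicator_of_mem huU, ← ENNReal.ofReal_mul (by positivity),
          ← ENNReal.ofReal_add (by positivity) (by positivity)]
        refine ENNReal.ofReal_le_ofReal ?_
        have e : ∀ y : E3, ‖y‖ ^ (-(14 / 5) : ℝ) = (‖y‖ ^ (-(7 / 5) : ℝ)) ^ 2 := by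
          intro y
          rw [← Real.rpow_natCast, ← Real.rpow_mul (norm_nonneg y)]
          norm_num
        rw [e z, e u]
        nlinarith [sq_nonneg (‖z‖ ^ (-(7 / 5) : ℝ) - ‖u‖ ^ (-(7 / 5) : ℝ)),
          sq_nonneg (‖z‖ ^ (-(7 / 5) : ℝ)), sq_nonneg (‖u‖ ^ (-(7 / 5) : ℝ))]
      · rw [hΨ0 _ hu]; simp
    · rw [indicator_of_notMem hz, mul_zero]; exact zero_le
  refine (lintegral_mono hpt).trans ?_
  have hm1 : Measurable fun q : E3 × E3 => b q.1 * Ψ (x - q.1 - q.2) := by fun_prop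
  have hm2 : Measurable fun q : E3 × E3 => b q.2 * Ψ (x - q.1 - q.2) := by fun_prop
  have hA1 : ∫⁻ z, ∫⁻ u, b z * Ψ (x - z - u) = I2 * ∫⁻ y, Ψ y := by
    rw [← hbI, ← lintegral_mul_const _ hbm]
    refine lintegral_congr fun z => ?_
    rw [lintegral_const_mul _ (by fun_prop),
      lintegral_sub_left_eq_self (μ := (volume : Measure E3)) Ψ (x - z)]
  have hA2 : ∫⁻ z, ∫⁻ u, b u * Ψ (x - z - u) = I2 * ∫⁻ y, Ψ y := by
    rw [lintegral_lintegral_swap hm2.aemeasurable, ← hbI, ← lintegral_mul_const _ hbm]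
    refine lintegral_congr fun u => ?_
    rw [lintegral_const_mul _ (by fun_prop)]
    have : ∀ z, Ψ (x - z - u) = Ψ ((x - u) - z) := fun z => by congr 1; abel
    simp only [this]
    rw [lintegral_sub_left_eq_self (μ := (volume : Measure E3)) Ψ (x - u)]
  rw [lintegral_add_left (Measurable.indicator (by fun_prop) measurableSet_ball),
    lintegral_indicator measurableSet_ball, ← hI1]
  have hsplit : ∀ z, ∫⁻ u, (b z * Ψ (x - z - u) + b u * Ψ (x - z - u))
      = (∫⁻ u, b z * Ψ (x - z - u)) + ∫⁻ u, b u * Ψ (x - z - u) := fun z =>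
    lintegral_add_left (by fun_prop) _
  simp only [hsplit]
  rw [lintegral_add_left hm1.lintegral_prod_right', hA1, hA2]
  have e1 : I1 = ENNReal.ofReal I1.toReal := (ENNReal.ofReal_toReal hI1t.ne).symm
  have e2 : I2 = ENNReal.ofReal I2.toReal := (ENNReal.ofReal_toReal hI2t.ne).symm
  rw [← add_mul, mul_add, mul_one]
  refine add_le_add ?_ (mul_le_mul' ?_ le_rfl)
  · rw [e1, ENNReal.toReal_ofReal ENNReal.toReal_nonneg]
    refine ENNReal.ofReal_le_ofReal ?_
    have : 0 ≤ I2.toReal := ENNReal.toReal_nonneg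
    linarith
  · have : 0 ≤ I2.toReal := ENNReal.toReal_nonneg
    have : 0 ≤ I1.toReal := ENNReal.toReal_nonneg
    rw [e2, ENNReal.toReal_ofReal ENNReal.toReal_nonneg, ← ENNReal.ofReal_add (by assumption)
      (by assumption)]
    refine ENNReal.ofReal_le_ofReal ?_
    linarith

namespace IsMildSolution

variable {Ω : Set E3} {D A : ℝ} {ν : E3 → ℝ} {k f g : E3 × E3 → ℝ}

/-- Starting from the density of `|f|²` in position, which is integrable, two potential steps give a
uniform bound. Each step costs two powers of the velocity, whence the fourth power. -/
theorem exists_source_sq_le_growth (h : IsMildSolution Ω D A ν k f g) :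
    ∃ C : ℝ, 0 < C ∧ ∀ᵐ x, ∀ v,
      ‖source Ω k f (x, v)‖ₑ ^ 2 ≤ ENNReal.ofReal (C * (1 + ‖v‖) ^ (4 : ℝ)) := by
  obtain ⟨C0, hC0, hK⟩ := exists_enorm_kernel_integral_sq_le h.A_pos h.kernel_le
  obtain ⟨C1, hC1, h1⟩ := h.exists_source_sq_le_potential (j := 0) le_rfl
  obtain ⟨C2, hC2, h2⟩ := h.exists_source_sq_le_potential (j := 2) zero_le_two
  obtain ⟨C3, hC3, h3⟩ := exists_lintegral_double_potential_le h.norm_sub_le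
  have hfm : Measurable fun p => ‖f p‖ₑ ^ 2 := h.measurable.enorm.pow_const 2
  set Ψ : E3 → ENNReal := fun x => ENNReal.ofReal C0 * ∫⁻ w, ‖f (x, w)‖ₑ ^ 2 with hΨ
  have hΨm : Measurable Ψ := by
    have := hfm.lintegral_prod_right' (ν := (volume : Measure E3))
    exact this.const_mul _
  have hΨ0 : ∀ x, x ∉ Ω → Ψ x = 0 := by
    intro x hx
    have : ∀ w, f (x, w) = 0 := fun w => h.eq_zero _ hx
    simp [hΨ, this]
  have hΨI : ∫⁻ x, Ψ x < ⊤ := by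
    rw [hΨ, lintegral_const_mul' _ _ ENNReal.ofReal_ne_top]
    refine ENNReal.mul_lt_top ENNReal.ofReal_lt_top ?_
    have := h.lintegral_lt_top
    rwa [Measure.volume_eq_prod, lintegral_prod _ hfm.aemeasurable] at this
  have b0 : ∀ᵐ x, ∀ w, ‖source Ω k f (x, w)‖ₑ ^ 2 ≤ ENNReal.ofReal ((1 + ‖w‖) ^ (0 : ℝ)) * Ψ x := by
    refine Eventually.of_forall fun x w => ?_
    by_cases hx : x ∈ Ω
    · rw [source_of_mem hx, Real.rpow_zero, ENNReal.ofReal_one, one_mul]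
      have hm : Measurable fun w => ‖f (x, w)‖ₑ := by
        have := h.measurable.comp (by fun_prop : Measurable fun w : E3 => (x, w))
        exact this.enorm
      refine (hK (fun w => f (x, w)) (fun w => ‖f (x, w)‖ₑ) w hm
        (Eventually.of_forall fun _ => le_rfl)).trans (mul_le_mul' le_rfl ?_)
      refine lintegral_mono fun u => mul_le_of_le_one_left zero_le ?_
      rw [ENNReal.ofReal_le_one, Real.exp_le_one_iff]
      have : 0 ≤ ‖w - u‖ ^ 2 := by positivity
      linarith
    · rw [source_of_notMem hx]; simp
  have b1 := h1 Ψ hΨm b0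
  set P : E3 → ENNReal := fun x =>
    1 + ∫⁻ z, ENNReal.ofReal (‖z‖ ^ (-(7 / 5) : ℝ)) * Ψ (x - z) with hP
  have hPm : Measurable P := by
    have hm : Measurable fun q : E3 × E3 => ENNReal.ofReal (‖q.2‖ ^ (-(7 / 5) : ℝ)) * Ψ (q.1 - q.2) := by
      fun_prop
    have := hm.lintegral_prod_right' (ν := (volume : Measure E3))
    exact this.const_add _
  have b2 := h2 (fun x => ENNReal.ofReal C1 * Ω.indicator P x)
    ((hPm.indicator h.isOpen.measurableSet).const_mul _) (by
      filter_upwards [b1] with x hx w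
      by_cases hxΩ : x ∈ Ω
      · rw [indicator_of_mem hxΩ, ← mul_assoc, ← ENNReal.ofReal_mul (by positivity), mul_comm _ C1]
        have := hx w
        rwa [zero_add] at this
      · rw [source_of_notMem hxΩ]; simp)
  refine ⟨C2 * (1 + C1 * (C3 * (1 + (∫⁻ x, Ψ x).toReal))), by positivity, ?_⟩
  filter_upwards [b2] with x hx v
  by_cases hxΩ : x ∈ Ω
  · refine (hx v).trans ?_
    have k1 : ∫⁻ z, ENNReal.ofReal (‖z‖ ^ (-(7 / 5) : ℝ)) *
        (ENNReal.ofReal C1 * Ω.indicator P (x - z))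
        ≤ ENNReal.ofReal C1 * (ENNReal.ofReal C3 * (1 + ∫⁻ y, Ψ y)) := by
      refine le_trans (le_of_eq ?_) (mul_le_mul' le_rfl (h3 Ψ hΨm hΨ0 x hxΩ))
      rw [← lintegral_const_mul' _ _ ENNReal.ofReal_ne_top]
      refine lintegral_congr fun z => ?_
      rw [mul_left_comm]
    refine (mul_le_mul' le_rfl (add_le_add le_rfl k1)).trans (le_of_eq ?_)
    have e : 1 + ∫⁻ y, Ψ y = ENNReal.ofReal (1 + (∫⁻ x, Ψ x).toReal) := by
      rw [ENNReal.ofReal_add zero_le_one ENNReal.toReal_nonneg, ENNReal.ofReal_toReal hΨI.ne,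
        ENNReal.ofReal_one]
    rw [e, ← ENNReal.ofReal_mul hC3.le, ← ENNReal.ofReal_mul hC1.le, ← ENNReal.ofReal_one,
      ← ENNReal.ofReal_add zero_le_one (by positivity), ← ENNReal.ofReal_mul (by positivity)]
    congr 1
    norm_num
    ring
  · rw [source_of_notMem hxΩ]; simp

/-- A bounded integrand along a ray of length `D/|w|` yields a factor `(D/|w|)²`. At infinity this
gains two powers of the velocity; the singularity `|w|⁻²` it creates at the origin is absorbed by
the Gaussian convolution. -/
theorem exists_source_sq_le_improve (h : IsMildSolution Ω D A ν k f g) {q C : ℝ} (hC : 0 < C)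
    (hb : ∀ᵐ x, ∀ v, ‖source Ω k f (x, v)‖ₑ ^ 2 ≤ ENNReal.ofReal (C * (1 + ‖v‖) ^ q)) :
    ∃ C' : ℝ, 0 < C' ∧ ∀ᵐ x, ∀ v,
      ‖source Ω k f (x, v)‖ₑ ^ 2 ≤ ENNReal.ofReal (C' * (1 + ‖v‖) ^ (q - 2)) := by
  obtain ⟨a, C1, ha, hC1, hs⟩ := h.exists_ae_enorm_source_sq_le
  obtain ⟨C2, hC2, h2⟩ := exists_exp_neg_mul_sq_le a (-(q - 2)) ha
  obtain ⟨C3, hC3, h3⟩ := exists_lintegral_gaussian_weight_le (1 / 8) (q - 2) (by norm_num)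
  have hD := h.D_pos
  have hb' : ∀ᵐ p : E3 × E3, ‖source Ω k f p‖ₑ ^ 2 ≤ ENNReal.ofReal (C * (1 + ‖p.2‖) ^ q) := by
    have := (Measure.quasiMeasurePreserving_fst (μ := (volume : Measure E3))
      (ν := (volume : Measure E3))).ae hb
    filter_upwards [this] with p hp using hp p.2
  refine ⟨C1 * ((C2 + 2 * D ^ 2 * C) * C3), by positivity, ?_⟩
  filter_upwards [hs, Measure.ae_ae_of_ae_prod (rayInt_le_of_ae D hb')] with x h4 h5 v
  refine (h4 v).trans ?_
  have hne : ∀ᵐ w : E3, w ≠ 0 := by simp [ae_iff]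
  rw [mul_assoc, ENNReal.ofReal_mul hC1.le]
  refine mul_le_mul' le_rfl ?_
  rw [mul_assoc, ENNReal.ofReal_mul (by positivity)]
  refine le_trans ?_ (mul_le_mul' le_rfl (h3 v))
  rw [← lintegral_const_mul' _ _ ENNReal.ofReal_ne_top]
  refine lintegral_mono_ae ?_
  filter_upwards [h5, hne] with w hw hw0
  have hwp : 0 < ‖w‖ := norm_pos_iff.2 hw0
  have k1 : rayInt D (fun q => ‖source Ω k f q‖ₑ) (x, w) ^ 2
      ≤ ENNReal.ofReal ((D / ‖w‖) ^ 2 * (C * (1 + ‖w‖) ^ q)) := by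
    refine (rayInt_sq_le h.measurable_source.enorm D (x, w)).trans ?_
    refine (mul_le_mul' le_rfl hw).trans ?_
    simp only [rayInt, lintegral_const, Measure.restrict_apply_univ, Real.volume_Ioc, sub_zero]
    rw [← ENNReal.ofReal_mul (by positivity), ← ENNReal.ofReal_mul (by positivity)]
    refine ENNReal.ofReal_le_ofReal (le_of_eq ?_)
    ring
  refine (mul_le_mul' le_rfl (add_le_add le_rfl k1)).trans ?_
  rw [← ENNReal.ofReal_add (by positivity) (by positivity), ← ENNReal.ofReal_mul (by positivity),
    ← ENNReal.ofReal_mul (by positivity)]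
  refine ENNReal.ofReal_le_ofReal ?_
  have k2 := h2 ‖w‖ hwp.le
  rw [neg_neg] at k2
  have k3 : (D / ‖w‖) ^ 2 * (C * (1 + ‖w‖) ^ q)
      ≤ 2 * D ^ 2 * C * (1 + ‖w‖) ^ (q - 2) * (1 + (‖w‖ ^ 2)⁻¹) := by
    rw [Real.rpow_sub (by positivity), Real.rpow_two, div_pow]
    have : (1 + ‖w‖) ^ 2 / ‖w‖ ^ 2 ≤ 2 * (1 + (‖w‖ ^ 2)⁻¹) := by
      rw [div_le_iff₀ (by positivity)]
      have : 2 * (1 + (‖w‖ ^ 2)⁻¹) * ‖w‖ ^ 2 = 2 * ‖w‖ ^ 2 + 2 := by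
        field_simp
      rw [this]
      nlinarith [sq_nonneg (‖w‖ - 1)]
    calc D ^ 2 / ‖w‖ ^ 2 * (C * (1 + ‖w‖) ^ q)
        = D ^ 2 * C * ((1 + ‖w‖) ^ q / (1 + ‖w‖) ^ 2) * ((1 + ‖w‖) ^ 2 / ‖w‖ ^ 2) := by
          field_simp
      _ ≤ D ^ 2 * C * ((1 + ‖w‖) ^ q / (1 + ‖w‖) ^ 2) * (2 * (1 + (‖w‖ ^ 2)⁻¹)) :=
          mul_le_mul_of_nonneg_left this (by positivity)
      _ = _ := by ring
  have k4 : 0 ≤ (‖v - w‖ ^ 2)⁻¹ := by positivity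
  have k5 : 0 ≤ (‖w‖ ^ 2)⁻¹ := by positivity
  have k6 : 0 < (1 + ‖w‖) ^ (q - 2) := by positivity
  calc Real.exp (-(1 / 8) * ‖v - w‖ ^ 2) *
        (Real.exp (-a * ‖w‖ ^ 2) + (D / ‖w‖) ^ 2 * (C * (1 + ‖w‖) ^ q))
      ≤ Real.exp (-(1 / 8) * ‖v - w‖ ^ 2) *
        ((C2 + 2 * D ^ 2 * C) * (1 + ‖w‖) ^ (q - 2) * (1 + (‖w‖ ^ 2)⁻¹ + (‖v - w‖ ^ 2)⁻¹)) := by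
        refine mul_le_mul_of_nonneg_left ?_ (by positivity)
        have e1 : 0 ≤ C2 * (1 + ‖w‖) ^ (q - 2) * ((‖w‖ ^ 2)⁻¹ + (‖v - w‖ ^ 2)⁻¹) := by positivity
        have e2 : 0 ≤ 2 * D ^ 2 * C * (1 + ‖w‖) ^ (q - 2) * (‖v - w‖ ^ 2)⁻¹ := by positivity
        linarith
    _ = _ := by ring

/-- The source decays faster than any power of the velocity. -/
theorem exists_source_sq_le (h : IsMildSolution Ω D A ν k f g) (q : ℝ) :
    ∃ C : ℝ, 0 < C ∧ ∀ᵐ x, ∀ v,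
      ‖source Ω k f (x, v)‖ₑ ^ 2 ≤ ENNReal.ofReal (C * (1 + ‖v‖) ^ q) := by
  have hn : ∀ n : ℕ, ∃ C : ℝ, 0 < C ∧ ∀ᵐ x, ∀ v,
      ‖source Ω k f (x, v)‖ₑ ^ 2 ≤ ENNReal.ofReal (C * (1 + ‖v‖) ^ (4 - 2 * n : ℝ)) := by
    intro n
    induction n with
    | zero => simpa using h.exists_source_sq_le_growth
    | succ n ih =>
      obtain ⟨C, hC, hb⟩ := ih
      obtain ⟨C', hC', hb'⟩ := h.exists_source_sq_le_improve hC hb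
      refine ⟨C', hC', ?_⟩
      filter_upwards [hb'] with x hx v
      convert hx v using 4
      push_cast; ring
  obtain ⟨n, hn'⟩ := exists_nat_ge (4 - q)
  obtain ⟨C, hC, hb⟩ := hn n
  refine ⟨C, hC, ?_⟩
  filter_upwards [hb] with x hx v
  refine (hx v).trans (ENNReal.ofReal_le_ofReal (mul_le_mul_of_nonneg_left ?_ hC.le))
  refine Real.rpow_le_rpow_of_exponent_le (by linarith [norm_nonneg v]) ?_
  have : (0 : ℝ) ≤ n := by positivity
  linarith

end IsMildSolution


/-! ### Differences in the space variable -/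

/-- The points of `Ω` that stay in `Ω` after translation by `h`. -/
def overlap (Ω : Set E3) (h : E3) : Set E3 := {x | x ∈ Ω ∧ x + h ∈ Ω}

theorem measurableSet_overlap {Ω : Set E3} (hΩ : MeasurableSet Ω) (h : E3) :
    MeasurableSet (overlap Ω h) := hΩ.inter (measurable_add_const h hΩ)

/-- The difference of `H` in the space variable, restricted to pairs of points of `Ω`. -/
def innerDiff (Ω : Set E3) (h : E3) (H : E3 × E3 → ℝ) (p : E3 × E3) : ℝ :=
  (overlap Ω h).indicator (fun x => H (x + h, p.2) - H (x, p.2)) p.1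

theorem innerDiff_of_mem {Ω : Set E3} {h : E3} {H : E3 × E3 → ℝ} {p : E3 × E3}
    (hp : p.1 ∈ overlap Ω h) : innerDiff Ω h H p = H (p.1 + h, p.2) - H p :=
  indicator_of_mem hp _

theorem innerDiff_of_notMem {Ω : Set E3} {h : E3} {H : E3 × E3 → ℝ} {p : E3 × E3}
    (hp : p.1 ∉ overlap Ω h) : innerDiff Ω h H p = 0 := indicator_of_notMem hp _

theorem measurable_innerDiff {Ω : Set E3} (hΩ : MeasurableSet Ω) (h : E3) {H : E3 × E3 → ℝ}
    (hH : Measurable H) : Measurable (innerDiff Ω h H) := by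
  have h1 : Measurable fun p : E3 × E3 => H (p.1 + h, p.2) - H (p.1, p.2) := by
    have := hH.comp (by fun_prop : Measurable fun p : E3 × E3 => (p.1 + h, p.2))
    exact this.sub hH
  refine (congrArg Measurable ?_).mp
    (h1.indicator (measurable_fst (measurableSet_overlap hΩ h)))
  ext p
  rfl

theorem measurable_duhamelTerm {D : ℝ} {ν : E3 → ℝ} (hν : Measurable ν) {H : E3 × E3 → ℝ}
    (hH : Measurable H) : Measurable (duhamelTerm D ν H) := by
  have hs : MeasurableSet {p : (E3 × E3) × ℝ | 0 < p.2 ∧ p.2 ≤ D / ‖p.1.2‖} :=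
    (measurableSet_lt measurable_const measurable_snd).inter
      (measurableSet_le measurable_snd (by fun_prop))
  have hm : Measurable fun p : (E3 × E3) × ℝ =>
      Real.exp (-ν p.1.2 * p.2) * H (p.1.1 - p.2 • p.1.2, p.1.2) := by
    have h1 := hH.comp
      (by fun_prop : Measurable fun p : (E3 × E3) × ℝ => (p.1.1 - p.2 • p.1.2, p.1.2))
    have h2 : Measurable fun p : (E3 × E3) × ℝ => Real.exp (-ν p.1.2 * p.2) := by fun_prop
    exact h2.mul h1
  have := ((hm.indicator hs).stronglyMeasurable.integral_prod_right'
    (ν := (volume : Measure ℝ))).measurable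
  refine (congrArg Measurable ?_).mp this
  ext p
  unfold duhamelTerm
  rw [← integral_indicator measurableSet_Ioc]
  rfl

/-- Both exit times are integrals of the indicator of `Ω` over the same interval, and the integrands
differ only where membership changes under the translation, that is, where `jump` is at least one.
-/
theorem enorm_backTime_sub_le {Ω : Set E3} (hΩ : MeasurableSet Ω) {D : ℝ} (x h v : E3) :
    ‖backTime Ω D (x + h) v - backTime Ω D x v‖ₑ
      ≤ ∫⁻ s in Ioc 0 (D / ‖v‖), jump Ω h (x - s • v) := by
  have hfin : ∀ y : E3, ∫⁻ s in Ioc 0 (D / ‖v‖), Ω.indicator (1 : E3 → ENNReal) (y - s • v) ≠ ⊤ := by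
    intro y
    refine ne_top_of_le_ne_top (b := ∫⁻ s in Ioc 0 (D / ‖v‖), 1) (by simp) ?_
    exact lintegral_mono fun s => indicator_le_self' (fun _ _ => zero_le) _
  have hle : ∀ (y y' : E3) (j : ENNReal), (¬(y ∈ Ω ↔ y' ∈ Ω) → 1 ≤ j) →
      Ω.indicator (1 : E3 → ENNReal) y ≤ Ω.indicator 1 y' + j := by
    intro y y' j hj
    by_cases h1 : y ∈ Ω
    · by_cases h2 : y' ∈ Ω
      · simp [h1, h2]
      · simpa [h1, h2] using hj (by tauto)
    · simp [h1]
  have e : ∀ s : ℝ, x + h - s • v = x - s • v + h := fun s => by abel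
  set a := ∫⁻ s in Ioc 0 (D / ‖v‖), Ω.indicator (1 : E3 → ENNReal) (x + h - s • v) with ha
  set b := ∫⁻ s in Ioc 0 (D / ‖v‖), Ω.indicator (1 : E3 → ENNReal) (x - s • v) with hb
  set c := ∫⁻ s in Ioc 0 (D / ‖v‖), jump Ω h (x - s • v) with hc
  have hjm : Measurable fun s : ℝ => jump Ω h (x - s • v) := by
    have := (measurable_jump hΩ h).comp (by fun_prop : Measurable fun s : ℝ => x - s • v)
    exact this
  have hab : a ≤ b + c := by
    rw [hb, hc, ← lintegral_add_right _ hjm]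
    refine lintegral_mono fun s => ?_
    rw [e s]
    exact hle _ _ _ fun hne => one_le_jump fun hiff => hne hiff.symm
  have hba : b ≤ a + c := by
    rw [ha, hc, ← lintegral_add_right _ hjm]
    refine lintegral_mono fun s => ?_
    rw [e s]
    exact hle _ _ _ one_le_jump
  have hbt : backTime Ω D (x + h) v - backTime Ω D x v = a.toReal - b.toReal := rfl
  rw [hbt, Real.enorm_eq_ofReal_abs]
  have haf : a ≠ ⊤ := hfin _
  have hbf : b ≠ ⊤ := hfin _
  rcases le_total b a with hl | hl
  · rw [abs_of_nonneg (sub_nonneg.2 (ENNReal.toReal_mono haf hl)), ← ENNReal.toReal_sub_of_le hl haf,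
      ENNReal.ofReal_toReal (ENNReal.sub_ne_top haf)]
    exact tsub_le_iff_left.2 hab
  · rw [abs_sub_comm, abs_of_nonneg (sub_nonneg.2 (ENNReal.toReal_mono hbf hl)),
      ← ENNReal.toReal_sub_of_le hl hbf, ENNReal.ofReal_toReal (ENNReal.sub_ne_top hbf)]
    exact tsub_le_iff_left.2 hba

/-- Interpolation between the size and the Lipschitz bound of a difference. -/
theorem sq_le_interpolate {d C E Q η ε : ℝ} (hC : 0 < C) (hE : 0 ≤ E) (hQ : 0 ≤ Q) (hη : 0 < η)
    (hε : 0 < ε) (hε1 : ε ≤ 1) (h1 : |d| ≤ 2 * C * E) (h2 : |d| ≤ C * Q) :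
    d ^ 2 ≤ (2 * C) ^ (2 : ℝ) * E ^ (2 * ε) * (η ^ (2 - 2 * ε) + η ^ (-(2 * ε)) * Q ^ 2) := by
  have hd : d ^ 2 = |d| ^ (2 * ε) * |d| ^ (2 - 2 * ε) := by
    rcases eq_or_ne d 0 with rfl | hd0
    · rw [abs_zero, Real.zero_rpow (by positivity)]; ring
    · rw [← Real.rpow_add (abs_pos.2 hd0), ← sq_abs, ← Real.rpow_two]; ring_nf
  have e1 : |d| ^ (2 * ε) ≤ (2 * C) ^ (2 * ε) * E ^ (2 * ε) := by
    rw [← Real.mul_rpow (by positivity) hE]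
    exact Real.rpow_le_rpow (abs_nonneg _) h1 (by positivity)
  have e2 : |d| ^ (2 - 2 * ε) ≤ (2 * C) ^ (2 - 2 * ε) * Q ^ (2 - 2 * ε) := by
    rw [← Real.mul_rpow (by positivity) hQ]
    refine Real.rpow_le_rpow (abs_nonneg _) (h2.trans ?_) (by linarith)
    nlinarith [mul_nonneg hC.le hQ]
  have e3 : Q ^ (2 - 2 * ε) ≤ η ^ (2 - 2 * ε) + η ^ (-(2 * ε)) * Q ^ 2 := by
    rcases le_total Q η with hQη | hQη
    · have := Real.rpow_le_rpow hQ hQη (by linarith : 0 ≤ 2 - 2 * ε)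
      have h3 : 0 ≤ η ^ (-(2 * ε)) * Q ^ 2 := by positivity
      linarith
    · have hQ0 : 0 < Q := hη.trans_le hQη
      have h3 : 0 ≤ η ^ (2 - 2 * ε) := by positivity
      have h4 : Q ^ (2 - 2 * ε) = Q ^ (-(2 * ε)) * Q ^ 2 := by
        rw [← Real.rpow_two, ← Real.rpow_add hQ0]; ring_nf
      have h5 : Q ^ (-(2 * ε)) ≤ η ^ (-(2 * ε)) :=
        Real.rpow_le_rpow_of_nonpos hη hQη (by linarith)
      rw [h4]
      have := mul_le_mul_of_nonneg_right h5 (sq_nonneg Q)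
      linarith
  rw [hd]
  have hCC : (2 * C) ^ (2 * ε) * (2 * C) ^ (2 - 2 * ε) = (2 * C) ^ (2 : ℝ) := by
    rw [← Real.rpow_add (by positivity)]; ring_nf
  calc |d| ^ (2 * ε) * |d| ^ (2 - 2 * ε)
      ≤ ((2 * C) ^ (2 * ε) * E ^ (2 * ε)) * ((2 * C) ^ (2 - 2 * ε) * Q ^ (2 - 2 * ε)) :=
        mul_le_mul e1 e2 (by positivity) (by positivity)
    _ = (2 * C) ^ (2 : ℝ) * E ^ (2 * ε) * Q ^ (2 - 2 * ε) := by rw [← hCC]; ring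
    _ ≤ _ := mul_le_mul_of_nonneg_left e3 (by positivity)

/-- The pointwise estimate of the difference of the contribution of the incoming data. -/
theorem boundary_term_diff_sq_le {A C E N η ε ν τ₁ τ₂ g₁ g₂ Q : ℝ} (hC : 0 < C) (hA : 0 ≤ A)
    (hE : 0 ≤ E) (hE1 : E ≤ 1)
    (hN : 1 ≤ N) (hη : 0 < η) (hη1 : η ≤ 1) (hε : 0 < ε) (hε1 : ε ≤ 1) (hν : 0 ≤ ν)
    (hνN : ν ≤ A * N) (hτ₁ : 0 ≤ τ₁) (hτ₂ : 0 ≤ τ₂) (hg₁ : |g₁| ≤ C * E) (hg₂ : |g₂| ≤ C * E)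
    (hg : |g₁ - g₂| ≤ C * Q) (hQ0 : 0 ≤ Q) (hQ : Q ≤ η + N * |τ₁ - τ₂|) :
    (Real.exp (-ν * τ₁) * g₁ - Real.exp (-ν * τ₂) * g₂) ^ 2
      ≤ (2 * A ^ 2 * C ^ 2 + 6 * (2 * C) ^ (2 : ℝ)) * E ^ (2 * ε) *
        (η ^ (2 - 2 * ε) + η ^ (-(2 * ε)) * N ^ 2 * (τ₁ - τ₂) ^ 2) := by
  have hexp : |Real.exp (-ν * τ₁) - Real.exp (-ν * τ₂)| ≤ ν * |τ₁ - τ₂| := by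
    have aux : ∀ a b : ℝ, 0 ≤ a → a ≤ b →
        |Real.exp (-ν * a) - Real.exp (-ν * b)| ≤ ν * |a - b| := by
      intro a b ha hab
      have h1 : Real.exp (-ν * b) ≤ Real.exp (-ν * a) := 
        Real.exp_le_exp.2 (by linarith [mul_le_mul_of_nonneg_left hab hν])
      rw [abs_of_nonneg (by linarith), abs_sub_comm, abs_of_nonneg (by linarith)]
      have h2 : Real.exp (-ν * b) = Real.exp (-ν * a) * Real.exp (-(ν * (b - a))) := by
        rw [← Real.exp_add]; ring_nf
      have h3 := Real.add_one_le_exp (-(ν * (b - a)))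
      have h4 : Real.exp (-ν * a) ≤ 1 := Real.exp_le_one_iff.2 (by linarith [mul_nonneg hν ha])
      have h5 := Real.exp_pos (-ν * a)
      have h6 : 0 ≤ ν * (b - a) := mul_nonneg hν (by linarith)
      rw [h2]
      have h7 := mul_le_mul_of_nonneg_left h3 h5.le
      have h8 := mul_le_mul_of_nonneg_right h4 h6
      linarith
    rcases le_total τ₁ τ₂ with h | h
    · exact aux _ _ hτ₁ h
    · rw [abs_sub_comm, abs_sub_comm τ₁]; exact aux _ _ hτ₂ h
  have hη2 : 1 ≤ η ^ (-(2 * ε)) := Real.one_le_rpow_of_pos_of_le_one_of_nonpos hη hη1 (by linarith)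
  have hEE : E ^ 2 ≤ E ^ (2 * ε) := by
    rcases hE.eq_or_lt with rfl | hE0
    · rw [Real.zero_rpow (by positivity)]; norm_num
    · rw [← Real.rpow_two]
      exact Real.rpow_le_rpow_of_exponent_ge hE0 hE1 (by linarith)
  have hηη : η ^ (-(2 * ε)) * η ^ 2 = η ^ (2 - 2 * ε) := by
    rw [← Real.rpow_two, ← Real.rpow_add hη]; ring_nf
  set δ := |τ₁ - τ₂| with hδ
  have hδ2 : (τ₁ - τ₂) ^ 2 = δ ^ 2 := (sq_abs _).symm
  have hδ0 : 0 ≤ δ := abs_nonneg _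
  set d := g₁ - g₂ with hd
  have hd1 : |d| ≤ 2 * C * E := by
    have := abs_sub g₁ g₂
    linarith
  have hint := sq_le_interpolate hC hE hQ0 hη hε hε1 hd1 hg
  set X := η ^ (-(2 * ε)) with hX
  set Y := η ^ (2 - 2 * ε) with hY
  have hY0 : 0 ≤ Y := by positivity
  have hX0 : 0 ≤ X := by positivity
  have hN2 : 0 ≤ N ^ 2 * δ ^ 2 := by positivity
  have hQ2 : Q ^ 2 ≤ 2 * η ^ 2 + 2 * (N ^ 2 * δ ^ 2) := by
    have h1 : Q ^ 2 ≤ (η + N * δ) ^ 2 := pow_le_pow_left₀ hQ0 hQ 2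
    have h2 : 2 * η ^ 2 + 2 * (N ^ 2 * δ ^ 2) - (η + N * δ) ^ 2 = (η - N * δ) ^ 2 := by ring
    linarith [sq_nonneg (η - N * δ)]
  have hd2 : d ^ 2 ≤ (2 * C) ^ (2 : ℝ) * E ^ (2 * ε) * (3 * (Y + X * N ^ 2 * δ ^ 2)) := by
    refine hint.trans (mul_le_mul_of_nonneg_left ?_ (by positivity))
    have h1 := mul_le_mul_of_nonneg_left hQ2 hX0
    have h2 : 0 ≤ X * (N ^ 2 * δ ^ 2) := by positivity
    have h5 : X * N ^ 2 * δ ^ 2 = X * (N ^ 2 * δ ^ 2) := by ring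
    have h6 : X * (2 * η ^ 2 + 2 * (N ^ 2 * δ ^ 2)) = 2 * (X * η ^ 2) + 2 * (X * (N ^ 2 * δ ^ 2)) := by
      ring
    linarith
  have hfirst : ((Real.exp (-ν * τ₁) - Real.exp (-ν * τ₂)) * g₁) ^ 2
      ≤ A ^ 2 * C ^ 2 * E ^ (2 * ε) * (Y + X * N ^ 2 * δ ^ 2) := by
    have h1 : |(Real.exp (-ν * τ₁) - Real.exp (-ν * τ₂)) * g₁| ≤ (A * N * δ) * (C * E) := by
      rw [abs_mul]
      refine mul_le_mul (hexp.trans ?_) hg₁ (abs_nonneg _) (by positivity)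
      exact mul_le_mul_of_nonneg_right hνN hδ0
    have h2 : ((Real.exp (-ν * τ₁) - Real.exp (-ν * τ₂)) * g₁) ^ 2 ≤ ((A * N * δ) * (C * E)) ^ 2 := by
      rw [← sq_abs]; exact pow_le_pow_left₀ (abs_nonneg _) h1 2
    refine h2.trans ?_
    have h3 : ((A * N * δ) * (C * E)) ^ 2 = A ^ 2 * C ^ 2 * E ^ 2 * (N ^ 2 * δ ^ 2) := by ring
    rw [h3]
    refine mul_le_mul (mul_le_mul_of_nonneg_left hEE (by positivity)) ?_ hN2 (by positivity)
    have h4 := mul_le_mul_of_nonneg_right hη2 hN2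
    have h5 : X * N ^ 2 * δ ^ 2 = X * (N ^ 2 * δ ^ 2) := by ring
    linarith
  have hsecond : (Real.exp (-ν * τ₂) * d) ^ 2 ≤ d ^ 2 := by
    rw [mul_pow]
    have h4 : Real.exp (-ν * τ₂) ≤ 1 := Real.exp_le_one_iff.2 (by linarith [mul_nonneg hν hτ₂])
    refine mul_le_of_le_one_left (sq_nonneg _) ?_
    exact pow_le_one₀ (Real.exp_pos _).le h4
  -- The damping factor is Lipschitz in the exit time and is multiplied by Gaussian data. The
  -- difference of the data has only an undamped Lipschitz bound, so it goes through the
  -- interpolation to retain the factor `E^(2ε)`.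
  have hsum : Real.exp (-ν * τ₁) * g₁ - Real.exp (-ν * τ₂) * g₂
      = (Real.exp (-ν * τ₁) - Real.exp (-ν * τ₂)) * g₁ + Real.exp (-ν * τ₂) * d := by
    rw [hd]; ring
  rw [hsum, hδ2]
  set α := (Real.exp (-ν * τ₁) - Real.exp (-ν * τ₂)) * g₁
  set β := Real.exp (-ν * τ₂) * d
  have h7 : (α + β) ^ 2 ≤ 2 * α ^ 2 + 2 * β ^ 2 := by
    have h8 : 2 * α ^ 2 + 2 * β ^ 2 - (α + β) ^ 2 = (α - β) ^ 2 := by ring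
    linarith [sq_nonneg (α - β)]
  calc (α + β) ^ 2 ≤ 2 * α ^ 2 + 2 * β ^ 2 := h7
    _ ≤ 2 * (A ^ 2 * C ^ 2 * E ^ (2 * ε) * (Y + X * N ^ 2 * δ ^ 2))
        + 2 * ((2 * C) ^ (2 : ℝ) * E ^ (2 * ε) * (3 * (Y + X * N ^ 2 * δ ^ 2))) := by
        linarith [hfirst, hsecond.trans hd2]
    _ = _ := by ring


/-! ### The contribution of the incoming data -/

theorem lintegral_one_add_norm_rpow_lt_top :
    ∫⁻ v : E3, ENNReal.ofReal ((1 + ‖v‖) ^ (-4 : ℝ)) < ⊤ :=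
  (integrable_one_add_norm (E := E3) (μ := volume) (r := 4) (by simp; norm_num)).lintegral_lt_top

/-- The contribution of the incoming data to the solution. -/
def boundaryTerm (Ω : Set E3) (D : ℝ) (ν : E3 → ℝ) (k f : E3 × E3 → ℝ) (p : E3 × E3) : ℝ :=
  f p - duhamelTerm D ν (source Ω k f) p

namespace IsMildSolution

variable {Ω : Set E3} {D A : ℝ} {ν : E3 → ℝ} {k f g : E3 × E3 → ℝ}

theorem measurable_boundaryTerm (h : IsMildSolution Ω D A ν k f g) :
    Measurable (boundaryTerm Ω D ν k f) :=
  h.measurable.sub (measurable_duhamelTerm h.measurable_freq h.measurable_source)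

theorem volume_lt_top (h : IsMildSolution Ω D A ν k f g) : volume Ω < ⊤ :=
  h.isBounded.measure_lt_top

/-- The two boundary points reached from `x + b` and `x` differ by at most `|b|` plus `|v|` times
the difference of exit times. Interpolating the Lipschitz bound of the data with their Gaussian
bound keeps a small power of the Gaussian, which dominates any polynomial weight in `v`. -/
theorem exists_ae_boundaryTerm_diff_le (h : IsMildSolution Ω D A ν k f g) {ε : ℝ} (hε : 0 < ε)
    (hε1 : ε ≤ 1) (m : ℝ) :
    ∃ C : ℝ, 0 < C ∧ ∀ b : E3, b ≠ 0 → ‖b‖ ≤ 1 → ∀ᵐ v : E3, ∀ᵐ x : E3,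
      ENNReal.ofReal ((1 + ‖v‖) ^ m) * ‖innerDiff Ω b (boundaryTerm Ω D ν k f) (x, v)‖ₑ ^ 2
        ≤ Ω.indicator (fun _ => ENNReal.ofReal (C * ‖b‖ ^ (2 - 2 * ε)) *
            ENNReal.ofReal ((1 + ‖v‖) ^ (-4 : ℝ))) x
          + ENNReal.ofReal (C * ‖b‖ ^ (-(2 * ε))) * (ENNReal.ofReal ((1 + ‖v‖) ^ 2)⁻¹ *
            (∫⁻ s in Ioc 0 (D / ‖v‖), jump Ω b (x - s • v)) ^ 2) := by
  obtain ⟨a, C, ha, hC, hg, hgL⟩ := h.data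
  obtain ⟨C7, hC7, hexp⟩ := exists_exp_neg_mul_sq_le (2 * ε * a) (m + 4) (by positivity)
  have hA := h.A_pos
  set C6 := 2 * A ^ 2 * C ^ 2 + 6 * (2 * C) ^ (2 : ℝ) with hC6
  have hC6' : 0 < C6 := by positivity
  refine ⟨C6 * C7, by positivity, fun b hb hb1 => ?_⟩
  have hb0 : 0 < ‖b‖ := norm_pos_iff.2 hb
  filter_upwards [h.mild] with v hv
  have hv' : ∀ᵐ x : E3, x + b ∈ Ω →
      (x + b - backTime Ω D (x + b) v • v, v) ∈ incoming Ω ∧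
      f (x + b, v) = Real.exp (-ν v * backTime Ω D (x + b) v)
          * g (x + b - backTime Ω D (x + b) v • v, v)
        + duhamelTerm D ν (source Ω k f) (x + b, v) :=
    (measurePreserving_add_right (volume : Measure E3) b).quasiMeasurePreserving.ae hv
  filter_upwards [hv, hv'] with x hx hx'
  by_cases hxo : x ∈ overlap Ω b
  swap
  · rw [innerDiff_of_notMem hxo]; simp
  obtain ⟨i1, e1⟩ := hx hxo.1
  obtain ⟨i2, e2⟩ := hx' hxo.2
  have hj := enorm_backTime_sub_le h.isOpen.measurableSet (D := D) x b v
  set τ₁ := backTime Ω D (x + b) v with hτ₁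
  set τ₂ := backTime Ω D x v with hτ₂
  have hJ : innerDiff Ω b (boundaryTerm Ω D ν k f) (x, v)
      = Real.exp (-ν v * τ₁) * g (x + b - τ₁ • v, v) - Real.exp (-ν v * τ₂) * g (x - τ₂ • v, v) := by
    rw [innerDiff_of_mem hxo]
    unfold boundaryTerm
    simp only
    rw [e1, e2]; ring
  have hE1 : Real.exp (-a * ‖v‖ ^ 2) ≤ 1 := by
    rw [Real.exp_le_one_iff]
    have : 0 ≤ a * ‖v‖ ^ 2 := by positivity
    linarith
  have hQ : ‖x + b - τ₁ • v - (x - τ₂ • v)‖ ≤ ‖b‖ + (1 + ‖v‖) * |τ₁ - τ₂| := by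
    have e3 : x + b - τ₁ • v - (x - τ₂ • v) = b - (τ₁ - τ₂) • v := by module
    rw [e3]
    refine (_root_.norm_sub_le _ _).trans ?_
    rw [norm_smul, Real.norm_eq_abs]
    have := abs_nonneg (τ₁ - τ₂)
    linarith
  have key := boundary_term_diff_sq_le (η := ‖b‖) (N := 1 + ‖v‖) (ε := ε) hC hA.le
    (Real.exp_pos _).le hE1 (by linarith [norm_nonneg v]) hb0 hb1 hε hε1 (h.freq_nonneg v)
    (h.freq_le v) (τ₁ := τ₁) (τ₂ := τ₂) ENNReal.toReal_nonneg ENNReal.toReal_nonneg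
    (hg _ _ i2) (hg _ _ i1) (hgL _ _ _ i2 i1) (norm_nonneg _) hQ
  rw [← hJ, ← hC6] at key
  have hN : 0 < 1 + ‖v‖ := by positivity
  have hEexp : (Real.exp (-a * ‖v‖ ^ 2)) ^ (2 * ε) ≤ C7 * (1 + ‖v‖) ^ (-(m + 4)) := by
    rw [← Real.exp_mul]
    refine le_trans (le_of_eq ?_) (hexp ‖v‖ (norm_nonneg v))
    ring_nf
  have hreal : (1 + ‖v‖) ^ m * innerDiff Ω b (boundaryTerm Ω D ν k f) (x, v) ^ 2
      ≤ C6 * C7 * ‖b‖ ^ (2 - 2 * ε) * (1 + ‖v‖) ^ (-4 : ℝ)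
        + C6 * C7 * ‖b‖ ^ (-(2 * ε)) * (((1 + ‖v‖) ^ 2)⁻¹ * (τ₁ - τ₂) ^ 2) := by
    calc (1 + ‖v‖) ^ m * innerDiff Ω b (boundaryTerm Ω D ν k f) (x, v) ^ 2
        ≤ (1 + ‖v‖) ^ m * (C6 * (C7 * (1 + ‖v‖) ^ (-(m + 4))) *
          (‖b‖ ^ (2 - 2 * ε) + ‖b‖ ^ (-(2 * ε)) * (1 + ‖v‖) ^ 2 * (τ₁ - τ₂) ^ 2)) := by
          refine mul_le_mul_of_nonneg_left (key.trans ?_) (by positivity)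
          refine mul_le_mul_of_nonneg_right ?_ (by positivity)
          exact mul_le_mul_of_nonneg_left hEexp hC6'.le
      _ = C6 * C7 * ((1 + ‖v‖) ^ m * (1 + ‖v‖) ^ (-(m + 4))) *
          (‖b‖ ^ (2 - 2 * ε) + ‖b‖ ^ (-(2 * ε)) * (1 + ‖v‖) ^ 2 * (τ₁ - τ₂) ^ 2) := by ring
      _ = C6 * C7 * (1 + ‖v‖) ^ (-4 : ℝ) *
          (‖b‖ ^ (2 - 2 * ε) + ‖b‖ ^ (-(2 * ε)) * (1 + ‖v‖) ^ 2 * (τ₁ - τ₂) ^ 2) := by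
          rw [← Real.rpow_add hN]; ring_nf
      _ = C6 * C7 * ‖b‖ ^ (2 - 2 * ε) * (1 + ‖v‖) ^ (-4 : ℝ)
        + C6 * C7 * ‖b‖ ^ (-(2 * ε)) * (((1 + ‖v‖) ^ (-4 : ℝ) * (1 + ‖v‖) ^ 2) * (τ₁ - τ₂) ^ 2) := by
          ring
      _ = _ := by
          have : (1 + ‖v‖) ^ (-4 : ℝ) * (1 + ‖v‖) ^ 2 = ((1 + ‖v‖) ^ 2)⁻¹ := by
            rw [Real.rpow_neg hN.le, show (4 : ℝ) = ((4 : ℕ) : ℝ) by norm_num, Real.rpow_natCast]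
            field_simp
          rw [this]
  have hsq : ‖innerDiff Ω b (boundaryTerm Ω D ν k f) (x, v)‖ₑ ^ 2
      = ENNReal.ofReal (innerDiff Ω b (boundaryTerm Ω D ν k f) (x, v) ^ 2) := by
    rw [Real.enorm_eq_ofReal_abs, ← ENNReal.ofReal_pow (abs_nonneg _), sq_abs]
  rw [hsq, ← ENNReal.ofReal_mul (by positivity), indicator_of_mem hxo.1]
  refine (ENNReal.ofReal_le_ofReal hreal).trans ?_
  rw [ENNReal.ofReal_add (by positivity) (by positivity)]
  refine add_le_add (le_of_eq (ENNReal.ofReal_mul (by positivity))) ?_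
  rw [ENNReal.ofReal_mul (by positivity)]
  refine mul_le_mul' le_rfl ?_
  rw [ENNReal.ofReal_mul (by positivity)]
  refine mul_le_mul' le_rfl ?_
  rw [← sq_abs, ENNReal.ofReal_pow (abs_nonneg _), ← Real.enorm_eq_ofReal_abs]
  exact pow_le_pow_left' hj 2

theorem exists_lintegral_boundaryTerm_diff_le (h : IsMildSolution Ω D A ν k f g) {ε : ℝ}
    (hε : 0 < ε) (hε1 : ε ≤ 1) (m : ℝ) :
    ∃ C : ℝ, 0 < C ∧ ∀ b : E3, b ≠ 0 → ‖b‖ ≤ 1 →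
      ∫⁻ v, ENNReal.ofReal ((1 + ‖v‖) ^ m) *
        ∫⁻ x, ‖innerDiff Ω b (boundaryTerm Ω D ν k f) (x, v)‖ₑ ^ 2
        ≤ ENNReal.ofReal (C * ‖b‖ ^ (2 - 3 * ε)) := by
  obtain ⟨C1, hC1, h1⟩ := h.exists_ae_boundaryTerm_diff_le hε hε1 m
  obtain ⟨C2, hC2, h2⟩ := exists_lintegral_sq_ray_jump_le h.isOpen.measurableSet h.convex
    h.isBounded hε hε1 h.D_pos.le
  set I := ∫⁻ v : E3, ENNReal.ofReal ((1 + ‖v‖) ^ (-4 : ℝ)) with hI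
  have hIt : I < ⊤ := lintegral_one_add_norm_rpow_lt_top
  have hV := h.volume_lt_top
  refine ⟨C1 * I.toReal * (volume Ω).toReal + C1 * C2, by positivity, fun b hb hb1 => ?_⟩
  have hb0 : 0 < ‖b‖ := norm_pos_iff.2 hb
  have hstep : ∫⁻ v, ENNReal.ofReal ((1 + ‖v‖) ^ m) *
        ∫⁻ x, ‖innerDiff Ω b (boundaryTerm Ω D ν k f) (x, v)‖ₑ ^ 2
      ≤ ∫⁻ v, (ENNReal.ofReal (C1 * ‖b‖ ^ (2 - 2 * ε)) *
            ENNReal.ofReal ((1 + ‖v‖) ^ (-4 : ℝ)) * volume Ω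
          + ENNReal.ofReal (C1 * ‖b‖ ^ (-(2 * ε))) * ∫⁻ x, ENNReal.ofReal ((1 + ‖v‖) ^ 2)⁻¹ *
            (∫⁻ s in Ioc 0 (D / ‖v‖), jump Ω b (x - s • v)) ^ 2) := by
    refine lintegral_mono_ae ?_
    filter_upwards [h1 b hb hb1] with v hv
    rw [← lintegral_const_mul' _ _ ENNReal.ofReal_ne_top]
    refine (lintegral_mono_ae hv).trans ?_
    rw [lintegral_add_left (measurable_const.indicator h.isOpen.measurableSet),
      lintegral_indicator h.isOpen.measurableSet, setLIntegral_const,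
      lintegral_const_mul' _ _ ENNReal.ofReal_ne_top]
  refine hstep.trans ?_
  rw [lintegral_add_left (by fun_prop), lintegral_mul_const' _ _ hV.ne,
    lintegral_const_mul' _ _ ENNReal.ofReal_ne_top, lintegral_const_mul' _ _ ENNReal.ofReal_ne_top,
    ← hI]
  refine (add_le_add le_rfl (mul_le_mul' le_rfl (h2 b hb1))).trans ?_
  rw [← ENNReal.ofReal_toReal hIt.ne, ← ENNReal.ofReal_toReal hV.ne,
    ENNReal.toReal_ofReal ENNReal.toReal_nonneg, ENNReal.toReal_ofReal ENNReal.toReal_nonneg,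
    ← ENNReal.ofReal_mul (by positivity), ← ENNReal.ofReal_mul (by positivity),
    ← ENNReal.ofReal_mul (by positivity), ← ENNReal.ofReal_add (by positivity) (by positivity)]
  refine ENNReal.ofReal_le_ofReal ?_
  have e1 : ‖b‖ ^ (2 - 2 * ε) ≤ ‖b‖ ^ (2 - 3 * ε) :=
    Real.rpow_le_rpow_of_exponent_ge hb0 hb1 (by linarith)
  -- The loss of `3ε` is the `2ε` of the interpolation plus the `ε` of the estimate for rays in the
  -- boundary layer.
  have e2 : ‖b‖ ^ (-(2 * ε)) * ‖b‖ ^ (2 - ε) = ‖b‖ ^ (2 - 3 * ε) := by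
    rw [← Real.rpow_add hb0]; ring_nf
  calc C1 * ‖b‖ ^ (2 - 2 * ε) * I.toReal * (volume Ω).toReal
        + C1 * ‖b‖ ^ (-(2 * ε)) * (C2 * ‖b‖ ^ (2 - ε))
      = C1 * I.toReal * (volume Ω).toReal * ‖b‖ ^ (2 - 2 * ε)
        + C1 * C2 * (‖b‖ ^ (-(2 * ε)) * ‖b‖ ^ (2 - ε)) := by ring
    _ ≤ C1 * I.toReal * (volume Ω).toReal * ‖b‖ ^ (2 - 3 * ε)
        + C1 * C2 * ‖b‖ ^ (2 - 3 * ε) := by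
        rw [e2]
        exact add_le_add (mul_le_mul_of_nonneg_left e1 (by positivity)) le_rfl
    _ = _ := by ring

end IsMildSolution


/-! ### Weighted masses and velocity averages -/

/-- The velocity weight `(1 + |v|)^m |v|⁻²`. -/
def wt (m : ℝ) (v : E3) : ENNReal := ENNReal.ofReal ((1 + ‖v‖) ^ m * (‖v‖ ^ 2)⁻¹)

theorem measurable_wt (m : ℝ) : Measurable (wt m) := by
  unfold wt; fun_prop

theorem wt_ne_top (m : ℝ) (v : E3) : wt m v ≠ ⊤ := ENNReal.ofReal_ne_top

theorem wt_ne_zero (m : ℝ) {v : E3} (hv : v ≠ 0) : wt m v ≠ 0 := by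
  have : 0 < ‖v‖ := norm_pos_iff.2 hv
  exact (ENNReal.ofReal_pos.2 (by positivity)).ne'

theorem ofReal_rpow_mul_wt (q m : ℝ) (v : E3) :
    ENNReal.ofReal ((1 + ‖v‖) ^ q) * wt m v = wt (m + q) v := by
  unfold wt
  rw [← ENNReal.ofReal_mul (by positivity), Real.rpow_add (by positivity)]
  congr 1; ring

theorem lintegral_wt_lt_top : ∫⁻ v, wt (-4) v < ⊤ := by
  have h1 := lintegral_ball_norm_rpow_lt_top (p := 2) (by norm_num) 1
  have h2 := lintegral_one_add_norm_rpow_lt_top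
  refine lt_of_le_of_lt (b := (∫⁻ v, (Metric.ball (0 : E3) 1).indicator
    (fun v => ENNReal.ofReal (‖v‖ ^ (-2 : ℝ))) v) + ∫⁻ v : E3, ENNReal.ofReal ((1 + ‖v‖) ^ (-4 : ℝ)))
    ?_ (ENNReal.add_lt_top.2 ⟨by rwa [lintegral_indicator measurableSet_ball], h2⟩)
  rw [← lintegral_add_left (Measurable.indicator (by fun_prop) measurableSet_ball)]
  refine lintegral_mono fun v => ?_
  unfold wt
  by_cases hv : v ∈ Metric.ball (0 : E3) 1
  · rw [indicator_of_mem hv]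
    refine le_add_right (ENNReal.ofReal_le_ofReal ?_)
    rw [Real.rpow_neg (norm_nonneg v), Real.rpow_two]
    refine mul_le_of_le_one_left (by positivity) ?_
    exact Real.rpow_le_one_of_one_le_of_nonpos (by linarith [norm_nonneg v]) (by norm_num)
  · refine le_add_left (ENNReal.ofReal_le_ofReal ?_)
    rw [mem_ball_zero_iff, not_lt] at hv
    refine mul_le_of_le_one_right (by positivity) ?_
    exact inv_le_one_of_one_le₀ (one_le_pow₀ hv)

/-- The weighted square mass of a function of position and velocity. -/
def wtMass (m : ℝ) (H : E3 × E3 → ℝ) : ENNReal := ∫⁻ v, wt m v * ∫⁻ y, ‖H (y, v)‖ₑ ^ 2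

/-- Since `|w|² ≤ 2(|v|² + |v-w|²)`, the product of two singularities at distance `|w|` is
controlled by `|w|⁻²` times their sum, and each summand is integrable on its own. -/
theorem inv_sq_mul_inv_sq_le (v w : E3) (hw : w ≠ 0) :
    (‖v‖ ^ 2)⁻¹ * (‖v - w‖ ^ 2)⁻¹ ≤ 2 * (‖w‖ ^ 2)⁻¹ * ((‖v‖ ^ 2)⁻¹ + (‖v - w‖ ^ 2)⁻¹) := by
  have hw0 : 0 < ‖w‖ := norm_pos_iff.2 hw
  rcases eq_or_ne v 0 with rfl | hv
  · simp; positivity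
  rcases eq_or_ne (v - w) 0 with hvw | hvw
  · rw [hvw]; simp; positivity
  have hv0 : 0 < ‖v‖ := norm_pos_iff.2 hv
  have hvw0 : 0 < ‖v - w‖ := norm_pos_iff.2 hvw
  have h1 : ‖w‖ ≤ ‖v‖ + ‖v - w‖ := by
    have := norm_sub_le v (v - w)
    rwa [sub_sub_cancel] at this
  have h2 : ‖w‖ ^ 2 ≤ 2 * (‖v‖ ^ 2 + ‖v - w‖ ^ 2) := by
    have := pow_le_pow_left₀ hw0.le h1 2
    nlinarith [sq_nonneg (‖v‖ - ‖v - w‖)]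
  have h3 : 2 * (‖w‖ ^ 2)⁻¹ * ((‖v‖ ^ 2)⁻¹ + (‖v - w‖ ^ 2)⁻¹)
      = ((‖v‖ ^ 2)⁻¹ * (‖v - w‖ ^ 2)⁻¹) * (2 * (‖v‖ ^ 2 + ‖v - w‖ ^ 2) / ‖w‖ ^ 2) := by
    field_simp
    ring
  rw [h3]
  refine le_mul_of_one_le_right (by positivity) ?_
  rwa [le_div_iff₀ (by positivity), one_mul]

/-- The Gaussian smooths the singularity of the weight, so the incoming contribution needs to be
estimated only with a polynomial weight. -/
theorem exists_lintegral_wt_exp_le (m : ℝ) :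
    ∃ C : ℝ, 0 < C ∧ ∀ w : E3, ∫⁻ v, wt m v * ENNReal.ofReal (Real.exp (-(1 / 8) * ‖v - w‖ ^ 2))
      ≤ ENNReal.ofReal (C * (1 + ‖w‖) ^ m) := by
  obtain ⟨C, hC, hCb⟩ := exists_lintegral_gaussian_weight_le (1 / 8) m (by norm_num)
  refine ⟨C, hC, fun w => (lintegral_mono fun v => ?_).trans (hCb w)⟩
  unfold wt
  rw [← ENNReal.ofReal_mul (by positivity), norm_sub_rev w v]
  refine ENNReal.ofReal_le_ofReal ?_
  have h2 : 0 ≤ (‖v - w‖ ^ 2)⁻¹ := by positivity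
  calc (1 + ‖v‖) ^ m * (‖v‖ ^ 2)⁻¹ * Real.exp (-(1 / 8) * ‖v - w‖ ^ 2)
      = Real.exp (-(1 / 8) * ‖v - w‖ ^ 2) * (1 + ‖v‖) ^ m * (‖v‖ ^ 2)⁻¹ := by ring
    _ ≤ _ := mul_le_mul_of_nonneg_left (by linarith) (by positivity)

/-- The square of the kernel has a singularity `|v-w|⁻²` next to the weight's `|v|⁻²`. After
separating the two, the factor `|w|⁻²` that comes out reproduces the weight, which can therefore be
kept through the iteration. -/
theorem exists_lintegral_wt_kernel_le {k : E3 × E3 → ℝ} {A : ℝ} (hA : 0 < A)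
    (hk : ∀ q, |k q| ≤ A * gradBound q.1 q.2) (m : ℝ) :
    ∃ C : ℝ, 0 < C ∧ ∀ w : E3, w ≠ 0 →
      ∫⁻ v, wt m v * ‖k (v, w)‖ₑ ^ 2 ≤ ENNReal.ofReal C * wt m w := by
  obtain ⟨C, hC, hCb⟩ := exists_lintegral_gaussian_weight_le (1 / 4) m (by norm_num)
  refine ⟨2 * A ^ 2 * C, by positivity, fun w hw => ?_⟩
  have e : ENNReal.ofReal (2 * A ^ 2 * C) * wt m w
      = ENNReal.ofReal (2 * A ^ 2 * (‖w‖ ^ 2)⁻¹) * ENNReal.ofReal (C * (1 + ‖w‖) ^ m) := by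
    unfold wt
    rw [← ENNReal.ofReal_mul (by positivity), ← ENNReal.ofReal_mul (by positivity)]
    congr 1; ring
  rw [e]
  refine le_trans ?_ (mul_le_mul' le_rfl (hCb w))
  rw [← lintegral_const_mul' _ _ ENNReal.ofReal_ne_top]
  refine lintegral_mono fun v => ?_
  unfold wt
  rw [Real.enorm_eq_ofReal_abs, ← ENNReal.ofReal_pow (abs_nonneg _),
    ← ENNReal.ofReal_mul (by positivity), ← ENNReal.ofReal_mul (by positivity)]
  refine ENNReal.ofReal_le_ofReal ?_
  have h1 : |k (v, w)| ^ 2 ≤ (A * gradBound v w) ^ 2 := pow_le_pow_left₀ (abs_nonneg _) (hk (v, w)) 2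
  have h2 : (A * gradBound v w) ^ 2
      = A ^ 2 * ((‖v - w‖ ^ 2)⁻¹ * Real.exp (-(1 / 4) * ‖v - w‖ ^ 2)) := by
    unfold gradBound
    rw [mul_pow, mul_pow, ← Real.exp_nat_mul, inv_pow]
    push_cast; ring_nf
  rw [h2] at h1
  have h3 := inv_sq_mul_inv_sq_le v w hw
  rw [norm_sub_rev w v]
  set X := Real.exp (-(1 / 4) * ‖v - w‖ ^ 2) with hX
  calc (1 + ‖v‖) ^ m * (‖v‖ ^ 2)⁻¹ * |k (v, w)| ^ 2
      ≤ (1 + ‖v‖) ^ m * (‖v‖ ^ 2)⁻¹ * (A ^ 2 * ((‖v - w‖ ^ 2)⁻¹ * X)) :=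
        mul_le_mul_of_nonneg_left h1 (by positivity)
    _ = A ^ 2 * X * (1 + ‖v‖) ^ m * ((‖v‖ ^ 2)⁻¹ * (‖v - w‖ ^ 2)⁻¹) := by ring
    _ ≤ A ^ 2 * X * (1 + ‖v‖) ^ m * (2 * (‖w‖ ^ 2)⁻¹ * ((‖v‖ ^ 2)⁻¹ + (‖v - w‖ ^ 2)⁻¹)) :=
        mul_le_mul_of_nonneg_left h3 (by positivity)
    _ ≤ A ^ 2 * X * (1 + ‖v‖) ^ m * (2 * (‖w‖ ^ 2)⁻¹ * (1 + (‖v‖ ^ 2)⁻¹ + (‖v - w‖ ^ 2)⁻¹)) := by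
        refine mul_le_mul_of_nonneg_left (mul_le_mul_of_nonneg_left ?_ (by positivity))
          (by positivity)
        linarith
    _ = _ := by ring

/-- The factor `(1 + |w|)²` in `avgMass` raises the weight from `m` to `m + 2`. This loss at each
averaging step is why estimates are proved for all `m`. -/
theorem exists_lintegral_avgMass_le {k : E3 × E3 → ℝ} (hkm : Measurable k) {A : ℝ} (hA : 0 < A)
    (hk : ∀ q, |k q| ≤ A * gradBound q.1 q.2) (m : ℝ) :
    ∃ C : ℝ, 0 < C ∧ ∀ H : E3 × E3 → ℝ, Measurable H →
      ∫⁻ v, wt m v * avgMass (fun w => k (v, w)) H ≤ ENNReal.ofReal C * wtMass (m + 2) H := by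
  obtain ⟨C, hC, hCb⟩ := exists_lintegral_wt_kernel_le hA hk m
  refine ⟨C, hC, fun H hH => ?_⟩
  have hHm : Measurable fun w => ∫⁻ y, ‖H (y, w)‖ₑ ^ 2 := by
    have h1 : Measurable fun q : E3 × E3 => ‖H (q.2, q.1)‖ₑ ^ 2 := by
      have := hH.comp (by fun_prop : Measurable fun q : E3 × E3 => (q.2, q.1))
      exact this.enorm.pow_const 2
    have h2 := h1.lintegral_prod_right' (ν := (volume : Measure E3))
    exact h2
  have hwm := measurable_wt m
  unfold avgMass wtMass
  simp only [← lintegral_const_mul' _ _ (wt_ne_top m _)]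
  rw [lintegral_lintegral_swap, ← lintegral_const_mul' _ _ ENNReal.ofReal_ne_top]
  · refine lintegral_mono_ae ?_
    have hne : ∀ᵐ w : E3, w ≠ 0 := by simp [ae_iff]
    filter_upwards [hne] with w hw
    have e1 : ∀ v, wt m v * (ENNReal.ofReal ((1 + ‖w‖) ^ 2) * ‖k (v, w)‖ₑ ^ 2 *
        ∫⁻ y, ‖H (y, w)‖ₑ ^ 2) = (wt m v * ‖k (v, w)‖ₑ ^ 2) *
          (ENNReal.ofReal ((1 + ‖w‖) ^ 2) * ∫⁻ y, ‖H (y, w)‖ₑ ^ 2) := fun v => by ring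
    simp only [e1]
    have hkw : Measurable fun v => k (v, w) := by
      have := hkm.comp (by fun_prop : Measurable fun v : E3 => (v, w))
      exact this
    rw [lintegral_mul_const _ (by fun_prop)]
    refine (mul_le_mul' (hCb w hw) le_rfl).trans (le_of_eq ?_)
    rw [← ofReal_rpow_mul_wt, Real.rpow_two]
    ring
  · have h1 : Measurable fun q : E3 × E3 => ∫⁻ y, ‖H (y, q.2)‖ₑ ^ 2 := hHm.comp measurable_snd
    have h2 : Measurable fun q : E3 × E3 => wt m q.1 := hwm.comp measurable_fst
    have h3 : Measurable fun q : E3 × E3 => ENNReal.ofReal ((1 + ‖q.2‖) ^ 2) := by fun_prop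
    exact (h2.mul ((h3.mul (hkm.enorm.pow_const 2)).mul h1)).aemeasurable

/-- The average over velocities of the damped integrals along characteristics. -/
def avg (D : ℝ) (ν : E3 → ℝ) (k H : E3 × E3 → ℝ) (p : E3 × E3) : ℝ :=
  rayAvg D ν (fun w => k (p.2, w)) H p.1

theorem measurable_avg {D : ℝ} {ν : E3 → ℝ} {k H : E3 × E3 → ℝ} (hν : Measurable ν)
    (hk : Measurable k) (hH : Measurable H) : Measurable (avg D ν k H) := by
  have h1 := measurable_rayIntegrand (D := D) (κ := fun _ => 1) hν measurable_const hH
  have h2 := h1.comp (by fun_prop : Measurable fun q : (E3 × E3) × (E3 × ℝ) => (q.1.1, q.2))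
  have h3 := hk.comp (by fun_prop : Measurable fun q : (E3 × E3) × (E3 × ℝ) => (q.1.2, q.2.1))
  have h4 := ((h3.mul h2).stronglyMeasurable.integral_prod_right'
    (ν := (volume : Measure (E3 × ℝ)))).measurable
  refine (congrArg Measurable ?_).mp h4
  ext p
  unfold avg rayAvg
  congr 1
  ext z
  simp only [Pi.mul_apply, Function.comp]
  by_cases hz : z.2 ∈ Ioc 0 (D / ‖z.1‖)
  · rw [show z = (z.1, z.2) from rfl, rayIntegrand_of_mem hz, rayIntegrand_of_mem hz, one_mul]
  · rw [show z = (z.1, z.2) from rfl, rayIntegrand_of_notMem hz, rayIntegrand_of_notMem hz,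
      mul_zero]

/-- The difference of `H` in the space variable. -/
def shiftDiff (b : E3) (H : E3 × E3 → ℝ) (p : E3 × E3) : ℝ := H (p.1 + b, p.2) - H p

theorem measurable_shiftDiff {H : E3 × E3 → ℝ} (hH : Measurable H) (b : E3) :
    Measurable (shiftDiff b H) := by
  have := hH.comp (by fun_prop : Measurable fun p : E3 × E3 => (p.1 + b, p.2))
  exact this.sub hH

namespace IsMildSolution

variable {Ω : Set E3} {D A : ℝ} {ν : E3 → ℝ} {k f g : E3 × E3 → ℝ}

theorem ae_avgMass_lt_top (h : IsMildSolution Ω D A ν k f g) {m : ℝ} {H : E3 × E3 → ℝ}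
    (hH : Measurable H) (hHm : wtMass (m + 2) H < ⊤) :
    ∀ᵐ v, avgMass (fun w => k (v, w)) H < ⊤ := by
  obtain ⟨C, hC, hCb⟩ := exists_lintegral_avgMass_le h.measurable_kernel h.A_pos h.kernel_le m
  have h1 : ∫⁻ v, wt m v * avgMass (fun w => k (v, w)) H < ⊤ :=
    (hCb H hH).trans_lt (ENNReal.mul_lt_top ENNReal.ofReal_lt_top hHm)
  have hm : Measurable fun v => avgMass (fun w => k (v, w)) H := by
    have hHm : Measurable fun w => ∫⁻ y, ‖H (y, w)‖ₑ ^ 2 := by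
      have h1 : Measurable fun q : E3 × E3 => ‖H (q.2, q.1)‖ₑ ^ 2 := by
        have := hH.comp (by fun_prop : Measurable fun q : E3 × E3 => (q.2, q.1))
        exact this.enorm.pow_const 2
      have h2 := h1.lintegral_prod_right' (ν := (volume : Measure E3))
      exact h2
    have h1 : Measurable fun q : E3 × E3 => ∫⁻ y, ‖H (y, q.2)‖ₑ ^ 2 := hHm.comp measurable_snd
    have h3 : Measurable fun q : E3 × E3 => ENNReal.ofReal ((1 + ‖q.2‖) ^ 2) := by fun_prop
    have h4 := ((h3.mul (h.measurable_kernel.enorm.pow_const 2)).mul h1).lintegral_prod_right'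
      (ν := (volume : Measure E3))
    exact h4
  have hne : ∀ᵐ v : E3, v ≠ 0 := by simp [ae_iff]
  filter_upwards [ae_lt_top ((measurable_wt m).mul hm) h1.ne, hne] with v hv hv0
  exact ENNReal.lt_top_of_mul_ne_top_right hv.ne (wt_ne_zero m hv0)

/-- The averaging estimate is applied for each fixed `v`, with `k(v, ·)` as averaging weight, and is
then integrated in `v`. -/
theorem exists_wtMass_shiftDiff_avg_le (h : IsMildSolution Ω D A ν k f g) {ε : ℝ} (hε : 0 < ε)
    (hε1 : ε ≤ 1) (m : ℝ) :
    ∃ C : ℝ, 0 < C ∧ ∀ H : E3 × E3 → ℝ, Measurable H → wtMass (m + 2) H < ⊤ → ∀ b : E3,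
      wtMass m (shiftDiff b (avg D ν k H)) ≤ ENNReal.ofReal (C * ‖b‖ ^ (1 - ε)) * wtMass (m + 2) H := by
  obtain ⟨C1, hC1, h1⟩ := exists_lintegral_avgMass_le h.measurable_kernel h.A_pos h.kernel_le m
  obtain ⟨C2, hC2, h2⟩ := exists_lintegral_rayAvg_diff_le h.D_pos.le hε hε1
  refine ⟨C2 * C1, by positivity, fun H hH hHm b => ?_⟩
  have e : ENNReal.ofReal (C2 * C1 * ‖b‖ ^ (1 - ε)) * wtMass (m + 2) H
      = ENNReal.ofReal (C2 * ‖b‖ ^ (1 - ε)) * (ENNReal.ofReal C1 * wtMass (m + 2) H) := by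
    rw [← mul_assoc, ← ENNReal.ofReal_mul (by positivity)]
    congr 2; ring
  rw [e]
  refine le_trans ?_ (mul_le_mul' le_rfl (h1 H hH))
  rw [← lintegral_const_mul' _ _ ENNReal.ofReal_ne_top]
  unfold wtMass
  refine lintegral_mono_ae ?_
  filter_upwards [h.ae_avgMass_lt_top hH hHm] with v hv
  rw [mul_left_comm]
  have hkv : Measurable fun w => k (v, w) := by
    have := h.measurable_kernel.comp (by fun_prop : Measurable fun w : E3 => (v, w))
    exact this
  exact mul_le_mul' le_rfl (h2 ν _ H h.measurable_freq h.freq_nonneg hkv hH hv b)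

/-- The average is linear and commutes with translations in `x`. The statement is almost everywhere
because the difference of two integrals may be taken under one integral sign only where both
converge. -/
theorem ae_avg_shiftDiff (h : IsMildSolution Ω D A ν k f g) {m : ℝ} {H : E3 × E3 → ℝ}
    (hH : Measurable H) (hHm : wtMass (m + 2) H < ⊤) (b : E3) :
    ∀ᵐ v, ∀ᵐ x, avg D ν k (shiftDiff b H) (x, v) = shiftDiff b (avg D ν k H) (x, v) := by
  filter_upwards [h.ae_avgMass_lt_top hH hHm] with v hv
  have hkv : Measurable fun w => k (v, w) := by
    have := h.measurable_kernel.comp (by fun_prop : Measurable fun w : E3 => (v, w))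
    exact this
  have h1 := ae_integrable_rayIntegrand (D := D) h.measurable_freq h.freq_nonneg hkv hH hv
  have h2 := (measurePreserving_add_right (volume : Measure E3) b).quasiMeasurePreserving.ae h1
  filter_upwards [h1, h2] with x hx hx'
  unfold shiftDiff avg rayAvg
  simp only
  rw [← integral_sub hx' hx]
  congr 1
  ext z
  by_cases hz : z.2 ∈ Ioc 0 (D / ‖z.1‖)
  · rw [show z = (z.1, z.2) from rfl, rayIntegrand_of_mem hz, rayIntegrand_of_mem hz,
      rayIntegrand_of_mem hz, show x - z.2 • z.1 + b = x + b - z.2 • z.1 by abel]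
    ring
  · rw [show z = (z.1, z.2) from rfl, rayIntegrand_of_notMem hz, rayIntegrand_of_notMem hz,
      rayIntegrand_of_notMem hz, sub_zero]

end IsMildSolution


/-! ### Splitting of the source and the cost of the boundary -/

theorem memLp_two_of_lintegral_lt_top {φ : E3 → ℝ} (hφ : Measurable φ)
    (h : ∫⁻ w, ‖φ w‖ₑ ^ 2 < ⊤) : MemLp φ 2 := by
  refine ⟨hφ.aestronglyMeasurable, ?_⟩
  rw [eLpNorm_lt_top_iff_lintegral_rpow_enorm_lt_top (by norm_num) (by norm_num)]
  simpa using h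

theorem wtMass_add_le {m : ℝ} {H : E3 × E3 → ℝ} {U V : E3 × E3 → ENNReal} (hU : Measurable U)
    (hle : ∀ᵐ v, ∀ᵐ x, ‖H (x, v)‖ₑ ^ 2 ≤ U (x, v) + V (x, v)) :
    wtMass m H ≤ (∫⁻ v, wt m v * ∫⁻ x, U (x, v)) + ∫⁻ v, wt m v * ∫⁻ x, V (x, v) := by
  have hUv : Measurable fun v => ∫⁻ x, U (x, v) := by
    have h1 := hU.comp (by fun_prop : Measurable fun q : E3 × E3 => (q.2, q.1))
    have h2 := h1.lintegral_prod_right' (ν := (volume : Measure E3))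
    exact h2
  have hm : Measurable fun v => wt m v * ∫⁻ x, U (x, v) := (measurable_wt m).mul hUv
  rw [← lintegral_add_left hm]
  refine lintegral_mono_ae ?_
  filter_upwards [hle] with v hv
  have hUx : Measurable fun x => U (x, v) := by
    have := hU.comp (by fun_prop : Measurable fun x : E3 => (x, v))
    exact this
  refine (mul_le_mul' le_rfl (lintegral_mono_ae hv)).trans (le_of_eq ?_)
  rw [lintegral_add_left hUx, mul_add]

namespace IsMildSolution

variable {Ω : Set E3} {D A : ℝ} {ν : E3 → ℝ} {k f g : E3 × E3 → ℝ}

/-- The rapid decay of the source reduces any weight to `(1 + |v|)⁻⁴ |v|⁻²`, which is integrable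
both at the origin and at infinity. -/
theorem wtMass_source_lt_top (h : IsMildSolution Ω D A ν k f g) (m : ℝ) :
    wtMass m (source Ω k f) < ⊤ := by
  obtain ⟨C, hC, hb⟩ := h.exists_source_sq_le (-4 - m)
  have hV := h.volume_lt_top
  refine lt_of_le_of_lt (b := ∫⁻ v, ENNReal.ofReal C * volume Ω * wt (-4) v) ?_ ?_
  · refine lintegral_mono fun v => ?_
    have h1 : ∫⁻ y, ‖source Ω k f (y, v)‖ₑ ^ 2
        ≤ ENNReal.ofReal (C * (1 + ‖v‖) ^ (-4 - m)) * volume Ω := by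
      rw [← setLIntegral_const, ← lintegral_indicator h.isOpen.measurableSet]
      refine lintegral_mono_ae ?_
      filter_upwards [hb] with y hy
      by_cases hyΩ : y ∈ Ω
      · rw [indicator_of_mem hyΩ]; exact hy v
      · rw [source_of_notMem hyΩ]; simp
    refine (mul_le_mul' le_rfl h1).trans (le_of_eq ?_)
    rw [ENNReal.ofReal_mul hC.le, show (-4 : ℝ) = m + (-4 - m) by ring, ← ofReal_rpow_mul_wt]
    ring_nf
  · rw [lintegral_const_mul _ (measurable_wt _)]
    exact ENNReal.mul_lt_top (ENNReal.mul_lt_top ENNReal.ofReal_lt_top hV) lintegral_wt_lt_top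

/-- The source splits into the contribution of the incoming data and a velocity average. -/
theorem ae_source_eq (h : IsMildSolution Ω D A ν k f g) :
    ∀ᵐ v, ∀ᵐ x, Integrable (fun w => k (v, w) * boundaryTerm Ω D ν k f (x, w)) ∧
      (x ∈ Ω → source Ω k f (x, v) = (∫ w, k (v, w) * boundaryTerm Ω D ν k f (x, w))
        + avg D ν k (source Ω k f) (x, v)) := by
  have hfm : Measurable fun p => ‖f p‖ₑ ^ 2 := h.measurable.enorm.pow_const 2
  have hL2 : ∀ᵐ x : E3, MemLp (fun w => f (x, w)) 2 := by
    have h1 := h.lintegral_lt_top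
    rw [Measure.volume_eq_prod, lintegral_prod _ hfm.aemeasurable] at h1
    filter_upwards [ae_lt_top hfm.lintegral_prod_right' h1.ne] with x hx
    refine memLp_two_of_lintegral_lt_top ?_ hx
    have := h.measurable.comp (by fun_prop : Measurable fun w : E3 => (x, w))
    exact this
  filter_upwards [h.ae_avgMass_lt_top (m := 0) h.measurable_source (h.wtMass_source_lt_top _)]
    with v hv
  have hkv : Measurable fun w => k (v, w) := by
    have := h.measurable_kernel.comp (by fun_prop : Measurable fun w : E3 => (v, w))
    exact this
  filter_upwards [hL2, ae_integrable_rayIntegrand (D := D) h.measurable_freq h.freq_nonneg hkv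
    h.measurable_source hv] with x hx hint
  have i1 := integrable_kernel_mul h.measurable_kernel h.kernel_le hx v
  have e1 : ∀ w, ∫ s, rayIntegrand D ν (fun w => k (v, w)) (source Ω k f) x (w, s)
      = k (v, w) * duhamelTerm D ν (source Ω k f) (x, w) := by
    intro w
    unfold duhamelTerm
    rw [← integral_const_mul, ← integral_indicator measurableSet_Ioc]
    rfl
  have i2 : Integrable fun w => k (v, w) * duhamelTerm D ν (source Ω k f) (x, w) := by
    have := Integrable.integral_prod_left (f := rayIntegrand D ν (fun w => k (v, w))
      (source Ω k f) x) (μ := (volume : Measure E3)) (ν := (volume : Measure ℝ)) hint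
    simpa only [e1] using this
  have e2 : avg D ν k (source Ω k f) (x, v)
      = ∫ w, k (v, w) * duhamelTerm D ν (source Ω k f) (x, w) := by
    unfold avg rayAvg
    rw [Measure.volume_eq_prod, integral_prod _ hint]
    simp only [e1]
  have e3 : (fun w => k (v, w) * boundaryTerm Ω D ν k f (x, w))
      = fun w => k (v, w) * f (x, w) - k (v, w) * duhamelTerm D ν (source Ω k f) (x, w) := by
    ext w; unfold boundaryTerm; ring
  rw [e3]
  refine ⟨i1.sub i2, fun hxΩ => ?_⟩
  rw [integral_sub i1 i2, e2, source_of_mem hxΩ]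
  ring

/-- Differencing the splitting of the source, `K` acts on the difference of the incoming
contribution, which is already almost one derivative small. The splitting holds only in `Ω`, hence
the restriction to pairs of points of `Ω` on the left; the average is defined on the whole space. -/
theorem exists_wtMass_innerDiff_source_le (h : IsMildSolution Ω D A ν k f g) {ε : ℝ}
    (hε : 0 < ε) (hε1 : ε ≤ 1) (m : ℝ) :
    ∃ C : ℝ, 0 < C ∧ ∀ b : E3, b ≠ 0 → ‖b‖ ≤ 1 → wtMass m (innerDiff Ω b (source Ω k f))
      ≤ ENNReal.ofReal (C * ‖b‖ ^ (2 - 3 * ε))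
        + 2 * wtMass m (shiftDiff b (avg D ν k (source Ω k f))) := by
  obtain ⟨C1, hC1, hK⟩ := exists_enorm_kernel_integral_sq_le h.A_pos h.kernel_le
  obtain ⟨C2, hC2, hJ⟩ := h.exists_lintegral_boundaryTerm_diff_le hε hε1 m
  obtain ⟨C3, hC3, hw⟩ := exists_lintegral_wt_exp_le m
  refine ⟨2 * C1 * (C3 * C2), by positivity, fun b hb hb1 => ?_⟩
  set J := innerDiff Ω b (boundaryTerm Ω D ν k f) with hJdef
  have hJm : Measurable fun p => ‖J p‖ₑ ^ 2 :=
    (measurable_innerDiff h.isOpen.measurableSet b h.measurable_boundaryTerm).enorm.pow_const 2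
  set U : E3 × E3 → ENNReal := fun p => ENNReal.ofReal (2 * C1) *
    ∫⁻ w, ENNReal.ofReal (Real.exp (-(1 / 8) * ‖p.2 - w‖ ^ 2)) * ‖J (p.1, w)‖ₑ ^ 2 with hU
  have hUm : Measurable U := by
    have h1 := hJm.comp (by fun_prop : Measurable fun q : (E3 × E3) × E3 => (q.1.1, q.2))
    have h2 : Measurable fun q : (E3 × E3) × E3 =>
      ENNReal.ofReal (Real.exp (-(1 / 8) * ‖q.1.2 - q.2‖ ^ 2)) := by fun_prop
    have h3 := (h2.mul h1).lintegral_prod_right' (ν := (volume : Measure E3))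
    exact h3.const_mul _
  have hpt : ∀ᵐ v, ∀ᵐ x, ‖innerDiff Ω b (source Ω k f) (x, v)‖ₑ ^ 2
      ≤ U (x, v) + 2 * ‖shiftDiff b (avg D ν k (source Ω k f)) (x, v)‖ₑ ^ 2 := by
    filter_upwards [h.ae_source_eq] with v hv
    have hv' := (measurePreserving_add_right (volume : Measure E3) b).quasiMeasurePreserving.ae hv
    filter_upwards [hv, hv'] with x hx hx'
    by_cases hxo : x ∈ overlap Ω b
    swap
    · rw [innerDiff_of_notMem hxo]; simp
    have e1 : innerDiff Ω b (source Ω k f) (x, v)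
        = (∫ w, k (v, w) * J (x, w)) + shiftDiff b (avg D ν k (source Ω k f)) (x, v) := by
      rw [innerDiff_of_mem hxo, hx.2 hxo.1]
      simp only
      rw [hx'.2 hxo.2]
      have e2 : ∀ w, k (v, w) * J (x, w) = k (v, w) * boundaryTerm Ω D ν k f (x + b, w)
          - k (v, w) * boundaryTerm Ω D ν k f (x, w) := by
        intro w
        rw [hJdef, innerDiff_of_mem hxo]; ring
      simp only [e2]
      rw [integral_sub hx'.1 hx.1]
      unfold shiftDiff
      ring
    rw [e1]
    refine (enorm_add_sq_le _ _).trans (add_le_add ?_ le_rfl)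
    have hJx : Measurable fun w => ‖J (x, w)‖ₑ := by
      have := (measurable_innerDiff h.isOpen.measurableSet b h.measurable_boundaryTerm).comp
        (by fun_prop : Measurable fun w : E3 => (x, w))
      exact this.enorm
    have h3 := hK (fun w => J (x, w)) (fun w => ‖J (x, w)‖ₑ) v hJx
      (Eventually.of_forall fun _ => le_rfl)
    refine (mul_le_mul' le_rfl h3).trans (le_of_eq ?_)
    rw [← mul_assoc, two_mul_ofReal]
  refine (wtMass_add_le (V := fun p => 2 * ‖shiftDiff b (avg D ν k (source Ω k f)) p‖ₑ ^ 2)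
    hUm hpt).trans (add_le_add ?_ (le_of_eq ?_))
  · have hsw : ∀ v, ∫⁻ x, U (x, v) = ENNReal.ofReal (2 * C1) *
        ∫⁻ w, ENNReal.ofReal (Real.exp (-(1 / 8) * ‖v - w‖ ^ 2)) * ∫⁻ x, ‖J (x, w)‖ₑ ^ 2 := by
      intro v
      rw [hU]
      simp only
      rw [lintegral_const_mul' _ _ ENNReal.ofReal_ne_top, lintegral_lintegral_swap]
      · congr 1
        refine lintegral_congr fun w => ?_
        rw [lintegral_const_mul' _ _ ENNReal.ofReal_ne_top]
      · have h2 : Measurable fun q : E3 × E3 =>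
          ENNReal.ofReal (Real.exp (-(1 / 8) * ‖v - q.2‖ ^ 2)) := by fun_prop
        exact (h2.mul hJm).aemeasurable
    have hJw : Measurable fun w => ∫⁻ x, ‖J (x, w)‖ₑ ^ 2 := by
      have h1 := hJm.comp (by fun_prop : Measurable fun q : E3 × E3 => (q.2, q.1))
      have h2 := h1.lintegral_prod_right' (ν := (volume : Measure E3))
      exact h2
    have hwm := measurable_wt m
    simp only [hsw, mul_left_comm (wt m _) (ENNReal.ofReal (2 * C1))]
    rw [lintegral_const_mul' _ _ ENNReal.ofReal_ne_top, mul_assoc (2 * C1),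
      ENNReal.ofReal_mul (p := 2 * C1) (by positivity)]
    refine mul_le_mul' le_rfl ?_
    simp only [← lintegral_const_mul' _ _ (wt_ne_top m _)]
    rw [lintegral_lintegral_swap]
    · rw [mul_assoc C3, ENNReal.ofReal_mul hC3.le]
      refine le_trans ?_ (mul_le_mul' le_rfl (hJ b hb hb1))
      rw [← lintegral_const_mul' _ _ ENNReal.ofReal_ne_top]
      refine lintegral_mono fun w => ?_
      simp only [← mul_assoc]
      rw [lintegral_mul_const _ (by fun_prop), ← ENNReal.ofReal_mul hC3.le]
      exact mul_le_mul' (hw w) le_rfl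
    · have h1 : Measurable fun q : E3 × E3 => ∫⁻ x, ‖J (x, q.2)‖ₑ ^ 2 := hJw.comp measurable_snd
      have h2 : Measurable fun q : E3 × E3 => wt m q.1 := hwm.comp measurable_fst
      have h3 : Measurable fun q : E3 × E3 =>
        ENNReal.ofReal (Real.exp (-(1 / 8) * ‖q.1 - q.2‖ ^ 2)) := by fun_prop
      exact (h2.mul (h3.mul h1)).aemeasurable
  · unfold wtMass
    rw [← lintegral_const_mul' _ _ (by norm_num)]
    refine lintegral_congr fun v => ?_
    rw [lintegral_const_mul' _ _ (by norm_num), mul_left_comm]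

/-- Extension by zero costs a jump across the boundary. Its squared size is that of the source on a
layer of volume `O(|b|)`, so half a derivative is all that the extended source can have. -/
theorem exists_wtMass_shiftDiff_source_le (h : IsMildSolution Ω D A ν k f g) (m : ℝ) :
    ∃ C : ℝ, 0 < C ∧ ∀ b : E3, ‖b‖ ≤ 1 → wtMass m (shiftDiff b (source Ω k f))
      ≤ wtMass m (innerDiff Ω b (source Ω k f)) + ENNReal.ofReal (C * ‖b‖) := by
  obtain ⟨C1, hC1, hs⟩ := h.exists_source_sq_le (-4 - m)
  obtain ⟨C2, hC2, hl⟩ := exists_lintegral_leaveSet_le h.isOpen.measurableSet h.convex h.isBounded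
    (ε := 1) one_pos le_rfl
  set I := ∫⁻ v, wt (-4) v with hI
  have hIt : I < ⊤ := lintegral_wt_lt_top
  refine ⟨C1 * I.toReal * (C2 + C2) + 1, by positivity, fun b hb => ?_⟩
  have hFm : Measurable fun p => ‖innerDiff Ω b (source Ω k f) p‖ₑ ^ 2 :=
    (measurable_innerDiff h.isOpen.measurableSet b h.measurable_source).enorm.pow_const 2
  have hpt : ∀ᵐ v : E3, ∀ᵐ x, ‖shiftDiff b (source Ω k f) (x, v)‖ₑ ^ 2
      ≤ ‖innerDiff Ω b (source Ω k f) (x, v)‖ₑ ^ 2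
        + ENNReal.ofReal (C1 * (1 + ‖v‖) ^ (-4 - m)) * jump Ω b x := by
    refine Eventually.of_forall fun v => ?_
    have hs' := (measurePreserving_add_right (volume : Measure E3) b).quasiMeasurePreserving.ae hs
    filter_upwards [hs, hs'] with x hx hx'
    by_cases hx1 : x ∈ Ω
    · by_cases hx2 : x + b ∈ Ω
      · rw [innerDiff_of_mem (show x ∈ overlap Ω b from ⟨hx1, hx2⟩)]
        exact le_self_add
      · unfold shiftDiff
        rw [source_of_notMem (p := (x + b, v)) hx2, zero_sub, enorm_neg]
        refine le_add_left ((hx v).trans (le_mul_of_one_le_right zero_le (one_le_jump (by tauto))))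
    · by_cases hx2 : x + b ∈ Ω
      · unfold shiftDiff
        rw [source_of_notMem (p := (x, v)) hx1, sub_zero]
        refine le_add_left ((hx' v).trans (le_mul_of_one_le_right zero_le
          (one_le_jump (by tauto))))
      · unfold shiftDiff
        rw [source_of_notMem (p := (x, v)) hx1, source_of_notMem (p := (x + b, v)) hx2]
        simp
  refine (wtMass_add_le (U := fun p => ‖innerDiff Ω b (source Ω k f) p‖ₑ ^ 2)
    (V := fun p => ENNReal.ofReal (C1 * (1 + ‖p.2‖) ^ (-4 - m)) * jump Ω b p.1) hFm hpt).trans (add_le_add le_rfl ?_)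
  have hj : ∫⁻ x, jump Ω b x ≤ ENNReal.ofReal ((C2 + C2) * ‖b‖) := by
    rw [lintegral_jump h.isOpen.measurableSet, add_mul, ENNReal.ofReal_add (by positivity)
      (by positivity)]
    refine add_le_add (hl b hb).1 ?_
    have := (hl (-b) (by rwa [norm_neg])).1
    rwa [norm_neg] at this
  calc ∫⁻ v, wt m v * ∫⁻ x, ENNReal.ofReal (C1 * (1 + ‖v‖) ^ (-4 - m)) * jump Ω b x
      ≤ ∫⁻ v, wt (-4) v * ENNReal.ofReal (C1 * ((C2 + C2) * ‖b‖)) := by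
        refine lintegral_mono fun v => ?_
        rw [lintegral_const_mul' _ _ ENNReal.ofReal_ne_top]
        refine (mul_le_mul' le_rfl (mul_le_mul' le_rfl hj)).trans (le_of_eq ?_)
        rw [ENNReal.ofReal_mul hC1.le, ENNReal.ofReal_mul hC1.le,
          show (-4 : ℝ) = m + (-4 - m) by ring, ← ofReal_rpow_mul_wt]
        ring_nf
    _ = ENNReal.ofReal (I.toReal * (C1 * ((C2 + C2) * ‖b‖))) := by
        rw [lintegral_mul_const' _ _ ENNReal.ofReal_ne_top, ← hI,
          ENNReal.ofReal_mul ENNReal.toReal_nonneg, ENNReal.ofReal_toReal hIt.ne]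
    _ ≤ _ := by
        refine ENNReal.ofReal_le_ofReal ?_
        have := norm_nonneg b
        linarith

end IsMildSolution


/-! ### From two half derivatives to almost one derivative -/

/-- A Marchaud type inequality: control of second differences gives control of first differences. -/
theorem exists_le_rpow_of_doubling {W : E3 → ENNReal} {θ σ C₀ C₁ : ℝ} (hθ : 0 ≤ θ) (hσ : 0 ≤ σ)
    (hθσ : θ * 2 ^ σ < 1) (hC₀ : 0 ≤ C₀) (hC₁ : 0 ≤ C₁)
    (h0 : ∀ b, b ≠ 0 → ‖b‖ ≤ 1 → W b ≤ ENNReal.ofReal C₀)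
    (h1 : ∀ b, b ≠ 0 → ‖b‖ ≤ 1 →
      W b ≤ ENNReal.ofReal θ * W ((2 : ℝ) • b) + ENNReal.ofReal (C₁ * ‖b‖ ^ σ)) :
    ∃ C : ℝ, 0 < C ∧ ∀ b, b ≠ 0 → ‖b‖ ≤ 1 → W b ≤ ENNReal.ofReal (C * ‖b‖ ^ σ) := by
  have hpos : 0 < 1 - θ * 2 ^ σ := by linarith
  set C := C₀ * 2 ^ σ + C₁ / (1 - θ * 2 ^ σ) + 1 with hC
  have hC1 : 0 ≤ C₁ / (1 - θ * 2 ^ σ) := by positivity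
  have hC2 : 0 ≤ C₀ * (2 : ℝ) ^ σ := by positivity
  have hCpos : 0 < C := by positivity
  -- Doubling is repeated until the length exceeds `1/2`; there the a priori bound suffices. The
  -- constant is closed under doubling because `θ 2^σ < 1`.
  have hbase : ∀ b, b ≠ 0 → ‖b‖ ≤ 1 → 1 / 2 < ‖b‖ → W b ≤ ENNReal.ofReal (C * ‖b‖ ^ σ) := by
    intro b hb hb1 hb2
    refine (h0 b hb hb1).trans (ENNReal.ofReal_le_ofReal ?_)
    have e1 : (1 / 2 : ℝ) ^ σ ≤ ‖b‖ ^ σ := Real.rpow_le_rpow (by norm_num) hb2.le hσ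
    have e2 : C₀ = C₀ * 2 ^ σ * (1 / 2 : ℝ) ^ σ := by
      rw [mul_assoc, ← Real.mul_rpow (by norm_num) (by norm_num)]; norm_num
    calc C₀ = C₀ * 2 ^ σ * (1 / 2 : ℝ) ^ σ := e2
      _ ≤ C * ‖b‖ ^ σ := mul_le_mul (by linarith) e1 (by positivity) hCpos.le
  have key : ∀ n : ℕ, ∀ b, b ≠ 0 → ‖b‖ ≤ 1 → 1 ≤ 2 ^ n * ‖b‖ →
      W b ≤ ENNReal.ofReal (C * ‖b‖ ^ σ) := by
    intro n
    induction n with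
    | zero =>
      intro b hb hb1 hn
      refine hbase b hb hb1 ?_
      rw [pow_zero, one_mul] at hn
      linarith
    | succ n ih =>
      intro b hb hb1 hn
      rcases lt_or_ge (1 / 2) ‖b‖ with hlt | hge
      · exact hbase b hb hb1 hlt
      have hn2 : ‖(2 : ℝ) • b‖ = 2 * ‖b‖ := by rw [norm_smul]; norm_num
      have h2 := ih ((2 : ℝ) • b) (smul_ne_zero two_ne_zero hb) (by rw [hn2]; linarith)
        (by rw [hn2, ← mul_assoc, ← pow_succ]; exact hn)
      refine (h1 b hb hb1).trans ((add_le_add (mul_le_mul' le_rfl h2) le_rfl).trans ?_)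
      rw [← ENNReal.ofReal_mul hθ, ← ENNReal.ofReal_add (by positivity) (by positivity), hn2,
        Real.mul_rpow zero_le_two (norm_nonneg _)]
      refine ENNReal.ofReal_le_ofReal ?_
      have h3 : C₁ ≤ C * (1 - θ * 2 ^ σ) := by
        have h4 : C₁ / (1 - θ * 2 ^ σ) * (1 - θ * 2 ^ σ) = C₁ := div_mul_cancel₀ _ hpos.ne'
        have h5 : 0 ≤ (C₀ * 2 ^ σ + 1) * (1 - θ * 2 ^ σ) := by positivity
        have h6 : C * (1 - θ * 2 ^ σ) = (C₀ * 2 ^ σ + 1) * (1 - θ * 2 ^ σ)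
          + C₁ / (1 - θ * 2 ^ σ) * (1 - θ * 2 ^ σ) := by rw [hC]; ring
        linarith
      have h7 := mul_le_mul_of_nonneg_right h3 (by positivity : 0 ≤ ‖b‖ ^ σ)
      calc θ * (C * (2 ^ σ * ‖b‖ ^ σ)) + C₁ * ‖b‖ ^ σ
          ≤ θ * (C * (2 ^ σ * ‖b‖ ^ σ)) + C * (1 - θ * 2 ^ σ) * ‖b‖ ^ σ := by linarith
        _ = C * ‖b‖ ^ σ := by ring
  refine ⟨C, hCpos, fun b hb hb1 => ?_⟩
  have hb0 : 0 < ‖b‖ := norm_pos_iff.2 hb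
  obtain ⟨n, hn⟩ := pow_unbounded_of_one_lt (‖b‖⁻¹) (one_lt_two (α := ℝ))
  refine key n b hb hb1 ?_
  have := mul_le_mul_of_nonneg_right hn.le hb0.le
  rwa [inv_mul_cancel₀ hb0.ne'] at this

/-- Young's inequality with parameter; the defect is the square `η⁻¹/4 (η c + d)²`. It is meant for
`a` the first difference with step `b`, `c` the first difference with step `2b` and `d` the second
difference. -/
theorem enorm_sq_le_doubling {η : ℝ} (hη : 0 < η) {a c d : ℝ} (h : 2 * a = c - d) :
    ‖a‖ₑ ^ 2 ≤ ENNReal.ofReal ((1 + η) / 4) * ‖c‖ₑ ^ 2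
      + ENNReal.ofReal ((1 + η⁻¹) / 4) * ‖d‖ₑ ^ 2 := by
  rw [Real.enorm_eq_ofReal_abs, Real.enorm_eq_ofReal_abs, Real.enorm_eq_ofReal_abs,
    ← ENNReal.ofReal_pow (abs_nonneg _), ← ENNReal.ofReal_pow (abs_nonneg _),
    ← ENNReal.ofReal_pow (abs_nonneg _), ← ENNReal.ofReal_mul (by positivity),
    ← ENNReal.ofReal_mul (by positivity), ← ENNReal.ofReal_add (by positivity) (by positivity),
    sq_abs, sq_abs, sq_abs]
  refine ENNReal.ofReal_le_ofReal ?_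
  have ha : a = (c - d) / 2 := by linarith
  have h1 : (1 + η) / 4 * c ^ 2 + (1 + η⁻¹) / 4 * d ^ 2 - a ^ 2 = η⁻¹ / 4 * (η * c + d) ^ 2 := by
    rw [ha]; field_simp; ring
  have h2 : 0 ≤ η⁻¹ / 4 * (η * c + d) ^ 2 := by positivity
  linarith

namespace IsMildSolution

variable {Ω : Set E3} {D A : ℝ} {ν : E3 → ℝ} {k f g : E3 × E3 → ℝ}

/-- The first gain: averaging contributes `|b|^(1-ε)`, the boundary jump `|b|` and the incoming data
`|b|^(2-3ε)`. The condition `ε ≤ 1/2` ensures that the last power is not the worst. -/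
theorem exists_wtMass_shiftDiff_source_le_rpow (h : IsMildSolution Ω D A ν k f g) {ε : ℝ}
    (hε : 0 < ε) (hε1 : ε ≤ 1 / 2) (m : ℝ) :
    ∃ C : ℝ, 0 < C ∧ ∀ b : E3, b ≠ 0 → ‖b‖ ≤ 1 →
      wtMass m (shiftDiff b (source Ω k f)) ≤ ENNReal.ofReal (C * ‖b‖ ^ (1 - ε)) := by
  obtain ⟨C1, hC1, h1⟩ := h.exists_wtMass_shiftDiff_source_le m
  obtain ⟨C2, hC2, h2⟩ := h.exists_wtMass_innerDiff_source_le hε (by linarith) m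
  obtain ⟨C3, hC3, h3⟩ := h.exists_wtMass_shiftDiff_avg_le hε (by linarith) m
  have hMt := h.wtMass_source_lt_top (m + 2)
  set M := wtMass (m + 2) (source Ω k f) with hM
  refine ⟨C2 + 2 * (C3 * M.toReal) + C1, by positivity, fun b hb hb1 => ?_⟩
  have hb0 : 0 < ‖b‖ := norm_pos_iff.2 hb
  refine (h1 b hb1).trans ((add_le_add (h2 b hb hb1) le_rfl).trans ?_)
  have h4 := h3 _ h.measurable_source hMt b
  rw [← hM, ← ENNReal.ofReal_toReal hMt.ne, ← ENNReal.ofReal_mul (by positivity)] at h4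
  refine (add_le_add (add_le_add le_rfl (mul_le_mul' le_rfl h4)) le_rfl).trans ?_
  rw [two_mul_ofReal, ← ENNReal.ofReal_add (by positivity) (by positivity),
    ← ENNReal.ofReal_add (by positivity) (by positivity)]
  refine ENNReal.ofReal_le_ofReal ?_
  have e1 : ‖b‖ ^ (2 - 3 * ε) ≤ ‖b‖ ^ (1 - ε) :=
    Real.rpow_le_rpow_of_exponent_ge hb0 hb1 (by linarith)
  have e2 : ‖b‖ ≤ ‖b‖ ^ (1 - ε) := by
    have := Real.rpow_le_rpow_of_exponent_ge hb0 hb1 (by linarith : 1 - ε ≤ 1)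
    rwa [Real.rpow_one] at this
  have e3 := mul_le_mul_of_nonneg_left e1 hC2.le
  have e4 := mul_le_mul_of_nonneg_left e2 hC1.le
  linarith

/-- The second difference of the average is the first difference of the average of a first
difference. Averaging contributes `|b|^(1-ε)`, and the half derivative of the extended source
contributes the same again. The Marchaud inequality passes to first differences; it applies because
the order stays strictly below one derivative. -/
theorem exists_wtMass_shiftDiff_avg_source_le (h : IsMildSolution Ω D A ν k f g) {ε : ℝ}
    (hε : 0 < ε) (hε1 : ε ≤ 1 / 2) (m : ℝ) :
    ∃ C : ℝ, 0 < C ∧ ∀ b : E3, b ≠ 0 → ‖b‖ ≤ 1 →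
      wtMass m (shiftDiff b (avg D ν k (source Ω k f))) ≤ ENNReal.ofReal (C * ‖b‖ ^ (2 - 2 * ε)) := by
  obtain ⟨C1, hC1, h1⟩ := h.exists_wtMass_shiftDiff_source_le_rpow hε hε1 (m + 2)
  obtain ⟨C2, hC2, h2⟩ := h.exists_wtMass_shiftDiff_avg_le hε (by linarith) m
  have hMt := h.wtMass_source_lt_top (m + 2)
  set M := wtMass (m + 2) (source Ω k f) with hM
  set F := source Ω k f with hF
  have hFm : Measurable F := h.measurable_source
  have hGm : Measurable (avg D ν k F) := measurable_avg h.measurable_freq h.measurable_kernel hFm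
  -- Chosen so that `(1 + η)/4 · 2^(2-2ε) = 2^(-ε) < 1`, the contraction condition for the doubling
  -- argument.
  set η : ℝ := 2 ^ ε - 1 with hη
  have hη0 : 0 < η := by
    have := Real.one_lt_rpow one_lt_two hε
    linarith
  refine exists_le_rpow_of_doubling (θ := (1 + η) / 4) (C₀ := C2 * M.toReal)
    (C₁ := (1 + η⁻¹) / 4 * (C2 * C1)) (by positivity) (by linarith) ?_ (by positivity)
    (by positivity) ?_ ?_
  · have e : (1 + η) / 4 * (2 : ℝ) ^ (2 - 2 * ε) = 2 ^ (-ε) := by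
      rw [hη, Real.rpow_sub two_pos, show 2 * ε = ε + ε by ring, Real.rpow_add two_pos,
        Real.rpow_two, Real.rpow_neg zero_le_two]
      have : (0 : ℝ) < 2 ^ ε := by positivity
      field_simp
      ring
    rw [e]
    exact Real.rpow_lt_one_of_one_lt_of_neg one_lt_two (by linarith)
  · intro b hb hb1
    have h3 := h2 F hFm hMt b
    rw [← hM, ← ENNReal.ofReal_toReal hMt.ne, ← ENNReal.ofReal_mul (by positivity)] at h3
    refine h3.trans (ENNReal.ofReal_le_ofReal ?_)
    refine mul_le_mul_of_nonneg_right ?_ ENNReal.toReal_nonneg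
    exact mul_le_of_le_one_right hC2.le
      (Real.rpow_le_one (norm_nonneg _) hb1 (by linarith))
  · intro b hb hb1
    have hb0 : 0 < ‖b‖ := norm_pos_iff.2 hb
    have hdm := measurable_shiftDiff hFm b
    have hfin : wtMass (m + 2) (shiftDiff b F) < ⊤ := (h1 b hb hb1).trans_lt ENNReal.ofReal_lt_top
    have hpt : ∀ᵐ v, ∀ᵐ x, ‖shiftDiff b (avg D ν k F) (x, v)‖ₑ ^ 2
        ≤ ENNReal.ofReal ((1 + η) / 4) * ‖shiftDiff ((2 : ℝ) • b) (avg D ν k F) (x, v)‖ₑ ^ 2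
          + ENNReal.ofReal ((1 + η⁻¹) / 4) *
            ‖shiftDiff b (avg D ν k (shiftDiff b F)) (x, v)‖ₑ ^ 2 := by
      filter_upwards [h.ae_avg_shiftDiff hFm hMt b] with v hv
      have hv' := (measurePreserving_add_right (volume : Measure E3) b).quasiMeasurePreserving.ae hv
      filter_upwards [hv, hv'] with x hx hx'
      refine enorm_sq_le_doubling hη0 ?_
      have e1 : shiftDiff b (avg D ν k (shiftDiff b F)) (x, v)
          = shiftDiff b (avg D ν k F) (x + b, v) - shiftDiff b (avg D ν k F) (x, v) := by
        rw [← hx, ← hx']; rfl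
      rw [e1]
      unfold shiftDiff
      simp only
      rw [show x + b + b = x + (2 : ℝ) • b by rw [two_smul, add_assoc]]
      ring
    have hUm : Measurable fun p => ENNReal.ofReal ((1 + η) / 4) *
        ‖shiftDiff ((2 : ℝ) • b) (avg D ν k F) p‖ₑ ^ 2 :=
      ((measurable_shiftDiff hGm _).enorm.pow_const 2).const_mul _
    refine (wtMass_add_le (U := fun p => ENNReal.ofReal ((1 + η) / 4) *
        ‖shiftDiff ((2 : ℝ) • b) (avg D ν k F) p‖ₑ ^ 2)
      (V := fun p => ENNReal.ofReal ((1 + η⁻¹) / 4) *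
            ‖shiftDiff b (avg D ν k (shiftDiff b F)) p‖ₑ ^ 2) hUm hpt).trans ?_
    have hpull : ∀ (c : ℝ) (H : E3 × E3 → ℝ),
        ∫⁻ v, wt m v * ∫⁻ x, ENNReal.ofReal c * ‖H (x, v)‖ₑ ^ 2 = ENNReal.ofReal c * wtMass m H := by
      intro c H
      unfold wtMass
      rw [← lintegral_const_mul' _ _ ENNReal.ofReal_ne_top]
      refine lintegral_congr fun v => ?_
      rw [lintegral_const_mul' _ _ ENNReal.ofReal_ne_top, mul_left_comm]
    rw [hpull, hpull]
    refine add_le_add le_rfl ?_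
    rw [mul_assoc, ENNReal.ofReal_mul (by positivity)]
    refine mul_le_mul' le_rfl ((h2 _ hdm hfin b).trans ?_)
    refine (mul_le_mul' le_rfl (h1 b hb hb1)).trans ?_
    rw [← ENNReal.ofReal_mul (by positivity)]
    refine ENNReal.ofReal_le_ofReal (le_of_eq ?_)
    rw [show 2 - 2 * ε = (1 - ε) + (1 - ε) by ring, Real.rpow_add hb0]
    ring

/-- Returning to the splitting with the improved average: away from the boundary jump, the source
itself has almost one derivative. -/
theorem exists_wtMass_innerDiff_source_le_rpow (h : IsMildSolution Ω D A ν k f g) {ε : ℝ}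
    (hε : 0 < ε) (hε1 : ε ≤ 1 / 2) (m : ℝ) :
    ∃ C : ℝ, 0 < C ∧ ∀ b : E3, b ≠ 0 → ‖b‖ ≤ 1 →
      wtMass m (innerDiff Ω b (source Ω k f)) ≤ ENNReal.ofReal (C * ‖b‖ ^ (2 - 3 * ε)) := by
  obtain ⟨C1, hC1, h1⟩ := h.exists_wtMass_innerDiff_source_le hε (by linarith) m
  obtain ⟨C2, hC2, h2⟩ := h.exists_wtMass_shiftDiff_avg_source_le hε hε1 m
  refine ⟨C1 + 2 * C2, by positivity, fun b hb hb1 => ?_⟩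
  have hb0 : 0 < ‖b‖ := norm_pos_iff.2 hb
  refine (h1 b hb hb1).trans ((add_le_add le_rfl (mul_le_mul' le_rfl (h2 b hb hb1))).trans ?_)
  rw [two_mul_ofReal, ← ENNReal.ofReal_add (by positivity) (by positivity)]
  refine ENNReal.ofReal_le_ofReal ?_
  have e1 : ‖b‖ ^ (2 - 2 * ε) ≤ ‖b‖ ^ (2 - 3 * ε) :=
    Real.rpow_le_rpow_of_exponent_ge hb0 hb1 (by linarith)
  have e3 := mul_le_mul_of_nonneg_left e1 hC2.le
  linarith

end IsMildSolution


/-! ### The difference estimate for the solution -/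

theorem rayInt_add {D : ℝ} {G H : E3 × E3 → ENNReal} (hG : Measurable G) (p : E3 × E3) :
    rayInt D (fun q => G q + H q) p = rayInt D G p + rayInt D H p := by
  have hm : Measurable fun s : ℝ => G (p.1 - s • p.2, p.2) := by
    have := hG.comp (by fun_prop : Measurable fun s : ℝ => (p.1 - s • p.2, p.2))
    exact this
  exact lintegral_add_left hm _

/-- Integration along characteristics is bounded in `L²` with the weight `|v|⁻²`. -/
theorem lintegral_rayInt_sq_le {D : ℝ} (hD : 0 ≤ D) {H : E3 × E3 → ℝ} (hH : Measurable H) :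
    ∫⁻ v, ∫⁻ x, rayInt D (fun q => ‖H q‖ₑ) (x, v) ^ 2 ≤ ENNReal.ofReal (D ^ 2) * wtMass 0 H := by
  unfold wtMass
  rw [← lintegral_const_mul' _ _ ENNReal.ofReal_ne_top]
  refine lintegral_mono fun v => ?_
  refine (lintegral_mono fun x => rayInt_sq_le hH.enorm D (x, v)).trans ?_
  simp only
  rw [lintegral_const_mul' _ _ ENNReal.ofReal_ne_top, lintegral_rayInt (hH.enorm.pow_const 2)]
  unfold wt
  rw [← mul_assoc, ← mul_assoc, ← ENNReal.ofReal_mul (by positivity),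
    ← ENNReal.ofReal_mul (by positivity)]
  refine mul_le_mul' (ENNReal.ofReal_le_ofReal (le_of_eq ?_)) le_rfl
  rw [Real.rpow_zero, one_mul, ← pow_two (D / ‖v‖), div_pow, div_eq_mul_inv]

theorem integrableOn_ray_of_rayInt_lt_top {D : ℝ} {ν : E3 → ℝ} (hν : ∀ v, 0 ≤ ν v)
    {H : E3 × E3 → ℝ} (hH : Measurable H) {p : E3 × E3}
    (hp : rayInt D (fun q => ‖H q‖ₑ) p < ⊤) :
    IntegrableOn (fun s => Real.exp (-ν p.2 * s) * H (p.1 - s • p.2, p.2)) (Ioc 0 (D / ‖p.2‖)) := by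
  have hm : Measurable fun s : ℝ => H (p.1 - s • p.2, p.2) := by
    have := hH.comp (by fun_prop : Measurable fun s : ℝ => (p.1 - s • p.2, p.2))
    exact this
  refine ⟨Measurable.aestronglyMeasurable (by fun_prop), lt_of_le_of_lt ?_ hp⟩
  refine setLIntegral_mono' measurableSet_Ioc fun s hs => ?_
  rw [enorm_mul]
  refine mul_le_of_le_one_left zero_le ?_
  rw [Real.enorm_of_nonneg (Real.exp_pos _).le, ENNReal.ofReal_le_one, Real.exp_le_one_iff]
  have := mul_nonneg (hν p.2) hs.1.le
  linarith

theorem enorm_shiftDiff_duhamelTerm_le {D : ℝ} {ν : E3 → ℝ} (hν : ∀ v, 0 ≤ ν v)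
    {H : E3 × E3 → ℝ} (hH : Measurable H) {x b v : E3}
    (h1 : rayInt D (fun q => ‖H q‖ₑ) (x, v) < ⊤) (h2 : rayInt D (fun q => ‖H q‖ₑ) (x + b, v) < ⊤) :
    ‖duhamelTerm D ν H (x + b, v) - duhamelTerm D ν H (x, v)‖ₑ
      ≤ rayInt D (fun q => ‖shiftDiff b H q‖ₑ) (x, v) := by
  have e : duhamelTerm D ν H (x + b, v) - duhamelTerm D ν H (x, v)
      = duhamelTerm D ν (shiftDiff b H) (x, v) := by
    have i1 := integrableOn_ray_of_rayInt_lt_top hν hH h1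
    have i2 := integrableOn_ray_of_rayInt_lt_top hν hH h2
    unfold duhamelTerm
    rw [← integral_sub i2 i1]
    congr 1
    ext s
    unfold shiftDiff
    simp only
    rw [show x - s • v + b = x + b - s • v by abel]
    ring
  rw [e]
  exact enorm_duhamelTerm_le hν _ _

namespace IsMildSolution

variable {Ω : Set E3} {D A : ℝ} {ν : E3 → ℝ} {k f g : E3 × E3 → ℝ}

theorem ae_rayInt_source_lt_top (h : IsMildSolution Ω D A ν k f g) :
    ∀ᵐ p, rayInt D (fun q => ‖source Ω k f q‖ₑ) p < ⊤ := by
  obtain ⟨C, hC, hb⟩ := h.exists_source_sq_le 0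
  have hb' : ∀ᵐ p : E3 × E3, ‖source Ω k f p‖ₑ ^ 2 ≤ ENNReal.ofReal C := by
    have := (Measure.quasiMeasurePreserving_fst (μ := (volume : Measure E3))
      (ν := (volume : Measure E3))).ae hb
    filter_upwards [this] with p hp
    have := hp p.2
    rwa [Real.rpow_zero, mul_one] at this
  filter_upwards [rayInt_le_of_ae D hb'] with p hp
  have h1 := rayInt_sq_le h.measurable_source.enorm D p
  have h2 : rayInt D (fun _ => ENNReal.ofReal C) p < ⊤ := by
    unfold rayInt
    simp only [lintegral_const, Measure.restrict_apply_univ, Real.volume_Ioc]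
    exact ENNReal.mul_lt_top ENNReal.ofReal_lt_top ENNReal.ofReal_lt_top
  have h3 := h1.trans_lt (ENNReal.mul_lt_top ENNReal.ofReal_lt_top (hp.trans_lt h2))
  by_contra hcon
  rw [not_lt, top_le_iff] at hcon
  rw [hcon] at h3
  simp at h3

/-- The difference of the extended source is an interior difference plus a jump. The factor `(1 +
|v|)⁻¹`, once squared, is the weight with which rays in the boundary layer are estimated; the jump
inside a ray integral thus contributes almost `|b|²`, not merely `|b|`. -/
theorem exists_ae_enorm_shiftDiff_source_le (h : IsMildSolution Ω D A ν k f g) :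
    ∃ C : ℝ, 0 < C ∧ ∀ b : E3, ∀ᵐ p : E3 × E3, ‖shiftDiff b (source Ω k f) p‖ₑ
      ≤ ‖innerDiff Ω b (source Ω k f) p‖ₑ + ENNReal.ofReal (C * (1 + ‖p.2‖)⁻¹) * jump Ω b p.1 := by
  obtain ⟨C, hC, hs⟩ := h.exists_source_sq_le (-2)
  refine ⟨√C, by positivity, fun b => ?_⟩
  have hs1 : ∀ᵐ x, ∀ v, ‖source Ω k f (x, v)‖ₑ ≤ ENNReal.ofReal (√C * (1 + ‖v‖)⁻¹) := by
    filter_upwards [hs] with x hx v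
    refine (ENNReal.pow_le_pow_left_iff two_ne_zero).1 ((hx v).trans (le_of_eq ?_))
    rw [← ENNReal.ofReal_pow (by positivity), mul_pow, Real.sq_sqrt hC.le,
      Real.rpow_neg (by positivity), Real.rpow_two, inv_pow]
  have hs2 := (measurePreserving_add_right (volume : Measure E3) b).quasiMeasurePreserving.ae hs1
  have hs1' := (Measure.quasiMeasurePreserving_fst (μ := (volume : Measure E3))
      (ν := (volume : Measure E3))).ae hs1
  have hs2' := (Measure.quasiMeasurePreserving_fst (μ := (volume : Measure E3))
      (ν := (volume : Measure E3))).ae hs2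
  filter_upwards [hs1', hs2'] with p hx hx'
  obtain ⟨x, v⟩ := p
  by_cases hx1 : x ∈ Ω
  · by_cases hx2 : x + b ∈ Ω
    · rw [innerDiff_of_mem (show (x, v).1 ∈ overlap Ω b from ⟨hx1, hx2⟩)]
      exact le_self_add
    · unfold shiftDiff
      rw [source_of_notMem (p := (x + b, v)) hx2, zero_sub, enorm_neg]
      exact le_add_left ((hx v).trans (le_mul_of_one_le_right zero_le (one_le_jump (by tauto))))
  · by_cases hx2 : x + b ∈ Ω
    · unfold shiftDiff
      rw [source_of_notMem (p := (x, v)) hx1, sub_zero]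
      exact le_add_left ((hx' v).trans (le_mul_of_one_le_right zero_le (one_le_jump (by tauto))))
    · unfold shiftDiff
      rw [source_of_notMem (p := (x, v)) hx1, source_of_notMem (p := (x + b, v)) hx2]
      simp

/-- The difference estimate for the solution itself. -/
theorem exists_lintegral_innerDiff_le (h : IsMildSolution Ω D A ν k f g) {ε : ℝ}
    (hε : 0 < ε) (hε1 : ε ≤ 1 / 2) :
    ∃ C : ℝ, 0 < C ∧ ∀ b : E3, b ≠ 0 → ‖b‖ ≤ 1 →
      ∫⁻ v, ∫⁻ x, ‖innerDiff Ω b f (x, v)‖ₑ ^ 2 ≤ ENNReal.ofReal (C * ‖b‖ ^ (2 - 3 * ε)) := by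
  obtain ⟨C1, hC1, h1⟩ := h.exists_lintegral_boundaryTerm_diff_le hε (by linarith) 0
  obtain ⟨C2, hC2, h2⟩ := h.exists_wtMass_innerDiff_source_le_rpow hε hε1 0
  obtain ⟨C3, hC3, h3⟩ := h.exists_ae_enorm_shiftDiff_source_le
  obtain ⟨C4, hC4, h4⟩ := exists_lintegral_sq_ray_jump_le h.isOpen.measurableSet h.convex
    h.isBounded hε (by linarith) h.D_pos.le
  have hD := h.D_pos
  refine ⟨2 * C1 + 4 * (D ^ 2 * C2) + 4 * (C3 ^ 2 * C4), by positivity, fun b hb hb1 => ?_⟩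
  have hb0 : 0 < ‖b‖ := norm_pos_iff.2 hb
  set F := source Ω k f with hF
  have hFm : Measurable F := h.measurable_source
  set J := innerDiff Ω b (boundaryTerm Ω D ν k f) with hJ
  have hJm : Measurable fun p => ‖J p‖ₑ ^ 2 :=
    (measurable_innerDiff h.isOpen.measurableSet b h.measurable_boundaryTerm).enorm.pow_const 2
  have hIm : Measurable (innerDiff Ω b F) := measurable_innerDiff h.isOpen.measurableSet b hFm
  have hRm : Measurable fun p => rayInt D (fun q => ‖innerDiff Ω b F q‖ₑ) p ^ 2 :=
    (measurable_rayInt hIm.enorm D).pow_const 2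
  set T : E3 × E3 → ENNReal := fun p => ENNReal.ofReal (C3 ^ 2) *
    (ENNReal.ofReal ((1 + ‖p.2‖) ^ 2)⁻¹ *
      (∫⁻ s in Ioc 0 (D / ‖p.2‖), jump Ω b (p.1 - s • p.2)) ^ 2) with hT
  have hpt : ∀ᵐ v, ∀ᵐ x, ‖innerDiff Ω b f (x, v)‖ₑ ^ 2 ≤ 2 * ‖J (x, v)‖ₑ ^ 2
      + (4 * rayInt D (fun q => ‖innerDiff Ω b F q‖ₑ) (x, v) ^ 2 + 4 * T (x, v)) := by
    filter_upwards [ae_ae_swap h.ae_rayInt_source_lt_top, ae_ae_swap (rayInt_le_of_ae D (h3 b))]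
      with v hv1 hv2
    have hv1' :=
      (measurePreserving_add_right (volume : Measure E3) b).quasiMeasurePreserving.ae hv1
    filter_upwards [hv1, hv1', hv2] with x hx1 hx1' hx2
    by_cases hxo : x ∈ overlap Ω b
    swap
    · rw [innerDiff_of_notMem hxo]; simp
    have e1 : innerDiff Ω b f (x, v) = J (x, v)
        + (duhamelTerm D ν F (x + b, v) - duhamelTerm D ν F (x, v)) := by
      rw [hJ, innerDiff_of_mem hxo, innerDiff_of_mem hxo]
      unfold boundaryTerm
      ring
    have e2 := enorm_shiftDiff_duhamelTerm_le h.freq_nonneg hFm hx1 hx1'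
    rw [rayInt_add hIm.enorm] at hx2
    have e3 : rayInt D (fun q : E3 × E3 => ENNReal.ofReal (C3 * (1 + ‖q.2‖)⁻¹) * jump Ω b q.1) (x, v)
        ^ 2 = T (x, v) := by
      rw [hT]
      unfold rayInt
      simp only
      rw [lintegral_const_mul' _ _ ENNReal.ofReal_ne_top, mul_pow, ← mul_assoc,
        ← ENNReal.ofReal_pow (by positivity), ← ENNReal.ofReal_mul (by positivity), mul_pow, inv_pow]
    rw [e1]
    refine (enorm_add_sq_le _ _).trans (add_le_add le_rfl ?_)
    refine (mul_le_mul' le_rfl ((pow_le_pow_left' (e2.trans hx2) 2).trans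
      (ennreal_add_sq_le _ _))).trans (le_of_eq ?_)
    rw [e3]
    ring
  have hswJ : Measurable fun v => ∫⁻ x, 2 * ‖J (x, v)‖ₑ ^ 2 := by
    have h5 := (hJm.const_mul 2).comp (by fun_prop : Measurable fun q : E3 × E3 => (q.2, q.1))
    have h6 := h5.lintegral_prod_right' (ν := (volume : Measure E3))
    exact h6
  have hswR : Measurable fun v =>
      ∫⁻ x, 4 * rayInt D (fun q => ‖innerDiff Ω b F q‖ₑ) (x, v) ^ 2 := by
    have h5 := (hRm.const_mul 4).comp (by fun_prop : Measurable fun q : E3 × E3 => (q.2, q.1))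
    have h6 := h5.lintegral_prod_right' (ν := (volume : Measure E3))
    exact h6
  have hle : ∫⁻ v, ∫⁻ x, ‖innerDiff Ω b f (x, v)‖ₑ ^ 2
      ≤ (∫⁻ v, ∫⁻ x, 2 * ‖J (x, v)‖ₑ ^ 2)
        + ((∫⁻ v, ∫⁻ x, 4 * rayInt D (fun q => ‖innerDiff Ω b F q‖ₑ) (x, v) ^ 2)
          + ∫⁻ v, ∫⁻ x, 4 * T (x, v)) := by
    rw [← lintegral_add_left hswR, ← lintegral_add_left hswJ]
    refine lintegral_mono_ae ?_
    filter_upwards [hpt] with v hv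
    have m1 : Measurable fun x => 2 * ‖J (x, v)‖ₑ ^ 2 := by
      have := (hJm.const_mul 2).comp (by fun_prop : Measurable fun x : E3 => (x, v))
      exact this
    have m2 : Measurable fun x => 4 * rayInt D (fun q => ‖innerDiff Ω b F q‖ₑ) (x, v) ^ 2 := by
      have := (hRm.const_mul 4).comp (by fun_prop : Measurable fun x : E3 => (x, v))
      exact this
    rw [← lintegral_add_left m2, ← lintegral_add_left m1]
    exact lintegral_mono_ae hv
  refine hle.trans ?_
  have hn2 : (2 : ENNReal) ≠ ⊤ := by norm_num
  have hn4 : (4 : ENNReal) ≠ ⊤ := by norm_num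
  simp only [lintegral_const_mul' _ _ hn2, lintegral_const_mul' _ _ hn4]
  have k1 : ∫⁻ v, ∫⁻ x, ‖J (x, v)‖ₑ ^ 2 ≤ ENNReal.ofReal (C1 * ‖b‖ ^ (2 - 3 * ε)) := by
    have := h1 b hb hb1
    simpa only [Real.rpow_zero, ENNReal.ofReal_one, one_mul] using this
  have k2 : ∫⁻ v, ∫⁻ x, rayInt D (fun q => ‖innerDiff Ω b F q‖ₑ) (x, v) ^ 2
      ≤ ENNReal.ofReal (D ^ 2 * (C2 * ‖b‖ ^ (2 - 3 * ε))) := by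
    refine (lintegral_rayInt_sq_le hD.le hIm).trans ?_
    rw [ENNReal.ofReal_mul (by positivity)]
    exact mul_le_mul' le_rfl (h2 b hb hb1)
  have k3 : ∫⁻ v, ∫⁻ x, T (x, v) ≤ ENNReal.ofReal (C3 ^ 2 * (C4 * ‖b‖ ^ (2 - ε))) := by
    rw [hT]
    simp only [lintegral_const_mul' _ _ (ENNReal.ofReal_ne_top (r := C3 ^ 2))]
    rw [ENNReal.ofReal_mul (by positivity)]
    exact mul_le_mul' le_rfl (h4 b hb1)
  refine (add_le_add (mul_le_mul' le_rfl k1) (add_le_add (mul_le_mul' le_rfl k2)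
    (mul_le_mul' le_rfl k3))).trans ?_
  have hfour : ∀ x : ℝ, (4 : ENNReal) * ENNReal.ofReal x = ENNReal.ofReal (4 * x) := by
    intro x
    rw [ENNReal.ofReal_mul (by norm_num), ENNReal.ofReal_ofNat]
  rw [two_mul_ofReal, hfour, hfour, ← ENNReal.ofReal_add (by positivity) (by positivity),
    ← ENNReal.ofReal_add (by positivity) (by positivity)]
  refine ENNReal.ofReal_le_ofReal ?_
  have e1 : ‖b‖ ^ (2 - ε) ≤ ‖b‖ ^ (2 - 3 * ε) :=
    Real.rpow_le_rpow_of_exponent_ge hb0 hb1 (by linarith)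
  have e3 := mul_le_mul_of_nonneg_left e1 (by positivity : 0 ≤ 4 * (C3 ^ 2 * C4))
  linarith

end IsMildSolution


/-! ### The Slobodeckij semi-norm -/

theorem slobodeckij_congr {Ω : Set E3} (hΩ : MeasurableSet Ω) (s : ℝ) {f f₀ : E3 × E3 → ℝ}
    (hf : ∀ᵐ p : E3 × E3, p.1 ∈ Ω → f p = f₀ p) : slobodeckij Ω s f = slobodeckij Ω s f₀ := by
  unfold slobodeckij
  refine lintegral_congr_ae ?_
  filter_upwards [ae_ae_swap hf] with v hv
  refine setLIntegral_congr_fun_ae hΩ ?_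
  filter_upwards [hv] with y hy hyΩ
  refine setLIntegral_congr_fun_ae hΩ ?_
  filter_upwards [hv] with x hx hxΩ
  rw [hx hxΩ, hy hyΩ]

/-- The Slobodeckij semi-norm as an integral over translations. -/
theorem slobodeckij_eq {Ω : Set E3} (hΩ : MeasurableSet Ω) (s : ℝ) {f : E3 × E3 → ℝ}
    (hf : Measurable f) :
    slobodeckij Ω s f = ∫⁻ b, ENNReal.ofReal (‖b‖ ^ (-(3 + 2 * s))) *
      ∫⁻ v, ∫⁻ y, ‖innerDiff Ω b f (y, v)‖ₑ ^ 2 := by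
  have hdiff : ∀ v y, y ∈ Ω → ∫⁻ x in Ω, ENNReal.ofReal (|f (x, v) - f (y, v)| ^ 2 /
      ‖x - y‖ ^ (3 + 2 * s)) = ∫⁻ b, ENNReal.ofReal (‖b‖ ^ (-(3 + 2 * s))) *
        ‖innerDiff Ω b f (y, v)‖ₑ ^ 2 := by
    intro v y hy
    rw [← lintegral_indicator hΩ, ← lintegral_add_left_eq_self (μ := (volume : Measure E3)) _ y]
    refine lintegral_congr fun b => ?_
    by_cases hb : y + b ∈ Ω
    · rw [indicator_of_mem hb, innerDiff_of_mem (show (y, v).1 ∈ overlap Ω b from ⟨hy, hb⟩),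
        Real.enorm_eq_ofReal_abs, ← ENNReal.ofReal_pow (abs_nonneg _),
        ← ENNReal.ofReal_mul (by positivity), add_sub_cancel_left, Real.rpow_neg (norm_nonneg _),
        div_eq_mul_inv, mul_comm]
    · rw [indicator_of_notMem hb, innerDiff_of_notMem (fun hcon => hb hcon.2)]
      simp
  have hzero : ∀ v y, y ∉ Ω → ∫⁻ b, ENNReal.ofReal (‖b‖ ^ (-(3 + 2 * s))) *
        ‖innerDiff Ω b f (y, v)‖ₑ ^ 2 = 0 := by
    intro v y hy
    have : ∀ b, innerDiff Ω b f (y, v) = 0 := fun b =>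
      innerDiff_of_notMem (fun hcon => hy hcon.1)
    simp [this]
  have hm : Measurable fun q : E3 × (E3 × E3) =>
      ENNReal.ofReal (‖q.1‖ ^ (-(3 + 2 * s))) * ‖innerDiff Ω q.1 f q.2‖ₑ ^ 2 := by
    have hset : MeasurableSet {q : E3 × (E3 × E3) | q.2.1 ∈ Ω ∧ q.2.1 + q.1 ∈ Ω} := by
      have h1 : Measurable fun q : E3 × (E3 × E3) => q.2.1 := by fun_prop
      have h2 : Measurable fun q : E3 × (E3 × E3) => q.2.1 + q.1 := by fun_prop
      exact (h1 hΩ).inter (h2 hΩ)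
    have h1 : Measurable fun q : E3 × (E3 × E3) => f (q.2.1 + q.1, q.2.2) - f (q.2.1, q.2.2) := by
      have h2 := hf.comp
        (by fun_prop : Measurable fun q : E3 × (E3 × E3) => (q.2.1 + q.1, q.2.2))
      have h3 := hf.comp (by fun_prop : Measurable fun q : E3 × (E3 × E3) => (q.2.1, q.2.2))
      exact h2.sub h3
    have h2 : Measurable fun q : E3 × (E3 × E3) => innerDiff Ω q.1 f q.2 := by
      refine (congrArg Measurable ?_).mp (h1.indicator hset)
      ext q
      rfl
    have h3 : Measurable fun q : E3 × (E3 × E3) => ENNReal.ofReal (‖q.1‖ ^ (-(3 + 2 * s))) := by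
      fun_prop
    exact h3.mul (h2.enorm.pow_const 2)
  have e1 : slobodeckij Ω s f = ∫⁻ v, ∫⁻ y, ∫⁻ b, ENNReal.ofReal (‖b‖ ^ (-(3 + 2 * s))) *
        ‖innerDiff Ω b f (y, v)‖ₑ ^ 2 := by
    unfold slobodeckij
    refine lintegral_congr fun v => ?_
    rw [← lintegral_indicator hΩ]
    refine lintegral_congr fun y => ?_
    by_cases hy : y ∈ Ω
    · rw [indicator_of_mem hy, hdiff v y hy]
    · rw [indicator_of_notMem hy, hzero v y hy]
  have e2 : ∀ v, ∫⁻ y, ∫⁻ b, ENNReal.ofReal (‖b‖ ^ (-(3 + 2 * s))) *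
        ‖innerDiff Ω b f (y, v)‖ₑ ^ 2 = ∫⁻ b, ENNReal.ofReal (‖b‖ ^ (-(3 + 2 * s))) *
        ∫⁻ y, ‖innerDiff Ω b f (y, v)‖ₑ ^ 2 := by
    intro v
    rw [lintegral_lintegral_swap]
    · refine lintegral_congr fun b => ?_
      rw [lintegral_const_mul' _ _ ENNReal.ofReal_ne_top]
    · have := hm.comp (by fun_prop : Measurable fun q : E3 × E3 => (q.2, (q.1, v)))
      exact Measurable.aemeasurable this
  rw [e1]
  simp only [e2]
  rw [lintegral_lintegral_swap]
  · refine lintegral_congr fun b => ?_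
    rw [lintegral_const_mul' _ _ ENNReal.ofReal_ne_top]
  · have h1 := hm.comp
      (by fun_prop : Measurable fun q : (E3 × E3) × E3 => (q.1.2, (q.2, q.1.1)))
    have h2 := h1.lintegral_prod_right' (ν := (volume : Measure E3))
    refine ((congrArg Measurable ?_).mp h2).aemeasurable
    ext q
    simp only [Function.comp, Function.uncurry]
    rw [lintegral_const_mul' _ _ ENNReal.ofReal_ne_top]

theorem lintegral_innerDiff_le {Ω : Set E3} {f : E3 × E3 → ℝ} (hf : Measurable f) (b : E3) :
    ∫⁻ v, ∫⁻ y, ‖innerDiff Ω b f (y, v)‖ₑ ^ 2 ≤ 4 * ∫⁻ p, ‖f p‖ₑ ^ 2 := by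
  have hfm : Measurable fun p => ‖f p‖ₑ ^ 2 := hf.enorm.pow_const 2
  rw [Measure.volume_eq_prod, lintegral_prod_symm' _ hfm, ← lintegral_const_mul' _ _ (by norm_num)]
  refine lintegral_mono fun v => ?_
  have hv : Measurable fun y => ‖f (y, v)‖ₑ ^ 2 := by
    have := hfm.comp (by fun_prop : Measurable fun y : E3 => (y, v))
    exact this
  have hvb : Measurable fun y => ‖f (y + b, v)‖ₑ ^ 2 := by
    have := hfm.comp (by fun_prop : Measurable fun y : E3 => (y + b, v))
    exact this
  have hpt : ∀ y, ‖innerDiff Ω b f (y, v)‖ₑ ^ 2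
      ≤ 2 * ‖f (y + b, v)‖ₑ ^ 2 + 2 * ‖f (y, v)‖ₑ ^ 2 := by
    intro y
    by_cases hy : y ∈ overlap Ω b
    · rw [innerDiff_of_mem hy, sub_eq_add_neg]
      refine (enorm_add_sq_le _ _).trans ?_
      rw [enorm_neg]
    · rw [innerDiff_of_notMem hy]; simp
  refine (lintegral_mono hpt).trans (le_of_eq ?_)
  rw [lintegral_add_left (hvb.const_mul 2), lintegral_const_mul _ hvb, lintegral_const_mul _ hv,
    lintegral_add_right_eq_self (μ := (volume : Measure E3)) (fun y => ‖f (y, v)‖ₑ ^ 2) b, ← add_mul]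
  norm_num

theorem IsMildSolution.slobodeckij_lt_top {Ω : Set E3} {D A : ℝ} {ν : E3 → ℝ}
    {k f g : E3 × E3 → ℝ} (h : IsMildSolution Ω D A ν k f g) {ε : ℝ} (hε : 0 < ε) (hε1 : ε < 1) :
    slobodeckij Ω (1 - ε) f < ⊤ := by
  -- With `ε/2` in place of `ε` the powers add up to `-(3 + 2(1-ε)) + (2 - 3ε/2) = -(3 - ε/2)`,
  -- integrable at the origin. Translations of length between `1` and `D + 1` are bounded trivially,
  -- and longer ones leave no overlap.
  obtain ⟨C, hC, hb⟩ := h.exists_lintegral_innerDiff_le (ε := ε / 2) (by positivity) (by linarith)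
  have hNt := h.lintegral_lt_top
  set N := ∫⁻ p, ‖f p‖ₑ ^ 2 with hN
  rw [slobodeckij_eq h.isOpen.measurableSet _ h.measurable]
  have h1 := lintegral_ball_norm_rpow_lt_top (p := 3 - ε / 2) (by linarith) 1
  have hmI : Measurable fun b : E3 => (Metric.ball (0 : E3) 1).indicator
      (fun b => ENNReal.ofReal C * ENNReal.ofReal (‖b‖ ^ (-(3 - ε / 2)))) b :=
    Measurable.indicator (by fun_prop) measurableSet_ball
  refine lt_of_le_of_lt (b := ∫⁻ b, ((Metric.ball (0 : E3) 1).indicator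
    (fun b => ENNReal.ofReal C * ENNReal.ofReal (‖b‖ ^ (-(3 - ε / 2)))) b
    + (Metric.ball (0 : E3) (D + 1)).indicator (fun _ => 4 * N) b)) ?_ ?_
  · refine lintegral_mono_ae ?_
    have hne : ∀ᵐ b : E3, b ≠ 0 := by simp [ae_iff]
    filter_upwards [hne] with b hb0
    have hbp : 0 < ‖b‖ := norm_pos_iff.2 hb0
    by_cases hb1 : b ∈ Metric.ball (0 : E3) 1
    · rw [indicator_of_mem hb1]
      refine le_add_right ?_
      rw [mem_ball_zero_iff] at hb1
      refine (mul_le_mul' le_rfl (hb b hb0 hb1.le)).trans ?_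
      rw [← ENNReal.ofReal_mul (by positivity), ← ENNReal.ofReal_mul (by positivity)]
      refine ENNReal.ofReal_le_ofReal (le_of_eq ?_)
      rw [mul_left_comm, ← Real.rpow_add hbp]
      congr 2; ring
    · rw [mem_ball_zero_iff, not_lt] at hb1
      by_cases hbD : b ∈ Metric.ball (0 : E3) (D + 1)
      · rw [indicator_of_mem hbD]
        refine le_add_left ?_
        refine (mul_le_of_le_one_left zero_le ?_).trans (lintegral_innerDiff_le h.measurable b)
        rw [ENNReal.ofReal_le_one]
        exact Real.rpow_le_one_of_one_le_of_nonpos hb1 (by linarith)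
      · have : ∀ p : E3 × E3, innerDiff Ω b f p = 0 := by
          intro p
          refine innerDiff_of_notMem fun hcon => hbD ?_
          have := h.norm_sub_le _ hcon.2 _ hcon.1
          rw [add_sub_cancel_left] at this
          rw [mem_ball_zero_iff]; linarith
        simp [this]
  · rw [lintegral_add_left hmI, lintegral_indicator measurableSet_ball,
      lintegral_indicator measurableSet_ball, lintegral_const_mul' _ _ ENNReal.ofReal_ne_top,
      setLIntegral_const]
    refine ENNReal.add_lt_top.2 ⟨ENNReal.mul_lt_top ENNReal.ofReal_lt_top h1, ?_⟩
    exact ENNReal.mul_lt_top (ENNReal.mul_lt_top (by norm_num) hNt) measure_ball_lt_top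

/-! ### From distributional solutions to mild solutions -/

theorem integrable_indicator_of_lintegral_sq {Ω : Set E3} (hΩ : MeasurableSet Ω)
    (hb : Bornology.IsBounded Ω) {H : E3 × E3 → ℝ} (hH : Measurable H)
    (h0 : ∀ p : E3 × E3, p.1 ∉ Ω → H p = 0) (h2 : ∫⁻ p, ‖H p‖ₑ ^ 2 < ⊤) (R : ℝ) :
    Integrable ({p : E3 × E3 | ‖p.2‖ < R}.indicator H) := by
  have hmem : MemLp H 2 := by
    refine ⟨hH.aestronglyMeasurable, ?_⟩
    rw [eLpNorm_lt_top_iff_lintegral_rpow_enorm_lt_top (by norm_num) (by norm_num)]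
    simpa using h2
  have e : {p : E3 × E3 | ‖p.2‖ < R}.indicator H = (Ω ×ˢ Metric.ball (0 : E3) R).indicator H := by
    ext p
    by_cases hp : p.1 ∈ Ω
    · by_cases hR : ‖p.2‖ < R
      · rw [indicator_of_mem (show p ∈ {p : E3 × E3 | ‖p.2‖ < R} from hR),
          indicator_of_mem (show p ∈ Ω ×ˢ Metric.ball (0 : E3) R from
            ⟨hp, mem_ball_zero_iff.2 hR⟩)]
      · rw [indicator_of_notMem (show p ∉ {p : E3 × E3 | ‖p.2‖ < R} from hR),
          indicator_of_notMem (fun hcon => hR (mem_ball_zero_iff.1 hcon.2))]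
    · rw [indicator_apply_eq_zero.2 fun _ => h0 p hp, indicator_apply_eq_zero.2 fun _ => h0 p hp]
  rw [e, integrable_indicator_iff (hΩ.prod measurableSet_ball)]
  have hfin : volume (Ω ×ˢ Metric.ball (0 : E3) R) < ⊤ := by
    rw [Measure.volume_eq_prod, Measure.prod_prod]
    exact ENNReal.mul_lt_top hb.measure_lt_top measure_ball_lt_top
  have : IsFiniteMeasure (volume.restrict (Ω ×ˢ Metric.ball (0 : E3) R)) :=
    ⟨by rwa [Measure.restrict_apply_univ]⟩
  exact (hmem.restrict _).integrable one_le_two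

theorem lintegral_source_sq_lt_top {Ω : Set E3} {k f : E3 × E3 → ℝ} {A : ℝ} (hA : 0 < A)
    (hk : ∀ q, |k q| ≤ A * gradBound q.1 q.2) (hf : Measurable f)
    (h2 : ∫⁻ p, ‖f p‖ₑ ^ 2 < ⊤) (hm : Measurable (source Ω k f)) :
    ∫⁻ p, ‖source Ω k f p‖ₑ ^ 2 < ⊤ := by
  obtain ⟨C1, hC1, hK⟩ := exists_enorm_kernel_integral_sq_le hA hk
  obtain ⟨C2, hC2, hexp⟩ := exists_lintegral_exp_le (c := 1 / 8) (by norm_num)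
  have hfm : Measurable fun p => ‖f p‖ₑ ^ 2 := hf.enorm.pow_const 2
  rw [Measure.volume_eq_prod, lintegral_prod _ (hm.enorm.pow_const 2).aemeasurable]
  rw [Measure.volume_eq_prod, lintegral_prod _ hfm.aemeasurable] at h2
  refine lt_of_le_of_lt (b := ENNReal.ofReal C1 * (ENNReal.ofReal C2 * ∫⁻ x, ∫⁻ w, ‖f (x, w)‖ₑ ^ 2))
    ?_ (ENNReal.mul_lt_top ENNReal.ofReal_lt_top (ENNReal.mul_lt_top ENNReal.ofReal_lt_top h2))
  rw [← lintegral_const_mul' _ _ ENNReal.ofReal_ne_top,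
    ← lintegral_const_mul' _ _ ENNReal.ofReal_ne_top]
  refine lintegral_mono fun x => ?_
  have hx : Measurable fun w => ‖f (x, w)‖ₑ := by
    have := hf.comp (by fun_prop : Measurable fun w : E3 => (x, w))
    exact this.enorm
  have hpt : ∀ v, ‖source Ω k f (x, v)‖ₑ ^ 2 ≤ ENNReal.ofReal C1 *
      ∫⁻ w, ENNReal.ofReal (Real.exp (-(1 / 8) * ‖v - w‖ ^ 2)) * ‖f (x, w)‖ₑ ^ 2 := by
    intro v
    by_cases hxΩ : x ∈ Ω
    · rw [source_of_mem hxΩ]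
      exact hK (fun w => f (x, w)) _ v hx (Eventually.of_forall fun _ => le_rfl)
    · rw [source_of_notMem hxΩ]; simp
  refine (lintegral_mono hpt).trans ?_
  rw [lintegral_const_mul' _ _ ENNReal.ofReal_ne_top]
  refine mul_le_mul' le_rfl ?_
  rw [lintegral_lintegral_swap (by fun_prop), ← lintegral_const_mul' _ _ ENNReal.ofReal_ne_top]
  refine lintegral_mono fun w => ?_
  rw [lintegral_mul_const _ (by fun_prop)]
  refine mul_le_mul' ?_ le_rfl
  have := hexp w
  simpa only [norm_sub_rev w] using this

/-- A solution of the boundary value problem agrees with a function given by Duhamel's formula. -/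
theorem exists_isMildSolution {Ω : Set E3} (hΩ : PositiveCurvatureDomain Ω) {γ : ℝ} (hγ0 : 0 ≤ γ)
    (hγ1 : γ ≤ 1) {B : ℝ → ℝ → ℝ} (hBm : Measurable (Function.uncurry B)) (hB : AngularCutoff γ B)
    {g : E3 × E3 → ℝ} (hg : IncomingAssumption Ω g) {f : E3 × E3 → ℝ}
    (hf : IsL2Solution Ω B g f) :
    ∃ (D A : ℝ) (ν : E3 → ℝ) (k f₀ : E3 × E3 → ℝ), IsMildSolution Ω D A ν k f₀ g ∧
      ∀ᵐ p : E3 × E3, p.1 ∈ Ω → f p = f₀ p := by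
  obtain ⟨ν, k, A, hA, hνm, hν0, hνA, hkm, hkA, hL⟩ := exists_linearizedL_eq hγ0 hγ1 hBm hB
  have hΩm : MeasurableSet Ω := hΩ.isOpen.measurableSet
  have hΩu : MeasurableSet (Ω ×ˢ (univ : Set E3)) := hΩm.prod MeasurableSet.univ
  have hD0 : 0 < Metric.diam Ω + 1 := by linarith [Metric.diam_nonneg (s := Ω)]
  have hD : ∀ x ∈ Ω, ∀ y ∈ Ω, ‖x - y‖ ≤ Metric.diam Ω + 1 := by
    intro x hx y hy
    have := Metric.dist_le_diam_of_mem hΩ.isBounded hx hy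
    rw [dist_eq_norm] at this
    linarith
  -- The solution is replaced by a measurable representative vanishing outside `Ω`. The difference
  -- is invisible to the weak equation and, for almost every characteristic, to the trace condition.
  obtain ⟨f₁, hf₁, hff₁⟩ := hf.memLp.1
  set f₀ : E3 × E3 → ℝ := (Ω ×ˢ univ).indicator f₁ with hf₀
  have hf₀m : Measurable f₀ := hf₁.measurable.indicator hΩu
  have hf₀0 : ∀ p : E3 × E3, p.1 ∉ Ω → f₀ p = 0 := fun p hp =>
    indicator_of_notMem (fun hcon => hp hcon.1) _
  have hff₀ : ∀ᵐ p : E3 × E3, p.1 ∈ Ω → f p = f₀ p := by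
    filter_upwards [(ae_restrict_iff' hΩu).1 hff₁] with p hp hpΩ
    rw [hf₀, indicator_of_mem (show p ∈ Ω ×ˢ univ from ⟨hpΩ, mem_univ _⟩)]
    exact hp ⟨hpΩ, mem_univ _⟩
  have hf₀2 : ∫⁻ p, ‖f₀ p‖ₑ ^ 2 < ⊤ := by
    have h1 := hf.memLp.2
    rw [eLpNorm_lt_top_iff_lintegral_rpow_enorm_lt_top (by norm_num) (by norm_num)] at h1
    refine lt_of_le_of_lt (le_of_eq ?_) h1
    rw [← lintegral_indicator hΩu]
    refine lintegral_congr_ae ?_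
    filter_upwards [hff₀] with p hp
    by_cases hpΩ : p.1 ∈ Ω
    · rw [indicator_of_mem (show p ∈ Ω ×ˢ univ from ⟨hpΩ, mem_univ _⟩), hp hpΩ]
      simp
    · rw [indicator_of_notMem (fun hcon => hpΩ hcon.1), hf₀0 p hpΩ]; simp
  set F := source Ω k f₀ with hF
  have hFm : Measurable F := measurable_source hΩm hkm hf₀m
  have hF2 : ∫⁻ p, ‖F p‖ₑ ^ 2 < ⊤ := lintegral_source_sq_lt_top hA hkA hf₀m hf₀2 hFm
  have hF0 : ∀ p : E3 × E3, p.1 ∉ Ω → F p = 0 := fun p hp => source_of_notMem hp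
  set G : E3 × E3 → ℝ := fun p => -ν p.2 * f₀ p + F p with hG
  have hGm : Measurable G := by fun_prop
  have hfi := integrable_indicator_of_lintegral_sq hΩm hΩ.isBounded hf₀m hf₀0 hf₀2
  have hFi := integrable_indicator_of_lintegral_sq hΩm hΩ.isBounded hFm hF0 hF2
  have hGi : ∀ R : ℝ, Integrable ({p : E3 × E3 | ‖p.2‖ < R}.indicator G) := by
    intro R
    have hset : MeasurableSet {p : E3 × E3 | ‖p.2‖ < R} :=
      measurableSet_lt (by fun_prop) measurable_const
    refine Integrable.mono' (((hfi R).norm.const_mul (A * (1 + R))).add (hFi R).norm)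
      (hGm.indicator hset).aestronglyMeasurable (Eventually.of_forall fun p => ?_)
    by_cases hp : p ∈ {p : E3 × E3 | ‖p.2‖ < R}
    · simp only [Pi.add_apply, indicator_of_mem hp]
      refine (norm_add_le _ _).trans (add_le_add ?_ le_rfl)
      rw [norm_mul, norm_neg, Real.norm_of_nonneg (hν0 _)]
      refine mul_le_mul_of_nonneg_right ((hνA _).trans ?_) (norm_nonneg _)
      have : ‖p.2‖ < R := hp
      exact mul_le_mul_of_nonneg_left (by linarith) hA.le
    · simp [indicator_of_notMem hp]
  -- For almost every `x` the velocity slice is in `L²` and the splitting of `L` applies. Its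
  -- integral part sees only the class of the slice, whereas the multiplication part evaluates it at
  -- `v`, so the replacement is valid for almost every pair.
  have hlin : ∀ᵐ p : E3 × E3, p.1 ∈ Ω → linearizedL B (fun w => f (p.1, w)) p.2 = G p := by
    have h1 : ∀ᵐ x : E3, ∀ᵐ w : E3, x ∈ Ω → f (x, w) = f₀ (x, w) := Measure.ae_ae_of_ae_prod hff₀
    have hfm2 : Measurable fun p => ‖f₀ p‖ₑ ^ 2 := hf₀m.enorm.pow_const 2
    have h2 : ∀ᵐ x : E3, ∫⁻ w, ‖f₀ (x, w)‖ₑ ^ 2 < ⊤ := by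
      have h3 := hf₀2
      rw [Measure.volume_eq_prod, lintegral_prod _ hfm2.aemeasurable] at h3
      exact ae_lt_top hfm2.lintegral_prod_right' h3.ne
    have h3 : ∀ᵐ x : E3, x ∈ Ω → ∀ v, linearizedL B (fun w => f (x, w)) v
        = -ν v * f (x, v) + F (x, v) := by
      filter_upwards [h1, h2] with x hx hx2 hxΩ v
      have hae : (fun w => f₀ (x, w)) =ᵐ[volume] fun w => f (x, w) := by
        filter_upwards [hx] with w hw using (hw hxΩ).symm
      have hmx : Measurable fun w => f₀ (x, w) := by
        have := hf₀m.comp (by fun_prop : Measurable fun w : E3 => (x, w))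
        exact this
      have hmem : MemLp (fun w => f (x, w)) 2 :=
        (memLp_congr_ae hae).1 (memLp_two_of_lintegral_lt_top hmx hx2)
      rw [hL _ hmem v, hF, source_of_mem hxΩ]
      congr 1
      refine integral_congr_ae ?_
      filter_upwards [hae] with w hw
      rw [hw]
    have h4 := (Measure.quasiMeasurePreserving_fst (μ := (volume : Measure E3))
      (ν := (volume : Measure E3))).ae h3
    filter_upwards [hff₀, h4] with p hp1 hp2 hpΩ
    rw [hp2 hpΩ p.2, hG]
    simp only
    rw [← hp1 hpΩ]
  have hweak : ∀ ψ : E3 × E3 → ℝ, ContDiff ℝ ∞ ψ → HasCompactSupport ψ → tsupport ψ ⊆ Ω ×ˢ univ →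
      ∫ p, f₀ p * fderiv ℝ ψ p (p.2, 0) = - ∫ p, G p * ψ p := by
    intro ψ h1 h2 h3
    have heq := hf.equation ψ h1 h2 h3
    rw [← integral_indicator hΩu, ← integral_indicator hΩu] at heq
    refine Eq.trans (integral_congr_ae ?_) (heq.trans (congrArg Neg.neg (integral_congr_ae ?_)))
    · filter_upwards [hff₀] with p hp
      by_cases hpΩ : p.1 ∈ Ω
      · rw [indicator_of_mem (show p ∈ Ω ×ˢ univ from ⟨hpΩ, mem_univ _⟩), hp hpΩ]
      · rw [indicator_of_notMem (fun hcon => hpΩ hcon.1), hf₀0 p hpΩ, zero_mul]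
    · filter_upwards [hlin] with p hp
      by_cases hpΩ : p.1 ∈ Ω
      · rw [indicator_of_mem (show p ∈ Ω ×ˢ univ from ⟨hpΩ, mem_univ _⟩), hp hpΩ]
      · rw [indicator_of_notMem (fun hcon => hpΩ hcon.1), hG]
        simp only
        rw [hf₀0 p hpΩ, hF0 p hpΩ]; ring
  refine ⟨Metric.diam Ω + 1, A, ν, k, f₀, ⟨hΩ.isOpen, hΩ.convex, hΩ.isBounded, hD0, hD, hA, hνm,
    hν0, hνA, hkm, hkA, hf₀m, hf₀0, hf₀2, hg, ?_⟩, hff₀⟩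
  exact ae_mild_formula hΩ.isOpen hΩ.convex hΩ.c2 hD hf₀m hff₀ hfi hGm hGi hweak
    (fun p _ => by rw [hG]; ring) hF0 hf.trace

end Boltzmann

end

theorem theorem1 (Ω : Set Boltzmann.E3) (hΩ : Boltzmann.PositiveCurvatureDomain Ω)
    (γ : ℝ) (hγ0 : 0 ≤ γ) (hγ1 : γ ≤ 1)
    (B : ℝ → ℝ → ℝ) (hBm : Measurable (Function.uncurry B)) (hB : Boltzmann.AngularCutoff γ B)
    (g : Boltzmann.E3 × Boltzmann.E3 → ℝ) (hg : Boltzmann.IncomingAssumption Ω g)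
    (f : Boltzmann.E3 × Boltzmann.E3 → ℝ) (hf : Boltzmann.IsL2Solution Ω B g f) :
    ∀ ε : ℝ, 0 < ε → ε < 1 → Boltzmann.MemL2Hs Ω (1 - ε) f := by
  intro ε hε hε1
  obtain ⟨D, A, ν, k, f₀, hmild, hae⟩ :=
    Boltzmann.exists_isMildSolution hΩ hγ0 hγ1 hBm hB hg hf
  refine ⟨hf.memLp, ?_⟩
  rw [Boltzmann.slobodeckij_congr hΩ.isOpen.measurableSet (1 - ε) hae]
  exact hmild.slobodeckij_lt_top hε hε1
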